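/- Let $\mathbb{k}$ be a field of characteristic zero; all operads are symmetric, all complexes are homological (the differential has degree $-1$), and Koszul signs are used throughout. Let $\mathrm{Lie}$ be the operad of Lie algebras; $\mathrm{Lie}(I)$ is the space of multilinear elements of the free Lie algebra on the finite set $I$, with composition by substitution, and $(\mathrm{Lie},0)$ is the corresponding dg operad in degree $0$ with zero differential. Let $\mathrm{PL}$ be the pre-Lie operad: $\mathrm{PL}(I)$ has as a basis the rooted trees with vertex set $I$, and $$T\circ_i S=\sum_{f\colon \mathrm{In}_T(i)\to J} T\circ_i^f S\qquad (T \text{ a tree on } I,\ i\in I,\ S \text{ a tree on } J),$$ where $\mathrm{In}_T(i)$ is the set of incoming edges of the vertex $i$ (edges from its children), and $T\circ_i^fS$ is obtained by putting $S$ in the place of the vertex $i$ and grafting the subtrees of $T$ growing from $i$ at the vertices of $S$ according to $f$. Write $a\triangleleft b$ for the tree with the root $a$ and one other vertex $b$, and put $[a_1,a_2]=a_1\triangleleft a_2-a_2\triangleleft a_1\in \mathrm{PL}(2)$. The operadic twisting $\mathrm{Tw}(\mathrm{PL})$ has as underlying graded operad the coproduct of $\mathrm{PL}$ (in degree $0$)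 with the operad freely generated by one operation $\alpha$ of arity $0$ and degree $-1$. (It is completed with respect to the number of occurrences of $\alpha$, as a graded operad; this changes nothing, since the component of degree $-m$ is spanned by the operations with exactly $m$ occurrences of $\alpha$.) Its differential is $$d_{\mathrm{Tw}}=d_{\mathrm{MC}}+[\ell_1^\alpha,-],$$ where $d_{\mathrm{MC}}$ is the derivation that vanishes on $\mathrm{PL}$ and satisfies $d_{\mathrm{MC}}(\alpha)=-\frac12[\alpha,\alpha]$, where $\ell_1^\alpha(a)=[\alpha,a]$, and where $[\ell_1^\alpha,x]=\ell_1^\alpha\circ_1 x-(-1)^{|x|}\sum_i x\circ_i\ell_1^\alpha$. Then $(\mathrm{Lie},0)$ and $\mathrm{Tw}(\mathrm{PL})$ are dg operads, there is a unique morphism of dg operads $(\mathrm{Lie},0)\to\mathrm{Tw}(\mathrm{PL})$ that sends the generator $[a_1,a_2]$ of $\mathrm{Lie}$ to the operation $[a_1,a_2]\in\mathrm{PL}(2)\subset\mathrm{Tw}(\mathrm{PL})(2)$, and this morphism induces an isomorphism on homology in every arity $n\ge 0$ and in every degree. In particular, $H_\bullet(\mathrm{Tw}(\mathrm{PL}))\cong\mathrm{Lie}$,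 concentrated in degree $0$. -/

import Mathlib

/-! ## Operads through partial compositions, on arbitrary finite label sets -/

/-- The label set of `x ∘ᵢ y`: remove the label `i` of `x` and put the labels of `y` instead. -/
abbrev Ins (I : Type) (i : I) (J : Type) : Type := {x : I // x ≠ i} ⊕ J

namespace Ins

/-- Relabelling both arguments of a partial composition. -/
def congr {I I' J J' : Type} (e : I ≃ I') (f : J ≃ J') (i : I) : Ins I i J ≃ Ins I' (e i) J' :=
  Equiv.sumCongr (e.subtypeEquiv fun a => by simp) f

/-- Removing a label from the left summand. -/
def removeInl {I A : Type} (i : I) : {x : I ⊕ A // x ≠ Sum.inl i} ≃ {x : I // x ≠ i} ⊕ A where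
  toFun := fun
    | ⟨.inl x, h⟩ => .inl ⟨x, fun hx => h (by rw [hx])⟩
    | ⟨.inr a, _⟩ => .inr a
  invFun := Sum.elim (fun x => ⟨.inl x.1, fun h => x.2 (Sum.inl.inj h)⟩) (fun a => ⟨.inr a, by simp⟩)
  left_inv := by rintro ⟨x | a, h⟩ <;> rfl
  right_inv := by rintro (x | a) <;> rfl

/-- Removing a label from the right summand. -/
def removeInr {I A : Type} (a : A) : {x : I ⊕ A // x ≠ Sum.inr a} ≃ I ⊕ {x : A // x ≠ a} where
  toFun := fun
    | ⟨.inl x, _⟩ => .inl x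
    | ⟨.inr x, h⟩ => .inr ⟨x, fun hx => h (by rw [hx])⟩
  invFun := Sum.elim (fun x => ⟨.inl x, by simp⟩) (fun x => ⟨.inr x.1, fun h => x.2 (Sum.inr.inj h)⟩)
  left_inv := by rintro ⟨x | a, h⟩ <;> rfl
  right_inv := by rintro (x | a) <;> rfl

/-- The label set of `(x ∘ᵢ y) ∘ⱼ z` is that of `x ∘ᵢ (y ∘ⱼ z)`. -/
def seq {I J : Type} (K : Type) (i : I) (j : J) :
    Ins (Ins I i J) (Sum.inr j) K ≃ Ins I i (Ins J j K) :=
  (Equiv.sumCongr (removeInr j) (Equiv.refl K)).trans (Equiv.sumAssoc _ _ _)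

/-- Removing two labels in either order. -/
def swapRemove {I : Type} (i i' : I) (h : i' ≠ i) :
    {w : {x : I // x ≠ i} // w ≠ ⟨i', h⟩} ≃ {w : {x : I // x ≠ i'} // w ≠ ⟨i, h.symm⟩} where
  toFun w := ⟨⟨w.1.1, fun e => w.2 (Subtype.ext e)⟩, fun e => w.1.2 (congrArg Subtype.val e)⟩
  invFun w := ⟨⟨w.1.1, fun e => w.2 (Subtype.ext e)⟩, fun e => w.1.2 (congrArg Subtype.val e)⟩
  left_inv _ := rfl
  right_inv _ := rfl

/-- The label set of `(x ∘ᵢ y) ∘ᵢ' z` is that of `(x ∘ᵢ' z) ∘ᵢ y`, for labels `i ≠ i'` of `x`. -/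
def par {I : Type} (J K : Type) (i i' : I) (h : i' ≠ i) :
    Ins (Ins I i J) (Sum.inl ⟨i', h⟩) K ≃ Ins (Ins I i' K) (Sum.inl ⟨i, h.symm⟩) J :=
  (Equiv.sumCongr (removeInl (A := J) (⟨i', h⟩ : {x : I // x ≠ i})) (Equiv.refl K)).trans <|
    (Equiv.sumCongr (Equiv.sumCongr (swapRemove i i' h) (Equiv.refl J)) (Equiv.refl K)).trans <|
    ((Equiv.sumAssoc _ _ _).trans ((Equiv.sumCongr (Equiv.refl _) (Equiv.sumComm J K)).trans
      (Equiv.sumAssoc _ _ _).symm)).trans <|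
    (Equiv.sumCongr (removeInl (A := K) (⟨i, h.symm⟩ : {x : I // x ≠ i'})) (Equiv.refl J)).symm

/-- The label set of `1 ∘ x`. -/
def unitLeft (I : Type) : Ins Unit () I ≃ I :=
  haveI : IsEmpty {u : Unit // u ≠ ()} := ⟨fun u => u.2 rfl⟩
  Equiv.emptySum _ I

open Classical in
/-- The label set of `x ∘ᵢ y` with `y` of arity one (labelled by `()`) is that of `x`. -/
noncomputable def unitRight {I : Type} (i : I) : Ins I i Unit ≃ I where
  toFun := Sum.elim Subtype.val fun _ => i
  invFun a := if h : a = i then .inr () else .inl ⟨a, h⟩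
  left_inv := by
    rintro (⟨x, h⟩ | ⟨⟩)
    · simp [h]
    · simp
  right_inv a := by by_cases h : a = i <;> simp [h]

end Ins

universe u

/-- Data of a `k`-linear symmetric operad in the category of vector spaces: a species with a unit
and equivariant partial compositions. The associativity and unit axioms are part of
`DGOperadData.IsDGOperad`. -/
structure OperadData (k : Type u) [Field k] where
  obj : (I : Type) → [Finite I] → Type u
  [addCommGroup : (I : Type) → [Finite I] → AddCommGroup (obj I)]
  [module : (I : Type) → [Finite I] → Module k (obj I)]
  /-- relabelling -/
  map : {I J : Type} → [Finite I] → [Finite J] → (I ≃ J) → obj I →ₗ[k] obj J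
  map_refl : ∀ {I : Type} [Finite I] (x : obj I), map (Equiv.refl I) x = x
  map_trans : ∀ {I J K : Type} [Finite I] [Finite J] [Finite K] (e : I ≃ J) (f : J ≃ K) (x : obj I),
    map (e.trans f) x = map f (map e x)
  one : obj Unit
  /-- `comp i x y` is `x ∘ᵢ y` -/
  comp : {I J : Type} → [Finite I] → [Finite J] → (i : I) → obj I →ₗ[k] obj J →ₗ[k] obj (Ins I i J)
  map_comp : ∀ {I I' J J' : Type} [Finite I] [Finite I'] [Finite J] [Finite J']
    (e : I ≃ I') (f : J ≃ J') (i : I) (x : obj I) (y : obj J),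
    map (Ins.congr e f i) (comp i x y) = comp (e i) (map e x) (map f y)

attribute [instance] OperadData.addCommGroup OperadData.module

theorem OperadData.map_comp_eq {k : Type u} [Field k] (P : OperadData k) {I I' J J' K : Type}
    [Finite I] [Finite I'] [Finite J] [Finite J'] [Finite K] (e : I ≃ I') (f : J ≃ J') {i : I}
    {i' : I'} (hi : e i = i') (g : Ins I' i' J' ≃ K) (h : Ins I i J ≃ K)
    (hl : ∀ a : {x // x ≠ i}, g (.inl ⟨e a.1, fun w => a.2 (e.injective (w.trans hi.symm))⟩) =
      h (.inl a))
    (hr : ∀ b : J, g (.inr (f b)) = h (.inr b)) (x : P.obj I) (y : P.obj J) :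
    P.map g (P.comp i' (P.map e x) (P.map f y)) = P.map h (P.comp i x y) := by
  subst hi
  rw [← P.map_comp, ← P.map_trans]
  congr 2
  ext z
  rcases z with a | b
  · exact hl a
  · exact hr b

/-- Data of a differential graded `k`-linear symmetric operad. The complex of operations with
inputs labelled by `I` is `obj I`, with homogeneous components `gr I n`, `n : ℤ`. -/
structure DGOperadData (k : Type u) [Field k] where
  obj : (I : Type) → [Finite I] → Type u
  [addCommGroup : (I : Type) → [Finite I] → AddCommGroup (obj I)]
  [module : (I : Type) → [Finite I] → Module k (obj I)]
  gr : (I : Type) → [Finite I] → ℤ → Submodule k (obj I)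
  map : {I J : Type} → [Finite I] → [Finite J] → (I ≃ J) → obj I →ₗ[k] obj J
  one : obj Unit
  comp : {I J : Type} → [Finite I] → [Finite J] → (i : I) → obj I →ₗ[k] obj J →ₗ[k] obj (Ins I i J)
  d : {I : Type} → [Finite I] → obj I →ₗ[k] obj I

attribute [instance] DGOperadData.addCommGroup DGOperadData.module

/-- The axioms of a differential graded symmetric operad (homological grading, Koszul signs). -/
structure DGOperadData.IsDGOperad {k : Type u} [Field k] (P : DGOperadData k) : Prop where
  internal : ∀ (I : Type) [Finite I], DirectSum.IsInternal (P.gr I)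
  map_mem : ∀ {I J : Type} [Finite I] [Finite J] (e : I ≃ J) {n : ℤ} {x : P.obj I},
    x ∈ P.gr I n → P.map e x ∈ P.gr J n
  map_refl : ∀ {I : Type} [Finite I] (x : P.obj I), P.map (Equiv.refl I) x = x
  map_trans : ∀ {I J K : Type} [Finite I] [Finite J] [Finite K] (e : I ≃ J) (f : J ≃ K)
    (x : P.obj I), P.map (e.trans f) x = P.map f (P.map e x)
  one_mem : P.one ∈ P.gr Unit 0
  comp_mem : ∀ {I J : Type} [Finite I] [Finite J] (i : I) {m n : ℤ} {x : P.obj I} {y : P.obj J},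
    x ∈ P.gr I m → y ∈ P.gr J n → P.comp i x y ∈ P.gr (Ins I i J) (m + n)
  map_comp : ∀ {I I' J J' : Type} [Finite I] [Finite I'] [Finite J] [Finite J']
    (e : I ≃ I') (f : J ≃ J') (i : I) (x : P.obj I) (y : P.obj J),
    P.map (Ins.congr e f i) (P.comp i x y) = P.comp (e i) (P.map e x) (P.map f y)
  one_comp : ∀ {I : Type} [Finite I] (x : P.obj I),
    P.map (Ins.unitLeft I) (P.comp () P.one x) = x
  comp_one : ∀ {I : Type} [Finite I] (i : I) (x : P.obj I),
    P.map (Ins.unitRight i) (P.comp i x P.one) = x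
  comp_seq : ∀ {I J K : Type} [Finite I] [Finite J] [Finite K] (i : I) (j : J)
    (x : P.obj I) (y : P.obj J) (z : P.obj K),
    P.map (Ins.seq K i j) (P.comp (Sum.inr j) (P.comp i x y) z) = P.comp i x (P.comp j y z)
  comp_par : ∀ {I J K : Type} [Finite I] [Finite J] [Finite K] (i i' : I) (h : i' ≠ i) {m n : ℤ}
    (x : P.obj I) {y : P.obj J} {z : P.obj K}, y ∈ P.gr J m → z ∈ P.gr K n →
    P.map (Ins.par J K i i' h) (P.comp (Sum.inl ⟨i', h⟩) (P.comp i x y) z) =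
      (m * n).negOnePow • P.comp (Sum.inl ⟨i, h.symm⟩) (P.comp i' x z) y
  d_mem : ∀ {I : Type} [Finite I] {n : ℤ} {x : P.obj I}, x ∈ P.gr I n → P.d x ∈ P.gr I (n - 1)
  d_d : ∀ {I : Type} [Finite I] (x : P.obj I), P.d (P.d x) = 0
  d_map : ∀ {I J : Type} [Finite I] [Finite J] (e : I ≃ J) (x : P.obj I),
    P.d (P.map e x) = P.map e (P.d x)
  d_comp : ∀ {I J : Type} [Finite I] [Finite J] (i : I) {m : ℤ} {x : P.obj I} (y : P.obj J),
    x ∈ P.gr I m →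
    P.d (P.comp i x y) = P.comp i (P.d x) y + m.negOnePow • P.comp i x (P.d y)

/-- An operad in vector spaces viewed as a differential graded operad `(P, 0)` in degree zero. -/
def OperadData.toDG {k : Type u} [Field k] (P : OperadData k) : DGOperadData k where
  obj I _ := P.obj I
  gr _ _ n := if n = 0 then ⊤ else ⊥
  map := P.map
  one := P.one
  comp := P.comp
  d := 0

namespace DGOperadData

variable {k : Type u} [Field k]

/-- Morphisms of differential graded operads. -/
@[ext]
structure Hom (P Q : DGOperadData k) where
  app : (I : Type) → [Finite I] → P.obj I →ₗ[k] Q.obj I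
  app_mem : ∀ (I : Type) [Finite I] (n : ℤ), ∀ x ∈ P.gr I n, app I x ∈ Q.gr I n
  app_map : ∀ {I J : Type} [Finite I] [Finite J] (e : I ≃ J) (x : P.obj I),
    app J (P.map e x) = Q.map e (app I x)
  app_one : app Unit P.one = Q.one
  app_comp : ∀ {I J : Type} [Finite I] [Finite J] (i : I) (x : P.obj I) (y : P.obj J),
    app (Ins I i J) (P.comp i x y) = Q.comp i (app I x) (app J y)
  app_d : ∀ {I : Type} [Finite I] (x : P.obj I), app I (P.d x) = Q.d (app I x)

/-- Cycles of degree `n`. -/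
def cycles (P : DGOperadData k) (I : Type) [Finite I] (n : ℤ) : Submodule k (P.obj I) :=
  P.gr I n ⊓ LinearMap.ker P.d

/-- Boundaries of degree `n`. -/
def boundaries (P : DGOperadData k) (I : Type) [Finite I] (n : ℤ) : Submodule k (P.obj I) :=
  (P.gr I (n + 1)).map P.d

/-- The degree `n` homology of the component of `P` with inputs labelled by `I`. -/
abbrev Homology (P : DGOperadData k) (I : Type) [Finite I] (n : ℤ) : Type u :=
  P.cycles I n ⧸ (P.boundaries I n).comap (P.cycles I n).subtype

/-- The map induced on cycles. -/
def Hom.mapCycles {P Q : DGOperadData k} (φ : Hom P Q) (I : Type) [Finite I] (n : ℤ) :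
    P.cycles I n →ₗ[k] Q.cycles I n :=
  (φ.app I).restrict fun x hx => ⟨φ.app_mem I n x hx.1, by
    have h : P.d x = 0 := hx.2
    change Q.d (φ.app I x) = 0
    rw [← φ.app_d, h, map_zero]⟩

/-- The map induced on homology. -/
def Hom.mapHomology {P Q : DGOperadData k} (φ : Hom P Q) (I : Type) [Finite I] (n : ℤ) :
    P.Homology I n →ₗ[k] Q.Homology I n :=
  Submodule.mapQ _ _ (φ.mapCycles I n) (by
    rintro ⟨x, hx⟩ ⟨y, hy, hxy⟩
    exact ⟨φ.app I y, φ.app_mem I _ y hy, by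
      rw [← φ.app_d, hxy]; rfl⟩)

/-- A morphism of dg operads that induces an isomorphism on homology, in all arities and degrees. -/
def Hom.IsHomologyIso {P Q : DGOperadData k} (φ : Hom P Q) : Prop :=
  ∀ (I : Type) [Finite I] (n : ℤ), Function.Bijective (φ.mapHomology I n)

end DGOperadData

/-! ## The pre-Lie operad: rooted trees and insertions -/

/-- Rooted trees with vertex set `I`, given by the parent of each vertex (`none` for the root). -/
@[ext]
structure RT (I : Type) where
  parent : I → Option I
  existsUnique_root : ∃! r, parent r = none
  wf : WellFounded fun a b => parent b = some a

namespace RT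

/-- Relabelling of the vertices. -/
def map {I J : Type} (e : I ≃ J) (T : RT I) : RT J where
  parent y := (T.parent (e.symm y)).map e
  existsUnique_root := by
    obtain ⟨r, hr, hu⟩ := T.existsUnique_root
    refine ⟨e r, by simp [hr], fun y hy => ?_⟩
    rw [← hu (e.symm y) (by simpa using hy)]; simp
  wf := by
    refine (InvImage.wf e.symm T.wf).mono ?_
    intro a b h
    obtain ⟨c, hc, rfl⟩ := Option.map_eq_some_iff.1 h
    simpa [InvImage] using hc

/-- The tree with one vertex. -/
def unit : RT Unit where
  parent _ := none
  existsUnique_root := ⟨(), rfl, fun _ _ => rfl⟩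
  wf := ⟨fun a => ⟨a, by simp⟩⟩

/-- The tree with the two vertices `0`, `1` and the root `r`. -/
def edge (r : Fin 2) : RT (Fin 2) where
  parent x := if x = r then none else some r
  existsUnique_root := ⟨r, by simp, fun y hy => by simpa using hy⟩
  wf := by
    have hr : Acc (fun a b : Fin 2 => (if b = r then none else some r) = some a) r :=
      ⟨_, fun y hy => by simp at hy⟩
    refine ⟨fun a => ⟨_, fun y hy => ?_⟩⟩
    split_ifs at hy
    cases hy
    exact hr

open Classical in
/-- The parent function of `T ∘ᵢᶠ S`. Subtrees of `T` growing from `i` are grafted at the vertices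
of `S` according to `f`, and the root of `S` is attached to the parent of `i` in `T`. -/
noncomputable def graftParent {I J : Type} (i : I) (T : RT I) (S : RT J)
    (f : {x : I // T.parent x = some i} → J) : Ins I i J → Option (Ins I i J)
  | .inl x =>
    if h : T.parent x = some i then some (.inr (f ⟨x, h⟩))
    else (T.parent x).bind fun y => if hy : y ≠ i then some (.inl ⟨y, hy⟩) else none
  | .inr j =>
    match S.parent j with
    | some j' => some (.inr j')
    | none => (T.parent i).bind fun y => if hy : y ≠ i then some (.inl ⟨y, hy⟩) else none

theorem parent_ne_self {I : Type} (T : RT I) (x : I) : T.parent x ≠ some x := fun h =>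
  T.wf.irrefl.irrefl x h

/-- The tree `T ∘ᵢᶠ S`. -/
noncomputable def graft {I J : Type} (i : I) (T : RT I) (S : RT J)
    (f : {x : I // T.parent x = some i} → J) : RT (Ins I i J) where
  parent := graftParent i T S f
  existsUnique_root := by
    obtain ⟨r, hr, hur⟩ := T.existsUnique_root
    obtain ⟨s, hs, hus⟩ := S.existsUnique_root
    have hinl : ∀ x : {x : I // x ≠ i}, graftParent i T S f (.inl x) = none → x.1 = r := by
      intro x hx
      apply hur
      cases hp : T.parent x.1 with
      | none => rfl
      | some y =>
        by_cases hy : y = i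
        · subst hy; simp [graftParent, hp] at hx
        · simp [graftParent, hp, hy] at hx
    have hinr : ∀ j : J, graftParent i T S f (.inr j) = none → j = s ∧ i = r := by
      intro j hj
      cases hq : S.parent j with
      | some j' => simp [graftParent, hq] at hj
      | none =>
        refine ⟨hus j hq, hur i ?_⟩
        cases hp : T.parent i with
        | none => exact hp
        | some y =>
          have hy : y ≠ i := fun h => T.parent_ne_self i (by rw [hp, h])
          simp [graftParent, hq, hp, hy] at hj
    by_cases h : i = r
    · refine ⟨.inr s, by simp [graftParent, hs, h, hr], ?_⟩
      rintro (x | j) hx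
      · exact absurd ((hinl x hx).trans h.symm) x.2
      · rw [(hinr j hx).1]
    · refine ⟨.inl ⟨r, Ne.symm h⟩, by simp [graftParent, hr], ?_⟩
      rintro (x | j) hx
      · exact congrArg Sum.inl (Subtype.ext (hinl x hx))
      · exact absurd (hinr j hx).2 h
  wf := by
    have key : ∀ x : I,
        (∀ h : x ≠ i, Acc (fun a b => graftParent i T S f b = some a) (.inl ⟨x, h⟩)) ∧
        (x = i → ∀ j, Acc (fun a b => graftParent i T S f b = some a) (.inr j)) := by
      intro x
      induction x using T.wf.induction with
      | _ x ih =>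
        refine ⟨fun h => ⟨_, fun y hy => ?_⟩, fun h j => ?_⟩
        · by_cases hp : T.parent x = some i
          · simp only [graftParent, hp, dite_true, Option.some.injEq] at hy
            rw [← hy]
            exact (ih i hp).2 rfl _
          · simp only [graftParent, hp, dite_false, Option.bind_eq_some_iff] at hy
            obtain ⟨z, hz, hzy⟩ := hy
            split_ifs at hzy with hzi
            cases hzy
            exact (ih z hz).1 hzi
        · subst h
          induction j using S.wf.induction with
          | _ j ihj =>
            refine ⟨_, fun y hy => ?_⟩
            cases hq : S.parent j with
            | some j' =>
              simp only [graftParent, hq, Option.some.injEq] at hy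
              rw [← hy]
              exact ihj j' hq
            | none =>
              simp only [graftParent, hq, Option.bind_eq_some_iff] at hy
              obtain ⟨z, hz, hzy⟩ := hy
              split_ifs at hzy with hzi
              cases hzy
              exact (ih z hz).1 hzi
    exact ⟨fun
      | .inl x => (key x.1).1 x.2
      | .inr j => (key i).2 rfl j⟩

theorem map_refl {I : Type} (T : RT I) : T.map (Equiv.refl I) = T := by
  ext x : 2
  simp [map]

theorem map_trans {I J K : Type} (e : I ≃ J) (f : J ≃ K) (T : RT I) :
    T.map (e.trans f) = (T.map e).map f := by
  ext x : 2
  simp [map]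

/-- Relabelling of the functions `f` that index the insertions. -/
def graftEquiv {I I' J J' : Type} (e : I ≃ I') (f : J ≃ J') (i : I) (T : RT I) :
    ({x : I // T.parent x = some i} → J) ≃ ({x : I' // (T.map e).parent x = some (e i)} → J') :=
  Equiv.arrowCongr (e.subtypeEquiv fun x => by simp [map]) f

theorem map_graft {I I' J J' : Type} (e : I ≃ I') (f : J ≃ J') (i : I) (T : RT I) (S : RT J)
    (g : {x : I // T.parent x = some i} → J) :
    (graft i T S g).map (Ins.congr e f i) =
      graft (e i) (T.map e) (S.map f) (graftEquiv e f i T g) := by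
  ext x : 2
  obtain ⟨x, rfl⟩ := (Ins.congr e f i).surjective x
  simp only [map, graft, Equiv.symm_apply_apply]
  rcases x with x | j
  · cases hp : T.parent x.1 with
    | none => simp [graftParent, Ins.congr, hp]
    | some y =>
      by_cases hy : y = i
      · subst hy
        have h1 : (T.map e).parent (e x.1) = some (e y) := by simp [map, hp]
        have h2 : graftEquiv e f y T g ⟨e x.1, h1⟩ = f (g ⟨x.1, hp⟩) := by
          simp [graftEquiv, Equiv.arrowCongr, Equiv.subtypeEquiv]
        simp only [map] at h1
        simp [graftParent, Ins.congr, hp, ← h2]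
        rfl
      · simp [graftParent, Ins.congr, hp, hy]
  · cases hq : S.parent j with
    | some j' => simp [graftParent, Ins.congr, hq]
    | none =>
      cases hp : T.parent i with
      | none => simp [graftParent, Ins.congr, hq, hp]
      | some y =>
        have hy : y ≠ i := fun h => T.parent_ne_self i (by rw [hp, h])
        simp [graftParent, Ins.congr, hq, hp, hy]

end RT

/-- The pre-Lie operad: linear combinations of rooted trees, with
`T ∘ᵢ S = ∑_f T ∘ᵢᶠ S`, the sum over all functions from the incoming edges of `i` in `T` to the
vertices of `S`. -/
noncomputable def PL (k : Type u) [Field k] : OperadData k where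
  obj I _ := RT I →₀ k
  map e := Finsupp.lmapDomain k k (RT.map e)
  map_refl {I} _ x := by
    have : RT.map (Equiv.refl I) = id := funext RT.map_refl
    simp [this]
  map_trans e f x := by
    have : RT.map (e.trans f) = RT.map f ∘ RT.map e := funext (RT.map_trans e f)
    simp [this, Finsupp.mapDomain_comp]
  one := Finsupp.single RT.unit 1
  comp i := Finsupp.linearCombination k fun T => Finsupp.linearCombination k fun S =>
    ∑ᶠ f : {x // T.parent x = some i} → _, Finsupp.single (RT.graft i T S f) (1 : k)
  map_comp {I I' J J'} _ _ _ _ e f i x y := by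
    induction x using Finsupp.induction_linear with
    | zero => simp
    | add a b ha hb => simp only [map_add, LinearMap.add_apply, ha, hb]
    | single T c =>
      induction y using Finsupp.induction_linear with
      | zero => simp
      | add a b ha hb => simp only [map_add, ha, hb]
      | single S c' =>
        simp only [Finsupp.linearCombination_single, LinearMap.smul_apply, map_smul,
          Finsupp.lmapDomain_apply, Finsupp.mapDomain_single]
        congr 2
        rw [← Finsupp.lmapDomain_apply k k, map_finsum _ (Set.toFinite _)]
        rw [← finsum_comp_equiv (RT.graftEquiv e f i T)]
        refine finsum_congr fun g => ?_
        rw [Finsupp.lmapDomain_apply, Finsupp.mapDomain_single, RT.map_graft]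

/-- The operation `[a₀, a₁] = a₀ ◁ a₁ - a₁ ◁ a₀` of the pre-Lie operad, where `a ◁ b` is the tree
with the root `a` and the other vertex `b`. -/
noncomputable def PL.bracket (k : Type u) [Field k] : (PL k).obj (Fin 2) :=
  (Finsupp.single (RT.edge 0) 1 - Finsupp.single (RT.edge 1) 1 : RT (Fin 2) →₀ k)

/-! ## The Lie operad: multilinear elements of free Lie algebras -/

/-- `IsMonomial A x`: `x` is a bracket monomial in which the letters of `A` occur exactly once each
and no other letters occur. -/
inductive IsMonomial (k : Type u) [Field k] {I : Type} : Set I → FreeLieAlgebra k I → Prop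
  | of (i : I) : IsMonomial k {i} (FreeLieAlgebra.of k i)
  | lie {A B : Set I} {x y : FreeLieAlgebra k I} :
      IsMonomial k A x → IsMonomial k B y → Disjoint A B → IsMonomial k (A ∪ B) ⁅x, y⁆

/-- Multilinear elements of the free Lie algebra on `I`. -/
noncomputable def multilinearLie (k : Type u) [Field k] (I : Type) : Submodule k (FreeLieAlgebra k I) :=
  Submodule.span k {x | IsMonomial k Set.univ x}

namespace multilinearLie

open FreeLieAlgebra

variable (k : Type u) [Field k]

/-- Renaming the letters. -/
noncomputable def rename {I J : Type} (g : I → J) : FreeLieAlgebra k I →ₗ⁅k⁆ FreeLieAlgebra k J :=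
  lift k fun i => of k (g i)

open Classical in
/-- The substitution of `y` for the letter `i`. -/
noncomputable def subst {I J : Type} (i : I) (y : FreeLieAlgebra k J) :
    FreeLieAlgebra k I →ₗ⁅k⁆ FreeLieAlgebra k (Ins I i J) :=
  lift k fun a => if h : a = i then rename k Sum.inr y else of k (Sum.inl ⟨a, h⟩)

variable {k}

theorem isMonomial_rename {I J : Type} {g : I → J} (hg : Function.Injective g) {A : Set I}
    {x : FreeLieAlgebra k I} (hx : IsMonomial k A x) : IsMonomial k (g '' A) (rename k g x) := by
  induction hx with
  | of i => simpa [rename] using IsMonomial.of (k := k) (g i)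
  | lie _ _ h ihx ihy =>
    rw [LieHom.map_lie, Set.image_union]
    exact .lie ihx ihy ((Set.disjoint_image_iff hg).2 h)

/-- The labels obtained from `A` by removing `i`. -/
def rest {I : Type} (i : I) (J : Type) (A : Set I) : Set (Ins I i J) :=
  {z | ∃ a, a.1 ∈ A ∧ z = Sum.inl a}

theorem rest_union {I J : Type} (i : I) (A B : Set I) :
    rest i J (A ∪ B) = rest i J A ∪ rest i J B := by
  ext z; simp [rest, or_and_right, exists_or]

theorem disjoint_rest {I J : Type} (i : I) {A B : Set I} (h : Disjoint A B) :
    Disjoint (rest i J A) (rest i J B) := by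
  rw [Set.disjoint_left] at h ⊢
  rintro _ ⟨a, ha, rfl⟩ ⟨b, hb, hab⟩
  cases hab
  exact h ha hb

theorem disjoint_rest_inr {I J : Type} (i : I) (A : Set I) (B : Set J) :
    Disjoint (rest i J A) (Sum.inr '' B) := by
  rw [Set.disjoint_left]
  rintro _ ⟨a, _, rfl⟩ ⟨b, _, hb⟩
  cases hb

theorem isMonomial_subst_of_notMem {I J : Type} {i : I} (y : FreeLieAlgebra k J) {A : Set I}
    {x : FreeLieAlgebra k I} (hx : IsMonomial k A x) (hi : i ∉ A) :
    IsMonomial k (rest i J A) (subst k i y x) ∧ subst k i y x = subst k i 0 x := by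
  induction hx with
  | of a =>
    have ha : a ≠ i := fun h => hi (by simp [h])
    have hr : rest i J {a} = {Sum.inl ⟨a, ha⟩} := by
      ext z; simp [rest, ha]
    simpa [subst, ha, hr] using IsMonomial.of (k := k) (Sum.inl ⟨a, ha⟩ : Ins I i J)
  | lie _ _ h ihx ihy =>
    simp only [Set.mem_union, not_or] at hi
    refine ⟨?_, by rw [LieHom.map_lie, LieHom.map_lie, (ihx hi.1).2, (ihy hi.2).2]⟩
    rw [LieHom.map_lie, rest_union]
    exact .lie (ihx hi.1).1 (ihy hi.2).1 (disjoint_rest i h)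

theorem isMonomial_subst {I J : Type} {i : I} {y : FreeLieAlgebra k J} {A : Set I} {B : Set J}
    {x : FreeLieAlgebra k I} (hx : IsMonomial k A x) (hi : i ∈ A) (hy : IsMonomial k B y) :
    IsMonomial k (rest i J A ∪ Sum.inr '' B) (subst k i y x) := by
  induction hx with
  | of a =>
    have ha : i = a := by simpa using hi
    subst ha
    have hr : rest i J {i} = ∅ := by
      ext z; simp [rest]
    simpa [subst, hr] using isMonomial_rename Sum.inr_injective hy
  | @lie A' B' _ _ hx' hy' h ihx ihy =>
    rw [LieHom.map_lie, rest_union]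
    rcases hi with hi | hi
    · have hi' := Set.disjoint_left.1 h hi
      rw [Set.union_right_comm]
      refine .lie (ihx hi) (isMonomial_subst_of_notMem y hy' hi').1 ?_
      exact Set.disjoint_union_left.2 ⟨disjoint_rest i h, (disjoint_rest_inr i _ _).symm⟩
    · have hi' := Set.disjoint_right.1 h hi
      rw [Set.union_assoc]
      refine .lie (isMonomial_subst_of_notMem y hx' hi').1 (ihy hi) ?_
      exact Set.disjoint_union_right.2 ⟨disjoint_rest i h, disjoint_rest_inr i _ _⟩

theorem subst_add_smul_of_isMonomial {I J : Type} {i : I} {A : Set I} {x : FreeLieAlgebra k I}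
    (hx : IsMonomial k A x) (hi : i ∈ A) (c : k) (y z : FreeLieAlgebra k J) :
    subst k i (c • y + z) x = c • subst k i y x + subst k i z x := by
  induction hx with
  | of a =>
    have ha : a = i := by simpa using hi.symm
    simp [subst, ha]
  | @lie A' B' _ _ hx' hy' h ihx ihy =>
    simp only [LieHom.map_lie]
    rcases hi with hi | hi
    · have hi' := Set.disjoint_left.1 h hi
      rw [ihx hi, (isMonomial_subst_of_notMem (c • y + z) hy' hi').2,
        (isMonomial_subst_of_notMem y hy' hi').2, (isMonomial_subst_of_notMem z hy' hi').2]
      simp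
    · have hi' := Set.disjoint_right.1 h hi
      rw [ihy hi, (isMonomial_subst_of_notMem (c • y + z) hx' hi').2,
        (isMonomial_subst_of_notMem y hx' hi').2, (isMonomial_subst_of_notMem z hx' hi').2]
      simp

theorem subst_add_smul {I J : Type} (i : I) {x : FreeLieAlgebra k I} (hx : x ∈ multilinearLie k I)
    (c : k) (y z : FreeLieAlgebra k J) :
    subst k i (c • y + z) x = c • subst k i y x + subst k i z x := by
  induction hx using Submodule.span_induction with
  | mem x hx => exact subst_add_smul_of_isMonomial hx (Set.mem_univ i) c y z
  | zero => simp
  | add a b _ _ ha hb => simp only [map_add, ha, hb, smul_add]; abel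
  | smul a b _ hb => simp only [map_smul, hb, smul_add, smul_comm a c]

theorem subst_smul {I J : Type} (i : I) {x : FreeLieAlgebra k I} (hx : x ∈ multilinearLie k I)
    (c : k) (y : FreeLieAlgebra k J) : subst k i (c • y) x = c • subst k i y x := by
  have h0 := subst_add_smul i hx 1 (0 : FreeLieAlgebra k J) 0
  simp only [smul_zero, add_zero, one_smul, left_eq_add] at h0
  simpa [h0] using subst_add_smul i hx c y 0

theorem subst_mem {I J : Type} (i : I) {x : FreeLieAlgebra k I} (hx : x ∈ multilinearLie k I)
    {y : FreeLieAlgebra k J} (hy : y ∈ multilinearLie k J) :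
    subst k i y x ∈ multilinearLie k (Ins I i J) := by
  induction hy using Submodule.span_induction with
  | mem y hy =>
    induction hx using Submodule.span_induction with
    | mem x hx =>
      refine Submodule.subset_span ?_
      have h := isMonomial_subst hx (Set.mem_univ i) hy
      rwa [show rest i J Set.univ ∪ Sum.inr '' Set.univ = Set.univ by
        ext z
        rcases z with z | z
        · exact iff_of_true (.inl ⟨z, trivial, rfl⟩) trivial
        · simp] at h
    | zero => simp
    | add a b _ _ ha hb => rw [map_add]; exact add_mem ha hb
    | smul a b _ hb => rw [map_smul]; exact Submodule.smul_mem _ _ hb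
  | zero =>
    have h := subst_smul i hx 0 (0 : FreeLieAlgebra k J)
    simp only [zero_smul] at h
    rw [h]; exact zero_mem _
  | add a b _ _ ha hb =>
    have h := subst_add_smul i hx 1 a b
    simp only [one_smul] at h
    rw [h]; exact add_mem ha hb
  | smul c a _ ha =>
    rw [subst_smul i hx]; exact Submodule.smul_mem _ _ ha

theorem rename_mem {I J : Type} (e : I ≃ J) {x : FreeLieAlgebra k I}
    (hx : x ∈ multilinearLie k I) : rename k e x ∈ multilinearLie k J := by
  induction hx using Submodule.span_induction with
  | mem x hx =>
    refine Submodule.subset_span ?_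
    have h := isMonomial_rename e.injective hx
    rwa [Set.image_univ, e.surjective.range_eq] at h
  | zero => simp
  | add a b _ _ ha hb => rw [map_add]; exact add_mem ha hb
  | smul a b _ hb => rw [map_smul]; exact Submodule.smul_mem _ _ hb

theorem rename_subst {I I' J J' : Type} (e : I ≃ I') (f : J ≃ J') (i : I)
    (x : FreeLieAlgebra k I) (y : FreeLieAlgebra k J) :
    rename k (Ins.congr e f i) (subst k i y x) = subst k (e i) (rename k f y) (rename k e x) := by
  have hy : rename k (Ins.congr e f i) (rename k Sum.inr y) = rename k Sum.inr (rename k f y) := by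
    rw [← LieHom.comp_apply, ← LieHom.comp_apply]
    congr 1
    ext a
    simp [rename, Ins.congr]
  rw [← LieHom.comp_apply, ← LieHom.comp_apply]
  congr 1
  ext a
  by_cases h : a = i
  · subst h
    simpa [subst, rename] using hy
  · simp [subst, rename, h, Ins.congr]

end multilinearLie

open multilinearLie in
/-- The Lie operad: operations with inputs labelled by `I` are the multilinear elements of the free
Lie algebra on `I`, and `x ∘ᵢ y` is the substitution of `y` for the letter `i` of `x`. -/
noncomputable def LieOp (k : Type u) [Field k] : OperadData k where
  obj I _ := multilinearLie k I
  map e := (rename k e : _ →ₗ[k] _).restrict fun _ hx => rename_mem e hx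
  map_refl {I} _ x := by
    have h : rename k (Equiv.refl I) = LieHom.id := by ext; simp [rename]
    exact Subtype.ext (congrArg (fun g => g x.1) h)
  map_trans e f x := by
    have h : rename k (e.trans f) = (rename k f).comp (rename k e) := by ext; simp [rename]
    exact Subtype.ext (congrArg (fun g => g x.1) h)
  one := ⟨FreeLieAlgebra.of k (), Submodule.subset_span (by
    have h : ({()} : Set Unit) = Set.univ := by ext; simp
    simpa [h] using IsMonomial.of (k := k) ())⟩
  comp i := LinearMap.mk₂ k (fun x y => ⟨subst k i y.1 x.1, subst_mem i x.2 y.2⟩)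
    (fun x x' y => Subtype.ext (by simp))
    (fun c x y => Subtype.ext (by simp))
    (fun x y y' => Subtype.ext (by simpa using subst_add_smul i x.2 1 y.1 y'.1))
    (fun c x y => Subtype.ext (subst_smul i x.2 c y.1))
  map_comp e f i x y := Subtype.ext (rename_subst e f i x.1 y.1)

/-- The generator `[a₀, a₁]` of the Lie operad. -/
noncomputable def LieOp.bracket (k : Type u) [Field k] : (LieOp k).obj (Fin 2) :=
  (⟨⁅FreeLieAlgebra.of k (0 : Fin 2), FreeLieAlgebra.of k (1 : Fin 2)⁆, Submodule.subset_span (by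
    have h : ({0} ∪ {1} : Set (Fin 2)) = Set.univ := by ext i; fin_cases i <;> simp
    have := IsMonomial.lie (IsMonomial.of (k := k) (0 : Fin 2)) (IsMonomial.of (k := k) 1) (by simp)
    rwa [h] at this)⟩ : multilinearLie k (Fin 2))

/-! ## Operadic twisting -/

namespace Tw

variable {k : Type u} [Field k] (P : OperadData k)

/-- The relation `μ(x; α_σ(1), …, α_σ(m)) = sgn(σ) μ(x; α_1, …, α_m)`, for `α` of degree `-1`. -/
def rel (I : Type) [Finite I] (m : ℕ) : Submodule k (P.obj (I ⊕ Fin m)) :=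
  Submodule.span k {x | ∃ (σ : Equiv.Perm (Fin m)) (μ : P.obj (I ⊕ Fin m)),
    x = P.map (Equiv.sumCongr (Equiv.refl I) σ) μ - Equiv.Perm.sign σ • μ}

/-- The component of the coproduct `P ∨ kα` with inputs labelled by `I`. Since `α` has arity zero
and degree `-1`, the part with `m` occurrences of `α` consists of the coinvariants of the operations
`μ(x; α, …, α)`, with `μ` in `P` having the additional inputs `Fin m`. That part is the homogeneous
component of degree `-m`, so completing with respect to the number of occurrences of `α` does not
change the homogeneous components. -/
abbrev Obj (I : Type) [Finite I] : Type u := DirectSum ℕ fun m => P.obj (I ⊕ Fin m) ⧸ rel P I m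

/-- `cls P m μ` is the operation `μ(x; α, …, α)` with `α` plugged into the inputs `Fin m`, in this
order. -/
noncomputable def cls {I : Type} [Finite I] (m : ℕ) : P.obj (I ⊕ Fin m) →ₗ[k] Obj P I :=
  DirectSum.lof k ℕ (fun m => P.obj (I ⊕ Fin m) ⧸ rel P I m) m ∘ₗ (rel P I m).mkQ

variable {P} in
theorem cls_perm {I : Type} [Finite I] {m : ℕ} (σ : Equiv.Perm (Fin m)) (μ : P.obj (I ⊕ Fin m)) :
    cls P m (P.map (Equiv.sumCongr (Equiv.refl I) σ) μ) = Equiv.Perm.sign σ • cls P m μ := by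
  have h : (rel P I m).mkQ (P.map (Equiv.sumCongr (Equiv.refl I) σ) μ) =
      Equiv.Perm.sign σ • (rel P I m).mkQ μ := by
    rw [← sub_eq_zero, Units.smul_def, ← map_zsmul, ← map_sub]
    exact (Submodule.Quotient.mk_eq_zero _).2 (Submodule.subset_span ⟨σ, μ, rfl⟩)
  rw [cls, LinearMap.comp_apply, h, Units.smul_def, map_zsmul]
  rfl

variable {P} in
/-- Linear maps out of the coproduct. -/
noncomputable def desc {I : Type} [Finite I] {V : Type u} [AddCommGroup V] [Module k V]
    (F : (m : ℕ) → P.obj (I ⊕ Fin m) →ₗ[k] V)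
    (hF : ∀ m (σ : Equiv.Perm (Fin m)) μ,
      F m (P.map (Equiv.sumCongr (Equiv.refl I) σ) μ) = Equiv.Perm.sign σ • F m μ) :
    Obj P I →ₗ[k] V :=
  DirectSum.toModule k ℕ V fun m => (rel P I m).liftQ (F m) (by
    rw [rel, Submodule.span_le]
    rintro _ ⟨σ, μ, rfl⟩
    change F m _ = 0
    rw [map_sub, hF, Units.smul_def, Units.smul_def, map_zsmul, sub_self])

variable {P} in
theorem desc_cls {I : Type} [Finite I] {V : Type u} [AddCommGroup V] [Module k V]
    (F : (m : ℕ) → P.obj (I ⊕ Fin m) →ₗ[k] V) (hF) (m : ℕ) (μ : P.obj (I ⊕ Fin m)) :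
    desc F hF (cls P m μ) = F m μ := by
  simp [desc, cls]

/-- Homogeneous elements of degree `n`: those with exactly `-n` occurrences of `α`. -/
def gr (I : Type) [Finite I] (n : ℤ) : Submodule k (Obj P I) where
  carrier := {x | ∀ m : ℕ, -(m : ℤ) ≠ n → x m = 0}
  zero_mem' _ _ := rfl
  add_mem' {x y} hx hy m hm := by rw [DirectSum.add_apply, hx m hm, hy m hm, add_zero]
  smul_mem' c x hx m hm := by rw [DirectSum.smul_apply, hx m hm, smul_zero]

/-- Relabelling of the inputs. -/
noncomputable def map {I J : Type} [Finite I] [Finite J] (e : I ≃ J) : Obj P I →ₗ[k] Obj P J :=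
  desc (fun m => cls P m ∘ₗ P.map (Equiv.sumCongr e (Equiv.refl (Fin m)))) (by
    intro m σ μ
    rw [LinearMap.comp_apply, LinearMap.comp_apply, ← cls_perm, ← P.map_trans, ← P.map_trans]
    congr 2
    congr 1
    ext x
    rcases x with x | x <;> rfl)

/-- The inputs of `μ(x; α, …, α) ∘ᵢ ν(y; α, …, α)`: the inputs labelled by `α` in `μ` come before
those in `ν`. -/
def compEquiv {I : Type} (J : Type) (i : I) (m l : ℕ) :
    Ins (I ⊕ Fin m) (Sum.inl i) (J ⊕ Fin l) ≃ Ins I i J ⊕ Fin (m + l) :=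
  (Equiv.sumCongr (Ins.removeInl i) (Equiv.refl _)).trans <|
    (Equiv.sumSumSumComm _ _ _ _).trans (Equiv.sumCongr (Equiv.refl _) finSumFinEquiv)

/-- `μ(x; α, …, α) ∘ᵢ ν(y; α, …, α) = (μ ∘ᵢ ν)(x, y; α, …, α, α, …, α)`. -/
noncomputable def compCls {I J : Type} [Finite I] [Finite J] (i : I) (m l : ℕ) :
    P.obj (I ⊕ Fin m) →ₗ[k] P.obj (J ⊕ Fin l) →ₗ[k] Obj P (Ins I i J) :=
  (P.comp (Sum.inl i)).compr₂ (cls P (m + l) ∘ₗ P.map (compEquiv J i m l))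

variable {P} in
theorem compCls_perm {I J : Type} [Finite I] [Finite J] (i : I) {m l : ℕ}
    (σ : Equiv.Perm (Fin m)) (τ : Equiv.Perm (Fin l)) (μ : P.obj (I ⊕ Fin m))
    (ν : P.obj (J ⊕ Fin l)) :
    compCls P i m l (P.map (Equiv.sumCongr (Equiv.refl I) σ) μ)
      (P.map (Equiv.sumCongr (Equiv.refl J) τ) ν) =
      (Equiv.Perm.sign σ * Equiv.Perm.sign τ) • compCls P i m l μ ν := by
  have hs : Equiv.Perm.sign (finSumFinEquiv.permCongr (Equiv.Perm.sumCongr σ τ)) =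
      Equiv.Perm.sign σ * Equiv.Perm.sign τ := by
    rw [Equiv.Perm.sign_permCongr, Equiv.Perm.sign_sumCongr]
  simp only [compCls, LinearMap.compr₂_apply, LinearMap.comp_apply]
  rw [← hs, ← cls_perm, ← P.map_trans]
  congr 1
  refine P.map_comp_eq (i := Sum.inl i) (i' := Sum.inl i) (Equiv.sumCongr (Equiv.refl I) σ)
    (Equiv.sumCongr (Equiv.refl J) τ) rfl _ _ ?_ ?_ μ ν
  · rintro ⟨x | x, hx⟩ <;> simp [compEquiv, Ins.removeInl, Equiv.permCongr_apply]
  · rintro (x | x) <;> simp [compEquiv, Equiv.permCongr_apply]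

variable {P} in
theorem map_sumCongr_one {I : Type} [Finite I] {m : ℕ} (μ : P.obj (I ⊕ Fin m)) :
    P.map (Equiv.sumCongr (Equiv.refl I) (1 : Equiv.Perm (Fin m))) μ = μ := by
  rw [show Equiv.sumCongr (Equiv.refl I) (1 : Equiv.Perm (Fin m)) = Equiv.refl _ from
    Equiv.sumCongr_refl, P.map_refl]

/-- The composition with `ν(y; α, …, α)`, with a fixed number of `α`'s in the latter. -/
noncomputable def compLeft {I J : Type} [Finite I] [Finite J] (i : I) (l : ℕ) :
    Obj P I →ₗ[k] P.obj (J ⊕ Fin l) →ₗ[k] Obj P (Ins I i J) :=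
  desc (V := P.obj (J ⊕ Fin l) →ₗ[k] Obj P (Ins I i J)) (fun m => compCls P i m l) (by
    intro m σ μ
    refine LinearMap.ext fun ν => ?_
    have h := compCls_perm i σ (1 : Equiv.Perm (Fin l)) μ ν
    rw [map_sumCongr_one, Equiv.Perm.sign_one, mul_one] at h
    exact h)

variable {P} in
theorem obj_hom_ext {I : Type} [Finite I] {V : Type u} [AddCommGroup V] [Module k V]
    {F G : Obj P I →ₗ[k] V} (h : ∀ m μ, F (cls P m μ) = G (cls P m μ)) : F = G := by
  refine DirectSum.linearMap_ext _ fun m => ?_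
  refine Submodule.linearMap_qext _ ?_
  exact LinearMap.ext fun μ => h m μ

/-- The partial composition of `P ∨ kα`. -/
noncomputable def comp {I J : Type} [Finite I] [Finite J] (i : I) :
    Obj P I →ₗ[k] Obj P J →ₗ[k] Obj P (Ins I i J) :=
  LinearMap.flip <| desc (V := Obj P I →ₗ[k] Obj P (Ins I i J))
    (fun l => (compLeft P i l).flip) (by
      intro l τ ν
      refine obj_hom_ext fun m μ => ?_
      have h := compCls_perm i (1 : Equiv.Perm (Fin m)) τ μ ν
      rw [map_sumCongr_one, Equiv.Perm.sign_one, one_mul] at h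
      change compLeft P i l (cls P m μ) _ = Equiv.Perm.sign τ • compLeft P i l (cls P m μ) ν
      rw [compLeft, desc_cls]
      exact h)

theorem comp_cls {I J : Type} [Finite I] [Finite J] (i : I) (m l : ℕ) (μ : P.obj (I ⊕ Fin m))
    (ν : P.obj (J ⊕ Fin l)) : comp P i (cls P m μ) (cls P l ν) = cls P (m + l)
      (P.map (compEquiv J i m l) (P.comp (Sum.inl i) μ ν)) := by
  rw [comp, LinearMap.flip_apply, desc_cls, LinearMap.flip_apply, compLeft, desc_cls]
  rfl

/-- The unit of `P`, viewed in `P ∨ kα`. -/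
noncomputable def one : Obj P Unit := cls P 0 (P.map (Equiv.sumEmpty Unit (Fin 0)).symm P.one)

/-- The inputs after the first of the inputs `Fin (m + 1)` is replaced by two inputs. -/
def splitEquiv (I : Type) (m : ℕ) :
    Ins (I ⊕ Fin (m + 1)) (Sum.inr 0) (Fin 2) ≃ I ⊕ Fin (m + 2) :=
  (Equiv.sumCongr ((Ins.removeInr 0).trans
    (Equiv.sumCongr (Equiv.refl I) (finSuccAboveEquiv 0).symm)) (Equiv.refl (Fin 2))).trans <|
    (Equiv.sumAssoc _ _ _).trans (Equiv.sumCongr (Equiv.refl I) finSumFinEquiv)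

variable (b : P.obj (Fin 2))

/-- `μ(x; [α, α], α, …, α)`, the bracket `[-,-]` being `b`. -/
noncomputable def splitFirst {I : Type} [Finite I] (m : ℕ) :
    P.obj (I ⊕ Fin (m + 1)) →ₗ[k] Obj P I :=
  cls P (m + 2) ∘ₗ P.map (splitEquiv I m) ∘ₗ (P.comp (Sum.inr 0)).flip b

/-- The derivation `d_MC` on `μ(x; α, …, α)`. It vanishes on `P` and `d_MC α = -½ [α, α]`. By the
Koszul sign rule, replacing the `j`-th occurrence of `α` (`j = 0, 1, …`) contributes the sign
`(-1) ^ j`. The permutation `j.cycleRange` moves `j` to `0` and keeps the order of the others; the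
place of `[α, α]` among the remaining `α`'s does not matter, since it is of even degree. -/
noncomputable def dMCCls {I : Type} [Finite I] : (m : ℕ) → P.obj (I ⊕ Fin m) →ₗ[k] Obj P I
  | 0 => 0
  | m + 1 => (-(1 / 2) : k) • ∑ j : Fin (m + 1), (-1 : ℤˣ) ^ (j : ℕ) •
      splitFirst P b m ∘ₗ P.map (Equiv.sumCongr (Equiv.refl I) j.cycleRange)

variable {P b} in
theorem splitFirst_perm {I : Type} [Finite I] {m : ℕ} (ρ : Equiv.Perm (Fin (m + 1))) (hρ : ρ 0 = 0)
    (μ : P.obj (I ⊕ Fin (m + 1))) :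
    splitFirst P b m (P.map (Equiv.sumCongr (Equiv.refl I) ρ) μ) =
      Equiv.Perm.sign ρ • splitFirst P b m μ := by
  obtain ⟨⟨p, τ⟩, rfl⟩ := Equiv.Perm.decomposeFin.symm.surjective ρ
  obtain rfl : p = 0 := by simpa using hρ
  have hs : Equiv.Perm.sign (finSumFinEquiv.permCongr
      (Equiv.Perm.sumCongr τ (1 : Equiv.Perm (Fin 2)))) =
      Equiv.Perm.sign (Equiv.Perm.decomposeFin.symm ((0 : Fin (m + 1)), τ)) := by
    rw [Equiv.Perm.sign_permCongr, Equiv.Perm.sign_sumCongr]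
    simp
  simp only [splitFirst, LinearMap.comp_apply, LinearMap.flip_apply]
  rw [← hs, ← cls_perm, ← P.map_trans]
  congr 1
  have h := P.map_comp_eq (i := (Sum.inr 0 : I ⊕ Fin (m + 1))) (i' := Sum.inr 0)
    (Equiv.sumCongr (Equiv.refl I) (Equiv.Perm.decomposeFin.symm ((0 : Fin (m + 1)), τ)))
    (Equiv.refl (Fin 2)) (by simp) (splitEquiv I m)
    ((splitEquiv I m).trans (Equiv.sumCongr (Equiv.refl I) (finSumFinEquiv.permCongr
      (Equiv.Perm.sumCongr τ (1 : Equiv.Perm (Fin 2)))))) ?_ ?_ μ b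
  · rwa [P.map_refl] at h
  · rintro ⟨x | x, hx⟩
    · simp [splitEquiv, Ins.removeInr]
    · obtain ⟨y, rfl⟩ := Fin.exists_succ_eq.2 (fun h : x = 0 => hx (by rw [h]))
      have hsucc : ∀ (z : Fin m) (hz : z.succ ≠ 0),
          (finSuccAboveEquiv (0 : Fin (m + 1))).symm ⟨z.succ, hz⟩ = z := fun z hz => by
        rw [Equiv.symm_apply_eq]; ext; simp [finSuccAboveEquiv_apply]
      simp [splitEquiv, Ins.removeInr, hsucc, Equiv.permCongr_apply]
  · intro x
    simp [splitEquiv, Equiv.permCongr_apply]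

variable {P b} in
theorem dMCCls_perm {I : Type} [Finite I] : ∀ (m : ℕ) (σ : Equiv.Perm (Fin m))
    (μ : P.obj (I ⊕ Fin m)), dMCCls P b m (P.map (Equiv.sumCongr (Equiv.refl I) σ) μ) =
      Equiv.Perm.sign σ • dMCCls P b m μ
  | 0, σ, μ => by simp [dMCCls]
  | m + 1, σ, μ => by
    have key : ∀ j : Fin (m + 1), (-1 : ℤˣ) ^ (σ j : ℕ) • splitFirst P b m
        (P.map (Equiv.sumCongr (Equiv.refl I) (σ j).cycleRange)
          (P.map (Equiv.sumCongr (Equiv.refl I) σ) μ)) =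
        Equiv.Perm.sign σ • (-1 : ℤˣ) ^ (j : ℕ) • splitFirst P b m
          (P.map (Equiv.sumCongr (Equiv.refl I) j.cycleRange) μ) := by
      intro j
      have h := splitFirst_perm (P := P) (b := b) (I := I)
        ((σ j).cycleRange * σ * j.cycleRange⁻¹) (by
          simp) (P.map (Equiv.sumCongr (Equiv.refl I) j.cycleRange) μ)
      rw [← P.map_trans] at h ⊢
      have he : (Equiv.sumCongr (Equiv.refl I) j.cycleRange).trans (Equiv.sumCongr (Equiv.refl I)
          ((σ j).cycleRange * σ * j.cycleRange⁻¹)) =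
          (Equiv.sumCongr (Equiv.refl I) σ).trans
            (Equiv.sumCongr (Equiv.refl I) (σ j).cycleRange) := by
        ext x
        rcases x with x | x <;> simp
      rw [he] at h
      rw [h, ← Fin.sign_cycleRange (σ j), smul_smul, smul_smul, ← Fin.sign_cycleRange j]
      congr 1
      simp only [map_mul, map_inv, Int.units_inv_eq_self]
      rw [← mul_assoc, ← mul_assoc, Int.units_mul_self, one_mul]
    simp only [dMCCls, LinearMap.smul_apply, LinearMap.sum_apply, LinearMap.comp_apply]
    rw [smul_comm]
    congr 1
    rw [Finset.smul_sum, ← Equiv.sum_comp σ]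
    exact Finset.sum_congr rfl fun j _ => key j

/-- The differential `d_MC` of the operad `MC(P)`. -/
noncomputable def dMC {I : Type} [Finite I] : Obj P I →ₗ[k] Obj P I :=
  desc (dMCCls P b) dMCCls_perm

/-- The operation `ℓ₁^α(a) = [α, a]`. -/
noncomputable def ell : Obj P Unit :=
  cls P 1 (P.map ((finSumFinEquiv (m := 1) (n := 1)).symm.trans ((Equiv.sumComm _ _).trans
    (Equiv.sumCongr (Equiv.ofUnique (Fin 1) Unit) (Equiv.refl (Fin 1))))) b)

/-- The sign automorphism `x ↦ (-1) ^ |x| x`. -/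
noncomputable def parity {I : Type} [Finite I] : Obj P I →ₗ[k] Obj P I :=
  desc (fun m => (-1 : ℤˣ) ^ m • cls P m) (by
    intro m σ μ
    rw [LinearMap.smul_apply, LinearMap.smul_apply, cls_perm, smul_comm])

/-- The commutator `[ℓ₁^α, x] = ℓ₁^α ∘ x - (-1) ^ |x| ∑ᵢ x ∘ᵢ ℓ₁^α`. -/
noncomputable def adEll {I : Type} [Finite I] : Obj P I →ₗ[k] Obj P I :=
  map P (Ins.unitLeft I) ∘ₗ comp P () (ell P b) -
    ∑ᶠ i : I, map P (Ins.unitRight i) ∘ₗ (comp P i).flip (ell P b) ∘ₗ parity P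

end Tw

/-- The operadic twisting `Tw(P)` of an operad `P` in vector spaces (with zero differential), with
respect to the morphism from the Lie operad to `P` that sends the generator to `b`: the operad
`P ∨ kα` with the differential `d_MC + [ℓ₁^α, -]`. -/
noncomputable def Tw {k : Type u} [Field k] (P : OperadData k) (b : P.obj (Fin 2)) :
    DGOperadData k where
  obj I _ := Tw.Obj P I
  gr I _ n := Tw.gr P I n
  map e := Tw.map P e
  one := Tw.one P
  comp i := Tw.comp P i
  d := Tw.dMC P b + Tw.adEll P b

/-- The inclusion of `P` into `Tw(P)`, as the operations without `α`. -/
noncomputable def Tw.incl {k : Type u} [Field k] (P : OperadData k) (b : P.obj (Fin 2))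
    (I : Type) [Finite I] : P.obj I →ₗ[k] (Tw P b).obj I :=
  Tw.cls P 0 ∘ₗ P.map (Equiv.sumEmpty I (Fin 0)).symm

/-! In characteristic zero the sign coinvariants that form the component of degree `-m` can be
replaced by functions. An element becomes a function on rooted trees with white vertices `I` (the
inputs) and `m` black vertices (the `α`'s), antisymmetric in the black labels (`PL.cls_eq_zero_iff`,
`PL.exists_alt_eq`). The value of `dφ` at a tree is then a signed sum, over the black vertices `p`
and the edges at `p`, of the values of `φ` at the trees with that edge contracted. After the
cancellations between `d_MC` and the two halves of `[ℓ₁^α, -]`, the weights (`ParentFun.wgt`) are as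
follows. The edge from `p` to its parent counts `1`, or `0` if `p` is a leaf. The edge from `p` to a
child counts `-1` if the child is white and `0` if it is black, increased by `1` if `p` is the root
and has no other child.

Fix an input `i`, and call a tree special if `i` is a leaf attached to another input `j`.
Contractions at black vertices do not touch the edge between `i` and `j`. So restriction to special
trees is a chain map onto the sum over `j ≠ i` of the complexes with inputs `I \ {i}`
(`ParentFun.diff_extLeaf`). The kernel of this restriction is contractible. Let `T⁺` be `T` with a
new black vertex in the place of `i` and with `i` hanging from it as a leaf (`ParentFun.plus`), and
let `(hφ)(T) = φ(T⁺)`. Contracting the edge between the new vertex and `i` returns `T` with weight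
`-1`. The other contractions at the new vertex lead to special trees, except the one into a black
parent, which cancels the failure of `T ↦ T⁺` to commute with contractions at that parent. Hence `dh
+ hd = -1` (`ParentFun.diff_plus`). The only exception is the tree with a single vertex, which is a
cycle.

Consequently the homology for `I` is the sum of copies, indexed by `j ≠ i`, of the homology for `I \
{i}` as soon as there are two inputs; with one input there are no special trees, and the homology in
negative degrees vanishes. In arity zero there is no input to choose. There the sum of the same
construction over all leaves is used: it gives a homotopy for multiplication by the number of
leaves, which the contractions preserve and which is invertible in characteristic zero
(`ParentFun.sum_diff_plus`).

In degree zero there are no boundaries, so the homology is the space of cycles. A cycle is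
determined by its coefficients at special trees, and these coefficients are again cycles with one
input fewer. The Lie operad obeys the same recursion: a Lie element with at least two inputs is a
sum over `j` of elements `z_j` in which `j` is replaced by `[i, j]` (`LieOp.exists_eq_sum_brR`), and
the coefficients of its image at the special trees with `i` attached to `j` are those of `-z_j`
(`PL.ev_addLeaf_brR`). Induction on the arity identifies Lie elements with cycles.

The morphism itself exists for any operad with an antisymmetric operation that satisfies the Jacobi
identity, by the universal property of free Lie algebras applied to the Lie algebra `LieSum`. It
lands in the cycles because `x ↦ b(ν, x) - ∑ x ∘ᵢ b(ν, i)` is a derivation that kills the unit and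
`b`. -/

/-! ### Operads in vector spaces: axioms, relabelled compositions, Lie brackets -/

namespace OperadData

variable {k : Type u} [Field k]

/-- The associativity and unit axioms of an operad in vector spaces. -/
structure IsOperad (P : OperadData k) : Prop where
  one_comp : ∀ {I : Type} [Finite I] (x : P.obj I),
    P.map (Ins.unitLeft I) (P.comp () P.one x) = x
  comp_one : ∀ {I : Type} [Finite I] (i : I) (x : P.obj I),
    P.map (Ins.unitRight i) (P.comp i x P.one) = x
  comp_seq : ∀ {I J K : Type} [Finite I] [Finite J] [Finite K] (i : I) (j : J)
    (x : P.obj I) (y : P.obj J) (z : P.obj K),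
    P.map (Ins.seq K i j) (P.comp (Sum.inr j) (P.comp i x y) z) = P.comp i x (P.comp j y z)
  comp_par : ∀ {I J K : Type} [Finite I] [Finite J] [Finite K] (i i' : I) (h : i' ≠ i)
    (x : P.obj I) (y : P.obj J) (z : P.obj K),
    P.map (Ins.par J K i i' h) (P.comp (Sum.inl ⟨i', h⟩) (P.comp i x y) z) =
      P.comp (Sum.inl ⟨i, h.symm⟩) (P.comp i' x z) y

theorem mem_toDG_gr {P : OperadData k} {I : Type} [Finite I] {n : ℤ} {x : P.obj I} :
    x ∈ P.toDG.gr I n ↔ n = 0 ∨ x = 0 := by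
  change x ∈ (if n = 0 then ⊤ else ⊥ : Submodule k (P.obj I)) ↔ _
  split_ifs with h <;> simp [h]

theorem isInternal_toDG_gr (P : OperadData k) (I : Type) [Finite I] :
    DirectSum.IsInternal fun n : ℤ => (if n = 0 then ⊤ else ⊥ : Submodule k (P.obj I)) := by
  rw [DirectSum.isInternal_submodule_iff_iSupIndep_and_iSup_eq_top]
  refine ⟨?_, ?_⟩
  · rw [iSupIndep_def]
    intro n
    by_cases hn : n = 0
    · refine Disjoint.mono_right (iSup₂_le fun m hm => ?_) disjoint_bot_right
      simp [show m ≠ 0 from fun h => hm (h.trans hn.symm)]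
    · simp [hn]
  · exact eq_top_iff.2 (le_trans (by simp) (le_iSup _ (0 : ℤ)))

theorem IsOperad.isDGOperad_toDG {P : OperadData k} (hP : P.IsOperad) : P.toDG.IsDGOperad where
  internal I _ := P.isInternal_toDG_gr I
  map_mem {I J} _ _ e n x hx := by
    refine mem_toDG_gr.2 ((mem_toDG_gr.1 hx).imp_right fun h => ?_)
    exact (congrArg (P.map e) h).trans (map_zero _)
  map_refl := P.map_refl
  map_trans := P.map_trans
  one_mem := mem_toDG_gr.2 (.inl rfl)
  comp_mem {I J} _ _ i m n x y hx hy := by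
    rcases mem_toDG_gr.1 hx with rfl | h
    · rw [zero_add]
      refine mem_toDG_gr.2 ((mem_toDG_gr.1 hy).imp_right fun h => ?_)
      exact (congrArg (P.comp i x) h).trans (map_zero _)
    · exact mem_toDG_gr.2 (.inr ((congrArg (fun t => P.comp i t y) h).trans ((P.comp i).map_zero₂ y)))
  map_comp := P.map_comp
  one_comp := hP.one_comp
  comp_one := hP.comp_one
  comp_seq := hP.comp_seq
  comp_par {I J K} _ _ _ i i' h m n x y z hy hz := by
    rcases mem_toDG_gr.1 hy with rfl | hy'
    · rw [zero_mul, Int.negOnePow_zero, one_smul]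
      exact hP.comp_par i i' h x y z
    · have e : y = (0 : P.toDG.obj J) := hy'
      simp [e]
  d_mem _ := mem_toDG_gr.2 (.inr rfl)
  d_d _ := rfl
  d_map e _ := (map_zero (P.map e)).symm
  d_comp {I J} _ _ i m x y _ := by
    have h₁ : P.toDG.d y = 0 := rfl
    have h₂ : P.toDG.d x = 0 := rfl
    rw [h₁, h₂]
    simp only [map_zero, LinearMap.zero_apply, smul_zero, add_zero]
    rfl

variable (P : OperadData k)

/-- The partial composition `x ∘ᵢ y` with its inputs relabelled by `g`. -/
noncomputable def cmp {X Y Z : Type} [Finite X] [Finite Y] [Finite Z] (x : X)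
    (g : Ins X x Y ≃ Z) : P.obj X →ₗ[k] P.obj Y →ₗ[k] P.obj Z :=
  (P.comp x).compr₂ (P.map g)

variable {P}

theorem map_cmp {X Y Z W : Type} [Finite X] [Finite Y] [Finite Z] [Finite W] {x : X}
    (g : Ins X x Y ≃ Z) (h : Z ≃ W) (μ : P.obj X) (ν : P.obj Y) :
    P.map h (P.cmp x g μ ν) = P.cmp x (g.trans h) μ ν := by
  simp [cmp, P.map_trans]

/-- Equivariance with the compatibility of the relabellings stated label by label, so that for
explicit bijections the hypotheses can be settled by definitional unfolding. -/
theorem cmp_map_map {X X' Y Y' Z : Type} [Finite X] [Finite Y] [Finite Z] [Finite X'] [Finite Y']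
    (e : X ≃ X') (f : Y ≃ Y') {x : X} {x' : X'} (hx : e x = x')
    (g : Ins X' x' Y' ≃ Z) (h : Ins X x Y ≃ Z)
    (hl : ∀ (a : {y // y ≠ x}) (ha), g (.inl ⟨e a.1, ha⟩) = h (.inl a))
    (hr : ∀ b : Y, g (.inr (f b)) = h (.inr b)) (μ : P.obj X) (ν : P.obj Y) :
    P.cmp x' g (P.map e μ) (P.map f ν) = P.cmp x h μ ν :=
  P.map_comp_eq e f hx g h (fun a => hl a _) hr μ ν

theorem cmp_map_left {X X' Y Z : Type} [Finite X] [Finite Y] [Finite Z] [Finite X']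
    (e : X ≃ X') {x : X} {x' : X'} (hx : e x = x') (g : Ins X' x' Y ≃ Z) (h : Ins X x Y ≃ Z)
    (hl : ∀ (a : {y // y ≠ x}) (ha), g (.inl ⟨e a.1, ha⟩) = h (.inl a))
    (hr : ∀ b : Y, g (.inr b) = h (.inr b)) (μ : P.obj X) (ν : P.obj Y) :
    P.cmp x' g (P.map e μ) ν = P.cmp x h μ ν := by
  conv_lhs => rw [← P.map_refl ν]
  exact cmp_map_map e (Equiv.refl Y) hx g h hl hr μ ν

theorem cmp_map_right {X Y Y' Z : Type} [Finite X] [Finite Y] [Finite Z] [Finite Y']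
    (f : Y ≃ Y') {x : X} (g : Ins X x Y' ≃ Z) (h : Ins X x Y ≃ Z)
    (hl : ∀ (a : {y // y ≠ x}), g (.inl a) = h (.inl a))
    (hr : ∀ b : Y, g (.inr (f b)) = h (.inr b)) (μ : P.obj X) (ν : P.obj Y) :
    P.cmp x g μ (P.map f ν) = P.cmp x h μ ν := by
  conv_lhs => rw [← P.map_refl μ]
  exact cmp_map_map (Equiv.refl X) f rfl g h (fun a _ => hl a) hr μ ν

/-- Sequential associativity freed from the canonical label sets: `h₁`, `h₂`, `h₃` say that the
inputs of `μ`, of `ν` and of `ρ` end up at the same labels on both sides. -/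
theorem IsOperad.cmp_seq (hP : P.IsOperad) {X Y Z W U V : Type} [Finite X] [Finite Y] [Finite Z]
    [Finite W] [Finite U] [Finite V] {x : X} {y : Y} {z : Z} (g : Ins X x Y ≃ Z)
    (hz : g (.inr y) = z) (h : Ins Z z W ≃ V) (g' : Ins Y y W ≃ U) (h' : Ins X x U ≃ V)
    (h₁ : ∀ (a : {a // a ≠ x}) (ha), h (.inl ⟨g (.inl a), ha⟩) = h' (.inl a))
    (h₂ : ∀ (b : {b // b ≠ y}) (hb), h (.inl ⟨g (.inr b.1), hb⟩) = h' (.inr (g' (.inl b))))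
    (h₃ : ∀ c, h (.inr c) = h' (.inr (g' (.inr c))))
    (μ : P.obj X) (ν : P.obj Y) (ρ : P.obj W) :
    P.cmp z h (P.cmp x g μ ν) ρ = P.cmp x h' μ (P.cmp y g' ν ρ) := by
  subst hz
  have e₁ : P.cmp (g (.inr y)) h (P.cmp x g μ ν) ρ =
      P.cmp (Sum.inr y) ((Ins.congr g (Equiv.refl W) (Sum.inr y)).trans h) (P.comp x μ ν) ρ :=
    cmp_map_left g rfl _ _ (fun _ _ => rfl) (fun _ => rfl) _ _
  have e₂ : P.cmp x h' μ (P.cmp y g' ν ρ) =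
      P.cmp x ((Ins.congr (Equiv.refl X) g' x).trans h') μ (P.comp y ν ρ) :=
    cmp_map_right g' _ _ (fun _ => rfl) (fun _ => rfl) _ _
  rw [e₁, e₂]
  simp only [cmp, LinearMap.compr₂_apply]
  rw [← hP.comp_seq, ← P.map_trans]
  congr 2
  ext t
  rcases t with ⟨a | b, hab⟩ | c
  · exact h₁ a _
  · exact h₂ ⟨b, fun e => hab (by rw [e])⟩ _
  · exact h₃ c

/-- The parallel axiom in the same form, with one hypothesis for the inputs of each of the three
operations. -/
theorem IsOperad.cmp_par (hP : P.IsOperad) {X Y Y' Z Z' V : Type} [Finite X] [Finite Y] [Finite Y']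
    [Finite Z] [Finite Z'] [Finite V] {x x' : X} (hx : x' ≠ x) {z : Z} {z' : Z'}
    (g : Ins X x Y ≃ Z) (g' : Ins X x' Y' ≃ Z')
    (hz : g (.inl ⟨x', hx⟩) = z) (hz' : g' (.inl ⟨x, hx.symm⟩) = z')
    (h : Ins Z z Y' ≃ V) (h' : Ins Z' z' Y ≃ V)
    (h₁ : ∀ (a : X) (ha : a ≠ x) (ha' : a ≠ x') (hb) (hb'),
      h (.inl ⟨g (.inl ⟨a, ha⟩), hb⟩) = h' (.inl ⟨g' (.inl ⟨a, ha'⟩), hb'⟩))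
    (h₂ : ∀ (b : Y) (hb), h (.inl ⟨g (.inr b), hb⟩) = h' (.inr b))
    (h₃ : ∀ (b : Y') (hb), h (.inr b) = h' (.inl ⟨g' (.inr b), hb⟩))
    (μ : P.obj X) (ν : P.obj Y) (ρ : P.obj Y') :
    P.cmp z h (P.cmp x g μ ν) ρ = P.cmp z' h' (P.cmp x' g' μ ρ) ν := by
  subst hz hz'
  have e₁ : P.cmp (g (.inl ⟨x', hx⟩)) h (P.cmp x g μ ν) ρ =
      P.cmp (Sum.inl ⟨x', hx⟩) ((Ins.congr g (Equiv.refl Y') (Sum.inl ⟨x', hx⟩)).trans h)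
        (P.comp x μ ν) ρ :=
    cmp_map_left g rfl _ _ (fun _ _ => rfl) (fun _ => rfl) _ _
  have e₂ : P.cmp (g' (.inl ⟨x, hx.symm⟩)) h' (P.cmp x' g' μ ρ) ν =
      P.cmp (Sum.inl ⟨x, hx.symm⟩) ((Ins.congr g' (Equiv.refl Y) (Sum.inl ⟨x, hx.symm⟩)).trans h')
        (P.comp x' μ ρ) ν :=
    cmp_map_left g' rfl _ _ (fun _ _ => rfl) (fun _ => rfl) _ _
  rw [e₁, e₂]
  simp only [cmp, LinearMap.compr₂_apply]
  rw [← hP.comp_par x x' hx, ← P.map_trans]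
  congr 2
  ext t
  rcases t with ⟨⟨a, ha⟩ | b, hab⟩ | c
  · exact h₁ a ha (fun e => hab (by subst e; rfl)) _ _
  · exact h₂ b _
  · exact h₃ c _

theorem IsOperad.cmp_one (hP : P.IsOperad) {X Y Z : Type} [Finite X] [Unique Y] [Finite Z]
    (x : X) (g : Ins X x Y ≃ Z) (e : X ≃ Z) (h₁ : ∀ a, g (.inl a) = e a.1)
    (h₂ : ∀ u, g (.inr u) = e x) (f : Unit ≃ Y) (μ : P.obj X) :
    P.cmp x g μ (P.map f P.one) = P.map e μ := by
  conv_rhs => rw [← hP.comp_one x μ, ← P.map_trans]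
  refine P.cmp_map_right f _ _ ?_ ?_ _ _
  · intro a; simp [h₁, Ins.unitRight]
  · intro a; simp [h₂, Ins.unitRight]

theorem IsOperad.one_cmp (hP : P.IsOperad) {X Y Z : Type} [Finite X] [Unique Y] [Finite Z]
    (y : Y) (g : Ins Y y X ≃ Z) (e : X ≃ Z) (h : ∀ a, g (.inr a) = e a) (f : Unit ≃ Y)
    (μ : P.obj X) : P.cmp y g (P.map f P.one) μ = P.map e μ := by
  conv_rhs => rw [← hP.one_comp μ, ← P.map_trans]
  refine P.cmp_map_left f (Subsingleton.elim _ _) _ _ ?_ ?_ _ _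
  · rintro ⟨a, ha⟩; exact absurd rfl ha
  · intro a; simp [h, Ins.unitLeft]

section Bracket

variable (P) (b : P.obj (Fin 2))

/-- The inputs of `b(ν, μ)`, where `ν` becomes the label `none`. -/
noncomputable def leftEquiv (X : Type) : Ins (Fin 2) 1 X ≃ Option X :=
  Equiv.ofBijective (Sum.elim (fun _ => none) some) (by
    refine ⟨?_, ?_⟩
    · rintro (⟨a, ha⟩ | a) (⟨c, hc⟩ | c) h
      · obtain rfl : a = 0 := by omega
        obtain rfl : c = 0 := by omega
        rfl
      · simp at h
      · simp at h
      · simpa using h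
    · rintro (_ | a)
      · exact ⟨.inl ⟨0, by simp⟩, rfl⟩
      · exact ⟨.inr a, rfl⟩)

/-- The inputs of `μ ∘ₓ b(ν, x)`, where `ν` becomes the label `none`. -/
noncomputable def rightEquiv {X : Type} (x : X) : Ins X x (Fin 2) ≃ Option X :=
  Equiv.ofBijective (Sum.elim (fun a => some a.1) ![none, some x]) (by
    refine ⟨?_, ?_⟩
    · rintro (⟨a, ha⟩ | a) (⟨c, hc⟩ | c) h
      · simpa using h
      · fin_cases c <;> simp_all
      · fin_cases a
        · simp at h
        · exact absurd (by simpa using h.symm) hc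
      · fin_cases a <;> fin_cases c <;> simp_all
    · rintro (_ | a)
      · exact ⟨.inr 0, rfl⟩
      · by_cases h : a = x
        · exact ⟨.inr 1, by simp [h]⟩
        · exact ⟨.inl ⟨a, h⟩, rfl⟩)

@[simp] theorem leftEquiv_inl {X : Type} (a) : leftEquiv X (.inl a) = none := rfl
@[simp] theorem leftEquiv_inr {X : Type} (a) : leftEquiv X (.inr a) = some a := rfl
@[simp] theorem rightEquiv_inl {X : Type} (x : X) (a) : rightEquiv x (.inl a) = some a.1 := rfl
@[simp] theorem rightEquiv_inr_zero {X : Type} (x : X) : rightEquiv x (.inr 0) = none := rfl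
@[simp] theorem rightEquiv_inr_one {X : Type} (x : X) : rightEquiv x (.inr 1) = some x := rfl

/-- `b(ν, μ)`. -/
noncomputable def brL {X : Type} [Finite X] : P.obj X →ₗ[k] P.obj (Option X) :=
  P.cmp 1 (leftEquiv X) b

/-- `μ ∘ₓ b(ν, x)`. -/
noncomputable def brR {X : Type} [Finite X] (x : X) : P.obj X →ₗ[k] P.obj (Option X) :=
  (P.cmp x (rightEquiv x)).flip b

/-- `b` is antisymmetric and satisfies the Jacobi identity. -/
structure IsLieBracket : Prop where
  antisymm : P.map (Equiv.swap 0 1) b = -b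
  jacobi : P.brL b b = P.brR b 0 b + P.brR b 1 b

variable {P b}

theorem map_brL {X Y : Type} [Finite X] [Finite Y] (e : X ≃ Y) (μ : P.obj X) :
    P.map (Equiv.optionCongr e) (P.brL b μ) = P.brL b (P.map e μ) := by
  rw [brL, brL, P.cmp_map_right e _ ((leftEquiv X).trans (Equiv.optionCongr e)), map_cmp]
  · intro a; simp
  · intro a; simp

theorem map_brR {X Y : Type} [Finite X] [Finite Y] (e : X ≃ Y) (x : X) (μ : P.obj X) :
    P.map (Equiv.optionCongr e) (P.brR b x μ) = P.brR b (e x) (P.map e μ) := by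
  simp only [brR, LinearMap.flip_apply]
  rw [P.cmp_map_left e rfl _ ((rightEquiv x).trans (Equiv.optionCongr e)), map_cmp]
  · intro a ha; simp
  · intro a; fin_cases a <;> simp

end Bracket

end OperadData

/-! ### Insertion of rooted trees as a relation -/

namespace RT

instance {I : Type} [Finite I] : Finite (RT I) :=
  Finite.of_injective RT.parent fun _ _ h => RT.ext h

/-- The projection that collapses the inserted labels to the label that they replace. -/
def proj {I J : Type} (i : I) : Ins I i J → I := Sum.elim Subtype.val fun _ => i

@[simp] theorem proj_inl {I J : Type} (i : I) (x) : proj (J := J) i (.inl x) = x.1 := rfl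
@[simp] theorem proj_inr {I J : Type} (i : I) (x : J) : proj i (.inr x) = i := rfl

theorem map_proj_eq_self {I J : Type} {i : I} {o : Option (Ins I i J)} :
    o.map (proj i) = some i ↔ ∃ j, o = some (.inr j) := by
  rcases o with _ | ⟨⟨x, hx⟩ | j⟩
  · simp
  · simp [hx]
  · simp

theorem map_proj_eq_ne {I J : Type} {i x : I} (hx : x ≠ i) {o : Option (Ins I i J)} :
    o.map (proj i) = some x ↔ o = some (.inl ⟨x, hx⟩) := by
  rcases o with _ | ⟨⟨y, hy⟩ | j⟩
  · simp
  · simp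
  · simp [Ne.symm hx]

/-- `U` is one of the trees `T ∘ᵢᶠ S`. -/
structure IsGraft {I J : Type} (i : I) (T : RT I) (S : RT J) (U : RT (Ins I i J)) : Prop where
  inl : ∀ x, (U.parent (.inl x)).map (proj i) = T.parent x.1
  inr_some : ∀ {j j'}, S.parent j = some j' → U.parent (.inr j) = some (.inr j')
  inr_none : ∀ {j}, S.parent j = none → (U.parent (.inr j)).map (proj i) = T.parent i

variable {I J K : Type} {i : I} {T : RT I} {S : RT J}

theorem graft_parent_inl_of_eq (f : {x : I // T.parent x = some i} → J) {x : {x : I // x ≠ i}}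
    (h : T.parent x = some i) : (graft i T S f).parent (.inl x) = some (.inr (f ⟨x, h⟩)) := by
  simp [graft, graftParent, h]

theorem isGraft_graft (f : {x : I // T.parent x = some i} → J) :
    IsGraft i T S (graft i T S f) where
  inl x := by
    by_cases h : T.parent x = some i
    · rw [graft_parent_inl_of_eq f h, h]; rfl
    · cases hp : T.parent x.1 with
      | none => simp [graft, graftParent, hp]
      | some y =>
        have hy : y ≠ i := fun e => h (by rw [hp, e])
        simp [graft, graftParent, hp, hy]
  inr_some h := by simp [graft, graftParent, h]
  inr_none h := by
    cases hp : T.parent i with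
    | none => simp [graft, graftParent, hp, h]
    | some y =>
      have hy : y ≠ i := fun e => T.parent_ne_self i (by rw [hp, e])
      simp [graft, graftParent, hp, hy, h]

theorem IsGraft.parent_inr_ne {U : RT (Ins I i J)} (h : IsGraft i T S U) {j : J}
    (hj : S.parent j = none) (j' : J) : U.parent (.inr j) ≠ some (.inr j') := by
  intro e
  have := h.inr_none hj
  rw [e] at this
  exact T.parent_ne_self i this.symm

/-- The parent of every vertex is forced by `T` and `S`, except for the children of `i`: for these
it is only known that the new parent lies in `S`. This freedom is the function `f`. -/
theorem IsGraft.ext {U V : RT (Ins I i J)} (hU : IsGraft i T S U) (hV : IsGraft i T S V)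
    (h : ∀ x : {x // x ≠ i}, T.parent x = some i → U.parent (.inl x) = V.parent (.inl x)) :
    U = V := by
  ext z : 2
  rcases z with x | j
  · cases hp : T.parent x.1 with
    | none =>
      have h₁ := hU.inl x
      have h₂ := hV.inl x
      rw [hp, Option.map_eq_none_iff] at h₁ h₂
      rw [h₁, h₂]
    | some y =>
      by_cases hy : y = i
      · exact h x (by rw [hp, hy])
      · have h₁ := hU.inl x
        have h₂ := hV.inl x
        rw [hp, map_proj_eq_ne hy] at h₁ h₂
        rw [h₁, h₂]
  · cases hq : S.parent j with
    | some j' => rw [hU.inr_some hq, hV.inr_some hq]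
    | none =>
      have h₁ := hU.inr_none hq
      have h₂ := hV.inr_none hq
      cases hp : T.parent i with
      | none =>
        rw [hp, Option.map_eq_none_iff] at h₁ h₂
        rw [h₁, h₂]
      | some y =>
        have hy : y ≠ i := fun e => T.parent_ne_self i (by rw [hp, e])
        rw [hp, map_proj_eq_ne hy] at h₁ h₂
        rw [h₁, h₂]

theorem IsGraft.exists_graft {U : RT (Ins I i J)} (h : IsGraft i T S U) :
    ∃ f, graft i T S f = U := by
  have key : ∀ x : {x : I // T.parent x = some i},
      ∃ j, U.parent (.inl ⟨x.1, fun e => T.parent_ne_self i (by rw [← e, x.2, e])⟩) =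
        some (.inr j) := fun x => by
    rw [← map_proj_eq_self, h.inl, x.2]
  choose f hf using key
  refine ⟨f, (isGraft_graft f).ext h fun x hx => ?_⟩
  rw [graft_parent_inl_of_eq f hx]
  exact (hf ⟨x, hx⟩).symm

theorem graft_injective : Function.Injective (graft i T S) := by
  intro f g h
  funext x
  have hx : x.1 ≠ i := fun e => T.parent_ne_self i (by rw [← e, x.2, e])
  have h₁ := graft_parent_inl_of_eq (S := S) f (x := ⟨x.1, hx⟩) x.2
  rw [h, graft_parent_inl_of_eq (S := S) g (x := ⟨x.1, hx⟩) x.2] at h₁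
  simpa using h₁.symm

/-- Collapsing `S` to the vertex `i` recovers `T`; the parent of `i` itself is read off at the root
of `S`. Together with `right_unique` this makes the intermediate tree of an iterated insertion
unique. -/
theorem IsGraft.left_unique {T' : RT I} {U : RT (Ins I i J)} (h : IsGraft i T S U)
    (h' : IsGraft i T' S U) : T = T' := by
  ext x : 2
  by_cases hx : x = i
  · subst hx
    obtain ⟨r, hr, -⟩ := S.existsUnique_root
    rw [← h.inr_none hr, ← h'.inr_none hr]
  · rw [← h.inl ⟨x, hx⟩, ← h'.inl ⟨x, hx⟩]

theorem IsGraft.right_unique {S' : RT J} {U : RT (Ins I i J)} (h : IsGraft i T S U)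
    (h' : IsGraft i T S' U) : S = S' := by
  ext x : 2
  cases hx : S.parent x with
  | none =>
    cases hx' : S'.parent x with
    | none => rfl
    | some y => exact absurd (h'.inr_some hx') (h.parent_inr_ne hx y)
  | some y =>
    cases hx' : S'.parent x with
    | none => exact absurd (h.inr_some hx) (h'.parent_inr_ne hx' y)
    | some z => simpa [h'.inr_some hx'] using (h.inr_some hx).symm

theorem map_parent {I J : Type} (e : I ≃ J) (T : RT I) (x : I) :
    (T.map e).parent (e x) = (T.parent x).map e := by simp [map]

theorem map_seq_parent_inl {i : I} {j : J} (U : RT (Ins (Ins I i J) (Sum.inr j) K)) (x) :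
    (U.map (Ins.seq K i j)).parent (.inl x) =
      (U.parent (.inl ⟨.inl x, by simp⟩)).map (Ins.seq K i j) :=
  map_parent (Ins.seq K i j) U (.inl ⟨.inl x, by simp⟩)

theorem map_seq_parent_inr_inl {i : I} {j : J} (U : RT (Ins (Ins I i J) (Sum.inr j) K)) (x) :
    (U.map (Ins.seq K i j)).parent (.inr (.inl x)) =
      (U.parent (.inl ⟨.inr x.1, fun e => x.2 (Sum.inr.inj e)⟩)).map (Ins.seq K i j) :=
  map_parent (Ins.seq K i j) U (.inl ⟨.inr x.1, fun e => x.2 (Sum.inr.inj e)⟩)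

theorem map_seq_parent_inr_inr {i : I} {j : J} (U : RT (Ins (Ins I i J) (Sum.inr j) K)) (x) :
    (U.map (Ins.seq K i j)).parent (.inr (.inr x)) = (U.parent (.inr x)).map (Ins.seq K i j) :=
  map_parent (Ins.seq K i j) U (.inr x)

/-- Inside `U` the vertices of `S` and `R` span an insertion `W` of `R` into `S`, and collapsing it
leaves `T`. With its converse this is associativity at the level of single trees. -/
theorem exists_isGraft_seq {i : I} {j : J} {R : RT K} {V : RT (Ins I i J)}
    {U : RT (Ins (Ins I i J) (Sum.inr j) K)} (hV : IsGraft i T S V)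
    (hU : IsGraft (Sum.inr j) V R U) :
    ∃ W, IsGraft j S R W ∧ IsGraft i T W (U.map (Ins.seq K i j)) := by
  -- A child of `j` in `S` is still a child of `j` in `V`, so in `U` it hangs from a vertex `c` of
  -- `R`; these vertices are the grafting function of `W`.
  have key : ∀ x : {x : J // S.parent x = some j}, ∃ c,
      U.parent (.inl ⟨.inr x.1, fun e => S.parent_ne_self j (by
        rw [← Sum.inr.inj e, x.2, Sum.inr.inj e])⟩) = some (.inr c) := fun x => by
    rw [← map_proj_eq_self, hU.inl, hV.inr_some x.2]
  choose g hg using key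
  have hW := isGraft_graft (T := S) (S := R) (i := j) g
  refine ⟨_, hW, ?_, ?_, ?_⟩
  · intro x
    have e₁ := hU.inl ⟨.inl x, by simp⟩
    rw [map_seq_parent_inl, ← hV.inl, ← e₁]
    simp only [Option.map_map]
    congr 1
    ext z
    rcases z with ⟨z | z, hz⟩ | z <;> rfl
  · rintro (x | c) w hw
    · rw [map_seq_parent_inr_inl]
      by_cases hx : S.parent x = some j
      · rw [graft_parent_inl_of_eq g hx, Option.some.injEq] at hw
        rw [hg ⟨x, hx⟩, ← hw]
        rfl
      · have h₁ := hW.inl x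
        rw [hw] at h₁
        rcases w with w | w
        · have h₂ := hU.inl ⟨.inr x.1, fun e => x.2 (Sum.inr.inj e)⟩
          rw [hV.inr_some h₁.symm, proj_inl, map_proj_eq_ne (fun e => w.2 (Sum.inr.inj e))] at h₂
          rw [h₂]
          rfl
        · exact absurd h₁.symm hx
    · rw [map_seq_parent_inr_inr]
      cases hc : R.parent c with
      | some c' =>
        rw [hW.inr_some hc, Option.some.injEq] at hw
        rw [hU.inr_some hc, ← hw]
        rfl
      | none =>
        have h₁ := hW.inr_none hc
        rw [hw] at h₁
        have h₂ := hU.inr_none hc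
        rcases w with w | w
        · rw [hV.inr_some h₁.symm, proj_inl, map_proj_eq_ne (fun e => w.2 (Sum.inr.inj e))] at h₂
          rw [h₂]
          rfl
        · exact absurd h₁.symm (S.parent_ne_self j)
  · have aux : ∀ o : Option (Ins (Ins I i J) (Sum.inr j) K),
        (o.map (Ins.seq K i j)).map (proj i) = (o.map (proj (Sum.inr j))).map (proj i) := by
      rintro (_ | ⟨⟨z | z, hz⟩ | z⟩) <;> rfl
    rintro (x | c) hw
    · rw [map_seq_parent_inr_inl, aux,
        hU.inl]
      refine hV.inr_none ?_
      rw [← hW.inl x, hw]; rfl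
    · rw [map_seq_parent_inr_inr, aux]
      cases hc : R.parent c with
      | some c' => rw [hW.inr_some hc] at hw; cases hw
      | none =>
        rw [hU.inr_none hc]
        refine hV.inr_none ?_
        rw [← hW.inr_none hc, hw]; rfl

theorem exists_isGraft_seq_symm {i : I} {j : J} {R : RT K} {W : RT (Ins J j K)}
    {U : RT (Ins (Ins I i J) (Sum.inr j) K)} (hW : IsGraft j S R W)
    (hU : IsGraft i T W (U.map (Ins.seq K i j))) :
    ∃ V, IsGraft i T S V ∧ IsGraft (Sum.inr j) V R U := by
  have key : ∀ x : {x : I // T.parent x = some i}, ∃ c,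
      (U.map (Ins.seq K i j)).parent (.inl ⟨x.1, fun e => T.parent_ne_self i (by
        rw [← e, x.2, e])⟩) = some (.inr c) := fun x => by
    rw [← map_proj_eq_self, hU.inl, x.2]
  choose f hf using key
  -- A subtree that `U` grafts at a vertex of `W` is grafted in `V` at the image of that vertex
  -- after collapsing `R` to `j`.
  have hV := isGraft_graft (T := T) (S := S) (i := i) fun x => proj j (f x)
  have inj : ∀ {o : Option (Ins (Ins I i J) (Sum.inr j) K)} (z),
      o.map (Ins.seq K i j) = some (Ins.seq K i j z) → o = some z :=
    fun z h => Option.map_injective (Ins.seq K i j).injective h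
  have aux : ∀ o : Option (Ins (Ins I i J) (Sum.inr j) K),
      (o.map (Ins.seq K i j)).map (proj i) = (o.map (proj (Sum.inr j))).map (proj i) := by
    rintro (_ | ⟨⟨z | z, hz⟩ | z⟩) <;> rfl
  refine ⟨_, hV, ?_, ?_, ?_⟩
  · rintro ⟨x | x, hx⟩
    · have h₁ := hU.inl x
      rw [map_seq_parent_inl] at h₁
      by_cases hp : T.parent x = some i
      · rw [graft_parent_inl_of_eq _ hp]
        have h₂ := hf ⟨x, hp⟩
        rw [map_seq_parent_inl] at h₂
        generalize f ⟨x, hp⟩ = w at h₂ ⊢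
        rcases w with w | w
        · rw [inj (.inl ⟨.inr w.1, fun e => w.2 (Sum.inr.inj e)⟩) h₂]
          rfl
        · rw [inj (.inr w) h₂]
          rfl
      · rw [aux, ← hV.inl] at h₁
        generalize hq : (graft i T S fun x => proj j (f x)).parent (.inl x) = q at h₁ ⊢
        rcases q with _ | ⟨⟨q, hq'⟩ | q⟩
        · simpa using h₁
        · rw [Option.map_some, proj_inl, map_proj_eq_ne hq'] at h₁
          exact h₁
        · have := hV.inl x
          rw [hq] at this
          exact absurd this.symm hp
    · have hx' : x ≠ j := fun e => hx (by rw [e])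
      cases hq : S.parent x with
      | some y =>
        rw [hV.inr_some hq]
        have h₁ := hW.inl ⟨x, hx'⟩
        rw [hq] at h₁
        by_cases hy : y = j
        · subst hy
          obtain ⟨c, hc⟩ := map_proj_eq_self.1 h₁
          have h₂ := hU.inr_some hc
          rw [map_seq_parent_inr_inl] at h₂
          rw [inj (.inr c) h₂]
          rfl
        · have h₂ := hU.inr_some ((map_proj_eq_ne hy).1 h₁)
          rw [map_seq_parent_inr_inl] at h₂
          rw [inj (.inl ⟨.inr y, fun e => hy (Sum.inr.inj e)⟩) h₂]
          rfl
      | none =>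
        have h₁ := hW.inl ⟨x, hx'⟩
        rw [hq, Option.map_eq_none_iff] at h₁
        have h₂ := hU.inr_none h₁
        rw [map_seq_parent_inr_inl, aux, ← hV.inr_none hq] at h₂
        generalize hz : (graft i T S fun x => proj j (f x)).parent (.inr x) = z at h₂ ⊢
        rcases z with _ | ⟨⟨z, hz'⟩ | z⟩
        · simpa using h₂
        · rw [Option.map_some, proj_inl, map_proj_eq_ne hz'] at h₂
          exact h₂
        · exact absurd hz (hV.parent_inr_ne hq z)
  · intro c c' hc
    have h₁ := hU.inr_some (hW.inr_some hc)
    rw [map_seq_parent_inr_inr] at h₁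
    exact inj (.inr c') h₁
  · intro c hc
    have h₀ := hW.inr_none hc
    cases hq : S.parent j with
    | some y =>
      rw [hV.inr_some hq]
      have hy : y ≠ j := fun e => S.parent_ne_self j (by rw [hq, e])
      rw [hq, map_proj_eq_ne hy] at h₀
      have h₁ := hU.inr_some h₀
      rw [map_seq_parent_inr_inr] at h₁
      rw [inj (.inl ⟨.inr y, fun e => hy (Sum.inr.inj e)⟩) h₁]
      rfl
    | none =>
      rw [hq, Option.map_eq_none_iff] at h₀
      have h₂ := hU.inr_none h₀
      rw [map_seq_parent_inr_inr, aux, ← hV.inr_none hq] at h₂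
      generalize hz : (graft i T S fun x => proj j (f x)).parent (.inr j) = z at h₂ ⊢
      rcases z with _ | ⟨⟨z, hz'⟩ | z⟩
      · simpa using h₂
      · rw [Option.map_some, proj_inl, map_proj_eq_ne hz'] at h₂
        exact h₂
      · exact absurd hz (hV.parent_inr_ne hq z)

theorem map_par_parent_inl {i i' : I} {h : i' ≠ i}
    (U : RT (Ins (Ins I i J) (Sum.inl ⟨i', h⟩) K)) (x : I) (hx : x ≠ i) (hx' : x ≠ i') (hy) :
    (U.map (Ins.par J K i i' h)).parent (.inl ⟨.inl ⟨x, hx'⟩, hy⟩) =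
      (U.parent (.inl ⟨.inl ⟨x, hx⟩, by simpa using hx'⟩)).map (Ins.par J K i i' h) :=
  map_parent (Ins.par J K i i' h) U (.inl ⟨.inl ⟨x, hx⟩, by simpa using hx'⟩)

theorem map_par_parent_inl_inr {i i' : I} {h : i' ≠ i}
    (U : RT (Ins (Ins I i J) (Sum.inl ⟨i', h⟩) K)) (x : K) (hy) :
    (U.map (Ins.par J K i i' h)).parent (.inl ⟨.inr x, hy⟩) =
      (U.parent (.inr x)).map (Ins.par J K i i' h) :=
  map_parent (Ins.par J K i i' h) U (.inr x)

theorem map_par_parent_inr {i i' : I} {h : i' ≠ i}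
    (U : RT (Ins (Ins I i J) (Sum.inl ⟨i', h⟩) K)) (x : J) :
    (U.map (Ins.par J K i i' h)).parent (.inr x) =
      (U.parent (.inl ⟨.inr x, by simp⟩)).map (Ins.par J K i i' h) :=
  map_parent (Ins.par J K i i' h) U (.inl ⟨.inr x, by simp⟩)

/-- Insertions at two different vertices can be performed in either order. Only one implication is
needed, since the other one is the same with the two vertices exchanged. -/
theorem exists_isGraft_par {i i' : I} {h : i' ≠ i} {R : RT K} {V : RT (Ins I i J)}
    {U : RT (Ins (Ins I i J) (Sum.inl ⟨i', h⟩) K)} (hV : IsGraft i T S V)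
    (hU : IsGraft (Sum.inl ⟨i', h⟩) V R U) :
    ∃ W, IsGraft i' T R W ∧ IsGraft (Sum.inl ⟨i, h.symm⟩) W S (U.map (Ins.par J K i i' h)) := by
  have aux : ∀ o : Option (Ins (Ins I i J) (Sum.inl ⟨i', h⟩) K),
      ((o.map (Ins.par J K i i' h)).map (proj (Sum.inl ⟨i, h.symm⟩))).map (proj i') =
        (o.map (proj (Sum.inl ⟨i', h⟩))).map (proj i) := by
    rintro (_ | ⟨⟨z | z, hz⟩ | z⟩) <;> rfl
  have aux' : ∀ (o : Option (Ins (Ins I i J) (Sum.inl ⟨i', h⟩) K)) (c : K),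
      (o.map (Ins.par J K i i' h)).map (proj (I := Ins I i' K) (J := J) (Sum.inl ⟨i, h.symm⟩)) =
        some (.inr c) ↔ o = some (.inr c) := by
    rintro (_ | ⟨⟨z | z, hz⟩ | z⟩) c <;> simp [Ins.par, Ins.removeInl, Ins.swapRemove]
  -- A label is determined by its image in `I` together with the knowledge of which vertex of `K`,
  -- if any, it is.
  have two : ∀ {o o' : Option (Ins I i' K)}, o.map (proj i') = o'.map (proj i') →
      (∀ c, o = some (.inr c) ↔ o' = some (.inr c)) → o = o' := by
    rintro (_ | ⟨z | z⟩) (_ | ⟨z' | z'⟩) h₁ h₂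
    · rfl
    · simp at h₁
    · simp at h₁
    · simp at h₁
    · simpa [Subtype.ext_iff] using h₁
    · simpa using h₂ z'
    · simp at h₁
    · simpa using h₂ z
    · exact ((h₂ z).1 rfl).symm
  have loc : ∀ x : {x : I // x ≠ i}, (hx : x.1 ≠ i') → T.parent x = some i' → ∃ c,
      U.parent (.inl ⟨.inl x, fun e => hx (congrArg Subtype.val (Sum.inl.inj e))⟩) =
        some (.inr c) := by
    intro x hx hp
    rw [← map_proj_eq_self, hU.inl]
    have := hV.inl x
    rwa [hp, map_proj_eq_ne h] at this
  have root : T.parent i = some i' → ∃ r, S.parent r = none ∧ ∃ c,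
      U.parent (.inl ⟨.inr r, by simp⟩) = some (.inr c) := by
    intro hp
    obtain ⟨r, hr, -⟩ := S.existsUnique_root
    refine ⟨r, hr, ?_⟩
    rw [← map_proj_eq_self, hU.inl]
    have := hV.inr_none hr
    rwa [hp, map_proj_eq_ne h] at this
  -- The children of `i'` in `T` hang from vertices of `R` in `U`. If `i` is such a child, it has
  -- been replaced by `S`, and the root of `S` takes over its role.
  have key : ∀ x : {x : I // T.parent x = some i'}, ∃ c,
      (∀ hx : x.1 ≠ i, U.parent (.inl ⟨.inl ⟨x.1, hx⟩, fun e => T.parent_ne_self i' (by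
        have := congrArg Subtype.val (Sum.inl.inj e)
        simp only at this
        rw [← this, x.2, this])⟩) = some (.inr c)) ∧
      (x.1 = i → ∀ r, S.parent r = none →
        U.parent (.inl ⟨.inr r, by simp⟩) = some (.inr c)) := by
    rintro ⟨x, hp⟩
    have hx' : x ≠ i' := fun e => T.parent_ne_self i' (by rw [← e, hp, e])
    by_cases hx : x = i
    · obtain ⟨r, hr, c, hc⟩ := root (by rw [← hx, hp])
      refine ⟨c, fun h => absurd hx h, fun _ r' hr' => ?_⟩
      rw [← hc]
      congr 4
      exact S.existsUnique_root.unique hr' hr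
    · obtain ⟨c, hc⟩ := loc ⟨x, hx⟩ hx' hp
      exact ⟨c, fun _ => hc, fun e => absurd e hx⟩
  choose f hf using key
  have hW := isGraft_graft (T := T) (S := R) (i := i') f
  have hWinr : ∀ (x : I) (hx : x ≠ i') c, (graft i' T R f).parent (.inl ⟨x, hx⟩) = some (.inr c) ↔
      ∃ hp : T.parent x = some i', f ⟨x, hp⟩ = c := by
    intro x hx c
    constructor
    · intro e
      have h₁ := hW.inl ⟨x, hx⟩
      rw [e] at h₁
      refine ⟨h₁.symm, ?_⟩
      rw [graft_parent_inl_of_eq (x := ⟨x, hx⟩) f h₁.symm] at e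
      simpa using e
    · rintro ⟨hp, rfl⟩
      rw [graft_parent_inl_of_eq (x := ⟨x, hx⟩) f hp]
  refine ⟨_, hW, ?_, ?_, ?_⟩
  · rintro ⟨⟨x, hx'⟩ | c, hx⟩
    · have hx₁ : x ≠ i := fun e => hx (by subst e; rfl)
      rw [map_par_parent_inl _ x hx₁ hx']
      refine two ?_ fun c => ?_
      · rw [aux, hU.inl, hV.inl, hW.inl]
      · rw [aux', hWinr]
        constructor
        · intro e
          have h₁ := hU.inl ⟨.inl ⟨x, hx₁⟩, by simpa using hx'⟩
          rw [e] at h₁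
          have h₂ := hV.inl ⟨x, hx₁⟩
          simp only at h₁ h₂
          rw [← h₁] at h₂
          refine ⟨h₂.symm, ?_⟩
          have h₃ := (hf ⟨x, h₂.symm⟩).1 hx₁
          rw [e] at h₃
          simpa using h₃.symm
        · rintro ⟨hp, rfl⟩
          exact (hf ⟨x, hp⟩).1 hx₁
    · rw [map_par_parent_inl_inr]
      cases hc : R.parent c with
      | some c' => rw [hU.inr_some hc, hW.inr_some hc]; rfl
      | none =>
        refine two ?_ fun c' => ?_
        · rw [aux, hU.inr_none hc, hV.inl, hW.inr_none hc]
        · rw [aux']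
          exact iff_of_false (hU.parent_inr_ne hc c') (hW.parent_inr_ne hc c')
  · intro j j' hj
    have h₁ := hU.inl ⟨.inr j, by simp⟩
    rw [hV.inr_some hj, map_proj_eq_ne (by simp)] at h₁
    rw [map_par_parent_inr, h₁]
    rfl
  · intro j hj
    rw [map_par_parent_inr]
    refine two ?_ fun c => ?_
    · rw [aux, hU.inl, hV.inr_none hj, hW.inl]
    · rw [aux', hWinr]
      constructor
      · intro e
        have h₁ := hU.inl ⟨.inr j, by simp⟩
        rw [e] at h₁
        have h₂ := hV.inr_none hj
        simp only at h₁ h₂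
        rw [← h₁] at h₂
        refine ⟨h₂.symm, ?_⟩
        have h₃ := (hf ⟨i, h₂.symm⟩).2 rfl j hj
        rw [e] at h₃
        simpa using h₃.symm
      · rintro ⟨hp, rfl⟩
        exact (hf ⟨i, hp⟩).2 rfl j hj

end RT

/-! ### The pre-Lie operad satisfies the operad axioms -/

namespace PL

open RT

variable {k : Type u} [Field k]

/-- A rooted tree, as an element of the pre-Lie operad. -/
noncomputable def tree {I : Type} [Finite I] (T : RT I) : (PL k).obj I :=
  (Finsupp.single T 1 : RT I →₀ k)

/-- The coefficient of a tree. -/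
noncomputable def coeff {I : Type} [Finite I] (T : RT I) : (PL k).obj I →ₗ[k] k :=
  (Finsupp.lapply T : (RT I →₀ k) →ₗ[k] k)

theorem ext_coeff {I : Type} [Finite I] {x y : (PL k).obj I}
    (h : ∀ T, coeff T x = coeff T y) : x = y :=
  Finsupp.ext (f := (x : RT I →₀ k)) (g := (y : RT I →₀ k)) h

open Classical in
theorem coeff_tree {I : Type} [Finite I] (T U : RT I) :
    coeff U (tree T : (PL k).obj I) = if T = U then 1 else 0 :=
  Finsupp.single_apply

theorem hom_ext {I : Type} [Finite I] {V : Type*} [AddCommGroup V] [Module k V]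
    {f g : (PL k).obj I →ₗ[k] V} (h : ∀ T, f (tree T) = g (tree T)) : f = g := by
  refine Finsupp.lhom_ext (fun T c => ?_)
  have e : (Finsupp.single T c : RT I →₀ k) = c • (tree T : (PL k).obj I) := by
    change _ = c • (Finsupp.single T 1 : RT I →₀ k)
    simp
  change f (Finsupp.single T c : RT I →₀ k) = g (Finsupp.single T c : RT I →₀ k)
  rw [e, map_smul, map_smul, h]

theorem map_tree {I J : Type} [Finite I] [Finite J] (e : I ≃ J) (T : RT I) :
    (PL k).map e (tree T) = tree (T.map e) :=
  Finsupp.mapDomain_single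

theorem comp_apply {I J : Type} [Finite I] [Finite J] (i : I) (x : RT I →₀ k) (y : RT J →₀ k) :
    @Eq (RT (Ins I i J) →₀ k) ((PL k).comp i x y)
      ((Finsupp.linearCombination k fun T => Finsupp.linearCombination k fun S =>
        ∑ᶠ f : {x // T.parent x = some i} → J, Finsupp.single (RT.graft i T S f) (1 : k) :
        (RT I →₀ k) →ₗ[k] (RT J →₀ k) →ₗ[k] (RT (Ins I i J) →₀ k)) x y) := rfl

theorem comp_tree {I J : Type} [Finite I] [Finite J] (i : I) (T : RT I) (S : RT J) :
    @Eq (RT (Ins I i J) →₀ k)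
      ((PL k).comp i (Finsupp.single T 1 : RT I →₀ k) (Finsupp.single S 1 : RT J →₀ k))
      (∑ᶠ f, Finsupp.single (graft i T S f) 1) := by
  rw [comp_apply]
  simp only [Finsupp.linearCombination_single, one_smul]

theorem map_injective {I J : Type} (e : I ≃ J) : Function.Injective (RT.map e) := by
  intro T S h
  have := congrArg (RT.map e.symm) h
  simpa [← RT.map_trans, RT.map_refl] using this

theorem coeff_map {I J : Type} [Finite I] [Finite J] (e : I ≃ J) (T : RT I) (x : (PL k).obj I) :
    coeff (T.map e) ((PL k).map e x) = coeff T x :=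
  Finsupp.mapDomain_apply (map_injective e) _ _

theorem coeff_map_symm {I J : Type} [Finite I] [Finite J] (e : I ≃ J) (T : RT J)
    (x : (PL k).obj I) : coeff T ((PL k).map e x) = coeff (T.map e.symm) x := by
  rw [← coeff_map e]
  simp [← RT.map_trans, RT.map_refl]

open Classical in
-- Different functions `f` give different trees, so no tree occurs twice in the sum that defines the
-- composition.
theorem coeff_comp_tree {I J : Type} [Finite I] [Finite J] (i : I) (T : RT I) (S : RT J)
    (U : RT (Ins I i J)) :
    coeff U ((PL k).comp i (tree T) (tree S)) = if IsGraft i T S U then 1 else 0 := by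
  have := Fintype.ofFinite ({x : I // T.parent x = some i} → J)
  refine (DFunLike.congr_fun (comp_tree i T S) U).trans ?_
  rw [finsum_eq_sum_of_fintype]
  simp only [Finsupp.finsetSum_apply, Finsupp.single_apply]
  split_ifs with h
  · obtain ⟨f, rfl⟩ := h.exists_graft
    rw [Finset.sum_eq_single f]
    · simp
    · intro g _ hg
      rw [if_neg fun e => hg (graft_injective e)]
    · simp
  · refine Finset.sum_eq_zero fun f _ => if_neg ?_
    rintro rfl
    exact h (isGraft_graft f)

theorem apply_eq_sum_coeff {I : Type} [Finite I] [Fintype (RT I)] {V : Type*}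
    [AddCommGroup V] [Module k V] (f : (PL k).obj I →ₗ[k] V) (x : (PL k).obj I) :
    f x = ∑ T : RT I, coeff T x • f (tree T) := by
  classical
  have : f = ∑ T : RT I, (coeff T).smulRight (f (tree T)) := by
    refine hom_ext fun T => ?_
    simp [coeff_tree]
  conv_lhs => rw [this]
  simp

open Classical in
-- By `IsGraft.left_unique` at most one intermediate tree contributes, so the coefficient is again
-- `0` or `1`.
theorem coeff_comp_comp_left {I J K : Type} [Finite I] [Finite J] [Finite K] {i : I}
    (z : Ins I i J) (T : RT I) (S : RT J) (R : RT K) (U : RT (Ins (Ins I i J) z K)) :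
    coeff U ((PL k).comp z ((PL k).comp i (tree T) (tree S)) (tree R)) =
      if ∃ V, IsGraft i T S V ∧ IsGraft z V R U then 1 else 0 := by
  have := Fintype.ofFinite (RT (Ins I i J))
  rw [← LinearMap.flip_apply, ← LinearMap.comp_apply, apply_eq_sum_coeff ]
  simp only [LinearMap.comp_apply, LinearMap.flip_apply, coeff_comp_tree, smul_eq_mul]
  split_ifs with h
  · obtain ⟨V, h₁, h₂⟩ := h
    rw [Finset.sum_eq_single V]
    · simp [h₁, h₂]
    · intro W _ hW
      rw [if_neg (fun e : IsGraft z W R U => hW (e.left_unique h₂)), mul_zero]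
    · simp
  · refine Finset.sum_eq_zero fun V _ => ?_
    by_cases h₁ : IsGraft i T S V
    · rw [if_neg (fun e : IsGraft z V R U => h ⟨V, h₁, e⟩), mul_zero]
    · rw [if_neg h₁, zero_mul]

open Classical in
theorem coeff_comp_comp_right {I J K : Type} [Finite I] [Finite J] [Finite K] (i : I) (j : J)
    (T : RT I) (S : RT J) (R : RT K) (U : RT (Ins I i (Ins J j K))) :
    coeff U ((PL k).comp i (tree T) ((PL k).comp j (tree S) (tree R))) =
      if ∃ W, IsGraft j S R W ∧ IsGraft i T W U then 1 else 0 := by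
  have := Fintype.ofFinite (RT (Ins J j K))
  rw [← LinearMap.comp_apply, apply_eq_sum_coeff ]
  simp only [LinearMap.comp_apply, coeff_comp_tree, smul_eq_mul]
  split_ifs with h
  · obtain ⟨V, h₁, h₂⟩ := h
    rw [Finset.sum_eq_single V]
    · simp [h₁, h₂]
    · intro W _ hW
      rw [if_neg (fun e : IsGraft i T W U => hW (e.right_unique h₂)), mul_zero]
    · simp
  · refine Finset.sum_eq_zero fun V _ => ?_
    by_cases h₁ : IsGraft j S R V
    · rw [if_neg (fun e : IsGraft i T V U => h ⟨V, h₁, e⟩), mul_zero]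
    · rw [if_neg h₁, zero_mul]

theorem tree_induction {I : Type} [Finite I] {p : (PL k).obj I → Prop} (zero : p 0)
    (add : ∀ x y, p x → p y → p (x + y)) (smul : ∀ (c : k) x, p x → p (c • x))
    (tree : ∀ T, p (tree T)) (x : (PL k).obj I) : p x := by
  have := Fintype.ofFinite (RT I)
  have h := apply_eq_sum_coeff (LinearMap.id : (PL k).obj I →ₗ[k] _) x
  rw [LinearMap.id_apply] at h
  rw [h]
  exact Finset.sum_induction _ p add zero fun T _ => smul _ _ (tree T)

theorem map_symm_map {I J : Type} (e : I ≃ J) (T : RT J) : (T.map e.symm).map e = T := by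
  simp [← RT.map_trans, RT.map_refl]

/-- By linearity the axioms reduce to trees, and there all coefficients are `0` or `1`; each axiom
becomes an equivalence between existence statements about insertions. -/
theorem isOperad : (PL k).IsOperad where
  one_comp {I} _ x := by
    have h : (PL k).map (Ins.unitLeft I) ∘ₗ (PL k).comp () (PL k).one = LinearMap.id := by
      classical
      refine hom_ext fun T => ext_coeff fun U => ?_
      rw [LinearMap.comp_apply, coeff_map_symm, LinearMap.id_apply]
      refine (coeff_comp_tree () RT.unit T _).trans ?_
      rw [coeff_tree]
      refine if_congr ⟨fun h => ?_, ?_⟩ rfl rfl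
      · ext x : 2
        have e := map_parent (Ins.unitLeft I).symm U x
        have e' : (Ins.unitLeft I).symm x = .inr x := rfl
        rw [e'] at e
        cases hx : T.parent x with
        | some y =>
          rw [h.inr_some hx, eq_comm, Option.map_eq_some_iff] at e
          obtain ⟨z, hz, hz'⟩ := e
          rw [hz]
          exact congrArg some (Sum.inr.inj hz').symm
        | none =>
          have := h.inr_none hx
          rw [e] at this
          change _ = none at this
          simp only [Option.map_map, Option.map_eq_none_iff] at this
          exact this.symm
      · rintro rfl
        have e := fun x => map_parent (Ins.unitLeft I).symm T x
        have e' : ∀ x, (Ins.unitLeft I).symm x = .inr x := fun _ => rfl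
        simp only [e'] at e
        refine ⟨fun x => absurd rfl x.2, fun h => ?_, fun h => ?_⟩
        · rw [e, h]; rfl
        · rw [e, h]; rfl
    exact LinearMap.congr_fun h x
  comp_one {I} _ i x := by
    have h : (PL k).map (Ins.unitRight i) ∘ₗ ((PL k).comp i).flip (PL k).one = LinearMap.id := by
      classical
      refine hom_ext fun T => ext_coeff fun U => ?_
      rw [LinearMap.comp_apply, coeff_map_symm, LinearMap.id_apply]
      refine (coeff_comp_tree i T RT.unit _).trans ?_
      rw [coeff_tree]
      have e : ∀ z, ((U.map (Ins.unitRight i).symm).parent z).map (proj i) =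
          U.parent (proj i z) := by
        intro z
        have e := map_parent (Ins.unitRight i).symm U (Ins.unitRight i z)
        rw [Equiv.symm_apply_apply] at e
        rw [e, Option.map_map]
        have : proj i ∘ (Ins.unitRight i).symm = id := by
          funext z
          obtain ⟨w, rfl⟩ := (Ins.unitRight i).surjective z
          rcases w with w | w <;> simp <;> rfl
        rw [this, Option.map_id]
        rcases z with z | z <;> rfl
      refine if_congr ⟨fun h => ?_, ?_⟩ rfl rfl
      · ext x : 2
        by_cases hx : x = i
        · subst hx
          rw [← h.inr_none (j := ()) rfl, e]; rfl
        · rw [← h.inl ⟨x, hx⟩, e]; rfl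
      · rintro rfl
        refine ⟨fun x => e _, fun h => ?_, fun h => e _⟩
        cases h
    exact LinearMap.congr_fun h x
  comp_seq {I J K} _ _ _ i j x y z := by
    induction x using tree_induction with
    | zero => simp
    | add x x' h h' => simp only [map_add, LinearMap.add_apply, h, h']
    | smul c x h => simp only [map_smul, LinearMap.smul_apply, h]
    | tree T =>
    induction y using tree_induction with
    | zero => simp
    | add x x' h h' => simp only [map_add, LinearMap.add_apply, h, h']
    | smul c x h => simp only [map_smul, LinearMap.smul_apply, h]
    | tree S =>
    induction z using tree_induction with
    | zero => simp
    | add x x' h h' => simp only [map_add, h, h']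
    | smul c x h => simp only [map_smul, h]
    | tree R =>
    classical
    refine ext_coeff fun U => ?_
    rw [coeff_map_symm, coeff_comp_comp_left, coeff_comp_comp_right]
    refine if_congr ⟨?_, ?_⟩ rfl rfl
    · rintro ⟨V, h₁, h₂⟩
      have := exists_isGraft_seq h₁ h₂
      rwa [map_symm_map] at this
    · rintro ⟨W, h₁, h₂⟩
      rw [← map_symm_map (Ins.seq K i j) U] at h₂
      exact exists_isGraft_seq_symm h₁ h₂
  comp_par {I J K} _ _ _ i i' hi x y z := by
    induction x using tree_induction with
    | zero => simp
    | add x x' h h' => simp only [map_add, LinearMap.add_apply, h, h']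
    | smul c x h => simp only [map_smul, LinearMap.smul_apply, h]
    | tree T =>
    induction y using tree_induction with
    | zero => simp
    | add x x' h h' => simp only [map_add, LinearMap.add_apply, h, h']
    | smul c x h => simp only [map_smul, LinearMap.smul_apply, h]
    | tree S =>
    induction z using tree_induction with
    | zero => simp
    | add x x' h h' => simp only [map_add, LinearMap.add_apply, h, h']
    | smul c x h => simp only [map_smul, LinearMap.smul_apply, h]
    | tree R =>
    classical
    refine ext_coeff fun U => ?_
    rw [coeff_map_symm, coeff_comp_comp_left, coeff_comp_comp_left]
    refine if_congr ⟨?_, ?_⟩ rfl rfl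
    · rintro ⟨V, h₁, h₂⟩
      have := exists_isGraft_par h₁ h₂
      rwa [map_symm_map] at this
    · rintro ⟨W, h₁, h₂⟩
      -- The exchange of the two insertion points is an involution, which turns the converse into
      -- `exists_isGraft_par`.
      have e : Ins.par K J i' i hi.symm = (Ins.par J K i i' hi).symm := by
        ext t
        rcases t with ⟨⟨a, ha⟩ | b, hab⟩ | c <;> rfl
      have := exists_isGraft_par h₁ h₂
      rwa [e] at this

end PL

/-! ### The twisted differential on representatives -/

namespace Tw

open OperadData

variable {k : Type u} [Field k] {P : OperadData k}

/-- The additional input, labelled by `none`, becomes the first of the inputs `Fin (m + 1)`. -/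
def optE (I : Type) (m : ℕ) : Option (I ⊕ Fin m) ≃ I ⊕ Fin (m + 1) where
  toFun
    | none => .inr 0
    | some (.inl i) => .inl i
    | some (.inr j) => .inr j.succ
  invFun := Sum.elim (fun i => some (.inl i)) (Fin.cases none fun j => some (.inr j))
  left_inv := by rintro (_ | _ | _) <;> rfl
  right_inv := by
    rintro (i | j)
    · rfl
    · induction j using Fin.cases <;> rfl

@[simp] theorem optE_none (I : Type) (m : ℕ) : optE I m none = .inr 0 := rfl
@[simp] theorem optE_inl {I : Type} (m : ℕ) (i : I) : optE I m (some (.inl i)) = .inl i := rfl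
@[simp] theorem optE_inr (I : Type) {m : ℕ} (j : Fin m) :
    optE I m (some (.inr j)) = .inr j.succ := rfl

/-- All signs in the twisting arise here: two numberings of the occurrences of `α` that differ by
`σ` give classes that differ by the sign of `σ`. The equation `n = n'` absorbs reassociated sums of
natural numbers. -/
theorem cls_map_eq {I Z : Type} [Finite I] [Finite Z] {n n' : ℕ} (h : n = n')
    (e : Z ≃ I ⊕ Fin n) (e' : Z ≃ I ⊕ Fin n') (σ : Equiv.Perm (Fin n'))
    (he : ∀ z, Sum.map id (fun j => σ (Fin.cast h j)) (e z) = e' z) (x : P.obj Z) :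
    cls P n' (P.map e' x) = Equiv.Perm.sign σ • cls P n (P.map e x) := by
  subst h
  rw [← cls_perm, ← P.map_trans]
  congr 2
  congr 1
  ext z
  rw [← he, Equiv.trans_apply]
  generalize e z = t
  rcases t with t | t <;> rfl

theorem cls_cmp_eq {I X X' Y Y' : Type} [Finite I] [Finite X] [Finite X'] [Finite Y] [Finite Y']
    {n n' : ℕ} (h : n = n') (σ : Equiv.Perm (Fin n')) (e : X ≃ X') (f : Y ≃ Y') {x : X} {x' : X'}
    (hx : e x = x') (g : Ins X' x' Y' ≃ I ⊕ Fin n) (g' : Ins X x Y ≃ I ⊕ Fin n')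
    (hl : ∀ (a : {y // y ≠ x}) (ha),
      Sum.map id (fun j => σ (Fin.cast h j)) (g (.inl ⟨e a.1, ha⟩)) = g' (.inl a))
    (hr : ∀ c : Y, Sum.map id (fun j => σ (Fin.cast h j)) (g (.inr (f c))) = g' (.inr c))
    (μ : P.obj X) (ν : P.obj Y) :
    cls P n' (P.cmp x g' μ ν) =
      Equiv.Perm.sign σ • cls P n (P.cmp x' g (P.map e μ) (P.map f ν)) := by
  subst hx
  have e₁ : P.cmp (e x) g (P.map e μ) (P.map f ν) =
      P.cmp x ((Ins.congr e f x).trans g) μ ν :=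
    cmp_map_map e f rfl _ _ (fun _ _ => rfl) (fun _ => rfl) _ _
  rw [e₁]
  refine cls_map_eq h _ _ σ ?_ _
  rintro (a | c)
  · exact hl a _
  · exact hr c

theorem map_cls {I J : Type} [Finite I] [Finite J] (e : I ≃ J) (m : ℕ) (μ : P.obj (I ⊕ Fin m)) :
    map P e (cls P m μ) = cls P m (P.map (Equiv.sumCongr e (Equiv.refl (Fin m))) μ) := by
  rw [map, desc_cls]; rfl

theorem parity_cls {I : Type} [Finite I] (m : ℕ) (μ : P.obj (I ⊕ Fin m)) :
    parity P (cls P m μ) = (-1 : ℤˣ) ^ m • cls P m μ := by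
  rw [parity, desc_cls]; rfl

theorem comp_cls_eq {I J : Type} [Finite I] [Finite J] (i : I) (m l : ℕ) (μ : P.obj (I ⊕ Fin m))
    (ν : P.obj (J ⊕ Fin l)) : comp P i (cls P m μ) (cls P l ν) = cls P (m + l)
      (P.cmp (Sum.inl i) (compEquiv J i m l) μ ν) :=
  comp_cls P i m l μ ν

variable {b : P.obj (Fin 2)}

/-- The inputs of `ℓ₁^α`. -/
def ellEquiv : Fin 2 ≃ Unit ⊕ Fin 1 :=
  (finSumFinEquiv (m := 1) (n := 1)).symm.trans ((Equiv.sumComm _ _).trans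
    (Equiv.sumCongr (Equiv.ofUnique (Fin 1) Unit) (Equiv.refl (Fin 1))))

theorem ellEquiv_zero : ellEquiv 0 = .inr 0 := by
  rw [ellEquiv, Equiv.trans_apply, show finSumFinEquiv.symm (0 : Fin (1 + 1)) = .inl 0 from rfl]
  rfl

theorem ellEquiv_one : ellEquiv 1 = .inl () := by
  rw [ellEquiv, Equiv.trans_apply, show finSumFinEquiv.symm (1 : Fin (1 + 1)) = .inr 0 from rfl]
  rfl

@[simp] theorem compEquiv_inl_inl {I J : Type} (i : I) (m l : ℕ) (a : I) (h) :
    compEquiv J i m l (.inl ⟨.inl a, h⟩) = .inl (.inl ⟨a, fun e => h (by rw [e])⟩) := rfl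

@[simp] theorem compEquiv_inl_inr {I J : Type} (i : I) (m l : ℕ) (a : Fin m) (h) :
    compEquiv J i m l (.inl ⟨.inr a, h⟩) = .inr (Fin.castAdd l a) := rfl

@[simp] theorem compEquiv_inr_inl {I J : Type} (i : I) (m l : ℕ) (a : J) :
    compEquiv J i m l (.inr (.inl a)) = .inl (.inr a) := rfl

@[simp] theorem compEquiv_inr_inr {I J : Type} (i : I) (m l : ℕ) (a : Fin l) :
    compEquiv J i m l (.inr (.inr a)) = .inr (Fin.natAdd m a) := rfl

@[simp] theorem splitEquiv_inl_inl {I : Type} (m : ℕ) (a : I) (h) :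
    splitEquiv I m (.inl ⟨.inl a, h⟩) = .inl a := rfl

theorem splitEquiv_inl_inr (I : Type) (m : ℕ) (a : Fin m) (h) :
    splitEquiv I m (.inl ⟨.inr a.succ, h⟩) = .inr (Fin.castAdd 2 a) := by
  have : (finSuccAboveEquiv (0 : Fin (m + 1))).symm ⟨a.succ, by simp⟩ = a := by
    rw [Equiv.symm_apply_eq]; ext; simp [finSuccAboveEquiv_apply]
  simp only [splitEquiv, Equiv.trans_apply, Equiv.sumCongr_apply, Sum.map_inl, Ins.removeInr,
    Equiv.coe_fn_mk, Sum.map_inr, this]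
  rfl

@[simp] theorem splitEquiv_inr (I : Type) (m : ℕ) (a : Fin 2) :
    splitEquiv I m (.inr a) = .inr (Fin.natAdd m a) := rfl

@[simp] theorem unitLeft_inr {I : Type} (i : I) : Ins.unitLeft I (.inr i) = i := rfl
@[simp] theorem unitRight_inl {I : Type} (i : I) (a) : Ins.unitRight i (.inl a) = a.1 := rfl
@[simp] theorem unitRight_inr {I : Type} (i : I) (a) : Ins.unitRight i (.inr a) = i := rfl

theorem finRotate_castAdd {m : ℕ} (j : Fin m) : finRotate (m + 1) (Fin.castAdd 1 j) = j.succ := by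
  ext
  rw [coe_finRotate_of_ne_last]
  · rfl
  · exact (Fin.castSucc_lt_last j).ne

theorem ell_comp_cls {I : Type} [Finite I] (m : ℕ) (μ : P.obj (I ⊕ Fin m)) :
    map P (Ins.unitLeft I) (comp P () (ell P b) (cls P m μ)) =
      cls P (m + 1) (P.map (optE I m) (P.brL b μ)) := by
  rw [ell, comp_cls_eq, map_cls, map_cmp, brL, map_cmp, cls_cmp_eq (add_comm 1 m) 1 ellEquiv
    (Equiv.refl _) ellEquiv_one ((compEquiv I () 1 m).trans
      (Equiv.sumCongr (Ins.unitLeft I) (Equiv.refl _))), P.map_refl, Equiv.Perm.sign_one, one_smul]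
  · rfl
  · rintro ⟨a, ha⟩ h
    obtain rfl : a = 0 := by omega
    simp only [ellEquiv_zero]
    simp [Fin.ext_iff]
  · rintro (i | j)
    · simp
    · simp

/-- The `α` of `ℓ₁^α` arrives behind the `m` occurrences in `μ`. Moving it to the front is a
rotation of `m + 1` places of sign `(-1) ^ m`, which cancels the Koszul sign in `parity`. -/
theorem cls_comp_ell {I : Type} [Finite I] (i : I) (m : ℕ) (μ : P.obj (I ⊕ Fin m)) :
    map P (Ins.unitRight i) (comp P i (parity P (cls P m μ)) (ell P b)) =
      cls P (m + 1) (P.map (optE I m) (P.brR b (.inl i) μ)) := by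
  rw [parity_cls, ell]
  simp only [Units.smul_def, map_zsmul, LinearMap.smul_apply]
  rw [comp_cls_eq, map_cls, map_cmp, brR, LinearMap.flip_apply, map_cmp, cls_cmp_eq rfl
    (finRotate (m + 1)) (Equiv.refl _) ellEquiv (x' := .inl i) rfl ((compEquiv Unit i m 1).trans
      (Equiv.sumCongr (Ins.unitRight i) (Equiv.refl _))), P.map_refl, sign_finRotate]
  · rfl
  · rintro ⟨i | j, ha⟩ h
    · simp only [Equiv.refl_apply, Equiv.trans_apply, compEquiv_inl_inl, Equiv.sumCongr_apply,
        Sum.map_inl, unitRight_inl, id, rightEquiv_inl, optE_inl]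
    · simp only [Equiv.refl_apply, Equiv.trans_apply, compEquiv_inl_inr, Equiv.sumCongr_apply,
        Sum.map_inr, rightEquiv_inl, optE_inr, Fin.cast_eq_self, finRotate_castAdd]
  · intro c
    fin_cases c
    · simp only [Fin.zero_eta, ellEquiv_zero, Equiv.trans_apply, compEquiv_inr_inr,
        Equiv.sumCongr_apply, Sum.map_inr, rightEquiv_inr_zero, optE_none, Fin.cast_eq_self,
        Equiv.refl_apply]
      exact congrArg Sum.inr finRotate_last
    · simp only [Fin.mk_one, ellEquiv_one, Equiv.trans_apply, compEquiv_inr_inl,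
        Equiv.sumCongr_apply, Sum.map_inl, rightEquiv_inr_one, optE_inl, unitRight_inr, id]

/-- The two inputs of the inserted bracket stand at the end. Two rotations, which together are even,
bring them to the front; restoring the second one to the place `j` inverts `j.cycleRange` and yields
the sign `(-1) ^ j`. -/
theorem splitFirst_cls {I : Type} [Finite I] (m : ℕ) (j : Fin (m + 1))
    (μ : P.obj (I ⊕ Fin (m + 1))) :
    (-1 : ℤˣ) ^ (j : ℕ) • splitFirst P b m (P.map (Equiv.sumCongr (Equiv.refl I) j.cycleRange) μ) =
      cls P (m + 2) (P.map (optE I (m + 1)) (P.brR b (.inr j) μ)) := by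
  have hs : splitFirst P b m (P.map (Equiv.sumCongr (Equiv.refl I) j.cycleRange) μ) =
      cls P (m + 2) (P.cmp (.inr 0) (splitEquiv I m)
        (P.map (Equiv.sumCongr (Equiv.refl I) j.cycleRange) μ) (P.map (Equiv.refl _) b)) := by
    rw [P.map_refl]; rfl
  have hr : ∀ t : Fin m, finRotate (m + 2) (finRotate (m + 2) (Fin.castAdd 2 t)) =
      t.succ.succ := by
    intro t
    rw [show Fin.castAdd 2 t = Fin.castAdd 1 (Fin.castAdd 1 t) from rfl, finRotate_castAdd,
      show (Fin.castAdd 1 t).succ = Fin.castAdd 1 t.succ from rfl, finRotate_castAdd]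
  have hr₀ : finRotate (m + 2) (finRotate (m + 2) (Fin.natAdd m 0)) = 0 := by
    rw [show (Fin.natAdd m 0 : Fin (m + 2)) = Fin.castAdd 1 (Fin.last m) from rfl,
      finRotate_castAdd, Fin.succ_last, finRotate_last]
  have hr₁ : finRotate (m + 2) (finRotate (m + 2) (Fin.natAdd m 1)) = 1 := by
    rw [show (Fin.natAdd m 1 : Fin (m + 2)) = Fin.last (m + 1) from rfl, finRotate_last]
    exact finRotate_castAdd (0 : Fin (m + 1))
  rw [hs, brR, LinearMap.flip_apply, map_cmp]
  refine Eq.trans ?_ (cls_cmp_eq rfl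
    (Equiv.Perm.decomposeFin.symm ((0 : Fin (m + 2)), j.cycleRange⁻¹) *
      (finRotate (m + 2) * finRotate (m + 2)))
    (Equiv.sumCongr (Equiv.refl I) j.cycleRange) (Equiv.refl _) (x := .inr j) (x' := .inr 0)
    (by simp) (splitEquiv I m) _ ?_ ?_ μ b).symm
  · congr 1
    simp
  · rintro ⟨i | j', ha⟩ h
    · simp
    · have hj : j.cycleRange j' ≠ 0 := fun e => h (by simp [e])
      obtain ⟨t, ht⟩ := Fin.exists_succ_eq.2 hj
      simp only [Equiv.sumCongr_apply, Sum.map_inr, ← ht, splitEquiv_inl_inr, Fin.cast_eq_self,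
        Equiv.Perm.mul_apply, hr, Equiv.trans_apply, rightEquiv_inl, optE_inr]
      congr 1
      rw [Equiv.Perm.decomposeFin_symm_apply_succ, Equiv.swap_self, Equiv.refl_apply, ht]
      simp
  · intro c
    fin_cases c
    · simp only [Fin.zero_eta, Equiv.refl_apply, splitEquiv_inr, Sum.map_inr, Fin.cast_eq_self,
        Equiv.Perm.mul_apply, hr₀, Equiv.trans_apply, rightEquiv_inr_zero, optE_none]
      simp
    · simp only [Fin.mk_one, Equiv.refl_apply, splitEquiv_inr, Sum.map_inr, Fin.cast_eq_self,
        Equiv.Perm.mul_apply, hr₁, Equiv.trans_apply, rightEquiv_inr_one, optE_inr]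
      congr 1
      rw [show (1 : Fin (m + 2)) = Fin.succ 0 from rfl, Equiv.Perm.decomposeFin_symm_apply_succ,
        Equiv.swap_self, Equiv.refl_apply]
      simp [Equiv.Perm.inv_def]

/-- The differential of the operadic twisting in terms of `b(ν, μ)` and `μ ∘ₓ b(ν, x)`. -/
theorem d_cls {I : Type} [Fintype I] (m : ℕ) (μ : P.obj (I ⊕ Fin m)) :
    (Tw P b).d (cls P m μ) = cls P (m + 1) (P.map (optE I m)
      (P.brL b μ - ∑ i : I, P.brR b (.inl i) μ - (1 / 2 : k) • ∑ j : Fin m, P.brR b (.inr j) μ)) := by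
  have h₁ : adEll P b (cls P m μ) = cls P (m + 1) (P.map (optE I m)
      (P.brL b μ - ∑ i : I, P.brR b (.inl i) μ)) := by
    rw [adEll, finsum_eq_sum_of_fintype, LinearMap.sub_apply, LinearMap.sum_apply]
    simp only [LinearMap.comp_apply, LinearMap.flip_apply, ell_comp_cls, cls_comp_ell, map_sub,
      map_sum]
  have h₂ : dMC P b (cls P m μ) = - cls P (m + 1) (P.map (optE I m)
      ((1 / 2 : k) • ∑ j : Fin m, P.brR b (.inr j) μ)) := by
    rw [dMC, desc_cls]
    cases m with
    | zero => simp [dMCCls]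
    | succ m =>
      simp only [dMCCls, LinearMap.smul_apply, LinearMap.sum_apply, LinearMap.comp_apply,
        splitFirst_cls, map_smul, map_sum, neg_smul]
  change dMC P b (cls P m μ) + adEll P b (cls P m μ) = _
  rw [h₁, h₂]
  simp only [map_sub]
  abel

end Tw

/-! ### The derivation `δ` and the identities behind `d² = 0` -/

namespace OperadData

variable {k : Type u} [Field k] {P : OperadData k} {b : P.obj (Fin 2)}

/-- The inputs of `μ(ν, …) ∘ₓ ρ`, with the additional input `ν` in the first argument. -/
def optInsL {X : Type} (x : X) (Y : Type) : Ins (Option X) (some x) Y ≃ Option (Ins X x Y) where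
  toFun
    | .inl ⟨none, _⟩ => none
    | .inl ⟨some a, h⟩ => some (.inl ⟨a, fun e => h (by rw [e])⟩)
    | .inr y => some (.inr y)
  invFun
    | none => .inl ⟨none, by simp⟩
    | some (.inl a) => .inl ⟨some a.1, by simpa using a.2⟩
    | some (.inr y) => .inr y
  left_inv := by rintro (⟨_ | a, h⟩ | y) <;> rfl
  right_inv := by rintro (_ | ⟨a | y⟩) <;> rfl

/-- The inputs of `μ ∘ₓ ρ(ν, …)`, with the additional input `ν` in the second argument. -/
def optInsR {X : Type} (x : X) (Y : Type) : Ins X x (Option Y) ≃ Option (Ins X x Y) where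
  toFun
    | .inl a => some (.inl a)
    | .inr none => none
    | .inr (some y) => some (.inr y)
  invFun
    | none => .inr none
    | some (.inl a) => .inl a
    | some (.inr y) => .inr (some y)
  left_inv := by rintro (a | _ | y) <;> rfl
  right_inv := by rintro (_ | ⟨a | y⟩) <;> rfl

/-- The exchange of the two additional inputs. -/
def swapOpt (X : Type) : Option (Option X) ≃ Option (Option X) where
  toFun
    | none => some none
    | some none => none
    | some (some x) => some (some x)
  invFun
    | none => some none
    | some none => none
    | some (some x) => some (some x)
  left_inv := by rintro (_ | _ | x) <;> rfl
  right_inv := by rintro (_ | _ | x) <;> rfl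

section

variable {X Y : Type} [Finite X] [Finite Y]

theorem comp_eq_cmp (x : X) (μ : P.obj X) (ν : P.obj Y) :
    P.comp x μ ν = P.cmp x (Equiv.refl _) μ ν := (P.map_refl _).symm

theorem cmp_congr {Z : Type} [Finite Z] {x : X} {g g' : Ins X x Y ≃ Z} (h : ∀ t, g t = g' t)
    (μ : P.obj X) (ν : P.obj Y) : P.cmp x g μ ν = P.cmp x g' μ ν := by
  rw [show g = g' from Equiv.ext h]

theorem IsOperad.brL_comp (hP : P.IsOperad) (x : X) (μ : P.obj X) (ν : P.obj Y) :
    P.brL b (P.comp x μ ν) = P.cmp (some x) (optInsL x Y) (P.brL b μ) ν := by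
  rw [comp_eq_cmp, brL, brL]
  refine (hP.cmp_seq (leftEquiv X) rfl (optInsL x Y) (Equiv.refl _) (leftEquiv _) ?_ ?_ ?_ _ _ _).symm
  · rintro ⟨a, ha⟩ h
    rfl
  · rintro a h
    rfl
  · intro c
    rfl

theorem IsOperad.brR_inl_comp (hP : P.IsOperad) (x : X) (a : {a // a ≠ x}) (μ : P.obj X) (ν : P.obj Y) :
    P.brR b (.inl a) (P.comp x μ ν) = P.cmp (some x) (optInsL x Y) (P.brR b a.1 μ) ν := by
  rw [comp_eq_cmp, brR, brR, LinearMap.flip_apply, LinearMap.flip_apply]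
  refine hP.cmp_par a.2 (Equiv.refl _) (rightEquiv a.1) rfl rfl (rightEquiv _) (optInsL x Y) ?_ ?_ ?_ _ _ _
  · intro c _ _ _ _
    rfl
  · intro c hc
    rfl
  · intro c hc
    fin_cases c <;> rfl

theorem IsOperad.brR_inr_comp (hP : P.IsOperad) (x : X) (y : Y) (μ : P.obj X) (ν : P.obj Y) :
    P.brR b (.inr y) (P.comp x μ ν) = P.cmp x (optInsR x Y) μ (P.brR b y ν) := by
  rw [comp_eq_cmp, brR, brR, LinearMap.flip_apply, LinearMap.flip_apply]
  refine hP.cmp_seq (Equiv.refl _) rfl (rightEquiv _) (rightEquiv y) (optInsR x Y) ?_ ?_ ?_ _ _ _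
  · intro a h
    rfl
  · intro a h
    rfl
  · intro c
    fin_cases c <;> rfl

/-- Both sides are `μ ∘ₓ b(ν', ρ)`, where `ν'` is the additional input and `ρ` stands for the second
argument. This is the term that cancels in the Leibniz rule `delta_comp`. -/
theorem IsOperad.brR_self_cmp (hP : P.IsOperad) (x : X) (μ : P.obj X) (ν : P.obj Y) :
    P.cmp (some x) (optInsL x Y) (P.brR b x μ) ν = P.cmp x (optInsR x Y) μ (P.brL b ν) := by
  rw [brR, brL, LinearMap.flip_apply]
  refine hP.cmp_seq (y := 1) (z := some x) (rightEquiv x) rfl (optInsL x Y) (leftEquiv Y) (optInsR x Y) ?_ ?_ ?_ _ _ _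
  · intro a h
    rfl
  · rintro ⟨a, ha⟩ h
    obtain rfl : a = 0 := by omega
    rfl
  · intro c
    rfl

theorem IsOperad.brR_some_brL (hP : P.IsOperad) (x : X) (μ : P.obj X) :
    P.brR b (some x) (P.brL b μ) = P.map (swapOpt X) (P.brL b (P.brR b x μ)) := by
  have h : P.brR b (some x) (P.brL b μ) = P.map (Equiv.optionCongr (leftEquiv X))
      (P.brR b (.inr x) (P.comp 1 b μ)) := by
    rw [map_brR]; rfl
  rw [h, hP.brR_inr_comp, map_cmp]
  conv_rhs => rw [brL, map_cmp]
  refine cmp_congr (fun t => ?_) _ _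
  rcases t with t | _ | t <;> rfl

/-- The Jacobi identity `[[ν', ν], μ] = [ν', [ν, μ]] - [ν, [ν', μ]]`; the additional input that is
introduced last is the outer `none`. -/
theorem IsOperad.brR_none_brL (hP : P.IsOperad) (hb : P.IsLieBracket b) (μ : P.obj X) :
    P.brR b none (P.brL b μ) = P.brL b (P.brL b μ) - P.map (swapOpt X) (P.brL b (P.brL b μ)) := by
  have h₀ : P.brR b none (P.brL b μ) = P.map (Equiv.optionCongr (leftEquiv X))
      (P.brR b (.inl ⟨0, by simp⟩) (P.comp 1 b μ)) := by
    rw [map_brR]; rfl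
  have h₁ : P.brL b (P.brL b μ) = P.map (Equiv.optionCongr (leftEquiv X))
      (P.brL b (P.comp 1 b μ)) := by
    rw [map_brL]; rfl
  have h₂ : P.map (swapOpt X) (P.brL b (P.brL b μ)) = P.map (Equiv.optionCongr (leftEquiv X))
      (P.cmp (some 1) (optInsL 1 X) (P.brR b 1 b) μ) := by
    rw [hP.brR_self_cmp, map_cmp]
    conv_lhs => rw [brL, map_cmp]
    refine cmp_congr (fun t => ?_) _ _
    rcases t with t | _ | t <;> rfl
  rw [h₀, h₂, h₁, hP.brL_comp, hP.brR_inl_comp, hb.jacobi]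
  simp

theorem cmp_some_rightEquiv (x : X) (μ : P.obj (Option X)) :
    P.map (swapOpt X) (P.brR b (some x) μ) =
      P.map (Equiv.optionCongr (rightEquiv x)) (P.cmp (some x) (optInsL x (Fin 2)) μ b) := by
  rw [brR, LinearMap.flip_apply, map_cmp, map_cmp]
  refine cmp_congr (fun t => ?_) _ _
  rcases t with ⟨_ | t, h⟩ | t
  · rfl
  · rfl
  · fin_cases t <;> rfl

theorem brR_rightEquiv (x : X) (z) (μ : P.obj X) :
    P.brR b (rightEquiv x z) (P.brR b x μ) = P.map (Equiv.optionCongr (rightEquiv x))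
      (P.brR b z (P.comp x μ b)) := by
  rw [map_brR]; rfl

theorem IsOperad.brR_some_brR (hP : P.IsOperad) (x x' : X) (h : x' ≠ x) (μ : P.obj X) :
    P.brR b (some x') (P.brR b x μ) =
      P.map (swapOpt X) (P.brR b (some x) (P.brR b x' μ)) := by
  rw [cmp_some_rightEquiv, ← hP.brR_inl_comp x ⟨x', h⟩, ← brR_rightEquiv]
  rfl

/-- The same Jacobi identity, inserted at the input `x` of `μ`. -/
theorem IsOperad.brR_none_brR (hP : P.IsOperad) (hb : P.IsLieBracket b) (x : X) (μ : P.obj X) :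
    P.brR b none (P.brR b x μ) = P.map (swapOpt X) (P.brR b (some x) (P.brR b x μ)) -
      P.brR b (some x) (P.brR b x μ) := by
  have h₀ := brR_rightEquiv (b := b) x (.inr 0) μ
  have h₁ := brR_rightEquiv (b := b) x (.inr 1) μ
  rw [rightEquiv_inr_zero] at h₀
  rw [rightEquiv_inr_one] at h₁
  rw [cmp_some_rightEquiv, h₀, h₁, hP.brR_self_cmp, hP.brR_inr_comp, hP.brR_inr_comp, hb.jacobi]
  simp

open Classical in
-- Here only antisymmetry is used: `[[ν', ν], x] = -[x, [ν', ν]]`, and the right-hand side is `[ν,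
-- [ν', x]]` with `ν` and `x` exchanged. It complements `brR_none_brR` when `x` is itself an `α`.
theorem IsOperad.brR_none_brR_eq_neg (hP : P.IsOperad) (hb : P.IsLieBracket b) (x : X) (μ : P.obj X) :
    P.brR b none (P.brR b x μ) =
      - P.map (Equiv.swap (some none) (some (some x))) (P.brR b (some x) (P.brR b x μ)) := by
  have h₀ := brR_rightEquiv (b := b) x (.inr 0) μ
  have h₁ := brR_rightEquiv (b := b) x (.inr 1) μ
  rw [rightEquiv_inr_zero] at h₀
  rw [rightEquiv_inr_one] at h₁
  have h₂ : P.brR b 0 b = - P.map (Equiv.optionCongr (Equiv.swap 0 1)) (P.brR b 1 b) := by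
    rw [map_brR, hb.antisymm]
    simp
  rw [h₀, h₁, hP.brR_inr_comp, hP.brR_inr_comp, h₂, map_neg, map_neg, neg_inj, map_cmp, map_cmp,
    map_cmp]
  refine cmp_map_right _ _ _ ?_ ?_ _ _
  · rintro ⟨a, ha⟩
    change some (some a) = _
    simp only [Equiv.trans_apply]
    change _ = Equiv.swap (some none) (some (some x)) (some (some a))
    rw [Equiv.swap_apply_of_ne_of_ne (by simp) (by simpa using ha)]
  · rintro (_ | c)
    · change none = Equiv.swap (some none) (some (some x)) none
      rw [Equiv.swap_apply_of_ne_of_ne (by simp) (by simp)]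
    · fin_cases c
      · simp [optInsR]
      · simp [optInsR]

end

/-- `b(ν, μ) - ∑ₓ w(x) μ ∘ₓ b(ν, x)`. -/
noncomputable def delta (P : OperadData k) (b : P.obj (Fin 2)) {X : Type} [Fintype X] (w : X → k) :
    P.obj X →ₗ[k] P.obj (Option X) :=
  P.brL b - ∑ x, w x • P.brR b x

theorem delta_apply {X : Type} [Fintype X] (w : X → k) (μ : P.obj X) :
    P.delta b w μ = P.brL b μ - ∑ x, w x • P.brR b x μ := by
  simp [delta]

theorem map_delta {X Y : Type} [Fintype X] [Fintype Y] (e : X ≃ Y) (w : Y → k) (μ : P.obj X) :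
    P.delta b w (P.map e μ) = P.map (Equiv.optionCongr e) (P.delta b (w ∘ e) μ) := by
  simp only [delta_apply, map_sub, map_sum, map_smul, map_brL, map_brR]
  rw [← Equiv.sum_comp e]
  rfl

/-- A Leibniz rule: inputs of the composite come from `μ` or from `ν`. The first summand also has
the term at `x`, which cancels `μ ∘ₓ b(ν', ν)` from the second one; for this the weight of `x` must
be `1`. -/
theorem IsOperad.delta_comp (hP : P.IsOperad) {X Y : Type} [Fintype X] [Fintype Y] (x : X)
    [DecidableEq X] (w : Ins X x Y → k) (w₁ : X → k) (w₂ : Y → k) (h : w₁ x = 1)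
    (h₁ : ∀ a, w (.inl a) = w₁ a.1) (h₂ : ∀ y, w (.inr y) = w₂ y) (μ : P.obj X) (ν : P.obj Y) :
    P.delta b w (P.comp x μ ν) = P.cmp (some x) (optInsL x Y) (P.delta b w₁ μ) ν +
      P.cmp x (optInsR x Y) μ (P.delta b w₂ ν) := by
  have hs : ∑ z, w z • P.brR b z (P.comp x μ ν) =
      ∑ a : {a // a ≠ x}, w₁ a • P.cmp (some x) (optInsL x Y) (P.brR b a.1 μ) ν +
      ∑ y, w₂ y • P.cmp x (optInsR x Y) μ (P.brR b y ν) := by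
    rw [Fintype.sum_sum_type]
    simp only [h₁, h₂, hP.brR_inl_comp, hP.brR_inr_comp]
  have hs₁ : P.cmp (some x) (optInsL x Y) (P.delta b w₁ μ) ν =
      P.cmp (some x) (optInsL x Y) (P.brL b μ) ν - P.cmp x (optInsR x Y) μ (P.brL b ν) -
      ∑ a : {a // a ≠ x}, w₁ a • P.cmp (some x) (optInsL x Y) (P.brR b a.1 μ) ν := by
    rw [delta_apply, Fintype.sum_eq_add_sum_subtype_ne _ x, h, one_smul]
    simp only [map_sub, map_add, map_sum, map_smul, LinearMap.sub_apply, LinearMap.add_apply,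
      LinearMap.sum_apply, LinearMap.smul_apply, hP.brR_self_cmp]
    abel
  rw [delta_apply, hs, hs₁, delta_apply, hP.brL_comp]
  simp only [map_sub, map_sum, map_smul]
  abel

/-- The square of the differential before passing to classes: `Φ` stands for the passage to
coinvariants, hence is odd under the exchange of the two new inputs. Terms that act at different
places cancel in pairs. The doubled bracket comes from the weight `1 / 2` of the first new input and
the Jacobi identity. The diagonal terms contribute `w(x)² - w(x)`, which vanishes for `w(x) = 1` but
not for the weight `1 / 2` of an `α`. -/
theorem IsOperad.apply_delta_delta [CharZero k] (hP : P.IsOperad) (hb : P.IsLieBracket b)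
    {X : Type} [Fintype X] {V : Type*} [AddCommGroup V] [Module k V]
    (Φ : P.obj (Option (Option X)) →ₗ[k] V) (hτ : ∀ z, Φ (P.map (swapOpt X) z) = - Φ z)
    (w : X → k) (w' : Option X → k) (hw' : w' none = 1 / 2) (hww' : ∀ x, w' (some x) = w x)
    (hw : ∀ x, w x = 1 ∨ (w x = 1 / 2 ∧ ∀ [DecidableEq (Option (Option X))] z,
      Φ (P.map (Equiv.swap (some none) (some (some x))) z) = - Φ z)) (μ : P.obj X) :
    Φ (P.delta b w' (P.delta b w μ)) = 0 := by
  classical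
  have two_ne : (2 : k) ≠ 0 := two_ne_zero
  have hLL : Φ (P.brL b (P.brL b μ)) = (1 / 2 : k) • Φ (P.brR b none (P.brL b μ)) := by
    rw [hP.brR_none_brL hb, map_sub, hτ, sub_neg_eq_add, ← two_smul k, smul_smul]
    norm_num
  have hLR : ∀ x, Φ (P.brR b (some x) (P.brL b μ)) = - Φ (P.brL b (P.brR b x μ)) := fun x => by
    rw [hP.brR_some_brL, hτ]
  set G : X → X → V := fun x x' => Φ (P.brR b (some x') (P.brR b x μ)) with hG
  have hGne : ∀ x x', x ≠ x' → G x x' = - G x' x := fun x x' h => by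
    simp only [hG]
    rw [hP.brR_some_brR x x' h.symm, hτ]
  have hn : ∀ x, Φ (P.brR b none (P.brR b x μ)) = -((2 : k) • G x x) := fun x => by
    rw [hP.brR_none_brR hb, map_sub, hτ, two_smul]
    simp only [hG]
    abel
  -- If `x` is an `α`, then `[[ν', ν], x]` equals `-2 G` by the Jacobi identity and `G` by
  -- antisymmetry, so `3 G = 0` and the diagonal term vanishes.
  have hdiag : ∀ x, w x • G x x = w x • w x • G x x := fun x => by
    rcases hw x with h | ⟨-, h⟩
    · rw [h, one_smul, one_smul]
    · have h₁ : G x x = -((2 : k) • G x x) := by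
        rw [← hn, hP.brR_none_brR_eq_neg hb, map_neg, h, neg_neg]
      have h₂ : (3 : k) • G x x = 0 := by
        have : (3 : k) • G x x = G x x + (2 : k) • G x x := by
          rw [show (3 : k) = 1 + 2 by norm_num, add_smul, one_smul]
        rw [this, ← eq_neg_iff_add_eq_zero]
        exact h₁
      have h₃ : G x x = 0 := (smul_eq_zero.1 h₂).resolve_left (by norm_num)
      rw [h₃, smul_zero, smul_zero]
  have hS : ∑ x, ∑ x', (w x * w x') • G x x' = ∑ x, w x • w x • G x x := by
    have h₁ : ∑ x, ∑ x', (w x * w x') • (G x x' + G x' x) =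
        ∑ x, (2 : k) • w x • w x • G x x := by
      refine Finset.sum_congr rfl fun x _ => ?_
      rw [Finset.sum_eq_single x]
      · rw [← two_smul k, smul_smul, smul_smul, smul_smul]
        congr 1
        ring
      · intro x' _ hx'
        rw [hGne x x' hx'.symm, neg_add_cancel, smul_zero]
      · simp
    simp only [smul_add, Finset.sum_add_distrib] at h₁
    have h₂ : ∑ x, ∑ x', (w x * w x') • G x' x = ∑ x, ∑ x', (w x * w x') • G x x' := by
      rw [Finset.sum_comm]
      simp only [mul_comm]
    rw [h₂, ← two_smul k, ← Finset.smul_sum] at h₁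
    exact smul_right_injective V two_ne h₁
  have e : Φ (P.delta b w' (P.delta b w μ)) =
      Φ (P.brL b (P.brL b μ)) - ∑ x, w x • Φ (P.brL b (P.brR b x μ)) -
      ((1 / 2 : k) • Φ (P.brR b none (P.brL b μ)) -
        (1 / 2 : k) • ∑ x, w x • Φ (P.brR b none (P.brR b x μ)) +
        (∑ x, w x • Φ (P.brR b (some x) (P.brL b μ)) - ∑ x, ∑ x', (w x * w x') • G x x')) := by
    rw [delta_apply, delta_apply, Fintype.sum_option]
    simp only [hww', hw', map_sub, map_add, map_sum, map_smul, smul_sub, Finset.sum_sub_distrib]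
    congr 3
    rw [Finset.sum_comm (s := Finset.univ) (t := Finset.univ)
      (f := fun x x' => (w x * w x') • G x x')]
    refine Finset.sum_congr rfl fun x _ => ?_
    rw [Finset.smul_sum]
    exact Finset.sum_congr rfl fun x' _ => by rw [smul_smul, mul_comm]
  have h₅ : (1 / 2 : k) • ∑ x, w x • Φ (P.brR b none (P.brR b x μ)) = - ∑ x, w x • w x • G x x := by
    rw [Finset.smul_sum, ← Finset.sum_neg_distrib]
    refine Finset.sum_congr rfl fun x _ => ?_
    rw [hn, ← hdiag, smul_neg, smul_neg, smul_smul, smul_smul]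
    congr 2
    ring
  rw [e, hLL, h₅, hS]
  simp only [hLR, smul_neg, Finset.sum_neg_distrib]
  abel

end OperadData

/-! ### Grading and operad axioms of the twisting -/

theorem finRotate_pow_val {N : ℕ} (p : ℕ) (x : Fin N) :
    (((finRotate N) ^ p) x : ℕ) = (x + p) % N := by
  induction p with
  | zero => simp [Nat.mod_eq_of_lt x.2]
  | succ p ih =>
    have := x.neZero
    rw [pow_succ', Equiv.Perm.mul_apply, finRotate_apply, Fin.val_add, ih,
      show ((1 : Fin N) : ℕ) = 1 % N from rfl, ← Nat.add_mod, add_assoc]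

/-- The exponent `(l + n - 1) l` differs from `l n` by the even number `l (l - 1)`. This rotation
exchanges two adjacent blocks. -/
theorem sign_finRotate_pow (l n : ℕ) :
    Equiv.Perm.sign ((finRotate (l + n)) ^ l) = (-1 : ℤˣ) ^ (l * n) := by
  rw [map_pow, sign_finRotate, ← pow_mul]
  cases l with
  | zero => simp
  | succ l =>
    rw [show l + 1 + n - 1 = l + n by omega, show (l + n) * (l + 1) = l * (l + 1) + (l + 1) * n by ring,
      pow_add, (Nat.even_mul_succ_self l).neg_one_pow, one_mul]

namespace Tw

open OperadData

variable {k : Type u} [Field k] {P : OperadData k}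

theorem cls_mem_gr {I : Type} [Finite I] (m : ℕ) (μ : P.obj (I ⊕ Fin m)) :
    cls P m μ ∈ gr P I (-(m : ℤ)) := by
  intro n hn
  have : n ≠ m := fun e => hn (by rw [e])
  simp only [cls, LinearMap.comp_apply, DirectSum.lof_eq_of]
  exact DirectSum.of_eq_of_ne _ _ _ this

/-- Lets the axioms with Koszul signs be checked on classes of representatives, where degrees are
numbers of occurrences of `α`. -/
theorem exists_cls_of_mem_gr {I : Type} [Finite I] {n : ℤ} {x : Obj P I} (hx : x ∈ gr P I n) :
    x = 0 ∨ ∃ (m : ℕ) (μ : P.obj (I ⊕ Fin m)), n = -(m : ℤ) ∧ x = cls P m μ := by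
  classical
  by_cases h : ∃ m : ℕ, n = -(m : ℤ)
  · obtain ⟨m, rfl⟩ := h
    obtain ⟨μ, hμ⟩ := Submodule.mkQ_surjective _ (x m)
    refine .inr ⟨m, μ, rfl, ?_⟩
    refine DFinsupp.ext fun n => ?_
    by_cases hn : n = m
    · subst hn
      rw [cls, LinearMap.comp_apply, hμ, DirectSum.lof_eq_of]
      exact (DirectSum.of_eq_same (β := fun m => P.obj (I ⊕ Fin m) ⧸ rel P I m) n (x n)).symm
    · rw [hx n (by simpa using hn), cls_mem_gr m μ n (by simpa using hn)]
  · exact .inl (DFinsupp.ext fun m => hx m fun e => h ⟨m, e.symm⟩)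

theorem cls_induction {I : Type} [Finite I] {p : Obj P I → Prop} (zero : p 0)
    (add : ∀ x y, p x → p y → p (x + y)) (cls : ∀ m μ, p (cls P m μ)) (x : Obj P I) : p x := by
  classical
  induction x using DirectSum.induction_on with
  | zero => exact zero
  | add x y hx hy => exact add x y hx hy
  | of m y =>
    obtain ⟨μ, rfl⟩ := Submodule.mkQ_surjective _ y
    exact cls m μ

theorem isInternal_gr (I : Type) [Finite I] : DirectSum.IsInternal (gr P I) := by
  rw [DirectSum.isInternal_submodule_iff_iSupIndep_and_iSup_eq_top]
  refine ⟨?_, ?_⟩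
  · rw [iSupIndep_def]
    intro n
    rw [Submodule.disjoint_def]
    intro x hx hx'
    -- `N` consists of the elements without a component in degree `n`. It contains all other graded
    -- pieces, which proves independence.
    let N : Submodule k (Obj P I) :=
      { carrier := {x | ∀ m : ℕ, -(m : ℤ) = n → x m = 0}
        zero_mem' := fun _ _ => rfl
        add_mem' := fun {x y} hx hy m hm => by
          rw [DirectSum.add_apply, hx m hm, hy m hm, add_zero]
        smul_mem' := fun c x hx m hm => by rw [DirectSum.smul_apply, hx m hm, smul_zero] }
    have hN : ⨆ j, ⨆ (_ : j ≠ n), gr P I j ≤ N :=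
      iSup₂_le fun j hj y hy m hm => hy m fun e => hj (e.symm.trans hm)
    refine DFinsupp.ext fun m => ?_
    by_cases hm : -(m : ℤ) = n
    · exact hN hx' m hm
    · exact hx m hm
  · rw [eq_top_iff]
    rintro x -
    induction x using cls_induction with
    | zero => exact zero_mem _
    | add x y hx hy => exact add_mem hx hy
    | cls m μ => exact Submodule.mem_iSup_of_mem _ (cls_mem_gr m μ)

theorem map_mem_gr {I J : Type} [Finite I] [Finite J] (e : I ≃ J) {n : ℤ} {x : Obj P I}
    (hx : x ∈ gr P I n) : map P e x ∈ gr P J n := by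
  rcases exists_cls_of_mem_gr hx with rfl | ⟨m, μ, rfl, rfl⟩
  · rw [map_zero]; exact zero_mem _
  · rw [map_cls]; exact cls_mem_gr _ _

theorem comp_mem_gr {I J : Type} [Finite I] [Finite J] (i : I) {m n : ℤ} {x : Obj P I}
    {y : Obj P J} (hx : x ∈ gr P I m) (hy : y ∈ gr P J n) :
    comp P i x y ∈ gr P (Ins I i J) (m + n) := by
  rcases exists_cls_of_mem_gr hx with rfl | ⟨m, μ, rfl, rfl⟩
  · rw [map_zero]; exact zero_mem _
  rcases exists_cls_of_mem_gr hy with rfl | ⟨n, ν, rfl, rfl⟩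
  · rw [map_zero]; exact zero_mem _
  rw [comp_cls, show -(m : ℤ) + -(n : ℤ) = -((m + n : ℕ) : ℤ) by push_cast; ring]
  exact cls_mem_gr _ _

theorem tw_map_refl {I : Type} [Finite I] (x : Obj P I) : map P (Equiv.refl I) x = x := by
  have : map P (Equiv.refl I) = LinearMap.id := obj_hom_ext fun m μ => by
    rw [map_cls, Equiv.sumCongr_refl, P.map_refl]; rfl
  rw [this]; rfl

theorem tw_map_trans {I J K : Type} [Finite I] [Finite J] [Finite K] (e : I ≃ J) (f : J ≃ K)
    (x : Obj P I) : map P (e.trans f) x = map P f (map P e x) := by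
  have : map P (e.trans f) = map P f ∘ₗ map P e := obj_hom_ext fun m μ => by
    rw [LinearMap.comp_apply, map_cls, map_cls, map_cls, ← P.map_trans]
    congr 3
    ext t
    rcases t with t | t <;> rfl
  rw [this]; rfl

theorem tw_map_comp {I I' J J' : Type} [Finite I] [Finite I'] [Finite J] [Finite J']
    (e : I ≃ I') (f : J ≃ J') (i : I) (x : Obj P I) (y : Obj P J) :
    map P (Ins.congr e f i) (comp P i x y) = comp P (e i) (map P e x) (map P f y) := by
  induction x using cls_induction with
  | zero => simp
  | add x x' h h' => simp only [map_add, LinearMap.add_apply, h, h']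
  | cls m μ =>
  induction y using cls_induction with
  | zero => simp
  | add x x' h h' => simp only [map_add, h, h']
  | cls l ν =>
  rw [map_cls, map_cls, comp_cls_eq, map_cls, comp_cls_eq, map_cmp]
  congr 1
  refine (cmp_map_map (Equiv.sumCongr e (Equiv.refl (Fin m)))
    (Equiv.sumCongr f (Equiv.refl (Fin l))) (x := .inl i) (x' := .inl (e i)) rfl
    (compEquiv J' (e i) m l) _ ?_ ?_ _ _).symm
  · rintro ⟨a | a, h⟩ ha <;> rfl
  · rintro (c | c) <;> rfl

theorem tw_one_comp (hP : P.IsOperad) {I : Type} [Finite I] (x : Obj P I) :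
    map P (Ins.unitLeft I) (comp P () (one P) x) = x := by
  induction x using cls_induction with
  | zero => simp
  | add x x' h h' => simp only [map_add, h, h']
  | cls m μ =>
  rw [one, comp_cls_eq, map_cls, map_cmp]
  have : Unique (Unit ⊕ Fin 0) := Equiv.unique (Equiv.sumEmpty Unit (Fin 0))
  rw [hP.one_cmp _ _ (Equiv.sumCongr (Equiv.refl I) (finCongr (zero_add m).symm))]
  · conv_rhs => rw [← P.map_refl μ]
    rw [cls_map_eq (zero_add m) (Equiv.sumCongr (Equiv.refl I) (finCongr (zero_add m).symm))
      (Equiv.refl _) 1, Equiv.Perm.sign_one, one_smul]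
    rintro (z | z) <;> simp
  · rintro (a | a)
    · rfl
    · simp

theorem tw_comp_one (hP : P.IsOperad) {I : Type} [Finite I] (i : I) (x : Obj P I) :
    map P (Ins.unitRight i) (comp P i x (one P)) = x := by
  induction x using cls_induction with
  | zero => simp
  | add x x' h h' => simp only [map_add, LinearMap.add_apply, h, h']
  | cls m μ =>
  rw [one, comp_cls_eq, map_cls, map_cmp]
  have : Unique (Unit ⊕ Fin 0) := Equiv.unique (Equiv.sumEmpty Unit (Fin 0))
  rw [hP.cmp_one _ _ (Equiv.refl _), P.map_refl]
  · rfl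
  · rintro ⟨a | a, h⟩ <;> rfl
  · rintro (a | a)
    · rfl
    · exact a.elim0

theorem tw_comp_seq (hP : P.IsOperad) {I J K : Type} [Finite I] [Finite J] [Finite K] (i : I)
    (j : J) (x : Obj P I) (y : Obj P J) (z : Obj P K) :
    map P (Ins.seq K i j) (comp P (Sum.inr j) (comp P i x y) z) = comp P i x (comp P j y z) := by
  induction x using cls_induction with
  | zero => simp
  | add x x' h h' => simp only [map_add, LinearMap.add_apply, h, h']
  | cls m μ =>
  induction y using cls_induction with
  | zero => simp
  | add x x' h h' => simp only [map_add, LinearMap.add_apply, h, h']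
  | cls l ν =>
  induction z using cls_induction with
  | zero => simp
  | add x x' h h' => simp only [map_add, h, h']
  | cls n ρ =>
  rw [comp_cls_eq, comp_cls_eq, comp_cls_eq, comp_cls_eq, map_cls, map_cmp]
  rw [hP.cmp_seq (compEquiv J i m l) (compEquiv_inr_inl i m l j) _ (compEquiv K j l n)
    ((compEquiv (Ins J j K) i m (l + n)).trans
      (Equiv.sumCongr (Equiv.refl _) (finCongr (add_assoc m l n).symm)))]
  · have := cls_map_eq (P := P) (add_assoc m l n) ((compEquiv (Ins J j K) i m (l + n)).trans
      (Equiv.sumCongr (Equiv.refl _) (finCongr (add_assoc m l n).symm)))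
      (compEquiv (Ins J j K) i m (l + n)) 1 (fun z => by
        rw [Equiv.trans_apply]
        generalize compEquiv (Ins J j K) i m (l + n) z = t
        rcases t with t | t <;> simp)
      (P.comp (Sum.inl i) μ (P.cmp (Sum.inl j) (compEquiv K j l n) ν ρ))
    rw [Equiv.Perm.sign_one, one_smul] at this
    exact this.symm
  · rintro ⟨a | a, h⟩ ha
    · rfl
    · rfl
  · rintro ⟨a | a, h⟩ ha
    · rfl
    · simp [Fin.ext_iff]
  · rintro (a | a)
    · rfl
    · simp [Fin.ext_iff, add_assoc]

/-- The two orders of composition number the `α`'s of `ν` and of `ρ` in opposite orders; exchanging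
a block of length `l` with one of length `n` costs the sign `(-1) ^ (l * n)`. -/
theorem tw_comp_par_cls (hP : P.IsOperad) {I J K : Type} [Finite I] [Finite J] [Finite K] (i i' : I)
    (h : i' ≠ i) (m l n : ℕ) (μ : P.obj (I ⊕ Fin m)) (ν : P.obj (J ⊕ Fin l))
    (ρ : P.obj (K ⊕ Fin n)) :
    map P (Ins.par J K i i' h) (comp P (Sum.inl ⟨i', h⟩) (comp P i (cls P m μ) (cls P l ν))
      (cls P n ρ)) = (-1 : ℤˣ) ^ (l * n) • comp P (Sum.inl ⟨i, h.symm⟩)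
        (comp P i' (cls P m μ) (cls P n ρ)) (cls P l ν) := by
  have hmn : m + n + l = m + (l + n) := by omega
  -- `τ` fixes the places of the `α`'s of `μ` and exchanges the blocks belonging to `ρ` and `ν`.
  let τ : Equiv.Perm (Fin (m + (l + n))) := finSumFinEquiv.permCongr
    (Equiv.Perm.sumCongr (1 : Equiv.Perm (Fin m)) (finRotate (l + n) ^ l))
  have hτ : Equiv.Perm.sign τ = (-1 : ℤˣ) ^ (l * n) := by
    rw [Equiv.Perm.sign_permCongr, Equiv.Perm.sign_sumCongr, Equiv.Perm.sign_one, one_mul,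
      sign_finRotate_pow]
  have τ₁ : ∀ a : Fin m, τ (Fin.castAdd _ a) = Fin.castAdd _ a := fun a => by
    simp [τ, Equiv.permCongr_apply]
  have τ₂ : ∀ a : Fin (l + n), τ (Fin.natAdd m a) = Fin.natAdd m ((finRotate (l + n) ^ l) a) :=
    fun a => by simp [τ, Equiv.permCongr_apply]
  rw [comp_cls_eq, comp_cls_eq, comp_cls_eq, comp_cls_eq, map_cls, map_cmp]
  let g : Ins (Ins I i J ⊕ Fin (m + l)) (Sum.inl (Sum.inl ⟨i', h⟩)) (K ⊕ Fin n) ≃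
      Ins (Ins I i' K) (Sum.inl ⟨i, h.symm⟩) J ⊕ Fin (m + (l + n)) :=
    (compEquiv (I := Ins I i J) K (Sum.inl ⟨i', h⟩) (m + l) n).trans
      (Equiv.sumCongr (Ins.par J K i i' h) (finCongr (add_assoc m l n)))
  let g' : Ins (Ins I i' K ⊕ Fin (m + n)) (Sum.inl (Sum.inl ⟨i, h.symm⟩)) (J ⊕ Fin l) ≃
      Ins (Ins I i' K) (Sum.inl ⟨i, h.symm⟩) J ⊕ Fin (m + (l + n)) :=
    (compEquiv (I := Ins I i' K) J (Sum.inl ⟨i, h.symm⟩) (m + n) l).trans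
      (Equiv.sumCongr (Equiv.refl _) ((finCongr hmn).trans τ))
  have e₁ := cls_map_eq (P := P) (add_assoc m l n) ((compEquiv (I := Ins I i J) K (Sum.inl ⟨i', h⟩) (m + l) n).trans
      (Equiv.sumCongr (Ins.par J K i i' h) (Equiv.refl _))) g 1 (fun z => by
        simp only [g, Equiv.trans_apply]
        generalize compEquiv K (Sum.inl ⟨i', h⟩ : Ins I i J) (m + l) n z = t
        rcases t with t | t <;> simp)
      (P.comp (Sum.inl (Sum.inl ⟨i', h⟩)) (P.cmp (Sum.inl i) (compEquiv J i m l) μ ν) ρ)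
  have e₂ := cls_map_eq (P := P) hmn (compEquiv (I := Ins I i' K) J (Sum.inl ⟨i, h.symm⟩) (m + n) l) g' τ (fun z => by
        simp only [g', Equiv.trans_apply]
        generalize compEquiv J (Sum.inl ⟨i, h.symm⟩ : Ins I i' K) (m + n) l z = t
        rcases t with t | t <;> simp)
      (P.comp (Sum.inl (Sum.inl ⟨i, h.symm⟩)) (P.cmp (Sum.inl i') (compEquiv K i' m n) μ ρ) ν)
  rw [Equiv.Perm.sign_one, one_smul] at e₁
  rw [hτ] at e₂
  refine e₁.symm.trans (Eq.trans ?_ e₂)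
  congr 1
  refine hP.cmp_par (x := .inl i) (x' := .inl i') (fun e => h (Sum.inl.inj e))
    (compEquiv J i m l) (compEquiv K i' m n) rfl rfl g g' ?_ ?_ ?_ μ ν ρ
  · rintro (a | a) ha ha' hb hb'
    · rfl
    · change Sum.inr _ = Sum.inr _
      congr 1
      refine Eq.trans ?_ (τ₁ a).symm
      simp [Fin.ext_iff]
  · rintro (a | a) hb
    · rfl
    · change Sum.inr _ = Sum.inr _
      congr 1
      have : finCongr hmn (Fin.natAdd (m + n) a) = Fin.natAdd m ⟨n + a, by omega⟩ := by
        simp [Fin.ext_iff, add_assoc]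
      refine Eq.trans ?_ ((congrArg τ this).trans (τ₂ _)).symm
      have h' : n + a + l = (l + n) + a := by omega
      simp [Fin.ext_iff, finRotate_pow_val, h', Nat.mod_eq_of_lt (show (a : ℕ) < l + n by omega)]
  · rintro (a | a) hb
    · rfl
    · change Sum.inr _ = Sum.inr _
      congr 1
      have : finCongr hmn (Fin.castAdd l (Fin.natAdd m a)) = Fin.natAdd m ⟨a, by omega⟩ := by
        simp [Fin.ext_iff]
      refine Eq.trans ?_ ((congrArg τ this).trans (τ₂ _)).symm
      simp [Fin.ext_iff, finRotate_pow_val, Nat.mod_eq_of_lt (show (a : ℕ) + l < l + n by omega)]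
      omega

end Tw

/-! ### The differential of the twisting: square zero and Leibniz rule -/

namespace Tw

open OperadData

variable {k : Type u} [Field k] {P : OperadData k} {b : P.obj (Fin 2)}

variable (P b) in
/-- The differential of the operadic twisting. -/
noncomputable def diff {I : Type} [Finite I] : Obj P I →ₗ[k] Obj P I := dMC P b + adEll P b

/-- The weights of the inputs in the differential: `1` for an input, `1 / 2` for an `α`. -/
noncomputable def wt (k : Type u) [Field k] (I : Type) (m : ℕ) : I ⊕ Fin m → k :=
  Sum.elim (fun _ => 1) fun _ => 1 / 2

theorem d_cls_eq_delta {I : Type} [Fintype I] (m : ℕ) (μ : P.obj (I ⊕ Fin m)) :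
    diff P b (cls P m μ) = cls P (m + 1) (P.map (optE I m) (P.delta b (wt k I m) μ)) := by
  refine (d_cls m μ).trans ?_
  rw [delta_apply, Fintype.sum_sum_type]
  simp only [wt, Sum.elim_inl, Sum.elim_inr, one_smul, ← Finset.smul_sum, sub_sub]
  rfl

theorem d_map {I J : Type} [Finite I] [Finite J] (e : I ≃ J) (x : Obj P I) :
    diff P b (map P e x) = map P e (diff P b x) := by
  have := Fintype.ofFinite I
  have := Fintype.ofFinite J
  induction x using cls_induction with
  | zero => simp
  | add x y hx hy => simp only [map_add, hx, hy]
  | cls m μ =>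
    rw [map_cls, d_cls_eq_delta, d_cls_eq_delta, map_cls, map_delta, ← P.map_trans, ← P.map_trans]
    have h₁ : (Equiv.optionCongr (Equiv.sumCongr e (Equiv.refl (Fin m)))).trans (optE J m) =
        (optE I m).trans (Equiv.sumCongr e (Equiv.refl (Fin (m + 1)))) := by
      ext z
      rcases z with _ | z | z <;> rfl
    have h₂ : wt k J m ∘ Equiv.sumCongr e (Equiv.refl (Fin m)) = wt k I m := by
      ext z
      rcases z with z | z <;> rfl
    rw [h₁, h₂]

theorem d_mem_gr {I : Type} [Finite I] {n : ℤ} {x : Obj P I} (hx : x ∈ gr P I n) :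
    diff P b x ∈ gr P I (n - 1) := by
  have := Fintype.ofFinite I
  rcases exists_cls_of_mem_gr hx with rfl | ⟨m, μ, rfl, rfl⟩
  · rw [map_zero]; exact zero_mem _
  · rw [d_cls_eq_delta, show -(m : ℤ) - 1 = -((m + 1 : ℕ) : ℤ) by push_cast; ring]
    exact cls_mem_gr _ _

/-- An instance of `apply_delta_delta`: classes change sign when the two new `α`'s, or a new and an
old `α`, are exchanged. These are exactly the symmetries required for the weights `1` and `1 / 2`.
-/
theorem d_d [CharZero k] (hP : P.IsOperad) (hb : P.IsLieBracket b) {I : Type} [Finite I]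
    (x : Obj P I) : diff P b (diff P b x) = 0 := by
  have := Fintype.ofFinite I
  induction x using cls_induction with
  | zero => simp
  | add x y hx hy => rw [map_add, map_add, hx, hy, add_zero]
  | cls m μ =>
    rw [d_cls_eq_delta, d_cls_eq_delta, map_delta, ← P.map_trans]
    let e := (Equiv.optionCongr (optE I m)).trans (optE I (m + 1))
    have hswap : ∀ (σ : Equiv.Perm (Option (Option (I ⊕ Fin m)))) (p q : Fin (m + 2)), p ≠ q →
        (∀ z, Sum.map id (Equiv.swap p q) (e z) = e (σ z)) →
        ∀ z, cls P (m + 2) (P.map e (P.map σ z)) = - cls P (m + 2) (P.map e z) := by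
      intro σ p q hpq h z
      rw [← P.map_trans, cls_map_eq rfl e (σ.trans e) (Equiv.swap p q) h,
        Equiv.Perm.sign_swap hpq, Units.neg_smul, one_smul]
    refine hP.apply_delta_delta hb ((cls P (m + 2)).comp (P.map e)) ?_ _ _ rfl ?_ ?_ μ
    · refine hswap _ 0 1 (by simp) ?_
      rintro (_ | _ | z | z)
      · simp [e, swapOpt]
      · change Sum.inr (Equiv.swap 0 1 (1 : Fin (m + 2))) = Sum.inr 0
        simp
      · rfl
      · change Sum.inr (Equiv.swap 0 1 z.succ.succ) = Sum.inr z.succ.succ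
        rw [Equiv.swap_apply_of_ne_of_ne (by simp) (by simp [Fin.ext_iff])]
    · rintro (x | x) <;> rfl
    · rintro (x | x)
      · exact .inl rfl
      · refine .inr ⟨rfl, ?_⟩
        intro _
        refine hswap _ 1 x.succ.succ (by simp [Fin.ext_iff]) ?_
        intro z
        have h₁ : e (some none) = .inr 1 := rfl
        have h₂ : e (some (some (.inr x))) = .inr x.succ.succ := rfl
        by_cases hz₁ : z = some none
        · subst hz₁; simp [h₁, h₂]
        by_cases hz₂ : z = some (some (.inr x))
        · subst hz₂; simp [h₁, h₂]
        rw [Equiv.swap_apply_of_ne_of_ne hz₁ hz₂]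
        rcases hz : e z with t | t
        · rfl
        · rw [Sum.map_inr, Equiv.swap_apply_of_ne_of_ne]
          · rintro rfl; exact hz₁ (e.injective (hz.trans h₁.symm))
          · rintro rfl; exact hz₂ (e.injective (hz.trans h₂.symm))

/-- The rule `delta_comp` on representatives; what remains is the place of the new `α`, which is
first in each differential but not first in the composite. -/
theorem d_comp_cls (hP : P.IsOperad) {I J : Type} [Finite I] [Finite J] (i : I) (m l : ℕ)
    (μ : P.obj (I ⊕ Fin m)) (ν : P.obj (J ⊕ Fin l)) :
    diff P b (comp P i (cls P m μ) (cls P l ν)) =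
      comp P i (diff P b (cls P m μ)) (cls P l ν) +
        (-1 : ℤˣ) ^ m • comp P i (cls P m μ) (diff P b (cls P l ν)) := by
  classical
  have := Fintype.ofFinite I
  have := Fintype.ofFinite J
  rw [comp_cls_eq, d_cls_eq_delta, d_cls_eq_delta, d_cls_eq_delta, comp_cls_eq, comp_cls_eq, OperadData.cmp,
    LinearMap.compr₂_apply, map_delta, hP.delta_comp _ _ (wt k I m) (wt k J l) rfl
    (by rintro ⟨a | a, h⟩ <;> rfl) (by rintro (a | a) <;> rfl), map_add, map_add, map_add]
  congr 1
  · rw [map_cmp, map_cmp]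
    refine Eq.trans (cls_cmp_eq (show m + 1 + l = m + l + 1 by omega) 1 (optE I m) (Equiv.refl _)
      rfl (compEquiv J i (m + 1) l) _ ?_ ?_ _ _) (by simp [P.map_refl])
    · rintro ⟨_ | a | a, h⟩ ha
      · exact congrArg Sum.inr (Fin.ext rfl)
      · rfl
      · exact congrArg Sum.inr (Fin.ext rfl)
    · rintro (a | a)
      · rfl
      · refine congrArg Sum.inr (Fin.ext ?_)
        change m + 1 + (a : ℕ) = m + a + 1
        omega
  · rw [map_cmp, map_cmp]
    -- The new `α` of `dν` stands behind the `m` occurrences in `μ`. The cycle of the first `m + 1`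
    -- places brings it to the front, with the sign `(-1) ^ m`.
    let p : Fin (m + l + 1) := ⟨m, by omega⟩
    refine Eq.trans (cls_cmp_eq (show m + (l + 1) = m + l + 1 by omega) p.cycleRange (Equiv.refl _)
      (optE J l) rfl (compEquiv J i m (l + 1)) _ ?_ ?_ _ _) ?_
    · rintro ⟨a | a, h⟩ ha
      · rfl
      · refine congrArg Sum.inr (Fin.ext ?_)
        have hlt : Fin.cast (by omega) (Fin.castAdd (l + 1) a) < p := a.2
        refine (congrArg Fin.val (Fin.cycleRange_of_lt hlt)).trans ?_
        rw [Fin.val_add_one_of_lt (lt_of_lt_of_le hlt (Fin.le_last p))]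
        rfl
    · rintro (_ | a | a)
      · exact congrArg Sum.inr (Fin.cycleRange_self p)
      · rfl
      · refine congrArg Sum.inr (Fin.ext ?_)
        have hgt : p < Fin.cast (by omega) (Fin.natAdd m a.succ) :=
          show m < m + (a + 1) by omega
        exact congrArg Fin.val (Fin.cycleRange_of_gt hgt)
    · rw [Fin.sign_cycleRange, P.map_refl]; rfl

theorem tw_comp_par (hP : P.IsOperad) {I J K : Type} [Finite I] [Finite J] [Finite K] (i i' : I)
    (h : i' ≠ i) {m n : ℤ} (x : Obj P I) {y : Obj P J} {z : Obj P K} (hy : y ∈ gr P J m)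
    (hz : z ∈ gr P K n) :
    map P (Ins.par J K i i' h) (comp P (Sum.inl ⟨i', h⟩) (comp P i x y) z) =
      (m * n).negOnePow • comp P (Sum.inl ⟨i, h.symm⟩) (comp P i' x z) y := by
  rcases exists_cls_of_mem_gr hy with rfl | ⟨l, ν, rfl, rfl⟩
  · simp
  rcases exists_cls_of_mem_gr hz with rfl | ⟨n, ρ, rfl, rfl⟩
  · simp
  rw [neg_mul_neg, ← Nat.cast_mul, Int.negOnePow_def, zpow_natCast]
  induction x using cls_induction with
  | zero => simp
  | add x y hx hy => simp only [map_add, LinearMap.add_apply, hx, hy, smul_add]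
  | cls m μ => exact tw_comp_par_cls hP i i' h m l n μ ν ρ

theorem d_comp (hP : P.IsOperad) {I J : Type} [Finite I] [Finite J] (i : I) {m : ℤ} {x : Obj P I}
    (y : Obj P J) (hx : x ∈ gr P I m) : diff P b (comp P i x y) =
      comp P i (diff P b x) y + m.negOnePow • comp P i x (diff P b y) := by
  rcases exists_cls_of_mem_gr hx with rfl | ⟨l, ν, rfl, rfl⟩
  · simp
  rw [Int.negOnePow_neg, Int.negOnePow_def, zpow_natCast]
  induction y using cls_induction with
  | zero => simp
  | add x y hx hy =>
    simp only [map_add, hx, hy, smul_add]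
    abel
  | cls m μ => exact d_comp_cls hP i l m ν μ

theorem isDGOperad [CharZero k] (hP : P.IsOperad) (hb : P.IsLieBracket b) :
    (Tw P b).IsDGOperad where
  internal I _ := isInternal_gr I
  map_mem e _ _ hx := map_mem_gr e hx
  map_refl x := tw_map_refl x
  map_trans e f x := tw_map_trans e f x
  one_mem := cls_mem_gr 0 _
  comp_mem i _ _ _ _ hx hy := comp_mem_gr i hx hy
  map_comp e f i x y := tw_map_comp e f i x y
  one_comp x := tw_one_comp hP x
  comp_one i x := tw_comp_one hP i x
  comp_seq i j x y z := tw_comp_seq hP i j x y z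
  comp_par i i' h _ _ x _ _ hy hz := tw_comp_par hP i i' h x hy hz
  d_mem hx := d_mem_gr hx
  d_d x := d_d hP hb x
  d_map e x := d_map e x
  d_comp i _ _ y hx := d_comp hP i y hx

end Tw

/-! ### The bracket `b(x, y)` of two operations -/

namespace OperadData

variable {k : Type u} [Field k] {P : OperadData k} {b : P.obj (Fin 2)}

/-- The additional input of the first summand becomes `none`. -/
def optSum (X Y : Type) : Option X ⊕ Y ≃ Option (X ⊕ Y) where
  toFun := Sum.elim (Option.map .inl) fun r => some (.inr r)
  invFun
    | none => .inl none
    | some (.inl j) => .inl (some j)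
    | some (.inr r) => .inr r
  left_inv := by rintro ((_ | j) | r) <;> rfl
  right_inv := by rintro (_ | j | r) <;> rfl

/-- The inputs of `b(x, y)`, where `x` is plugged into the additional input of `b(ν, y)`. -/
def plugEquiv (X Y : Type) : Ins (Option Y) none X ≃ X ⊕ Y where
  toFun
    | .inl ⟨none, h⟩ => absurd rfl h
    | .inl ⟨some y, _⟩ => .inr y
    | .inr x => .inl x
  invFun
    | .inl x => .inr x
    | .inr y => .inl ⟨some y, by simp⟩
  left_inv := by
    rintro (⟨_ | y, h⟩ | x)
    · exact absurd rfl h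
    · rfl
    · rfl
  right_inv := by rintro (x | y) <;> rfl

variable (P b) in
/-- `b(x, y)`. -/
noncomputable def bra {X Y : Type} [Finite X] [Finite Y] :
    P.obj X →ₗ[k] P.obj Y →ₗ[k] P.obj (X ⊕ Y) :=
  ((P.cmp none (plugEquiv X Y)) ∘ₗ P.brL b).flip

section

variable {X X' Y Y' Z : Type} [Finite X] [Finite X'] [Finite Y] [Finite Y'] [Finite Z]

theorem bra_apply (x : P.obj X) (y : P.obj Y) :
    P.bra b x y = P.cmp none (plugEquiv X Y) (P.brL b y) x := rfl

theorem bra_map_map (e : X ≃ X') (f : Y ≃ Y') (x : P.obj X) (y : P.obj Y) :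
    P.bra b (P.map e x) (P.map f y) = P.map (Equiv.sumCongr e f) (P.bra b x y) := by
  rw [bra_apply, bra_apply, ← map_brL, map_cmp]
  refine cmp_map_map (Equiv.optionCongr f) e (x := none) (x' := none) rfl (plugEquiv X' Y')
    ((plugEquiv X Y).trans (Equiv.sumCongr e f)) ?_ ?_ _ _
  · rintro ⟨_ | a, h⟩ ha
    · exact absurd rfl h
    · rfl
  · intro a
    rfl

/-- Antisymmetry of `b` lets `x` be plugged into the first input instead of the second, up to a
sign; the two arguments are then plugged in in the opposite order by parallel associativity. -/
theorem IsOperad.bra_swap (hP : P.IsOperad) (hb : P.IsLieBracket b) (x : P.obj X) (y : P.obj Y) :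
    P.map (Equiv.sumComm X Y) (P.bra b x y) = - P.bra b y x := by
  let g : Ins (Fin 2) 0 X ≃ Option X := Equiv.ofBijective (Sum.elim (fun _ => none) some) (by
    refine ⟨?_, ?_⟩
    · rintro (⟨a, ha⟩ | a) (⟨c, hc⟩ | c) h
      · obtain rfl : a = 1 := by omega
        obtain rfl : c = 1 := by omega
        rfl
      · simp at h
      · simp at h
      · simpa using h
    · rintro (_ | a)
      · exact ⟨.inl ⟨1, by simp⟩, rfl⟩
      · exact ⟨.inr a, rfl⟩)
  have h₁ : P.brL b x = - P.cmp 0 g b x := by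
    have e : P.cmp 1 (leftEquiv X) (P.map (Equiv.swap 0 1) b) x = P.cmp 0 g b x :=
      cmp_map_left (Equiv.swap 0 1) (x := 0) (x' := 1) (by simp) _ _ (fun _ _ => rfl) (fun _ => rfl) _ _
    rw [hb.antisymm, LinearMap.map_neg₂] at e
    rw [← e, neg_neg]
    rfl
  rw [bra_apply, bra_apply, h₁, LinearMap.map_neg₂, neg_neg, map_cmp, brL]
  refine hP.cmp_par (x := (1 : Fin 2)) (x' := 0) (by simp) (leftEquiv Y) g rfl rfl _ _ ?_ ?_ ?_ b y x
  · intro a h h'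
    omega
  · intro a h
    rfl
  · intro a h
    rfl

theorem IsOperad.cmp_bra_left (hP : P.IsOperad) (a : X) (x : P.obj X) (y : P.obj Y) (z : P.obj Z)
    {W : Type} [Finite W] (g : Ins (X ⊕ Y) (.inl a) Z ≃ W) (g' : Ins X a Z ⊕ Y ≃ W)
    (h₁ : ∀ c h, g (.inl ⟨.inl c, h⟩) = g' (.inl (.inl ⟨c, fun e => h (by rw [e])⟩)))
    (h₂ : ∀ c h, g (.inl ⟨.inr c, h⟩) = g' (.inr c))
    (h₃ : ∀ c, g (.inr c) = g' (.inl (.inr c))) :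
    P.cmp (.inl a) g (P.bra b x y) z = P.map g' (P.bra b (P.comp a x z) y) := by
  rw [bra_apply, bra_apply, map_cmp, comp_eq_cmp]
  refine hP.cmp_seq (plugEquiv X Y) rfl g (Equiv.refl _) ((plugEquiv _ Y).trans g') ?_ ?_ ?_ _ _ _
  · rintro ⟨_ | c, hc⟩ h
    · exact absurd rfl hc
    · exact h₂ c h
  · rintro ⟨c, hc⟩ h
    exact h₁ c h
  · intro c
    exact h₃ c

theorem IsOperad.cmp_bra_right (hP : P.IsOperad) (a : Y) (x : P.obj X) (y : P.obj Y) (z : P.obj Z)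
    {W : Type} [Finite W] (g : Ins (X ⊕ Y) (.inr a) Z ≃ W) (g' : X ⊕ Ins Y a Z ≃ W)
    (h₁ : ∀ c h, g (.inl ⟨.inl c, h⟩) = g' (.inl c))
    (h₂ : ∀ c h, g (.inl ⟨.inr c, h⟩) = g' (.inr (.inl ⟨c, fun e => h (by rw [e])⟩)))
    (h₃ : ∀ c, g (.inr c) = g' (.inr (.inr c))) :
    P.cmp (.inr a) g (P.bra b x y) z = P.map g' (P.bra b x (P.comp a y z)) := by
  rw [bra_apply, bra_apply, map_cmp, hP.brL_comp]
  refine hP.cmp_par (x := none) (x' := some a) (by simp) (plugEquiv X Y)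
    (optInsL a Z) rfl rfl g ((plugEquiv X _).trans g') ?_ ?_ ?_ _ _ _
  · rintro (_ | c) h h' hb hb'
    · exact absurd rfl h
    · exact h₂ c hb
  · intro c h
    exact h₁ c h
  · intro c h
    exact h₃ c

/-- `brR_none_brL` with `x` and `y` plugged into the two additional inputs. Each of the three double
brackets is rewritten as such a substitution into an operation on `Option (Option Z)`. -/
theorem IsOperad.bra_bra (hP : P.IsOperad) (hb : P.IsLieBracket b) (x : P.obj X) (y : P.obj Y)
    (z : P.obj Z) : P.bra b x (P.bra b y z) = P.map (Equiv.sumAssoc X Y Z) (P.bra b (P.bra b x y) z) +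
      P.map ((Equiv.sumAssoc Y X Z).symm.trans (((Equiv.sumComm Y X).sumCongr (Equiv.refl Z)).trans
        (Equiv.sumAssoc X Y Z))) (P.bra b y (P.bra b x z)) := by
  let g : Ins (Option (Option Z)) (some none) Y ≃ Option (Y ⊕ Z) :=
    (optInsL none Y).trans (Equiv.optionCongr (plugEquiv Y Z))
  have hL : ∀ {X : Type} [Finite X] (x : P.obj X), P.brL b (P.bra b x z) = P.cmp (some none)
      ((optInsL none X).trans (Equiv.optionCongr (plugEquiv X Z))) (P.brL b (P.brL b z)) x := by
    intro X _ x
    rw [← map_cmp, ← hP.brL_comp, map_brL]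
    rfl
  have e₁ : P.bra b x (P.bra b y z) =
      P.cmp none (plugEquiv X (Y ⊕ Z)) (P.cmp (some none) g (P.brL b (P.brL b z)) y) x := by
    rw [bra_apply, hL]
  have e₂ : P.map (Equiv.sumAssoc X Y Z) (P.bra b (P.bra b x y) z) =
      P.cmp none (plugEquiv X (Y ⊕ Z)) (P.cmp (some none) g (P.brR b none (P.brL b z)) y) x := by
    rw [bra_apply, bra_apply, ← map_cmp, hP.brR_self_cmp, map_cmp, map_cmp]
    symm
    refine hP.cmp_seq (x := none) (y := none)
      ((optInsR none Y).trans (Equiv.optionCongr (plugEquiv Y Z))) rfl (plugEquiv X (Y ⊕ Z))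
      (plugEquiv X Y) ((plugEquiv (X ⊕ Y) Z).trans (Equiv.sumAssoc X Y Z)) ?_ ?_ ?_ _ _ _
    · rintro ⟨_ | c, hc⟩ h
      · exact absurd rfl hc
      · rfl
    · rintro ⟨_ | c, hc⟩ h
      · exact absurd rfl hc
      · rfl
    · intro c
      rfl
  have e₃ : P.map ((Equiv.sumAssoc Y X Z).symm.trans (((Equiv.sumComm Y X).sumCongr
      (Equiv.refl Z)).trans (Equiv.sumAssoc X Y Z))) (P.bra b y (P.bra b x z)) =
      P.cmp none (plugEquiv X (Y ⊕ Z)) (P.cmp (some none) g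
        (P.map (swapOpt Z) (P.brL b (P.brL b z))) y) x := by
    have e : P.cmp (some none) g (P.map (swapOpt Z) (P.brL b (P.brL b z))) y =
        P.cmp none ((Ins.congr (swapOpt Z) (Equiv.refl Y) none).trans g) (P.brL b (P.brL b z)) y :=
      P.cmp_map_left (swapOpt Z) (x := none) (x' := some none) rfl _ _ (fun _ _ => rfl) (fun _ => rfl) _ _
    rw [bra_apply, hL, map_cmp, e]
    refine hP.cmp_par (x := some none) (x' := none) (by simp)
      ((optInsL none X).trans (Equiv.optionCongr (plugEquiv X Z)))
      ((Ins.congr (swapOpt Z) (Equiv.refl Y) none).trans g) rfl rfl _ _ ?_ ?_ ?_ _ _ _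
    · rintro (_ | _ | c) h h' hb hb'
      · exact absurd rfl h'
      · exact absurd rfl h
      · rfl
    · intro c h
      rfl
    · intro c h
      rfl
  rw [e₁, e₂, e₃, hP.brR_none_brL hb]
  simp

theorem IsOperad.map_bra_one_one (hP : P.IsOperad) (e : Unit ⊕ Unit ≃ Fin 2) (h₀ : e (.inl ()) = 0)
    (h₁ : e (.inr ()) = 1) : P.map e (P.bra b P.one P.one) = b := by
  let f : Fin 2 ≃ Option Unit := ⟨![none, some ()], fun t => t.elim 0 fun _ => 1,
    by decide, by decide⟩
  have h : P.brL b P.one = P.map f b := by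
    have := hP.cmp_one (P := P) 1 (leftEquiv Unit) f ?_ ?_ (Equiv.refl Unit) b
    · rwa [P.map_refl] at this
    · rintro ⟨a, ha⟩
      obtain rfl : a = 0 := by omega
      rfl
    · intro u
      rfl
  rw [bra_apply, h, map_cmp]
  have := hP.cmp_one (P := P) none ((plugEquiv Unit Unit).trans e) f.symm ?_ ?_ (Equiv.refl Unit)
    (P.map f b)
  · rw [P.map_refl] at this
    rw [this, ← P.map_trans, Equiv.self_trans_symm, P.map_refl]
  · rintro ⟨_ | a, ha⟩
    · exact absurd rfl ha
    · exact h₁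
  · intro u
    exact h₀

end

end OperadData

/-! ### The Lie operad: axioms and generation by the bracket -/

namespace LieOp

open multilinearLie FreeLieAlgebra OperadData

variable {k : Type u} [Field k]

section

variable {I J K : Type}

@[simp] theorem rename_of (g : I → J) (i : I) : rename k g (of k i) = of k (g i) := by
  simp [rename]

theorem rename_rename (g : I → J) (h : J → K) (x : FreeLieAlgebra k I) :
    rename k h (rename k g x) = rename k (h ∘ g) x := by
  rw [← LieHom.comp_apply]
  congr 1
  ext a
  simp

theorem rename_id (x : FreeLieAlgebra k I) : rename k id x = x := by
  have : rename k (id : I → I) = LieHom.id := by ext; simp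
  rw [this]; rfl

@[simp] theorem subst_of_self (i : I) (y : FreeLieAlgebra k J) :
    subst k i y (of k i) = rename k Sum.inr y := by
  simp [subst]

theorem subst_of_ne {i a : I} (h : a ≠ i) (y : FreeLieAlgebra k J) :
    subst k i y (of k a) = of k (Sum.inl ⟨a, h⟩) := by
  simp [subst, h]

theorem subst_rename (i : J) (y : FreeLieAlgebra k K) (g : I → J) (h : ∀ a, g a ≠ i)
    (x : FreeLieAlgebra k I) :
    subst k i y (rename k g x) = rename k (fun a => Sum.inl ⟨g a, h a⟩) x := by
  rw [← LieHom.comp_apply]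
  congr 1
  ext a
  simp [subst_of_ne (h a)]

end

theorem isOperad (k : Type u) [Field k] : (LieOp k).IsOperad where
  one_comp {I} _ x := Subtype.ext <| by
    change rename k _ (subst k () x.1 (of k ())) = x.1
    rw [subst_of_self, rename_rename]
    exact rename_id x.1
  comp_one {I} _ i x := Subtype.ext <| by
    change rename k _ (subst k i (of k ()) x.1) = x.1
    conv_rhs => rw [← rename_id x.1]
    rw [← LieHom.comp_apply]
    congr 1
    ext a
    by_cases h : a = i
    · subst h; simp [Ins.unitRight]
    · simp [subst_of_ne h, Ins.unitRight]
  comp_seq {I J K} _ _ _ i j x y z := Subtype.ext <| by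
    change rename k _ (subst k (Sum.inr j) z.1 (subst k i y.1 x.1)) =
      subst k i (subst k j z.1 y.1) x.1
    rw [← LieHom.comp_apply, ← LieHom.comp_apply]
    congr 1
    ext a
    by_cases h : a = i
    · subst h
      simp only [LieHom.comp_apply, subst_of_self]
      rw [← LieHom.comp_apply, ← LieHom.comp_apply, ← LieHom.comp_apply]
      congr 1
      ext c
      by_cases hc : c = j
      · subst hc
        simp only [LieHom.comp_apply, subst_of_self, rename_of, rename_rename]
        rfl
      · simp only [LieHom.comp_apply, rename_of, subst_of_ne hc]
        rw [subst_of_ne (fun e => hc (Sum.inr.inj e))]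
        simp only [rename_of]
        rfl
    · simp only [LieHom.comp_apply, subst_of_ne h]
      rw [subst_of_ne (by simp)]
      simp only [rename_of]
      rfl
  comp_par {I J K} _ _ _ i i' h x y z := Subtype.ext <| by
    change rename k _ (subst k (Sum.inl ⟨i', h⟩) z.1 (subst k i y.1 x.1)) =
      subst k (Sum.inl ⟨i, h.symm⟩) y.1 (subst k i' z.1 x.1)
    rw [← LieHom.comp_apply, ← LieHom.comp_apply, ← LieHom.comp_apply]
    congr 1
    ext a
    by_cases ha : a = i
    · subst ha
      simp only [LieHom.comp_apply, subst_of_self, subst_of_ne h.symm]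
      rw [subst_rename _ _ _ (by simp), rename_rename]
      rfl
    by_cases ha' : a = i'
    · subst ha'
      simp only [LieHom.comp_apply, subst_of_self, subst_of_ne h]
      rw [subst_rename _ _ _ (by simp), rename_rename]
      rfl
    · simp only [LieHom.comp_apply, subst_of_ne ha, subst_of_ne ha']
      rw [subst_of_ne (fun e => ha' (congrArg Subtype.val (Sum.inl.inj e))),
        subst_of_ne (fun e => ha (congrArg Subtype.val (Sum.inl.inj e)))]
      simp only [rename_of]
      rfl

section

variable {X Y : Type} [Finite X] [Finite Y]

theorem val_map (e : X ≃ Y) (x : (LieOp k).obj X) :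
    ((LieOp k).map e x).1 = rename k e x.1 := rfl

theorem val_brL (x : (LieOp k).obj X) :
    ((LieOp k).brL (bracket k) x).1 = ⁅of k (none : Option X), rename k some x.1⁆ := by
  change rename k _ (subst k (1 : Fin 2) x.1 ⁅of k (0 : Fin 2), of k (1 : Fin 2)⁆) = _
  rw [LieHom.map_lie, LieHom.map_lie, subst_of_self, subst_of_ne (by simp), rename_of,
    rename_rename]
  rfl

theorem val_bra (x : (LieOp k).obj X) (y : (LieOp k).obj Y) :
    ((LieOp k).bra (bracket k) x y).1 = ⁅rename k (Sum.inl : X → X ⊕ Y) x.1,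
      rename k (Sum.inr : Y → X ⊕ Y) y.1⁆ := by
  rw [bra_apply]
  change rename k _ (subst k none x.1 ((LieOp k).brL (bracket k) y).1) = _
  rw [val_brL, LieHom.map_lie, LieHom.map_lie, subst_of_self, subst_rename _ _ _ (by simp),
    rename_rename, rename_rename]
  rfl

theorem val_brR (i : X) (x : (LieOp k).obj X) :
    ((LieOp k).brR (bracket k) i x).1 = rename k (rightEquiv i)
      (subst k i ⁅of k (0 : Fin 2), of k (1 : Fin 2)⁆ x.1) := rfl

end

theorem isLieBracket (k : Type u) [Field k] : (LieOp k).IsLieBracket (bracket k) where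
  antisymm := Subtype.ext <| by
    change rename k (Equiv.swap (0 : Fin 2) 1) ⁅of k (0 : Fin 2), of k (1 : Fin 2)⁆ = -⁅of k (0 : Fin 2), of k (1 : Fin 2)⁆
    rw [LieHom.map_lie, lie_skew]
    simp
  jacobi := Subtype.ext <| by
    change _ = ((LieOp k).brR (bracket k) 0 (bracket k)).1 +
      ((LieOp k).brR (bracket k) 1 (bracket k)).1
    rw [val_brL, val_brR, val_brR]
    change ⁅of k (none : Option (Fin 2)), rename k some ⁅of k (0 : Fin 2), of k (1 : Fin 2)⁆⁆ = rename k _ (subst k 0 _ ⁅of k (0 : Fin 2), of k (1 : Fin 2)⁆) +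
      rename k _ (subst k 1 _ ⁅of k (0 : Fin 2), of k (1 : Fin 2)⁆)
    simp only [LieHom.map_lie, subst_of_self, rename_of, subst_of_ne (show (1 : Fin 2) ≠ 0 by simp),
      subst_of_ne (show (0 : Fin 2) ≠ 1 by simp), rightEquiv_inl, rightEquiv_inr_zero,
      rightEquiv_inr_one]
    rw [leibniz_lie]

/-- Multilinear Lie elements are generated by the unit under brackets, relabelling, and linear
combinations. -/
theorem induction {p : (X : Type) → [Finite X] → (LieOp k).obj X → Prop}
    (one : p Unit (LieOp k).one)
    (bra : ∀ {X Y : Type} [Finite X] [Finite Y] (x y), p X x → p Y y →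
      p (X ⊕ Y) ((LieOp k).bra (bracket k) x y))
    (map : ∀ {X Y : Type} [Finite X] [Finite Y] (e : X ≃ Y) (x), p X x → p Y ((LieOp k).map e x))
    (zero : ∀ {X : Type} [Finite X], p X 0)
    (add : ∀ {X : Type} [Finite X] (x y), p X x → p X y → p X (x + y))
    (smul : ∀ {X : Type} [Finite X] (c : k) (x), p X x → p X (c • x))
    {X : Type} [Finite X] (x : (LieOp k).obj X) : p X x := by
  -- A submonomial uses only some of the letters and so is not itself an operation on `X`. The
  -- induction therefore presents it as the image of an operation on another label set `Z` embedded
  -- onto its letters.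
  have key : ∀ (A : Set X) (x : FreeLieAlgebra k X), IsMonomial k A x →
      ∃ (Z : Type) (_ : Finite Z) (g : Z → X) (z : (LieOp k).obj Z), Function.Injective g ∧
        Set.range g = A ∧ rename k g z.1 = x ∧ p Z z := by
    intro A x hx
    induction hx with
    | of i =>
      refine ⟨Unit, inferInstance, fun _ => i, (LieOp k).one, ?_, by simp, ?_, one⟩
      · intro a b _; rfl
      · exact rename_of _ _
    | lie _ _ h ihx ihy =>
      obtain ⟨Z, _, g, z, hg, rfl, rfl, hz⟩ := ihx
      obtain ⟨Z', _, g', z', hg', rfl, rfl, hz'⟩ := ihy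
      refine ⟨Z ⊕ Z', inferInstance, Sum.elim g g', (LieOp k).bra (bracket k) z z', ?_,
        Set.Sum.elim_range g g', ?_, bra z z' hz hz'⟩
      · refine hg.sumElim hg' fun a b e => ?_
        exact Set.disjoint_left.1 h ⟨a, rfl⟩ ⟨b, e.symm⟩
      · rw [val_bra, LieHom.map_lie, rename_rename, rename_rename]
        rfl
  obtain ⟨x, hx⟩ := x
  change x ∈ multilinearLie k X at hx
  change p X (⟨x, hx⟩ : multilinearLie k X)
  induction hx using Submodule.span_induction with
  | mem x hx =>
    obtain ⟨Z, _, g, z, hg, hr, rfl, hz⟩ := key _ x hx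
    exact map (Equiv.ofBijective g ⟨hg, Set.range_eq_univ.1 hr⟩) z hz
  | zero => exact zero
  | add x y hx hy hx' hy' => exact add ⟨x, hx⟩ ⟨y, hy⟩ hx' hy'
  | smul c x hx hx' => exact smul c ⟨x, hx⟩ hx'

end LieOp

/-! ### The Lie algebra of operations on subsets of the labels -/

open Classical in
/-- The operations of `P` with inputs labelled by the subsets of `I`. -/
def LieSum {k : Type u} [Field k] (P : OperadData k) (_b : P.obj (Fin 2)) (I : Type) [Finite I] :
    Type u := DirectSum (Set I) fun A => P.obj A

namespace LieSum

open OperadData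

variable {k : Type u} [Field k] {P : OperadData k} {b : P.obj (Fin 2)} {I : Type} [Finite I]

noncomputable instance : AddCommGroup (LieSum P b I) :=
  inferInstanceAs (AddCommGroup (DirectSum (Set I) fun A => P.obj A))

noncomputable instance : Module k (LieSum P b I) :=
  inferInstanceAs (Module k (DirectSum (Set I) fun A => P.obj A))

open Classical in
variable (P b) in
/-- The operations with inputs labelled by `A`. -/
noncomputable def ofSet (A : Set I) : P.obj A →ₗ[k] LieSum P b I :=
  DirectSum.lof k (Set I) (fun A => P.obj A) A

open Classical in
variable (b) in
/-- Relabelling along `g`; the result is zero unless `g` is injective. -/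
noncomputable def incl {X : Type} [Finite X] (g : X → I) : P.obj X →ₗ[k] LieSum P b I :=
  if hg : Function.Injective g then ofSet P b (Set.range g) ∘ₗ P.map (Equiv.ofInjective g hg) else 0

open Classical in
/-- Linear maps out of the sum over all subsets. -/
noncomputable def desc {V : Type*} [AddCommGroup V] [Module k V] (F : (A : Set I) → P.obj A →ₗ[k] V) :
    LieSum P b I →ₗ[k] V :=
  DirectSum.toModule k (Set I) V F

theorem desc_ofSet {V : Type*} [AddCommGroup V] [Module k V] (F : (A : Set I) → P.obj A →ₗ[k] V)
    (A : Set I) (x : P.obj A) : desc F (ofSet P b A x) = F A x :=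
  DirectSum.toModule_lof _ _ _

theorem incl_of_not_injective {X : Type} [Finite X] {g : X → I} (hg : ¬ Function.Injective g)
    (x : P.obj X) : incl b g x = 0 := by
  rw [incl, dif_neg hg]; rfl

theorem incl_val_comp {X : Type} [Finite X] (A : Set I) (e : X ≃ A) (x : P.obj X) :
    incl b (Subtype.val ∘ e) x = ofSet P b A (P.map e x) := by
  have hg : Function.Injective (Subtype.val ∘ e : X → I) :=
    Subtype.val_injective.comp e.injective
  have hr : A = Set.range (Subtype.val ∘ e : X → I) := by simp
  rw [incl, dif_pos hg]
  -- The range of the embedding is equal to `A` only propositionally; a general set `B` allows the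
  -- equality to be eliminated.
  have key : ∀ (B : Set I) (h : A = B) (f : X ≃ B), (∀ x, (f x : I) = e x) →
      ofSet P b B (P.map f x) = ofSet P b A (P.map e x) := by
    rintro B rfl f hf
    rw [show f = e from Equiv.ext fun x => Subtype.ext (hf x)]
  exact key _ hr _ fun _ => rfl

theorem incl_val (A : Set I) (x : P.obj A) : incl b (Subtype.val : A → I) x = ofSet P b A x := by
  have := incl_val_comp (b := b) A (Equiv.refl _) x
  rwa [P.map_refl] at this

theorem incl_comp {X Y : Type} [Finite X] [Finite Y] (e : X ≃ Y) (g : Y → I) (x : P.obj X) :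
    incl b (g ∘ e) x = incl b g (P.map e x) := by
  by_cases hg : Function.Injective g
  · have := incl_val_comp (b := b) (Set.range g) (e.trans (Equiv.ofInjective g hg)) x
    rw [P.map_trans] at this
    rw [incl.eq_1 b g, dif_pos hg]
    exact this
  · rw [incl_of_not_injective hg, incl_of_not_injective]
    exact fun h => hg (by simpa using h.comp e.symm.injective)

protected theorem induction {p : LieSum P b I → Prop} (zero : p 0)
    (add : ∀ x y, p x → p y → p (x + y))
    (incl : ∀ {X : Type} [Finite X] (g : X → I) (x : P.obj X), p (incl b g x)) (x : LieSum P b I) :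
    p x := by
  classical
  refine DirectSum.induction_on (ι := Set I) (β := fun A => P.obj A) (motive := p) x zero ?_ add
  intro A x
  have := incl (X := A) Subtype.val x
  rwa [incl_val] at this

variable (P b I) in
/-- The bracket: on operations with inputs labelled by disjoint subsets it is `b(x, y)`. -/
noncomputable def br : LieSum P b I →ₗ[k] LieSum P b I →ₗ[k] LieSum P b I :=
  desc fun A => LinearMap.flip <| desc fun B => LinearMap.flip <|
    (P.bra b).compr₂ (incl b (Sum.elim (Subtype.val : A → I) (Subtype.val : B → I)))

theorem br_incl {X Y : Type} [Finite X] [Finite Y] (g : X → I) (h : Y → I) (x : P.obj X)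
    (y : P.obj Y) : br P b I (incl b g x) (incl b h y) = incl b (Sum.elim g h) (P.bra b x y) := by
  by_cases hg : Function.Injective g
  · by_cases hh : Function.Injective h
    · rw [incl.eq_1 b g, incl.eq_1 b h, dif_pos hg, dif_pos hh, br, LinearMap.comp_apply,
        LinearMap.comp_apply, desc_ofSet, LinearMap.flip_apply, desc_ofSet, LinearMap.flip_apply,
        LinearMap.compr₂_apply, bra_map_map, ← incl_comp]
      congr 2
      ext t
      rcases t with t | t <;> rfl
    · rw [incl_of_not_injective hh, map_zero, incl_of_not_injective]
      exact fun e => hh (e.comp Sum.inr_injective)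
  · rw [incl_of_not_injective hg, LinearMap.map_zero₂, incl_of_not_injective]
    exact fun e => hg (e.comp Sum.inl_injective)

open Classical in
/-- The component with inputs labelled by `I`. -/
noncomputable def top : LieSum P b I →ₗ[k] P.obj I :=
  desc fun A => if h : A = Set.univ then P.map ((Equiv.setCongr h).trans (Equiv.Set.univ I)) else 0

theorem top_incl {X : Type} [Finite X] (e : X ≃ I) (x : P.obj X) :
    top (incl b e x) = P.map e x := by
  have : incl b e x = ofSet P b Set.univ (P.map (e.trans (Equiv.Set.univ I).symm) x) := by
    rw [← incl_val_comp]
    rfl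
  rw [this, top, desc_ofSet, dif_pos rfl, ← P.map_trans]
  congr 1

theorem incl_id_injective {X : Type} [Finite X] :
    Function.Injective (incl (P := P) b (id : X → X)) := by
  intro x y h
  have := congrArg top h
  have e : ∀ x : P.obj X, top (incl b (id : X → X) x) = x := fun x =>
    (top_incl (Equiv.refl X) x).trans (P.map_refl x)
  rwa [e, e] at this

variable [hP : Fact P.IsOperad] [hb : Fact (P.IsLieBracket b)]

theorem br_swap (x y : LieSum P b I) : br P b I x y = - br P b I y x := by
  induction x using LieSum.induction with
  | zero => simp
  | add x x' h h' => simp only [map_add, LinearMap.add_apply, h, h', neg_add]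
  | incl g x =>
  induction y using LieSum.induction with
  | zero => simp
  | add y y' h h' => simp only [map_add, LinearMap.add_apply, h, h', neg_add]
  | incl h y =>
  rw [br_incl, br_incl, ← map_neg, ← hP.1.bra_swap hb.1 x y, ← incl_comp]
  congr 2
  ext t
  rcases t with t | t <;> rfl

theorem br_leibniz (x y z : LieSum P b I) : br P b I x (br P b I y z) =
    br P b I (br P b I x y) z + br P b I y (br P b I x z) := by
  induction x using LieSum.induction with
  | zero => simp
  | add x x' h h' => simp only [map_add, LinearMap.add_apply, h, h']; abel
  | incl g x =>
  induction y using LieSum.induction with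
  | zero => simp
  | add y y' h h' => simp only [map_add, LinearMap.add_apply, h, h']; abel
  | incl h y =>
  induction z using LieSum.induction with
  | zero => simp
  | add y y' h h' => simp only [map_add, h, h']; abel
  | incl l z =>
  simp only [br_incl]
  rw [hP.1.bra_bra hb.1, map_add, ← incl_comp, ← incl_comp]
  congr 3
  · ext t
    rcases t with (t | t) | t <;> rfl
  · ext t
    rcases t with t | t | t <;> rfl

variable [CharZero k]

noncomputable instance : LieRing (LieSum P b I) where
  bracket x y := br P b I x y
  add_lie x y z := by simp
  lie_add x y z := by simp
  -- Antisymmetry gives `2 [x, x] = 0`, and `2` is invertible.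
  lie_self x := by
    have h : br P b I x x = - br P b I x x := br_swap x x
    have h₂ : (2 : k) • br P b I x x = 0 := by
      rw [two_smul, add_eq_zero_iff_eq_neg]
      exact h
    exact (smul_eq_zero.1 h₂).resolve_left two_ne_zero
  leibniz_lie := br_leibniz

noncomputable instance : LieAlgebra k (LieSum P b I) where
  lie_smul c x y := by
    change br P b I x (c • y) = c • br P b I x y
    simp

theorem lie_incl {X Y : Type} [Finite X] [Finite Y] (g : X → I) (h : Y → I) (x : P.obj X)
    (y : P.obj Y) : ⁅incl b g x, incl b h y⁆ = incl b (Sum.elim g h) (P.bra b x y) := br_incl g h x y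

end LieSum

/-! ### The morphism from the Lie operad to an operad with a Lie bracket -/

namespace LieOp

open multilinearLie FreeLieAlgebra OperadData LieSum

section

variable {k : Type u} [Field k] [CharZero k] (P : OperadData k) (b : P.obj (Fin 2))
variable [hP : Fact P.IsOperad] [hb : Fact (P.IsLieBracket b)]

/-- The morphism from the free Lie algebra on `I` that sends `i` to the unit of `P`, labelled by
`i`. -/
noncomputable def toLieSum (I : Type) [Finite I] : FreeLieAlgebra k I →ₗ⁅k⁆ LieSum P b I :=
  lift k fun i => incl b (fun _ : Unit => i) P.one

/-- The morphism of operads that sends the bracket to `b`. -/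
noncomputable def toOperad (I : Type) [Finite I] : (LieOp k).obj I →ₗ[k] P.obj I :=
  top ∘ₗ (toLieSum P b I : FreeLieAlgebra k I →ₗ[k] LieSum P b I) ∘ₗ (multilinearLie k I).subtype

variable {P b}

/-- A multilinear element lands in the component of the full label set and is represented there by
`toOperad`. Renaming along a non-injective map gives zero on both sides, since brackets of
operations with overlapping labels vanish. The compatibilities of `toOperad` with relabelling and
brackets are read off from this. -/
theorem toLieSum_rename {X : Type} [Finite X] (x : (LieOp k).obj X) {I : Type} [Finite I]
    (f : X → I) : toLieSum P b I (rename k f x.1) = incl b f (toOperad P b X x) := by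
  have key : ∀ (A : Set X) (x : FreeLieAlgebra k X), IsMonomial k A x →
      ∃ (Z : Type) (_ : Finite Z) (g : Z → X) (z : P.obj Z), Function.Injective g ∧
        Set.range g = A ∧ ∀ {I : Type} [Finite I] (f : X → I),
          toLieSum P b I (rename k f x) = incl b (f ∘ g) z := by
    intro A x hx
    induction hx with
    | of i =>
      refine ⟨Unit, inferInstance, fun _ => i, P.one, fun a b _ => rfl, by simp, ?_⟩
      intro I _ f
      rw [rename_of, toLieSum, lift_of_apply]
      rfl
    | lie _ _ h ihx ihy =>
      obtain ⟨Z, _, g, z, hg, rfl, hz⟩ := ihx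
      obtain ⟨Z', _, g', z', hg', rfl, hz'⟩ := ihy
      refine ⟨Z ⊕ Z', inferInstance, Sum.elim g g', P.bra b z z', ?_,
        Set.Sum.elim_range g g', ?_⟩
      · refine hg.sumElim hg' fun a b e => ?_
        exact Set.disjoint_left.1 h ⟨a, rfl⟩ ⟨b, e.symm⟩
      · intro I _ f
        rw [LieHom.map_lie, LieHom.map_lie, hz, hz', lie_incl, Sum.comp_elim]
  obtain ⟨x, hx⟩ := x
  change x ∈ multilinearLie k X at hx
  change toLieSum P b I (rename k f x) = incl b f (top (toLieSum P b X x))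
  induction hx using Submodule.span_induction with
  | mem x hx =>
    obtain ⟨Z, _, g, z, hg, hr, hz⟩ := key _ x hx
    have h := hz (id : X → X)
    rw [rename_id] at h
    let e := Equiv.ofBijective g ⟨hg, Set.range_eq_univ.1 hr⟩
    have h' : top (incl b (id ∘ g) z) = P.map e z := top_incl e z
    rw [hz, h, h', ← incl_comp]
    rfl
  | zero => simp
  | add x y hx hy hx' hy' => simp only [map_add, hx', hy']
  | smul c x hx hx' => simp only [map_smul, hx']

theorem toOperad_eq {X : Type} [Finite X] {x : (LieOp k).obj X} {y : P.obj X}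
    (h : toLieSum P b X x.1 = incl b id y) : toOperad P b X x = y := by
  apply incl_id_injective (b := b)
  rw [← toLieSum_rename x id, rename_id, h]

theorem toOperad_map {X Y : Type} [Finite X] [Finite Y] (e : X ≃ Y) (x : (LieOp k).obj X) :
    toOperad P b Y ((LieOp k).map e x) = P.map e (toOperad P b X x) := by
  apply toOperad_eq
  rw [val_map, toLieSum_rename, ← incl_comp]
  rfl

theorem toOperad_one : toOperad P b Unit (LieOp k).one = P.one := by
  apply toOperad_eq
  change toLieSum P b Unit (of k ()) = _
  rw [toLieSum, lift_of_apply]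

theorem toOperad_bra {X Y : Type} [Finite X] [Finite Y] (x : (LieOp k).obj X)
    (y : (LieOp k).obj Y) : toOperad P b (X ⊕ Y) ((LieOp k).bra (bracket k) x y) =
      P.bra b (toOperad P b X x) (toOperad P b Y y) := by
  apply toOperad_eq
  rw [val_bra, LieHom.map_lie, toLieSum_rename, toLieSum_rename, lie_incl, Sum.elim_inl_inr]

theorem toOperad_bracket : toOperad P b (Fin 2) (bracket k) = b := by
  let e : Unit ⊕ Unit ≃ Fin 2 := ⟨Sum.elim (fun _ => 0) fun _ => 1, ![.inl (), .inr ()],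
    by decide, by decide⟩
  have h₁ := (isOperad k).map_bra_one_one (b := bracket k) e rfl rfl
  have h₂ := hP.1.map_bra_one_one (b := b) e rfl rfl
  conv_lhs => rw [← h₁]
  rw [toOperad_map, toOperad_bra, toOperad_one, h₂]

end

section

variable {k : Type u} [Field k] {P : OperadData k} {b : P.obj (Fin 2)}

/-- A family of linear maps compatible with relabelling, units and brackets is compatible with
compositions. -/
theorem map_comp_of_map_bra (hP : P.IsOperad)
    (φ : (X : Type) → [Finite X] → (LieOp k).obj X →ₗ[k] P.obj X)
    (map : ∀ {X Y : Type} [Finite X] [Finite Y] (e : X ≃ Y) (x : (LieOp k).obj X),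
      φ Y ((LieOp k).map e x) = P.map e (φ X x))
    (one : φ Unit (LieOp k).one = P.one)
    (bra : ∀ {X Y : Type} [Finite X] [Finite Y] (x : (LieOp k).obj X) (y : (LieOp k).obj Y),
      φ (X ⊕ Y) ((LieOp k).bra (bracket k) x y) = P.bra b (φ X x) (φ Y y))
    {X Y : Type} [Finite X] [Finite Y] (a : X) (x : (LieOp k).obj X) (y : (LieOp k).obj Y) :
    φ (Ins X a Y) ((LieOp k).comp a x y) = P.comp a (φ X x) (φ Y y) := by
  revert a
  -- Induction on the left argument. Each case expresses a composition through units, brackets and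
  -- relabellings by an identity valid in every operad; it is applied once in the Lie operad and
  -- once in `P`.
  refine LieOp.induction (p := fun X _ x => ∀ a : X,
    φ (Ins X a Y) ((LieOp k).comp a x y) = P.comp a (φ X x) (φ Y y)) ?_ ?_ ?_ ?_ ?_ ?_ x
  · rintro ⟨⟩
    have h : ∀ {Q : OperadData k} (hQ : Q.IsOperad) (z : Q.obj Y),
        Q.comp () Q.one z = Q.map (Ins.unitLeft Y).symm z := fun {Q} hQ z => by
      conv_rhs => rw [← hQ.one_comp z, ← Q.map_trans, Equiv.self_trans_symm, Q.map_refl]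
    rw [h (isOperad k), map, one, h hP]
  · rintro X X' _ _ x x' hx hx' (a | a)
    · let g : Ins (X ⊕ X') (.inl a) Y ≃ Ins X a Y ⊕ X' :=
        (Equiv.sumCongr (Ins.removeInl a) (Equiv.refl Y)).trans
          ((Equiv.sumAssoc _ _ _).trans ((Equiv.sumCongr (Equiv.refl _) (Equiv.sumComm _ _)).trans
            (Equiv.sumAssoc _ _ _).symm))
      have h : ∀ {Q : OperadData k} (hQ : Q.IsOperad) (c : Q.obj (Fin 2)) (x : Q.obj X)
          (x' : Q.obj X') (z : Q.obj Y),
          Q.comp (.inl a) (Q.bra c x x') z = Q.map g.symm (Q.bra c (Q.comp a x z) x') := by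
        intro Q hQ c x x' z
        rw [comp_eq_cmp, hQ.cmp_bra_left a x x' z (Equiv.refl _) g.symm]
        · intro c h; exact (Equiv.symm_apply_eq g).2 rfl |>.symm
        · intro c h; exact (Equiv.symm_apply_eq g).2 rfl |>.symm
        · intro c; exact (Equiv.symm_apply_eq g).2 rfl |>.symm
      rw [h (isOperad k), map, bra, hx, bra, h hP]
    · let g : Ins (X ⊕ X') (.inr a) Y ≃ X ⊕ Ins X' a Y :=
        (Equiv.sumCongr (Ins.removeInr a) (Equiv.refl Y)).trans (Equiv.sumAssoc _ _ _)
      have h : ∀ {Q : OperadData k} (hQ : Q.IsOperad) (c : Q.obj (Fin 2)) (x : Q.obj X)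
          (x' : Q.obj X') (z : Q.obj Y),
          Q.comp (.inr a) (Q.bra c x x') z = Q.map g.symm (Q.bra c x (Q.comp a x' z)) := by
        intro Q hQ c x x' z
        rw [comp_eq_cmp, hQ.cmp_bra_right a x x' z (Equiv.refl _) g.symm]
        · intro c h; exact (Equiv.symm_apply_eq g).2 rfl |>.symm
        · intro c h; exact (Equiv.symm_apply_eq g).2 rfl |>.symm
        · intro c; exact (Equiv.symm_apply_eq g).2 rfl |>.symm
      rw [h (isOperad k), map, bra, hx', bra, h hP]
  · intro X X' _ _ e x hx a
    obtain ⟨a, rfl⟩ := e.surjective a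
    have h : ∀ {Q : OperadData k} (x : Q.obj X), Q.comp (e a) (Q.map e x) =
        (Q.map (Ins.congr e (Equiv.refl Y) a)) ∘ₗ Q.comp a x := fun {Q} x => by
      ext z
      rw [LinearMap.comp_apply, Q.map_comp, Q.map_refl]
    rw [h, LinearMap.comp_apply, map, hx, map, h, LinearMap.comp_apply]
  · simp
  · intro X _ x x' h h' a
    simp only [map_add, LinearMap.add_apply, h, h']
  · intro X _ c x h a
    simp only [map_smul, LinearMap.smul_apply, h]

end

end LieOp

/-! ### Lie elements are cycles -/

namespace OperadData

variable {k : Type u} [Field k] {P : OperadData k} {b : P.obj (Fin 2)}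

theorem IsOperad.delta_one (hP : P.IsOperad) : P.delta b 1 P.one = 0 := by
  let f : Fin 2 ≃ Option Unit := ⟨![none, some ()], fun t => t.elim 0 fun _ => 1,
    by decide, by decide⟩
  have h₁ : P.brL b P.one = P.map f b := by
    have := hP.cmp_one (P := P) 1 (leftEquiv Unit) f ?_ ?_ (Equiv.refl Unit) b
    · rwa [P.map_refl] at this
    · rintro ⟨a, ha⟩
      obtain rfl : a = 0 := by omega
      rfl
    · intro u
      rfl
  have h₂ : P.brR b () P.one = P.map f b := by
    have := hP.one_cmp (P := P) () (rightEquiv ()) f ?_ (Equiv.refl Unit) b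
    · rwa [P.map_refl] at this
    · intro a
      fin_cases a <;> rfl
  simp [delta_apply, h₁, h₂]

/-- The kernel of the derivation `δ` is closed under composition, and it contains `b` because `δ b =
0` is the Jacobi identity. -/
theorem IsOperad.delta_bra (hP : P.IsOperad) (hb : P.IsLieBracket b) {X Y : Type} [Fintype X]
    [Fintype Y] {x : P.obj X} {y : P.obj Y} (hx : P.delta b 1 x = 0) (hy : P.delta b 1 y = 0) :
    P.delta b 1 (P.bra b x y) = 0 := by
  classical
  have hb' : P.delta b 1 b = 0 := by
    simp [delta_apply, hb.jacobi]
  have hL : P.delta b 1 (P.brL b y) = 0 := by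
    rw [brL, OperadData.cmp, LinearMap.compr₂_apply, map_delta, hP.delta_comp _ _ 1 1 rfl (fun _ => rfl)
      (fun _ => rfl), hb', hy]
    simp
  rw [bra_apply, OperadData.cmp, LinearMap.compr₂_apply, map_delta, hP.delta_comp _ _ 1 1 rfl (fun _ => rfl)
      (fun _ => rfl), hL, hx]
  simp

end OperadData

namespace LieOp

open OperadData

variable {k : Type u} [Field k] [CharZero k] {P : OperadData k} {b : P.obj (Fin 2)}
variable [hP : Fact P.IsOperad] [hb : Fact (P.IsLieBracket b)]

theorem delta_toOperad {X : Type} [Fintype X] (x : (LieOp k).obj X) :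
    P.delta b 1 (toOperad P b X x) = 0 := by
  have key : ∀ [Fintype X], P.delta b 1 (toOperad P b X x) = 0 := by
    refine LieOp.induction (p := fun X _ x => ∀ [Fintype X], P.delta b 1 (toOperad P b X x) = 0)
      ?_ ?_ ?_ ?_ ?_ ?_ x
    · intro _
      rw [toOperad_one, ← hP.1.delta_one]
      congr!
    · intro X Y _ _ x y hx hy _
      have := Fintype.ofFinite X
      have := Fintype.ofFinite Y
      rw [toOperad_bra, ← hP.1.delta_bra hb.1 hx hy]
      congr!
    · intro X Y _ _ e x hx _
      have := Fintype.ofFinite X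
      rw [toOperad_map, map_delta, show (1 : Y → k) ∘ e = 1 from rfl, hx, map_zero]
    · intro X _ _
      simp
    · intro X _ x y hx hy _
      simp [hx, hy]
    · intro X _ c x hx _
      simp [hx]
  exact key

end LieOp

/-! ### The morphism of dg operads -/

namespace Tw

open OperadData

variable {k : Type u} [Field k] {P : OperadData k} {b : P.obj (Fin 2)}

theorem map_incl {I J : Type} [Finite I] [Finite J] (e : I ≃ J) (x : P.obj I) :
    map P e (incl P b I x) = incl P b J (P.map e x) := by
  change map P e (cls P 0 (P.map (Equiv.sumEmpty I (Fin 0)).symm x)) =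
    cls P 0 (P.map (Equiv.sumEmpty J (Fin 0)).symm (P.map e x))
  rw [map_cls, ← P.map_trans, ← P.map_trans]
  exact congrArg (fun g => cls P 0 (P.map g x)) (Equiv.ext fun _ => rfl)

theorem comp_incl {I J : Type} [Finite I] [Finite J] (i : I) (x : P.obj I) (y : P.obj J) :
    comp P i (incl P b I x) (incl P b J y) = incl P b (Ins I i J) (P.comp i x y) := by
  have h := comp_cls_eq (P := P) i 0 0 (P.map (Equiv.sumEmpty I (Fin 0)).symm x)
    (P.map (Equiv.sumEmpty J (Fin 0)).symm y)
  refine h.trans ?_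
  have h' := cmp_map_map (P := P) (Equiv.sumEmpty I (Fin 0)).symm (Equiv.sumEmpty J (Fin 0)).symm
    (x := i) (x' := .inl i) rfl (compEquiv J i 0 0) (Equiv.sumEmpty _ (Fin 0)).symm
    (fun a ha => rfl) (fun a => rfl) x y
  exact congrArg (cls P 0) h'

theorem diff_incl {I : Type} [Fintype I] (x : P.obj I) :
    diff P b (incl P b I x) = cls P 1 (P.map (optE I 0) (P.map (Equiv.optionCongr
      (Equiv.sumEmpty I (Fin 0)).symm) (P.delta b 1 x))) := by
  refine (d_cls_eq_delta 0 _).trans ?_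
  rw [map_delta]
  rfl

/-- The morphism `(Lie, 0) → Tw(P)` that sends the bracket to `b`. -/
noncomputable def lieHom (P : OperadData k) (b : P.obj (Fin 2)) [CharZero k]
    [hP : Fact P.IsOperad] [hb : Fact (P.IsLieBracket b)] :
    DGOperadData.Hom (LieOp k).toDG (Tw P b) where
  app I _ := incl P b I ∘ₗ LieOp.toOperad P b I
  app_mem I _ n x hx := by
    rcases mem_toDG_gr.1 hx with rfl | hx
    · exact cls_mem_gr 0 _
    · have : (incl P b I ∘ₗ LieOp.toOperad P b I) x = 0 :=
        (congrArg (incl P b I ∘ₗ LieOp.toOperad P b I) hx).trans (map_zero _)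
      exact this ▸ zero_mem ((Tw P b).gr I n)
  app_map e x := (congrArg (incl P b _) (LieOp.toOperad_map e x)).trans (map_incl e _).symm
  app_one := congrArg (incl P b _) LieOp.toOperad_one
  app_comp i x y := (congrArg (incl P b _) (LieOp.map_comp_of_map_bra hP.1 (LieOp.toOperad P b)
    LieOp.toOperad_map LieOp.toOperad_one LieOp.toOperad_bra i x y)).trans (comp_incl i _ _).symm
  app_d {I} _ x := by
    have := Fintype.ofFinite I
    refine Eq.trans (map_zero (incl P b I ∘ₗ LieOp.toOperad P b I)) ?_
    refine Eq.trans ?_ (diff_incl (LieOp.toOperad P b I x)).symm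
    have h := congrArg (fun t => cls P 1 (P.map (optE I 0) (P.map (Equiv.optionCongr
      (Equiv.sumEmpty I (Fin 0)).symm) t))) (LieOp.delta_toOperad (P := P) (b := b) (X := I) x)
    refine Eq.trans ?_ h.symm
    simp only [map_zero]
    rfl

theorem lieHom_bracket (P : OperadData k) (b : P.obj (Fin 2)) [CharZero k]
    [hP : Fact P.IsOperad] [hb : Fact (P.IsLieBracket b)] :
    (lieHom P b).app (Fin 2) (LieOp.bracket k) = incl P b (Fin 2) b :=
  congrArg (incl P b _) LieOp.toOperad_bracket

end Tw

/-! ### Uniqueness of the morphism -/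

namespace LieOp

open OperadData

variable {k : Type u} [Field k]

/-- The bracket of two operations is an iterated composition with the generator, so a morphism is
determined along `LieOp.induction`. -/
theorem hom_ext {Q : DGOperadData k} {φ ψ : DGOperadData.Hom (LieOp k).toDG Q}
    (h : φ.app (Fin 2) (bracket k) = ψ.app (Fin 2) (bracket k)) : φ = ψ := by
  have key : ∀ {X : Type} [Finite X] (x : (LieOp k).obj X), φ.app X x = ψ.app X x := by
    intro X _ x
    refine LieOp.induction (p := fun X _ x => φ.app X x = ψ.app X x) ?_ ?_ ?_ ?_ ?_ ?_ x
    · exact φ.app_one.trans ψ.app_one.symm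
    · intro X Y _ _ x y hx hy
      have hc : ∀ χ : DGOperadData.Hom (LieOp k).toDG Q,
          χ.app (X ⊕ Y) ((LieOp k).bra (bracket k) x y) =
          Q.map (plugEquiv X Y) (Q.comp none (Q.map (leftEquiv Y) (Q.comp 1
            (χ.app (Fin 2) (bracket k)) (χ.app Y y))) (χ.app X x)) := by
        intro χ
        have h₁ : χ.app (Option Y) ((LieOp k).brL (bracket k) y) = Q.map (leftEquiv Y)
            (Q.comp 1 (χ.app (Fin 2) (bracket k)) (χ.app Y y)) :=
          (χ.app_map (leftEquiv Y) _).trans (congrArg _ (χ.app_comp 1 _ _))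
        rw [← h₁]
        exact (χ.app_map (plugEquiv X Y) _).trans (congrArg _ (χ.app_comp none _ _))
      rw [hc, hc, h, hx, hy]
    · intro X Y _ _ e x hx
      exact (φ.app_map e x).trans ((congrArg (Q.map e) hx).trans (ψ.app_map e x).symm)
    · intro X _
      exact (map_zero (φ.app X)).trans (map_zero (ψ.app X)).symm
    · intro X _ x y hx hy
      exact (map_add (φ.app X) x y).trans ((congrArg₂ _ hx hy).trans (map_add (ψ.app X) x y).symm)
    · intro X _ c x hx
      exact (map_smul (φ.app X) c x).trans
        ((congrArg (c • ·) hx).trans (map_smul (ψ.app X) c x).symm)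
  refine DGOperadData.Hom.ext ?_
  funext X _
  exact LinearMap.ext key

end LieOp

/-! ### Parent functions and contraction of edges -/

/-- A parent function is that of a rooted tree. -/
def IsTree {V : Type} (f : V → Option V) : Prop :=
  (∃! r, f r = none) ∧ ∃ d : V → ℕ, ∀ x y, f x = some y → d y < d x

/-- The depth of a vertex, defined by well-founded recursion, decreases along the parent map. Depth
functions are easy to transport through contractions and attachments of vertices. -/
theorem RT.isTree {V : Type} (T : RT V) : IsTree T.parent := by
  refine ⟨T.existsUnique_root, ?_⟩
  let F : (b : V) → ((a : V) → T.parent b = some a → ℕ) → ℕ := fun b ih =>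
    match h : T.parent b with
    | none => 0
    | some a => ih a h + 1
  refine ⟨T.wf.fix F, fun x y h => ?_⟩
  rw [T.wf.fix_eq F x]
  have : F x (fun y _ => T.wf.fix F y) = T.wf.fix F y + 1 := by
    simp only [F]
    split
    · next h' => simp [h] at h'
    · next a h' =>
      rw [h] at h'
      cases h'
      rfl
  omega

theorem IsTree.exists_rt {V : Type} {f : V → Option V} (hf : IsTree f) :
    ∃ T : RT V, T.parent = f := by
  obtain ⟨h, d, hd⟩ := hf
  exact ⟨⟨f, h, (InvImage.wf d wellFounded_lt).mono fun a b hab => hd b a hab⟩, rfl⟩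

theorem IsTree.ne_self {V : Type} {f : V → Option V} (hf : IsTree f) (x : V) : f x ≠ some x := by
  obtain ⟨h, d, hd⟩ := hf
  exact fun e => lt_irrefl _ (hd x x e)

theorem IsTree.not_two_cycle {V : Type} {f : V → Option V} (hf : IsTree f) {x y : V}
    (h : f x = some y) : f y ≠ some x := by
  obtain ⟨_, d, hd⟩ := hf
  exact fun e => lt_asymm (hd x y h) (hd y x e)

namespace ParentFun

/-- Relabelling of a parent function. -/
def map {V W : Type} (e : V ≃ W) (f : V → Option V) : W → Option W := fun y => (f (e.symm y)).map e

@[simp] theorem map_apply {V W : Type} (e : V ≃ W) (f : V → Option V) (x : V) :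
    map e f (e x) = (f x).map e := by
  simp [map]

theorem map_map {V W Z : Type} (e : V ≃ W) (e' : W ≃ Z) (f : V → Option V) :
    map e' (map e f) = map (e.trans e') f := by
  funext y
  simp [map]

theorem map_refl {V : Type} (f : V → Option V) : map (Equiv.refl V) f = f := by
  funext y
  simp [map]

theorem isTree_map {V W : Type} (e : V ≃ W) {f : V → Option V} (hf : IsTree f) :
    IsTree (map e f) := by
  obtain ⟨T, rfl⟩ := hf.exists_rt
  exact (T.map e).isTree

open Classical in
/-- The contraction of the edge between `none` and `x`; the resulting vertex is labelled by `x`. -/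
noncomputable def ctr {X : Type} (x : X) (U : Option X → Option (Option X)) : X → Option X := fun y =>
  (if y = x ∧ U (some x) = some none then U none else U (some y)).map (·.getD x)

theorem ctr_of_ne {X : Type} {x y : X} (h : y ≠ x) (U : Option X → Option (Option X)) :
    ctr x U y = (U (some y)).map (·.getD x) := by
  simp [ctr, h]

theorem ctr_self_of_child {X : Type} {x : X} {U : Option X → Option (Option X)}
    (h : U (some x) = some none) : ctr x U x = (U none).map (·.getD x) := by
  simp [ctr, h]

theorem ctr_self_of_ne {X : Type} {x : X} {U : Option X → Option (Option X)}
    (h : U (some x) ≠ some none) : ctr x U x = (U (some x)).map (·.getD x) := by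
  simp [ctr, h]

theorem map_ctr {X Y : Type} (e : X ≃ Y) (x : X) (U : Option X → Option (Option X)) :
    map e (ctr x U) = ctr (e x) (map (Equiv.optionCongr e) U) := by
  have hs : ∀ z, map (Equiv.optionCongr e) U (some (e z)) =
      (U (some z)).map (Equiv.optionCongr e) := fun z => map_apply (Equiv.optionCongr e) U (some z)
  have hn : map (Equiv.optionCongr e) U none = (U none).map (Equiv.optionCongr e) :=
    map_apply (Equiv.optionCongr e) U none
  have hg : ∀ o : Option (Option X), (o.map (·.getD x)).map e =
      (o.map (Equiv.optionCongr e)).map (·.getD (e x)) := by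
    rintro (_ | _ | o) <;> rfl
  have hc : (U (some x)).map (Equiv.optionCongr e) = some none ↔ U (some x) = some none := by
    rcases U (some x) with _ | _ | o <;> simp
  funext y
  obtain ⟨y, rfl⟩ := e.surjective y
  rw [map_apply]
  by_cases hy : y = x
  · subst hy
    by_cases h : U (some y) = some none
    · rw [ctr_self_of_child h, ctr_self_of_child (by rw [hs, hc, h]), hn, hg]
    · rw [ctr_self_of_ne h, ctr_self_of_ne (by rwa [hs, Ne, hc]), hs, hg]
  · rw [ctr_of_ne hy, ctr_of_ne (fun h => hy (e.injective h)), hs, hg]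

/-- Without adjacency the merged vertex could create a cycle. The merged vertex gets the depth of
the upper end of the contracted edge, and any other vertex keeps its own. -/
theorem isTree_ctr {X : Type} {x : X} {U : Option X → Option (Option X)} (hU : IsTree U)
    (h : U (some x) = some none ∨ U none = some (some x)) : IsTree (ctr x U) := by
  classical
  obtain ⟨⟨r, hr, hru⟩, d, hd⟩ := id hU
  have hru : ∀ y, U y = none → y = r := hru
  rcases h with h | h
  · refine ⟨?_, fun y => if y = x then d none else d (some y), ?_⟩
    · rcases r with _ | r
      · refine ⟨x, by simp [ctr_self_of_child h, hr], fun y (hy : ctr x U y = none) => ?_⟩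
        by_contra hyx
        rw [ctr_of_ne hyx, Option.map_eq_none_iff] at hy
        exact absurd (hru _ hy) (by simp)
      · have hrx : r ≠ x := by rintro rfl; simp [h] at hr
        refine ⟨r, by simp [ctr_of_ne hrx, hr], fun y (hy : ctr x U y = none) => ?_⟩
        by_cases hyx : y = x
        · subst hyx
          rw [ctr_self_of_child h, Option.map_eq_none_iff] at hy
          exact absurd (hru _ hy) (by simp)
        · rw [ctr_of_ne hyx, Option.map_eq_none_iff] at hy
          simpa using hru _ hy
    · intro y z hyz
      by_cases hyx : y = x
      · subst hyx
        rw [ctr_self_of_child h] at hyz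
        obtain ⟨o, ho, rfl⟩ := Option.map_eq_some_iff.1 hyz
        have h₁ := hd _ _ ho
        rcases o with _ | o
        · exact absurd h₁ (lt_irrefl _)
        · have : o ≠ y := by rintro rfl; exact hU.not_two_cycle h ho
          simpa [this] using h₁
      · rw [ctr_of_ne hyx] at hyz
        obtain ⟨o, ho, rfl⟩ := Option.map_eq_some_iff.1 hyz
        have h₁ := hd _ _ ho
        rcases o with _ | o
        · simpa [hyx] using h₁
        · by_cases hox : o = x
          · subst hox
            have := hd _ _ h
            simp only [hyx, if_false, Option.getD_some, if_true]
            omega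
          · simpa [hyx, hox] using h₁
  · have hx : U (some x) ≠ some none := hU.not_two_cycle h
    have hc : ∀ y, ctr x U y = (U (some y)).map (·.getD x) := fun y => by
      by_cases hy : y = x
      · subst hy; exact ctr_self_of_ne hx
      · exact ctr_of_ne hy U
    refine ⟨?_, fun y => d (some y), ?_⟩
    · rcases r with _ | r
      · simp [h] at hr
      · refine ⟨r, by simp [hc, hr], fun y (hy : ctr x U y = none) => ?_⟩
        rw [hc, Option.map_eq_none_iff] at hy
        simpa using hru _ hy
    · intro y z hyz
      rw [hc] at hyz
      obtain ⟨o, ho, rfl⟩ := Option.map_eq_some_iff.1 hyz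
      have h₁ := hd _ _ ho
      rcases o with _ | o
      · exact (hd _ _ h).trans h₁
      · exact h₁

/-- The vertex `none` is the root, and `x` is its only child. -/
def OnlyChild {X : Type} (x : X) (U : Option X → Option (Option X)) : Prop :=
  U none = none ∧ U (some x) = some none ∧ ∀ y, U (some y) = some none → y = x

/-- The vertex `none` is a leaf. -/
def Leaf {X : Type} (U : Option X → Option (Option X)) : Prop := ∀ y, U (some y) ≠ some none

end ParentFun

/-! ### Coefficients of brackets of trees; the Jacobi identity -/

namespace PL

open RT ParentFun OperadData

variable {k : Type u} [Field k]

open Classical in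
/-- The coefficient of the tree with the given parent function, if there is one. -/
noncomputable def ev {X : Type} [Finite X] (f : X → Option X) : (PL k).obj X →ₗ[k] k :=
  if h : ∃ T : RT X, T.parent = f then coeff h.choose else 0

theorem ev_parent {X : Type} [Finite X] (T : RT X) : ev (k := k) T.parent = coeff T := by
  have h : ∃ T' : RT X, T'.parent = T.parent := ⟨T, rfl⟩
  rw [ev, dif_pos h, show h.choose = T from RT.ext h.choose_spec]

theorem ev_of_not_isTree {X : Type} [Finite X] {f : X → Option X} (hf : ¬ IsTree f) :
    ev (k := k) f = 0 := by
  rw [ev, dif_neg]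
  rintro ⟨T, rfl⟩
  exact hf T.isTree

open Classical in
theorem ev_tree {X : Type} [Finite X] (f : X → Option X) (T : RT X) :
    ev f (tree T : (PL k).obj X) = if T.parent = f then 1 else 0 := by
  by_cases hf : IsTree f
  · obtain ⟨S, rfl⟩ := hf.exists_rt
    rw [ev_parent, coeff_tree]
    congr 1
    exact propext ⟨fun h => by rw [h], RT.ext⟩
  · rw [ev_of_not_isTree hf, LinearMap.zero_apply, if_neg]
    rintro rfl
    exact hf T.isTree

theorem ev_map {X Y : Type} [Finite X] [Finite Y] (e : X ≃ Y) (f : X → Option X)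
    (μ : (PL k).obj X) : ev (ParentFun.map e f) ((PL k).map e μ) = ev f μ := by
  by_cases hf : IsTree f
  · obtain ⟨S, rfl⟩ := hf.exists_rt
    rw [ev_parent, ← coeff_map e, ← ev_parent]
    rfl
  · rw [ev_of_not_isTree hf, ev_of_not_isTree]
    · rfl
    · intro h
      have := isTree_map e.symm h
      rw [map_map, Equiv.self_trans_symm, ParentFun.map_refl] at this
      exact hf this

theorem map_symm_parent {X Y : Type} (e : X ≃ Y) (U : RT Y) (a : X) :
    (U.map e.symm).parent a = (U.parent (e a)).map e.symm := by
  rw [← RT.map_parent e.symm]; simp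

theorem proj_rightEquiv_symm {X : Type} (x : X) (o : Option X) :
    RT.proj x ((rightEquiv x).symm o) = o.getD x := by
  obtain ⟨t, rfl⟩ := (rightEquiv x).surjective o
  rw [Equiv.symm_apply_apply]
  rcases t with t | t
  · rfl
  · fin_cases t <;> rfl

section

variable {X : Type}

/-- Inserting a tree with two vertices splits `x` into an edge and distributes its children over the
two ends; contracting that edge is the inverse operation. -/
theorem isGraft_rightEquiv_zero (x : X) (T : RT X) (U : RT (Option X)) :
    IsGraft x T (edge 0) (U.map (rightEquiv x).symm) ↔
      U.parent (some x) = some none ∧ T.parent = ctr x U.parent := by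
  have hp : ∀ t, ((U.map (rightEquiv x).symm).parent t).map (RT.proj x) =
      (U.parent (rightEquiv x t)).map (·.getD x) := fun t => by
    rw [map_symm_parent, Option.map_map]
    congr 1
    funext o
    exact proj_rightEquiv_symm x o
  have hc : (U.map (rightEquiv x).symm).parent (.inr 1) = some (.inr 0) ↔
      U.parent (some x) = some none := by
    rw [map_symm_parent, rightEquiv_inr_one, Option.map_eq_some_iff]
    simp only [Equiv.symm_apply_eq, rightEquiv_inr_zero, exists_eq_right]
  constructor
  · intro h
    have h₁ := hc.1 (h.inr_some (j := 1) (j' := 0) rfl)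
    refine ⟨h₁, funext fun y => ?_⟩
    by_cases hy : y = x
    · subst hy
      rw [ctr_self_of_child h₁, ← h.inr_none (j := 0) rfl, hp]; rfl
    · rw [ctr_of_ne hy, ← h.inl ⟨y, hy⟩, hp]; rfl
  · rintro ⟨h₁, h⟩
    refine ⟨?_, ?_, ?_⟩
    · rintro ⟨y, hy⟩
      rw [h, ctr_of_ne hy, hp]; rfl
    · intro j j' hj
      fin_cases j
      · simp [edge] at hj
      · obtain rfl : 0 = j' := by simpa [edge] using hj
        exact hc.2 h₁
    · intro j hj
      fin_cases j
      · rw [h, ctr_self_of_child h₁, hp]; rfl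
      · simp [edge] at hj

theorem isGraft_rightEquiv_one (x : X) (T : RT X) (U : RT (Option X)) :
    IsGraft x T (edge 1) (U.map (rightEquiv x).symm) ↔
      U.parent none = some (some x) ∧ T.parent = ctr x U.parent := by
  have hp : ∀ t, ((U.map (rightEquiv x).symm).parent t).map (RT.proj x) =
      (U.parent (rightEquiv x t)).map (·.getD x) := fun t => by
    rw [map_symm_parent, Option.map_map]
    congr 1
    funext o
    exact proj_rightEquiv_symm x o
  have hc : (U.map (rightEquiv x).symm).parent (.inr 0) = some (.inr 1) ↔
      U.parent none = some (some x) := by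
    rw [map_symm_parent, rightEquiv_inr_zero, Option.map_eq_some_iff]
    simp only [Equiv.symm_apply_eq, rightEquiv_inr_one, exists_eq_right]
  constructor
  · intro h
    have h₁ := hc.1 (h.inr_some (j := 0) (j' := 1) rfl)
    refine ⟨h₁, funext fun y => ?_⟩
    by_cases hy : y = x
    · subst hy
      rw [ctr_self_of_ne (U.isTree.not_two_cycle h₁), ← h.inr_none (j := 1) rfl, hp]; rfl
    · rw [ctr_of_ne hy, ← h.inl ⟨y, hy⟩, hp]; rfl
  · rintro ⟨h₁, h⟩
    refine ⟨?_, ?_, ?_⟩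
    · rintro ⟨y, hy⟩
      rw [h, ctr_of_ne hy, hp]; rfl
    · intro j j' hj
      fin_cases j
      · obtain rfl : 1 = j' := by simpa [edge] using hj
        exact hc.2 h₁
      · simp [edge] at hj
    · intro j hj
      fin_cases j
      · simp [edge] at hj
      · rw [h, ctr_self_of_ne (U.isTree.not_two_cycle h₁), hp]; rfl

open Classical in
theorem coeff_cmp_edge_zero [Finite X] (x : X) (U : RT (Option X)) (μ : (PL k).obj X) :
    coeff U ((PL k).cmp x (rightEquiv x) μ (tree (edge 0))) =
      (if U.parent (some x) = some none then 1 else 0) * ev (ctr x U.parent) μ := by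
  have : (coeff U ∘ₗ ((PL k).cmp x (rightEquiv x)).flip (tree (edge 0)) : (PL k).obj X →ₗ[k] k) =
      (if U.parent (some x) = some none then (1 : k) else 0) • ev (ctr x U.parent) := by
    refine hom_ext fun T => ?_
    rw [LinearMap.comp_apply, LinearMap.flip_apply, OperadData.cmp, LinearMap.compr₂_apply,
      coeff_map_symm, coeff_comp_tree, LinearMap.smul_apply, ev_tree, smul_eq_mul]
    simp only [isGraft_rightEquiv_zero, ite_and]
    split_ifs <;> simp
  exact DFunLike.congr_fun this μ

open Classical in
theorem coeff_cmp_edge_one [Finite X] (x : X) (U : RT (Option X)) (μ : (PL k).obj X) :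
    coeff U ((PL k).cmp x (rightEquiv x) μ (tree (edge 1))) =
      (if U.parent none = some (some x) then 1 else 0) * ev (ctr x U.parent) μ := by
  have : (coeff U ∘ₗ ((PL k).cmp x (rightEquiv x)).flip (tree (edge 1)) : (PL k).obj X →ₗ[k] k) =
      (if U.parent none = some (some x) then (1 : k) else 0) • ev (ctr x U.parent) := by
    refine hom_ext fun T => ?_
    rw [LinearMap.comp_apply, LinearMap.flip_apply, OperadData.cmp, LinearMap.compr₂_apply,
      coeff_map_symm, coeff_comp_tree, LinearMap.smul_apply, ev_tree, smul_eq_mul]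
    simp only [isGraft_rightEquiv_one, ite_and]
    split_ifs <;> simp
  exact DFunLike.congr_fun this μ

theorem bracket_eq : PL.bracket k = tree (edge 0) - tree (edge 1) := rfl

open Classical in
theorem coeff_brR [Finite X] (x : X) (U : RT (Option X)) (μ : (PL k).obj X) :
    coeff U ((PL k).brR (PL.bracket k) x μ) =
      ((if U.parent (some x) = some none then 1 else 0) -
        (if U.parent none = some (some x) then 1 else 0)) * ev (ctr x U.parent) μ := by
  rw [brR, LinearMap.flip_apply, bracket_eq, map_sub, map_sub, coeff_cmp_edge_zero,
    coeff_cmp_edge_one, sub_mul]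

theorem proj_leftEquiv_symm (o : Option X) :
    RT.proj 1 ((leftEquiv X).symm o) = o.elim 0 fun _ => 1 := by
  obtain ⟨t, rfl⟩ := (leftEquiv X).surjective o
  rw [Equiv.symm_apply_apply]
  rcases t with ⟨t, ht⟩ | t
  · obtain rfl : t = 0 := by omega
    rfl
  · rfl

/-- Placing `T` under the new root `none` is undone by contracting the only edge at the root. This
presents it as a contraction too, so that it can be added to the other terms of the differential. -/
theorem isGraft_leftEquiv_zero (T : RT X) (U : RT (Option X)) :
    IsGraft 1 (edge 0) T (U.map (leftEquiv X).symm) ↔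
      ∃ x, OnlyChild x U.parent ∧ T.parent = ctr x U.parent := by
  have hp : ∀ t, ((U.map (leftEquiv X).symm).parent t).map (RT.proj 1) =
      (U.parent (leftEquiv X t)).map (fun o => o.elim 0 fun _ => 1) := fun t => by
    rw [map_symm_parent, Option.map_map]
    congr 1
    funext o
    exact proj_leftEquiv_symm o
  have hr : ∀ j j', (U.map (leftEquiv X).symm).parent (.inr j) = some (.inr j') ↔
      U.parent (some j) = some (some j') := fun j j' => by
    rw [map_symm_parent, leftEquiv_inr, Option.map_eq_some_iff]
    simp only [Equiv.symm_apply_eq, leftEquiv_inr, exists_eq_right]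
  have hm : ∀ o : Option (Option X), o.map (fun o => o.elim (0 : Fin 2) fun _ => 1) = some 0 ↔
      o = some none := by
    rintro (_ | _ | o) <;> simp
  constructor
  · intro h
    obtain ⟨x, hx, hxu⟩ := T.existsUnique_root
    have h₀ : U.parent none = none := by
      have := h.inl ⟨0, by simp⟩
      rw [hp] at this
      simpa [edge] using this
    have h₁ : ∀ y, T.parent y = none → U.parent (some y) = some none := fun y hy => by
      have := h.inr_none hy
      rw [hp] at this
      exact (hm _).1 (by simpa [edge] using this)
    have h₂ : ∀ y z, T.parent y = some z → U.parent (some y) = some (some z) := fun y z hy =>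
      (hr y z).1 (h.inr_some hy)
    refine ⟨x, ⟨h₀, h₁ x hx, fun y hy => hxu y ?_⟩, funext fun y => ?_⟩
    · rcases hy' : T.parent y with _ | z
      · exact hy'
      · rw [h₂ y z hy'] at hy
        simp at hy
    · by_cases hyx : y = x
      · subst hyx
        rw [ctr_self_of_child (h₁ y hx), h₀, hx]; rfl
      · rw [ctr_of_ne hyx]
        rcases hy' : T.parent y with _ | z
        · exact absurd (hxu y hy') hyx
        · rw [h₂ y z hy']; rfl
  · rintro ⟨x, ⟨h₀, h₁, h₂⟩, h⟩
    have hx : T.parent x = none := by rw [h, ctr_self_of_child h₁, h₀]; rfl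
    have hy : ∀ y, y ≠ x → ∃ z, U.parent (some y) = some (some z) ∧ T.parent y = some z := by
      intro y hyx
      rcases hy : U.parent (some y) with _ | _ | z
      · exact absurd (U.existsUnique_root.unique hy h₀) (by simp)
      · exact absurd (h₂ y hy) hyx
      · exact ⟨z, rfl, by rw [h, ctr_of_ne hyx, hy]; rfl⟩
    refine ⟨?_, ?_, ?_⟩
    · rintro ⟨a, ha⟩
      obtain rfl : a = 0 := by omega
      rw [hp, leftEquiv_inl, h₀]
      rfl
    · intro j j' hj
      rw [hr]
      by_cases hjx : j = x
      · subst hjx; simp [hx] at hj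
      · obtain ⟨z, hz, hz'⟩ := hy j hjx
        rw [hz, ← hz', hj]
    · intro j hj
      by_cases hjx : j = x
      · subst hjx
        rw [hp, leftEquiv_inr, h₁]
        rfl
      · obtain ⟨z, hz, hz'⟩ := hy j hjx
        simp [hz'] at hj

/-- Attaching `none` as a leaf to an arbitrary vertex `x` of `T` is likewise undone by contracting
the edge between them. -/
theorem isGraft_leftEquiv_one (T : RT X) (U : RT (Option X)) :
    IsGraft 1 (edge 1) T (U.map (leftEquiv X).symm) ↔
      ∃ x, U.parent none = some (some x) ∧ Leaf U.parent ∧ T.parent = ctr x U.parent := by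
  have hp : ∀ t, ((U.map (leftEquiv X).symm).parent t).map (RT.proj 1) =
      (U.parent (leftEquiv X t)).map (fun o => o.elim 0 fun _ => 1) := fun t => by
    rw [map_symm_parent, Option.map_map]
    congr 1
    funext o
    exact proj_leftEquiv_symm o
  have hr : ∀ j j', (U.map (leftEquiv X).symm).parent (.inr j) = some (.inr j') ↔
      U.parent (some j) = some (some j') := fun j j' => by
    rw [map_symm_parent, leftEquiv_inr, Option.map_eq_some_iff]
    simp only [Equiv.symm_apply_eq, leftEquiv_inr, exists_eq_right]
  have hc : ∀ x, Leaf U.parent → U.parent none = some (some x) →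
      ∀ y, ctr x U.parent y = (U.parent (some y)).map (·.getD x) := fun x hl hx y => by
    by_cases hy : y = x
    · subst hy; exact ctr_self_of_ne (hl y)
    · exact ctr_of_ne hy _
  constructor
  · intro h
    have h₀ : ∃ x, U.parent none = some (some x) := by
      have := h.inl ⟨0, by simp⟩
      rw [hp, leftEquiv_inl] at this
      rcases hU : U.parent none with _ | _ | x
      · simp [hU, edge] at this
      · exact absurd hU (U.isTree.ne_self none)
      · exact ⟨x, rfl⟩
    obtain ⟨x, hx⟩ := h₀
    have h₁ : ∀ y, T.parent y = none → U.parent (some y) = none := fun y hy => by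
      have := h.inr_none hy
      rw [hp] at this
      simpa [edge] using this
    have h₂ : ∀ y z, T.parent y = some z → U.parent (some y) = some (some z) := fun y z hy =>
      (hr y z).1 (h.inr_some hy)
    have hl : Leaf U.parent := fun y hy => by
      rcases hy' : T.parent y with _ | z
      · simp [h₁ y hy'] at hy
      · simp [h₂ y z hy'] at hy
    refine ⟨x, hx, hl, funext fun y => ?_⟩
    rw [hc x hl hx]
    rcases hy' : T.parent y with _ | z
    · rw [h₁ y hy']; rfl
    · rw [h₂ y z hy']; rfl
  · rintro ⟨x, hx, hl, h⟩
    refine ⟨?_, ?_, ?_⟩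
    · rintro ⟨a, ha⟩
      obtain rfl : a = 0 := by omega
      rw [hp, leftEquiv_inl, hx]
      rfl
    · intro j j' hj
      rw [hr]
      rw [h, hc x hl hx] at hj
      rcases hU : U.parent (some j) with _ | _ | z
      · simp [hU] at hj
      · exact absurd hU (hl j)
      · simpa [hU] using hj
    · intro j hj
      rw [h, hc x hl hx, Option.map_eq_none_iff] at hj
      rw [hp, leftEquiv_inr, hj]
      rfl

open Classical in
-- In each of the two families at most one `x` contributes; the sum over `x` has the same shape as
-- the sum of the terms `brR`.
theorem coeff_brL [Fintype X] (U : RT (Option X)) (μ : (PL k).obj X) :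
    coeff U ((PL k).brL (PL.bracket k) μ) =
      ∑ x, ((if OnlyChild x U.parent then 1 else 0) -
        (if U.parent none = some (some x) ∧ Leaf U.parent then 1 else 0)) *
          ev (ctr x U.parent) μ := by
  have h : (coeff U ∘ₗ (PL k).brL (PL.bracket k) : (PL k).obj X →ₗ[k] k) =
      ∑ x, ((if OnlyChild x U.parent then (1 : k) else 0) -
        (if U.parent none = some (some x) ∧ Leaf U.parent then 1 else 0)) •
          ev (ctr x U.parent) := by
    refine hom_ext fun T => ?_
    rw [LinearMap.comp_apply, brL, bracket_eq, map_sub, LinearMap.sub_apply, map_sub,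
      OperadData.cmp, LinearMap.compr₂_apply, LinearMap.compr₂_apply, coeff_map_symm,
      coeff_map_symm, coeff_comp_tree, coeff_comp_tree, isGraft_leftEquiv_zero,
      isGraft_leftEquiv_one]
    simp only [LinearMap.sum_apply, LinearMap.smul_apply, ev_tree, smul_eq_mul, sub_mul,
      Finset.sum_sub_distrib]
    congr 1
    · split_ifs with h
      · obtain ⟨x, hx, hT⟩ := h
        rw [Finset.sum_eq_single x]
        · rw [if_pos hx, if_pos hT, mul_one]
        · intro y _ hy
          rw [if_neg, zero_mul]
          exact fun h => hy (hx.2.2 y h.2.1)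
        · simp
      · refine (Finset.sum_eq_zero fun x _ => ?_).symm
        rw [ite_zero_mul_ite_zero, if_neg fun hx => h ⟨x, hx⟩]
    · split_ifs with h
      · obtain ⟨x, hx, hl, hT⟩ := h
        rw [Finset.sum_eq_single x]
        · rw [if_pos ⟨hx, hl⟩, if_pos hT, mul_one]
        · intro y _ hy
          rw [if_neg, zero_mul]
          exact fun h => hy (by simpa [hx] using h.1.symm)
        · simp
      · refine (Finset.sum_eq_zero fun x _ => ?_).symm
        rw [ite_zero_mul_ite_zero, if_neg fun hx => h ⟨x, hx.1.1, hx.1.2, hx.2⟩]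
  have h' := DFunLike.congr_fun h μ
  simpa [LinearMap.sum_apply] using h'

end

theorem map_swap_edge (r : Fin 2) : (edge r).map (Equiv.swap 0 1) = edge (Equiv.swap 0 1 r) := by
  ext x : 2
  fin_cases r <;> fin_cases x <;> rfl

theorem ev_bracket (f : Fin 2 → Option (Fin 2)) :
    ev f (PL.bracket k) = (((if f 0 = none ∧ f 1 = some 0 then 1 else 0) -
      (if f 1 = none ∧ f 0 = some 1 then 1 else 0) : ℤ) : k) := by
  have h₀ : (edge 0).parent = f ↔ f 0 = none ∧ f 1 = some 0 := by
    constructor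
    · rintro rfl
      exact ⟨rfl, rfl⟩
    · rintro ⟨h, h'⟩
      funext x
      fin_cases x
      · exact h.symm
      · exact h'.symm
  have h₁ : (edge 1).parent = f ↔ f 1 = none ∧ f 0 = some 1 := by
    constructor
    · rintro rfl
      exact ⟨rfl, rfl⟩
    · rintro ⟨h, h'⟩
      funext x
      fin_cases x
      · exact h'.symm
      · exact h.symm
  rw [bracket_eq, map_sub, ev_tree, ev_tree]
  simp only [h₀, h₁]
  push_cast
  rfl

/-- For the Jacobi identity the coefficients are compared at each tree with three vertices. -/
theorem isLieBracket : (PL k).IsLieBracket (PL.bracket k) where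
  antisymm := by
    rw [bracket_eq, map_sub, map_tree, map_tree, map_swap_edge, map_swap_edge]
    simp
  jacobi := by
    classical
    refine ext_coeff fun U => ?_
    rw [map_add, coeff_brL, coeff_brR, coeff_brR, Fin.sum_univ_two]
    have hU := U.isTree
    generalize U.parent = f at hU ⊢
    simp only [ev_bracket, OnlyChild, Leaf, Fin.forall_fin_two]
    have e₀ := hU.ne_self none
    have e₁ := hU.ne_self (some 0)
    have e₂ := hU.ne_self (some 1)
    have t₀ := fun h => hU.not_two_cycle (x := none) (y := some 0) h
    have t₁ := fun h => hU.not_two_cycle (x := none) (y := some 1) h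
    have t₂ := fun h => hU.not_two_cycle (x := some 0) (y := some 1) h
    have u₀ := fun h h' => hU.1.unique (y₁ := none) (y₂ := some 0) h h'
    have u₁ := fun h h' => hU.1.unique (y₁ := none) (y₂ := some 1) h h'
    have u₂ := fun h h' => hU.1.unique (y₁ := some 0) (y₂ := some 1) h h'
    -- All values of the three parents are tried; the facts above exclude loops, cycles of length
    -- two and several roots.
    rcases hn : f none with _ | _ | x <;> rcases h0 : f (some 0) with _ | _ | y <;>
      rcases h1 : f (some 1) with _ | _ | z <;>
      simp_all [ctr]

end PL

/-! ### The differential on functions of trees -/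

namespace ParentFun

variable {k : Type u} [Field k]

open Classical in
/-- The coefficient with which the contraction of the edge between `none` and `x` occurs in the
differential; `wh` are the vertices labelled by inputs. -/
noncomputable def wgt (k : Type u) [Field k] {X : Type} (wh : X → Prop) (x : X)
    (U : Option X → Option (Option X)) : k :=
  (if U (some x) = some none then
    (if OnlyChild x U then 1 else 0) - (if wh x then 1 else 0) else 0) +
  (if U none = some (some x) then (if Leaf U then 0 else 1) else 0)

/-- The sum over all contractions of edges at `none`. -/
noncomputable def ctrSum {X : Type} [Fintype X] (wh : X → Prop) (φ : (X → Option X) → k)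
    (U : Option X → Option (Option X)) : k :=
  ∑ x, wgt k wh x U * φ (ctr x U)

theorem adj_of_wgt_ne_zero {X : Type} {wh : X → Prop} {x : X} {U : Option X → Option (Option X)}
    (h : wgt k wh x U ≠ 0) : U (some x) = some none ∨ U none = some (some x) := by
  by_contra! h'
  simp [wgt, h'.1, h'.2] at h

theorem ctrSum_congr {X : Type} [Fintype X] {wh : X → Prop} {φ ψ : (X → Option X) → k}
    (h : ∀ f, IsTree f → φ f = ψ f) {U : Option X → Option (Option X)} (hU : IsTree U) :
    ctrSum wh φ U = ctrSum wh ψ U := by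
  refine Finset.sum_congr rfl fun x _ => ?_
  by_cases hx : wgt k wh x U = 0
  · rw [hx, zero_mul, zero_mul]
  · rw [h _ (isTree_ctr hU (adj_of_wgt_ne_zero hx))]

section

variable {X Y : Type} (e : X ≃ Y) (U : Option X → Option (Option X))

theorem map_optionCongr_some (x : X) : map (Equiv.optionCongr e) U (some (e x)) =
    (U (some x)).map (Equiv.optionCongr e) := map_apply (Equiv.optionCongr e) U (some x)

theorem map_optionCongr_none : map (Equiv.optionCongr e) U none =
    (U none).map (Equiv.optionCongr e) := map_apply (Equiv.optionCongr e) U none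

theorem map_optionCongr_eq_none {o : Option (Option X)} :
    o.map (Equiv.optionCongr e) = some none ↔ o = some none := by
  rcases o with _ | _ | o <;> simp

theorem map_optionCongr_eq_some {o : Option (Option X)} {x : X} :
    o.map (Equiv.optionCongr e) = some (some (e x)) ↔ o = some (some x) := by
  rcases o with _ | _ | o <;> simp

theorem wgt_map (wh : Y → Prop) (x : X) :
    wgt k wh (e x) (map (Equiv.optionCongr e) U) = wgt k (wh ∘ e) x U := by
  have h₁ : OnlyChild (e x) (map (Equiv.optionCongr e) U) ↔ OnlyChild x U := by
    simp only [OnlyChild, map_optionCongr_some, map_optionCongr_none, map_optionCongr_eq_none,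
      Option.map_eq_none_iff, e.surjective.forall, e.injective.eq_iff]
  have h₂ : Leaf (map (Equiv.optionCongr e) U) ↔ Leaf U := by
    simp only [Leaf, e.surjective.forall, map_optionCongr_some, Ne, map_optionCongr_eq_none]
  have h₃ : map (Equiv.optionCongr e) U (some (e x)) = some none ↔ U (some x) = some none := by
    rw [map_optionCongr_some, map_optionCongr_eq_none]
  have h₄ : map (Equiv.optionCongr e) U none = some (some (e x)) ↔ U none = some (some x) := by
    rw [map_optionCongr_none, map_optionCongr_eq_some]
  classical
  exact congrArg₂ (· + ·) (if_congr h₃ (congrArg₂ _ (if_congr h₁ rfl rfl) rfl) rfl)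
    (if_congr h₄ (if_congr h₂ rfl rfl) rfl)

theorem ctrSum_map [Fintype X] [Fintype Y] (wh : Y → Prop) (φ : (Y → Option Y) → k) :
    ctrSum wh φ (map (Equiv.optionCongr e) U) = ctrSum (wh ∘ e) (φ ∘ map e) U := by
  rw [ctrSum, ← Equiv.sum_comp e]
  simp only [wgt_map, ← map_ctr]
  rfl

end

/-- The permutations of the labels `Fin m`. -/
abbrev permR (I : Type) {m : ℕ} (σ : Equiv.Perm (Fin m)) : I ⊕ Fin m ≃ I ⊕ Fin m :=
  Equiv.sumCongr (Equiv.refl I) σ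

/-- The `p`-th of the labels `Fin (m + 1)` becomes `none`. -/
def pick (I : Type) {m : ℕ} (p : Fin (m + 1)) : I ⊕ Fin (m + 1) ≃ Option (I ⊕ Fin m) :=
  (permR I (Equiv.swap 0 p)).trans (Tw.optE I m).symm

/-- The vertex is labelled by an input. -/
def White {I : Type} {m : ℕ} (x : I ⊕ Fin m) : Prop := x.isLeft

variable {I : Type} [Fintype I] {m : ℕ}

/-- The differential in terms of functions on trees. -/
noncomputable def diff (φ : (I ⊕ Fin m → Option (I ⊕ Fin m)) → k)
    (f : I ⊕ Fin (m + 1) → Option (I ⊕ Fin (m + 1))) : k :=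
  ∑ p : Fin (m + 1), (if p = 0 then 1 else -1) * ctrSum White φ (map (pick I p) f)

/-- Antisymmetric functions with respect to the labels `Fin m`. -/
def Antisymm (φ : (I ⊕ Fin m → Option (I ⊕ Fin m)) → k) : Prop :=
  ∀ (σ : Equiv.Perm (Fin m)) f, φ (map (permR I σ) f) = ((Equiv.Perm.sign σ : ℤ) : k) * φ f

theorem diff_congr {φ ψ : (I ⊕ Fin m → Option (I ⊕ Fin m)) → k}
    (h : ∀ f, IsTree f → φ f = ψ f) {f : I ⊕ Fin (m + 1) → Option (I ⊕ Fin (m + 1))}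
    (hf : IsTree f) : diff φ f = diff ψ f := by
  refine Finset.sum_congr rfl fun p _ => ?_
  rw [ctrSum_congr h (isTree_map _ hf)]

end ParentFun

/-! ### Coinvariants as antisymmetric functions -/

namespace PL

open RT ParentFun OperadData

variable {k : Type u} [Field k]

section

variable {X : Type} [Fintype X]

variable (k) in
open Classical in
/-- `b(ν, μ) - ∑ μ ∘ₓ b(ν, x) + ∑ μ ∘ₓ (x ◁ ν)`, where the first sum is over the inputs and the
second one is over the other labels. -/
noncomputable def dElt (wh : X → Prop) : (PL k).obj X →ₗ[k] (PL k).obj (Option X) :=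
  (PL k).brL (PL.bracket k) + ∑ x, if wh x then - (PL k).brR (PL.bracket k) x
    else ((PL k).cmp x (rightEquiv x)).flip (tree (edge 1))

/-- The weights `wgt` arise by collecting terms. Attaching `none` as a leaf in `b(ν, μ)` cancels the
leaf case of the edge from `none` to its parent, for inputs and `α`'s alike. -/
theorem coeff_dElt (wh : X → Prop) (U : RT (Option X)) (μ : (PL k).obj X) :
    coeff U (dElt k wh μ) = ctrSum wh (fun f => ev f μ) U.parent := by
  classical
  rw [dElt, LinearMap.add_apply, map_add, coeff_brL, LinearMap.sum_apply, map_sum,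
    ← Finset.sum_add_distrib]
  refine Finset.sum_congr rfl fun x _ => ?_
  have h : OnlyChild x U.parent → U.parent (some x) = some none := fun h => h.2.1
  by_cases hx : wh x
  · rw [if_pos hx, LinearMap.neg_apply, map_neg, coeff_brR, ← neg_mul, ← add_mul]
    congr 1
    simp only [wgt, hx, if_true]
    by_cases h₁ : U.parent (some x) = some none <;> by_cases h₂ : U.parent none = some (some x) <;>
      by_cases h₃ : OnlyChild x U.parent <;> by_cases h₄ : Leaf U.parent <;> simp_all
  · rw [if_neg hx, LinearMap.flip_apply, coeff_cmp_edge_one, ← add_mul]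
    congr 1
    simp only [wgt, hx, if_false]
    by_cases h₁ : U.parent (some x) = some none <;> by_cases h₂ : U.parent none = some (some x) <;>
      by_cases h₃ : OnlyChild x U.parent <;> by_cases h₄ : Leaf U.parent <;> simp_all

end

variable {I : Type} [Fintype I] {m : ℕ}

/-- The edge joins the new `α` to the old one `j`; exchanging these two labels reverses the edge and
changes the sign of the class. -/
theorem cls_edge_zero (j : Fin m) (μ : (PL k).obj (I ⊕ Fin m)) :
    Tw.cls (PL k) (m + 1) ((PL k).map (Tw.optE I m)
      ((PL k).cmp (.inr j) (rightEquiv _) μ (tree (edge 0)))) =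
    - Tw.cls (PL k) (m + 1) ((PL k).map (Tw.optE I m)
      ((PL k).cmp (.inr j) (rightEquiv _) μ (tree (edge 1)))) := by
  have e : (tree (edge 0) : (PL k).obj (Fin 2)) = (PL k).map (Equiv.swap 0 1) (tree (edge 1)) := by
    rw [map_tree, map_swap_edge]; simp
  rw [map_cmp, map_cmp, e]
  have h := Tw.cls_cmp_eq (P := PL k) (I := I) (n := m + 1) (n' := m + 1) rfl
    (Equiv.swap 0 j.succ) (Equiv.refl (I ⊕ Fin m)) (Equiv.swap (0 : Fin 2) 1) (x := .inr j) rfl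
    ((rightEquiv (Sum.inr j)).trans (Tw.optE I m)) ((rightEquiv (Sum.inr j)).trans (Tw.optE I m))
    ?_ ?_ μ (tree (edge 1))
  · rw [(PL k).map_refl, Equiv.Perm.sign_swap (Fin.succ_ne_zero j).symm, Units.neg_smul,
      one_smul] at h
    exact (neg_eq_iff_eq_neg.2 h).symm
  · rintro ⟨a | a, ha⟩ h
    · rfl
    · refine congrArg Sum.inr (Equiv.swap_apply_of_ne_of_ne (Fin.succ_ne_zero _) ?_)
      intro e
      exact ha (congrArg Sum.inr (Fin.succ_injective _ e))
  · intro c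
    fin_cases c
    · exact congrArg Sum.inr (Equiv.swap_apply_right _ _)
    · exact congrArg Sum.inr (Equiv.swap_apply_left _ _)

/-- At an `α`, the bracket `tree (edge 0) - tree (edge 1)` becomes `-2` times the second tree by
`cls_edge_zero`, so that `-1 / 2` times the bracket is just that tree. This is why black vertices
have no weight for white-type splittings. -/
theorem diff_cls [CharZero k] (μ : (PL k).obj (I ⊕ Fin m)) :
    Tw.diff (PL k) (PL.bracket k) (Tw.cls (PL k) m μ) =
      Tw.cls (PL k) (m + 1) ((PL k).map (Tw.optE I m) (dElt k White μ)) := by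
  classical
  rw [Tw.d_cls_eq_delta, delta_apply, dElt, LinearMap.add_apply, sub_eq_add_neg, map_add, map_add,
    map_add, map_add, LinearMap.sum_apply, map_neg, map_neg]
  congr 1
  rw [Fintype.sum_sum_type, Fintype.sum_sum_type]
  simp only [map_add, map_sum, neg_add, ← Finset.sum_neg_distrib]
  congr 1
  · refine Finset.sum_congr rfl fun i _ => ?_
    simp [White, Tw.wt]
  · refine Finset.sum_congr rfl fun j _ => ?_
    have h₁ : Tw.wt k I m (Sum.inr j) = 1 / 2 := rfl
    have h₂ : ¬ White (Sum.inr j : I ⊕ Fin m) := by simp [White]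
    rw [h₁, if_neg h₂, brR, LinearMap.flip_apply, LinearMap.flip_apply, bracket_eq]
    rw [map_sub, map_smul, map_smul, map_sub, map_sub, cls_edge_zero]
    rw [← neg_add', ← two_smul k, smul_neg, smul_smul, neg_neg]
    norm_num

/-- The antisymmetrization. -/
noncomputable def alt (μ : (PL k).obj (I ⊕ Fin m)) (f : I ⊕ Fin m → Option (I ⊕ Fin m)) : k :=
  ∑ σ : Equiv.Perm (Fin m), ((Equiv.Perm.sign σ : ℤ) : k) * ev (ParentFun.map (permR I σ) f) μ

theorem permR_trans {I : Type} {m : ℕ} (σ τ : Equiv.Perm (Fin m)) :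
    (permR I σ).trans (permR I τ) = permR I (τ * σ) := by
  ext x
  rcases x with x | x <;> rfl

theorem alt_antisymm (μ : (PL k).obj (I ⊕ Fin m)) : Antisymm (alt μ) := by
  intro τ f
  rw [alt, alt, ← Equiv.sum_comp (Equiv.mulRight τ⁻¹), Finset.mul_sum]
  refine Finset.sum_congr rfl fun σ _ => ?_
  rw [map_map, permR_trans]
  simp only [Equiv.coe_mulRight, inv_mul_cancel_right, map_mul, map_inv, Int.units_inv_eq_self]
  push_cast
  ring

theorem alt_add (μ ν : (PL k).obj (I ⊕ Fin m)) (f : I ⊕ Fin m → Option (I ⊕ Fin m)) :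
    alt (μ + ν) f = alt μ f + alt ν f := by
  simp [alt, mul_add, Finset.sum_add_distrib]

theorem alt_smul (c : k) (μ : (PL k).obj (I ⊕ Fin m)) (f : I ⊕ Fin m → Option (I ⊕ Fin m)) :
    alt (c • μ) f = c * alt μ f := by
  simp only [alt, map_smul, smul_eq_mul, Finset.mul_sum]
  exact Finset.sum_congr rfl fun σ _ => by ring

theorem alt_of_not_isTree (μ : (PL k).obj (I ⊕ Fin m)) {f : I ⊕ Fin m → Option (I ⊕ Fin m)}
    (hf : ¬ IsTree f) : alt μ f = 0 := by
  refine Finset.sum_eq_zero fun σ _ => ?_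
  rw [ev_of_not_isTree, LinearMap.zero_apply, mul_zero]
  intro h
  have := isTree_map (permR I σ).symm h
  rw [map_map, Equiv.self_trans_symm, ParentFun.map_refl] at this
  exact hf this

/-- A permutation of the `m + 1` black labels amounts to the choice of the label `p` that plays the
role of the new `α` and a permutation of the others. The latter produces `alt μ`, the former the sum
in `ParentFun.diff`. -/
theorem alt_map_dElt (μ : (PL k).obj (I ⊕ Fin m))
    {f : I ⊕ Fin (m + 1) → Option (I ⊕ Fin (m + 1))} (hf : IsTree f) :
    alt ((PL k).map (Tw.optE I m) (dElt k White μ)) f = ParentFun.diff (alt μ) f := by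
  have h₁ : ∀ σ : Equiv.Perm (Fin (m + 1)), ev (ParentFun.map (permR I σ) f)
      ((PL k).map (Tw.optE I m) (dElt k White μ)) = ctrSum White (fun f => ev f μ)
        (ParentFun.map ((permR I σ).trans (Tw.optE I m).symm) f) := by
    intro σ
    obtain ⟨U, hU⟩ := (isTree_map ((permR I σ).trans (Tw.optE I m).symm) hf).exists_rt
    have h : ParentFun.map (permR I σ) f = ParentFun.map (Tw.optE I m) U.parent := by
      rw [hU, map_map, Equiv.trans_assoc, Equiv.symm_trans_self, Equiv.trans_refl]
    rw [h, ev_map, ← hU, ev_parent, coeff_dElt]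
  have h₂ : ∀ (p : Fin (m + 1)) (τ : Equiv.Perm (Fin m)),
      (permR I (Equiv.Perm.decomposeFin.symm (p, τ⁻¹))⁻¹).trans (Tw.optE I m).symm =
        (pick I p).trans (Equiv.optionCongr (permR I τ)) := by
    intro p τ
    have h : (Equiv.Perm.decomposeFin.symm (p, τ⁻¹))⁻¹ =
        Equiv.Perm.decomposeFin.symm (0, τ) * Equiv.swap 0 p := by
      rw [inv_eq_iff_mul_eq_one]
      ext x
      obtain ⟨y, rfl⟩ := (Equiv.swap 0 p).surjective x
      refine Fin.cases ?_ (fun y => ?_) y <;> simp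
    rw [h, ← permR_trans, pick, Equiv.trans_assoc, Equiv.trans_assoc]
    congr 1
    ext x : 1
    rcases x with x | x
    · rfl
    · refine Fin.cases ?_ (fun x => ?_) x
      · simp [Equiv.symm_apply_eq]
        rfl
      · simp [Equiv.symm_apply_eq]
        rfl
  have h₃ : ∀ τ : Equiv.Perm (Fin m), (White : I ⊕ Fin m → Prop) ∘ permR I τ = White := by
    intro τ
    funext x
    rcases x with x | x <;> rfl
  -- `decomposeFin` records the image of `0`, while `pick` needs the label that is sent to `0`;
  -- hence the passage to inverses.
  rw [alt, ← Equiv.sum_comp (Equiv.inv _), ← Equiv.sum_comp Equiv.Perm.decomposeFin.symm,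
    Fintype.sum_prod_type]
  refine Finset.sum_congr rfl fun p _ => ?_
  rw [← Equiv.sum_comp (Equiv.inv _)]
  simp only [Equiv.inv_apply, h₁, h₂, ← map_map, ctrSum_map, h₃]
  simp only [ctrSum, alt, Finset.mul_sum]
  rw [Finset.sum_comm]
  refine Finset.sum_congr rfl fun x _ => Finset.sum_congr rfl fun τ _ => ?_
  rw [Equiv.Perm.sign_inv, Equiv.Perm.decomposeFin.symm_sign, Equiv.Perm.sign_inv]
  simp only [Function.comp_apply]
  split_ifs <;> push_cast <;> ring

theorem exists_ev_eq {X : Type} [Finite X] (φ : (X → Option X) → k) :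
    ∃ μ : (PL k).obj X, ∀ f, IsTree f → ev f μ = φ f := by
  classical
  have := Fintype.ofFinite (RT X)
  refine ⟨∑ T : RT X, φ T.parent • tree T, fun f hf => ?_⟩
  obtain ⟨T, rfl⟩ := hf.exists_rt
  rw [ev_parent, map_sum]
  simp [coeff_tree]

/-- On an antisymmetric function the antisymmetrization is multiplication by `m!`. -/
theorem exists_alt_eq [CharZero k] {φ : (I ⊕ Fin m → Option (I ⊕ Fin m)) → k} (hφ : Antisymm φ) :
    ∃ μ : (PL k).obj (I ⊕ Fin m), ∀ f, IsTree f → alt μ f = φ f := by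
  obtain ⟨μ, h⟩ := exists_ev_eq φ
  refine ⟨((m.factorial : k)⁻¹) • μ, fun f hf => ?_⟩
  rw [alt_smul, alt]
  have h' : ∀ σ : Equiv.Perm (Fin m), ((Equiv.Perm.sign σ : ℤ) : k) *
      ev (ParentFun.map (permR I σ) f) μ = φ f := by
    intro σ
    rw [h _ (isTree_map _ hf), hφ, ← mul_assoc, ← Int.cast_mul, ← Units.val_mul, Int.units_mul_self]
    simp
  simp only [h']
  rw [Finset.sum_const, Finset.card_univ, Fintype.card_perm, Fintype.card_fin, nsmul_eq_mul,
    inv_mul_cancel_left₀]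
  exact_mod_cast m.factorial_ne_zero

/-- The antisymmetrization kills the relations; conversely the class of the antisymmetrized element
is `m!` times the class of `μ`. -/
theorem cls_eq_zero_iff [CharZero k] (μ : (PL k).obj (I ⊕ Fin m)) :
    Tw.cls (PL k) m μ = 0 ↔ ∀ f, IsTree f → alt μ f = 0 := by
  constructor
  · intro h f _
    have h' : μ ∈ Tw.rel (PL k) I m := by
      rw [Tw.cls, LinearMap.comp_apply] at h
      have := (DirectSum.lof_eq_of k ℕ (fun m => (PL k).obj (I ⊕ Fin m) ⧸ Tw.rel (PL k) I m) m
        _).symm.trans h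
      have := DirectSum.of_injective (β := fun m => (PL k).obj (I ⊕ Fin m) ⧸ Tw.rel (PL k) I m) m
        (this.trans (map_zero _).symm)
      exact (Submodule.Quotient.mk_eq_zero _).1 this
    let F : (PL k).obj (I ⊕ Fin m) →ₗ[k] k :=
      { toFun := fun μ => alt μ f
        map_add' := fun μ ν => alt_add μ ν f
        map_smul' := fun c μ => alt_smul c μ f }
    have hF : Tw.rel (PL k) I m ≤ LinearMap.ker F := by
      rw [Tw.rel, Submodule.span_le]
      rintro _ ⟨σ, ν, rfl⟩
      change F _ = 0
      rw [map_sub, sub_eq_zero, Units.smul_def, map_zsmul]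
      change alt _ f = _ • alt ν f
      rw [alt, alt, ← Equiv.sum_comp (Equiv.mulLeft σ), zsmul_eq_mul, Finset.mul_sum]
      refine Finset.sum_congr rfl fun τ _ => ?_
      rw [Equiv.coe_mulLeft, ← permR_trans, ← map_map, ev_map]
      simp [mul_assoc]
    exact hF h'
  · intro h
    have h₁ : ∑ σ : Equiv.Perm (Fin m), Equiv.Perm.sign σ • (PL k).map (permR I σ) μ = 0 := by
      refine ext_coeff fun T => ?_
      rw [map_zero, map_sum, ← h T.parent T.isTree, alt, ← Equiv.sum_comp (Equiv.inv _)]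
      refine Finset.sum_congr rfl fun σ _ => ?_
      have e : T.parent = ParentFun.map (permR I σ⁻¹)
          (ParentFun.map (permR I σ) T.parent) := by
        rw [map_map, permR_trans, inv_mul_cancel]
        exact ((congrArg (fun g => ParentFun.map g T.parent) Equiv.sumCongr_refl).trans
          (ParentFun.map_refl _)).symm
      rw [Equiv.inv_apply, Units.smul_def, map_zsmul, ← ev_parent]
      conv_lhs => rw [e, ev_map]
      simp
    have h₂ : (m.factorial : k) • Tw.cls (PL k) m μ = Tw.cls (PL k) m
        (∑ σ : Equiv.Perm (Fin m), Equiv.Perm.sign σ • (PL k).map (permR I σ) μ) := by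
      rw [map_sum]
      have : ∀ σ : Equiv.Perm (Fin m), Tw.cls (PL k) m (Equiv.Perm.sign σ •
          (PL k).map (permR I σ) μ) = Tw.cls (PL k) m μ := fun σ => by
        rw [Units.smul_def, map_zsmul, Tw.cls_perm, ← Units.smul_def, smul_smul,
          Int.units_mul_self, one_smul]
      simp only [this]
      rw [Finset.sum_const, Finset.card_univ, Fintype.card_perm, Fintype.card_fin,
        Nat.cast_smul_eq_nsmul]
    rw [h₁, map_zero] at h₂
    exact (smul_eq_zero.1 h₂).resolve_left (by exact_mod_cast m.factorial_ne_zero)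

theorem cls_eq_iff [CharZero k] (μ ν : (PL k).obj (I ⊕ Fin m)) :
    Tw.cls (PL k) m μ = Tw.cls (PL k) m ν ↔ ∀ f, IsTree f → alt μ f = alt ν f := by
  have h : ∀ f, alt (μ - ν) f = alt μ f - alt ν f := fun f => by
    rw [sub_eq_add_neg, ← neg_one_smul k, alt_add, alt_smul]; ring
  rw [← sub_eq_zero, ← map_sub, cls_eq_zero_iff]
  simp only [h, sub_eq_zero]

theorem diff_cls_eq_zero_iff [CharZero k] (μ : (PL k).obj (I ⊕ Fin m)) :
    Tw.diff (PL k) (PL.bracket k) (Tw.cls (PL k) m μ) = 0 ↔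
      ∀ f, IsTree f → ParentFun.diff (alt μ) f = 0 := by
  rw [diff_cls, cls_eq_zero_iff]
  exact forall₂_congr fun f hf => by rw [alt_map_dElt μ hf]

theorem diff_cls_eq_iff [CharZero k] (μ : (PL k).obj (I ⊕ Fin m))
    (ν : (PL k).obj (I ⊕ Fin (m + 1))) :
    Tw.diff (PL k) (PL.bracket k) (Tw.cls (PL k) m μ) = Tw.cls (PL k) (m + 1) ν ↔
      ∀ f, IsTree f → ParentFun.diff (alt μ) f = alt ν f := by
  rw [diff_cls, cls_eq_iff]
  exact forall₂_congr fun f hf => by rw [alt_map_dElt μ hf]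

/-- `d² = 0` in the twisting, transported to functions. Only values at trees are compared, because
representatives see nothing else. -/
theorem diff_diff [CharZero k] {φ : (I ⊕ Fin m → Option (I ⊕ Fin m)) → k} (hφ : Antisymm φ)
    {f : I ⊕ Fin (m + 2) → Option (I ⊕ Fin (m + 2))} (hf : IsTree f) :
    ParentFun.diff (ParentFun.diff φ) f = 0 := by
  obtain ⟨μ, hμ⟩ := exists_alt_eq hφ
  have h := Tw.d_d PL.isOperad PL.isLieBracket (Tw.cls (PL k) m μ)
  rw [diff_cls, diff_cls_eq_zero_iff] at h
  rw [← h f hf]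
  refine diff_congr (fun g hg => ?_) hf
  rw [alt_map_dElt μ hg]
  exact (diff_congr hμ hg).symm

end PL

/-! ### The tree with a new vertex in the place of a given one -/

namespace ParentFun

open OperadData

variable {k : Type u} [Field k] {X : Type}

open Classical in
/-- A new vertex `none` takes the place of `v`, and `v` becomes a leaf attached to it. -/
noncomputable def plus (v : X) (T : X → Option X) : Option X → Option (Option X)
  | none => (T v).map some
  | some y => if y = v ∨ T y = some v then some none else (T y).map some

theorem plus_none (v : X) (T : X → Option X) : plus v T none = (T v).map some := rfl

theorem plus_self (v : X) (T : X → Option X) : plus v T (some v) = some none := by simp [plus]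

theorem plus_of_eq {v y : X} {T : X → Option X} (h : T y = some v) :
    plus v T (some y) = some none := by simp [plus, h]

theorem plus_of_ne {v y : X} {T : X → Option X} (hy : y ≠ v) (h : T y ≠ some v) :
    plus v T (some y) = (T y).map some := by simp [plus, hy, h]

theorem map_plus {Y : Type} (e : X ≃ Y) (v : X) (T : X → Option X) :
    map (Equiv.optionCongr e) (plus v T) = plus (e v) (map e T) := by
  funext o
  rcases o with _ | y
  · rw [map_optionCongr_none, plus_none, plus_none, map_apply]
    rcases T v with _ | a <;> rfl
  · obtain ⟨y, rfl⟩ := e.surjective y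
    rw [map_optionCongr_some]
    have h : map e T (e y) = some (e v) ↔ T y = some v := by
      rw [map_apply]
      rcases T y with _ | a <;> simp
    by_cases hy : y = v
    · subst hy; rw [plus_self, plus_self]; rfl
    by_cases hT : T y = some v
    · rw [plus_of_eq hT, plus_of_eq (h.2 hT)]; rfl
    · rw [plus_of_ne hy hT, plus_of_ne (fun e' => hy (e.injective e')) (fun h' => hT (h.1 h')),
        map_apply]
      rcases T y with _ | a <;> rfl

theorem isTree_plus (v : X) {T : X → Option X} (hT : IsTree T) : IsTree (plus v T) := by
  classical
  obtain ⟨⟨r, hr, hru⟩, d, hd⟩ := id hT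
  have hru : ∀ y, T y = none → y = r := hru
  refine ⟨?_, fun o => o.elim (2 * d v) fun y => if y = v then 2 * d v + 1 else 2 * d y, ?_⟩
  · by_cases hv : r = v
    · subst hv
      refine ⟨none, by simp [plus_none, hr], ?_⟩
      rintro (_ | y) (hy : plus r T _ = none)
      · rfl
      · simp only [plus] at hy
        split_ifs at hy with h
        rw [Option.map_eq_none_iff] at hy
        exact absurd (hru y hy) (by tauto)
    · refine ⟨some r, ?_, ?_⟩
      · simp [plus, hv, hr]
      · rintro (_ | y) (hy : plus v T _ = none)
        · rw [plus_none, Option.map_eq_none_iff] at hy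
          exact absurd (hru v hy).symm hv
        · simp only [plus] at hy
          split_ifs at hy with h
          rw [Option.map_eq_none_iff] at hy
          rw [hru y hy]
  · rintro (_ | y) z hz
    · rw [plus_none] at hz
      obtain ⟨z, hz', rfl⟩ := Option.map_eq_some_iff.1 hz
      have := hd _ _ hz'
      have hzv : z ≠ v := by rintro rfl; exact lt_irrefl _ this
      simp [hzv, this]
    · simp only [plus] at hz
      split_ifs at hz with h
      · cases hz
        rcases h with rfl | h
        · simp
        · have := hd _ _ h
          by_cases hy : y = v <;> simp [hy]
          omega
      · push Not at h
        obtain ⟨z, hz', rfl⟩ := Option.map_eq_some_iff.1 hz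
        have := hd _ _ hz'
        have hzv : z ≠ v := by rintro rfl; exact h.2 hz'
        simp [hzv, h.1, this]

theorem ctr_plus_self {v : X} {T : X → Option X} (hv : T v ≠ some v) : ctr v (plus v T) = T := by
  funext y
  by_cases hy : y = v
  · subst hy
    rw [ctr_self_of_child (plus_self _ _), plus_none]
    rcases T y with _ | a <;> rfl
  · rw [ctr_of_ne hy]
    by_cases hT : T y = some v
    · rw [plus_of_eq hT, hT]; rfl
    · rw [plus_of_ne hy hT]
      rcases T y with _ | a <;> rfl

/-- The parent function `plus (some v) U`, where `none` and the new vertex are exchanged. -/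
noncomputable def plusSwap (v : X) (U : Option X → Option (Option X)) :
    Option (Option X) → Option (Option (Option X)) :=
  map (swapOpt X) (plus (some v) U)

section

variable (v : X) (U : Option X → Option (Option X))

open Classical in
theorem plusSwap_none : plusSwap v U none =
    if U none = some (some v) then some (some none) else (U none).map (Option.map some) := by
  have h : plusSwap v U none = (plus (some v) U (some none)).map (swapOpt X) :=
    map_apply (swapOpt X) (plus (some v) U) (some none)
  rw [h]
  split_ifs with hU
  · rw [plus_of_eq hU]; rfl
  · rw [plus_of_ne (by simp) hU]
    rcases U none with _ | _ | a <;> rfl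

theorem plusSwap_new : plusSwap v U (some none) = (U (some v)).map (Option.map some) := by
  have h : plusSwap v U (some none) = (plus (some v) U none).map (swapOpt X) :=
    map_apply (swapOpt X) (plus (some v) U) none
  rw [h, plus_none]
  rcases U (some v) with _ | _ | a <;> rfl

open Classical in
theorem plusSwap_some (y : X) : plusSwap v U (some (some y)) =
    if y = v ∨ U (some y) = some (some v) then some (some none)
    else (U (some y)).map (Option.map some) := by
  have h : plusSwap v U (some (some y)) = (plus (some v) U (some (some y))).map (swapOpt X) :=
    map_apply (swapOpt X) (plus (some v) U) (some (some y))
  rw [h]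
  split_ifs with hU
  · rcases hU with rfl | hU
    · rw [plus_self]; rfl
    · rw [plus_of_eq hU]; rfl
  · push Not at hU
    rw [plus_of_ne (fun e => hU.1 (Option.some.inj e)) hU.2]
    rcases U (some y) with _ | _ | a <;> rfl

end

section

variable {v : X} {U : Option X → Option (Option X)}

theorem plusSwap_none_eq_none : plusSwap v U none = none ↔ U none = none := by
  rw [plusSwap_none]
  split_ifs with h
  · simp [h]
  · simp

theorem plusSwap_none_eq_some {x : X} (hx : x ≠ v) :
    plusSwap v U none = some (some (some x)) ↔ U none = some (some x) := by
  rw [plusSwap_none]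
  split_ifs with h
  · simp [h, Ne.symm hx]
  · rcases U none with _ | _ | a <;> simp

theorem plusSwap_none_eq_new : plusSwap v U none = some (some none) ↔ U none = some (some v) := by
  rw [plusSwap_none]
  split_ifs with h
  · simp [h]
  · rcases hU : U none with _ | _ | a <;> simp
    rintro rfl
    exact h hU

theorem plusSwap_none_ne : plusSwap v U none ≠ some (some (some v)) := by
  rw [plusSwap_none]
  split_ifs with h
  · simp
  · rcases hU : U none with _ | _ | a <;> simp
    rintro rfl
    exact h hU

theorem plusSwap_new_eq : plusSwap v U (some none) = some none ↔ U (some v) = some none := by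
  rw [plusSwap_new]
  rcases U (some v) with _ | _ | a <;> simp

theorem plusSwap_some_eq {y : X} :
    plusSwap v U (some (some y)) = some none ↔ y ≠ v ∧ U (some y) = some none := by
  rw [plusSwap_some]
  split_ifs with h
  · rcases h with rfl | h
    · simp
    · simp [h]
  · push Not at h
    rcases U (some y) with _ | _ | a <;> simp [h.1]

theorem leaf_plusSwap : Leaf (plusSwap v U) ↔ Leaf U := by
  constructor
  · intro h y hy
    by_cases hyv : y = v
    · subst hyv; exact h none (plusSwap_new_eq.2 hy)
    · exact h (some y) (plusSwap_some_eq.2 ⟨hyv, hy⟩)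
  · rintro h (_ | y) hy
    · exact h v (plusSwap_new_eq.1 hy)
    · exact h y (plusSwap_some_eq.1 hy).2

theorem onlyChild_plusSwap {x : X} (hx : x ≠ v) :
    OnlyChild (some x) (plusSwap v U) ↔ OnlyChild x U := by
  constructor
  · rintro ⟨h₀, h₁, h₂⟩
    refine ⟨plusSwap_none_eq_none.1 h₀, (plusSwap_some_eq.1 h₁).2, fun y hy => ?_⟩
    by_cases hyv : y = v
    · subst hyv
      exact absurd (h₂ none (plusSwap_new_eq.2 hy)) (by simp)
    · exact Option.some.inj (h₂ (some y) (plusSwap_some_eq.2 ⟨hyv, hy⟩))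
  · rintro ⟨h₀, h₁, h₂⟩
    refine ⟨plusSwap_none_eq_none.2 h₀, plusSwap_some_eq.2 ⟨hx, h₁⟩, ?_⟩
    rintro (_ | y) hy
    · exact absurd (h₂ v (plusSwap_new_eq.1 hy)).symm hx
    · rw [h₂ y (plusSwap_some_eq.1 hy).2]

theorem onlyChild_plusSwap_new : OnlyChild none (plusSwap v U) ↔ OnlyChild v U := by
  constructor
  · rintro ⟨h₀, h₁, h₂⟩
    refine ⟨plusSwap_none_eq_none.1 h₀, plusSwap_new_eq.1 h₁, fun y hy => ?_⟩
    by_contra hyv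
    exact absurd (h₂ (some y) (plusSwap_some_eq.2 ⟨hyv, hy⟩)) (by simp)
  · rintro ⟨h₀, h₁, h₂⟩
    refine ⟨plusSwap_none_eq_none.2 h₀, plusSwap_new_eq.2 h₁, ?_⟩
    rintro (_ | y) hy
    · rfl
    · have := plusSwap_some_eq.1 hy
      exact absurd (h₂ y this.2) this.1

open Classical in
theorem map_getD_aux {x : X} (hx : v ≠ x) (o : Option (Option X)) :
    (if o = some (some v) then some (some none) else o.map (Option.map some)).map
      (·.getD (some x)) =
    if o.map (·.getD x) = some v then some none else (o.map (·.getD x)).map some := by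
  rcases o with _ | _ | a
  · simp
  · simp [hx.symm]
  · by_cases h : a = v
    · simp [h]
    · simp [h]

/-- Contractions of `none` with vertices other than `v` commute with the construction `plus`. -/
theorem ctr_plusSwap {x : X} (hx : x ≠ v) :
    ctr (some x) (plusSwap v U) = plus v (ctr x U) := by
  classical
  funext o
  rcases o with _ | y
  · rw [ctr_of_ne (by simp), plus_none, plusSwap_new, ctr_of_ne hx.symm]
    rcases U (some v) with _ | _ | a <;> rfl
  · by_cases hyv : y = v
    · subst hyv
      rw [ctr_of_ne (by simpa using hx.symm), plus_self, plusSwap_some, if_pos (.inl rfl)]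
      rfl
    · have e : plus v (ctr x U) (some y) = if ctr x U y = some v then some none
          else (ctr x U y).map some := by simp [plus, hyv]
      rw [e]
      by_cases hyx : y = x
      · subst hyx
        by_cases hc : U (some y) = some none
        · rw [ctr_self_of_child (plusSwap_some_eq.2 ⟨hyv, hc⟩), ctr_self_of_child hc,
            plusSwap_none, map_getD_aux (Ne.symm hyv)]
        · rw [ctr_self_of_ne (fun h => hc (plusSwap_some_eq.1 h).2), ctr_self_of_ne hc,
            plusSwap_some]
          simp only [hyv, false_or]
          rw [map_getD_aux (Ne.symm hyv)]
      · rw [ctr_of_ne (by simpa using hyx), ctr_of_ne hyx, plusSwap_some]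
        simp only [hyv, false_or]
        rw [map_getD_aux hx.symm]

/-- The new vertex has taken the place of `v`, so an edge between `none` and `v` becomes an edge
between `none` and the new vertex. -/
theorem ctr_plusSwap_new (hU : IsTree U)
    (h : U (some v) = some none ∨ U none = some (some v)) :
    ctr none (plusSwap v U) = plus v (ctr v U) := by
  funext o
  have h' : ∀ o : Option (Option X), o ≠ some none →
      (o.map (Option.map some)).map (·.getD none) = (o.map (·.getD v)).map some := by
    rintro (_ | _ | a) ha
    · rfl
    · exact absurd rfl ha
    · rfl
  rcases o with _ | y
  · by_cases hc : U (some v) = some none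
    · rw [ctr_self_of_child (plusSwap_new_eq.2 hc), plus_none, ctr_self_of_child hc, plusSwap_none,
        if_neg (hU.not_two_cycle hc), h' _ (hU.ne_self none)]
    · rw [ctr_self_of_ne (fun e => hc (plusSwap_new_eq.1 e)), plus_none, ctr_self_of_ne hc,
        plusSwap_new, h' _ hc]
  · rw [ctr_of_ne (by simp), plusSwap_some]
    by_cases hyv : y = v
    · subst hyv
      rw [plus_self, if_pos (.inl rfl)]
      rfl
    · have e : ctr v U y = (U (some y)).map (·.getD v) := ctr_of_ne hyv U
      rcases hy : U (some y) with _ | _ | a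
      · rw [plus_of_ne hyv (by rw [e, hy]; simp), e, hy]; simp [hyv]
      · rw [plus_of_eq (by rw [e, hy]; rfl)]; simp [hyv]
      · by_cases hav : a = v
        · subst hav
          rw [plus_of_eq (by rw [e, hy]; rfl)]; simp
        · rw [plus_of_ne hyv (by rw [e, hy]; simpa using hav), e, hy]; simp [hav, hyv]

theorem wgt_congr {Y : Type} {wh : X → Prop} {wh' : Y → Prop} {x : X} {y : Y}
    {U : Option X → Option (Option X)} {V : Option Y → Option (Option Y)}
    (h₁ : V (some y) = some none ↔ U (some x) = some none) (h₂ : OnlyChild y V ↔ OnlyChild x U)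
    (h₃ : wh' y ↔ wh x) (h₄ : V none = some (some y) ↔ U none = some (some x))
    (h₅ : Leaf V ↔ Leaf U) : wgt k wh' y V = wgt k wh x U := by
  classical
  exact congrArg₂ (· + ·)
    (if_congr h₁ (congrArg₂ _ (if_congr h₂ rfl rfl) (if_congr h₃ rfl rfl)) rfl)
    (if_congr h₄ (if_congr h₅ rfl rfl) rfl)

open Classical in
-- The contractions at an old black vertex correspond to each other, with the new vertex in the role
-- of `v`. The only discrepancy is that a white child has weight one less than a black one: if `v`
-- is white and a child of `none`, an extra term appears.
theorem ctrSum_plusSwap [Fintype X] {wh : X → Prop} {wh' : Option X → Prop} (hn : ¬ wh' none)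
    (hs : ∀ x, wh' (some x) ↔ wh x) (hU : IsTree U) (Ψ : (Option X → Option (Option X)) → k) :
    ctrSum wh' Ψ (plusSwap v U) = ctrSum wh (fun f => Ψ (plus v f)) U +
      if wh v ∧ U (some v) = some none then Ψ (plus v (ctr v U)) else 0 := by
  have hA : ∀ x, x ≠ v → wgt k wh' (some x) (plusSwap v U) * Ψ (ctr (some x) (plusSwap v U)) =
      wgt k wh x U * Ψ (plus v (ctr x U)) := by
    intro x hx
    rw [ctr_plusSwap hx]
    rw [wgt_congr (by rw [plusSwap_some_eq]; simp [hx]) (onlyChild_plusSwap hx) (hs x)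
      (plusSwap_none_eq_some hx) leaf_plusSwap]
  have hB : wgt k wh' (some v) (plusSwap v U) = 0 := by
    have h₁ : ¬ plusSwap v U (some (some v)) = some none := by simp [plusSwap_some_eq]
    simp [wgt, h₁, plusSwap_none_ne]
  have hC : wgt k wh' none (plusSwap v U) * Ψ (ctr none (plusSwap v U)) =
      wgt k wh v U * Ψ (plus v (ctr v U)) +
        if wh v ∧ U (some v) = some none then Ψ (plus v (ctr v U)) else 0 := by
    have e : wgt k wh' none (plusSwap v U) = wgt k wh v U +
        if wh v ∧ U (some v) = some none then 1 else 0 := by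
      simp only [wgt, plusSwap_new_eq, plusSwap_none_eq_new, onlyChild_plusSwap_new,
        leaf_plusSwap, hn]
      by_cases h₁ : U (some v) = some none <;> by_cases h₂ : wh v <;> simp [h₁, h₂]
      ring
    by_cases h : U (some v) = some none ∨ U none = some (some v)
    · rw [ctr_plusSwap_new hU h, e, add_mul, ite_mul, one_mul, zero_mul]
    · push Not at h
      have h₀ : wgt k wh v U = 0 := by simp [wgt, h.1, h.2]
      rw [e, h₀]
      simp [h.1]
  rw [ctrSum, Fintype.sum_option, hC, ctrSum, add_right_comm]
  congr 1
  rw [Fintype.sum_eq_add_sum_compl v, hB, zero_mul, zero_add, Fintype.sum_eq_add_sum_compl v]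
  congr 1
  exact Finset.sum_congr rfl fun x hx => hA x (by simpa using hx)

/-- When `v` is a child of `none`, the new vertex is one too. Merging it with `none` gives the same
tree as first merging `v` with `none` and then applying `plus`. This identifies the extra term of
`ctrSum_plusSwap` with a contraction at the new vertex. -/
theorem ctr_none_plus (hU : IsTree U) (h : U (some v) = some none) :
    ctr none (plus (some v) U) = plus v (ctr v U) := by
  classical
  have hn : plus (some v) U none = some (some none) := by rw [plus_none, h]; rfl
  have hnn : U none ≠ some (some v) := hU.not_two_cycle h
  have hx : ∀ o, ctr none (plus (some v) U) o = (plus (some v) U (some o)).map (·.getD none) := by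
    intro o
    by_cases ho : o = none
    · subst ho
      refine ctr_self_of_ne ?_
      rw [plus_of_ne (by simp) hnn]
      rcases U none with _ | a <;> simp
    · exact ctr_of_ne ho _
  have h' : ∀ o : Option (Option X), o ≠ some none →
      (o.map some).map (·.getD none) = (o.map (·.getD v)).map some := by
    rintro (_ | _ | a) ha
    · rfl
    · exact absurd rfl ha
    · rfl
  funext o
  rw [hx]
  rcases o with _ | y
  · rw [plus_of_ne (by simp) hnn, plus_none, ctr_self_of_child h, h' _ (hU.ne_self none)]
  · by_cases hyv : y = v
    · subst hyv
      rw [plus_self, plus_self]; rfl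
    · have e : ctr v U y = (U (some y)).map (·.getD v) := ctr_of_ne hyv U
      by_cases hy : U (some y) = some (some v)
      · rw [plus_of_eq hy, plus_of_eq (by rw [e, hy]; rfl)]; rfl
      · rw [plus_of_ne (by simpa using hyv) hy]
        by_cases hy' : U (some y) = some none
        · rw [plus_of_eq (by rw [e, hy']; rfl), hy']; rfl
        · rw [plus_of_ne hyv, e, h' _ hy']
          rw [e]
          rcases hU' : U (some y) with _ | _ | a
          · simp
          · exact absurd hU' hy'
          · rintro h
            exact hy (by rw [hU']; simpa using h)

end

end ParentFun

/-! ### The contracting homotopy at an input -/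

namespace ParentFun

open OperadData

variable {k : Type u} [Field k] {X : Type}

theorem plus_ne {v : X} {T : X → Option X} (hv : T v ≠ some v) (o : Option X) :
    plus v T o ≠ some (some v) := by
  rcases o with _ | y
  · rw [plus_none]
    rcases h : T v with _ | a
    · simp
    · rintro e
      rw [h] at hv
      exact hv (by simpa using e)
  · by_cases hy : y = v
    · subst hy; rw [plus_self]; simp
    by_cases hT : T y = some v
    · rw [plus_of_eq hT]; simp
    · rw [plus_of_ne hy hT]
      rcases h : T y with _ | a
      · simp
      · rintro e
        rw [h] at hT
        exact hT (by simpa using e)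

theorem plus_some_eq {v : X} {T : X → Option X} {y : X} :
    plus v T (some y) = some none ↔ y = v ∨ T y = some v := by
  simp only [plus]
  split_ifs with h
  · simp [h]
  · simp [h]

theorem plus_none_eq {v : X} {T : X → Option X} {x : X} :
    plus v T none = some (some x) ↔ T v = some x := by
  rw [plus_none]
  rcases T v with _ | a <;> simp

theorem not_leaf_plus (v : X) (T : X → Option X) : ¬ Leaf (plus v T) :=
  fun h => h v (plus_self v T)

theorem onlyChild_plus {v : X} {T : X → Option X} {x : X} :
    OnlyChild x (plus v T) ↔ x = v ∧ T v = none ∧ ∀ y, T y = some v → y = v := by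
  constructor
  · rintro ⟨h₀, h₁, h₂⟩
    obtain rfl := h₂ v (plus_self v T)
    refine ⟨rfl, by simpa [plus_none] using h₀, fun y hy => h₂ y (plus_of_eq hy)⟩
  · rintro ⟨rfl, h₀, h₂⟩
    refine ⟨by simp [plus_none, h₀], plus_self _ _, fun y hy => ?_⟩
    rcases plus_some_eq.1 hy with h | h
    · exact h
    · exact h₂ y h

theorem ctr_plus_ne {v : X} {T : X → Option X} (hv : T v ≠ some v) {x : X} (hx : x ≠ v) (y : X) :
    ctr x (plus v T) y ≠ some v := by
  have h : ∀ o, (plus v T o).map (·.getD x) ≠ some v := by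
    intro o
    have := plus_ne hv o
    generalize plus v T o = p at this ⊢
    rcases p with _ | _ | a
    · simp
    · simpa using hx
    · simpa using this
  simp only [ctr]
  split_ifs <;> exact h _

/-- A vertex of a tree which is the root and has no children is the only vertex. -/
theorem _root_.IsTree.eq_of_root_of_leaf {T : X → Option X} (hT : IsTree T) {v : X}
    (hv : T v = none) (hl : ∀ y, T y ≠ some v) (y : X) : y = v := by
  obtain ⟨⟨r, hr, hru⟩, d, hd⟩ := id hT
  have hru : ∀ y, T y = none → y = r := hru
  have h : ∀ n y, d y ≤ n → y = v := by
    intro n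
    induction n with
    | zero =>
      intro y hy
      rcases h : T y with _ | z
      · rw [hru y h, hru v hv]
      · have := hd _ _ h
        omega
    | succ n ih =>
      intro y hy
      rcases h : T y with _ | z
      · rw [hru y h, hru v hv]
      · have := hd _ _ h
        exact absurd (h.trans (congrArg some (ih z (by omega)))) (hl y)
  exact h _ y le_rfl

open Classical in
/-- The contractions of `plus v T` at the new vertex, for a function that vanishes where `v` is a
leaf attached to an input. -/
theorem ctrSum_plus [Fintype X] {wh : X → Prop} {v : X} (hv : wh v) {T : X → Option X}
    (hT : IsTree T) (hne : ∃ y, y ≠ v) {χ : (X → Option X) → k}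
    (hχ : ∀ g x, g v = some x → wh x → (∀ y, g y ≠ some v) → χ g = 0) :
    ctrSum wh χ (plus v T) =
      - χ T + ∑ x, if T v = some x ∧ ¬ wh x then χ (ctr x (plus v T)) else 0 := by
  have hvv := hT.ne_self v
  -- Otherwise `v` would be a root without children in `T`, hence the only vertex; this is where the
  -- second vertex is needed.
  have hoc : ∀ x, ¬ OnlyChild x (plus v T) := by
    intro x hx
    obtain ⟨rfl, h₀, h₂⟩ := onlyChild_plus.1 hx
    obtain ⟨y, hy⟩ := hne
    refine hy (hT.eq_of_root_of_leaf h₀ (fun z hz => ?_) y)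
    obtain rfl := h₂ z hz
    exact hvv hz
  have h₁ : wgt k wh v (plus v T) * χ (ctr v (plus v T)) = - χ T := by
    rw [ctr_plus_self hvv]
    simp [wgt, plus_self, plus_none_eq, hvv, hoc, hv]
  have h₂ : ∀ x, x ≠ v → wgt k wh x (plus v T) * χ (ctr x (plus v T)) =
      if T v = some x ∧ ¬ wh x then χ (ctr x (plus v T)) else 0 := by
    intro x hx
    by_cases hw : wh x
    · have : χ (ctr x (plus v T)) = 0 := by
        refine hχ _ x ?_ hw (ctr_plus_ne hvv hx)
        rw [ctr_of_ne (Ne.symm hx), plus_self]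
        rfl
      simp [this]
    · by_cases hx' : T v = some x
      · simp [wgt, plus_some_eq, plus_none_eq, hoc, hw, not_leaf_plus, hx']
      · simp [wgt, plus_some_eq, plus_none_eq, hoc, hw, hx']
  rw [ctrSum, Fintype.sum_eq_add_sum_compl v, h₁, Fintype.sum_eq_add_sum_compl v]
  simp only [hv, not_true, and_false, if_false, zero_add]
  congr 1
  exact Finset.sum_congr rfl fun x hx => h₂ x (by simpa using hx)

section

variable {I : Type} {m : ℕ}

theorem pick_zero : pick I (0 : Fin (m + 1)) = (Tw.optE I m).symm := by
  ext x
  rcases x with x | x <;> simp [pick, permR]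

@[simp] theorem pick_inl (p : Fin (m + 1)) (i : I) : pick I p (.inl i) = some (.inl i) := rfl

@[simp] theorem pick_symm_none (p : Fin (m + 1)) : (pick I p).symm none = .inr p :=
  congrArg Sum.inr (Equiv.swap_apply_left 0 p)

theorem pick_self (p : Fin (m + 1)) : pick I p (.inr p) = none := by
  rw [← Equiv.eq_symm_apply, pick_symm_none]

theorem white_pick_symm (p : Fin (m + 1)) (x : I ⊕ Fin m) :
    White ((pick I p).symm (some x)) ↔ White x := by
  rcases x with x | x <;> rfl

theorem not_white_pick_symm_none (p : Fin (m + 1)) : ¬ White ((pick I p).symm none) := by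
  rw [pick_symm_none]; simp [White]

/-- The new vertex is the black label `0`. Choosing the old label `q` there, now `q.succ`, means
choosing `q` first, then exchanging it with the new vertex, which inherits the label `q`. -/
theorem optE_trans_pick_succ (q : Fin (m + 1)) :
    (Tw.optE I (m + 1)).trans (pick I q.succ) =
      ((Equiv.optionCongr (pick I q)).trans (swapOpt (I ⊕ Fin m))).trans
        (Equiv.optionCongr (pick I q).symm) := by
  refine Equiv.ext fun o => ?_
  rcases o with _ | x | j
  · have h : pick I q.succ (.inr 0) = some (.inr q) := by
      change (Tw.optE I (m + 1)).symm (.inr (Equiv.swap 0 q.succ 0)) = _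
      rw [Equiv.swap_apply_left]
      rfl
    exact h.trans (congrArg some (pick_symm_none q).symm)
  · rfl
  · by_cases hj : j = q
    · subst hj
      have h : ((Equiv.optionCongr (pick I j)).trans (swapOpt (I ⊕ Fin m)))
          (some (Sum.inr j)) = none := by
        change swapOpt _ (some (pick I j (Sum.inr j))) = _
        rw [pick_self]; rfl
      exact (pick_self j.succ).trans (by rw [Equiv.trans_apply, h]; rfl)
    · have h₁ : pick I q.succ (.inr j.succ) = some (.inr j) := by
        change (Tw.optE I (m + 1)).symm (.inr (Equiv.swap 0 q.succ j.succ)) = _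
        rw [Equiv.swap_apply_of_ne_of_ne (Fin.succ_ne_zero j)
          (fun e => hj (Fin.succ_injective _ e))]
        rfl
      obtain ⟨z, hz⟩ : ∃ z, pick I q (.inr j) = some z := by
        rcases h : pick I q (.inr j) with _ | z
        · rw [← Equiv.eq_symm_apply, pick_symm_none] at h
          exact absurd (Sum.inr.inj h) hj
        · exact ⟨z, rfl⟩
      have h₂ : ((Equiv.optionCongr (pick I q)).trans (swapOpt (I ⊕ Fin m)))
          (some (Sum.inr j)) = some (some z) := by
        change swapOpt _ (some (pick I q (Sum.inr j))) = _
        rw [hz]; rfl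
      refine h₁.trans ?_
      rw [Equiv.trans_apply, h₂]
      exact congrArg some (by rw [Equiv.eq_symm_apply, hz])

theorem antisymm_pick_symm [Fintype I] {χ : (I ⊕ Fin (m + 1) → Option (I ⊕ Fin (m + 1))) → k} (hχ : Antisymm χ)
    (q : Fin (m + 1)) (g : Option (I ⊕ Fin m) → Option (Option (I ⊕ Fin m))) :
    χ (map (pick I q).symm g) = (if q = 0 then 1 else -1) * χ (map (Tw.optE I m) g) := by
  have h : (pick I q).symm = (Tw.optE I m).trans (permR I (Equiv.swap 0 q)) := by
    ext x
    simp [pick, permR]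
  rw [h, ← map_map, hχ]
  congr 1
  split_ifs with hq
  · subst hq; simp
  · rw [Equiv.Perm.sign_swap (Ne.symm hq)]; simp

open Classical in
-- `ctrSum_plusSwap` in terms of numbered black vertices: antisymmetry turns the label `q` of the
-- new vertex back into the label `0`, which accounts for the sign.
theorem ctrSum_pick_succ_plus [Fintype I] {χ : (I ⊕ Fin (m + 1) → Option (I ⊕ Fin (m + 1))) → k}
    (hχ : Antisymm χ) {q : Fin (m + 1)} {v : I ⊕ Fin (m + 1)} {v' : I ⊕ Fin m}
    (hv : pick I q v = some v') {T : I ⊕ Fin (m + 1) → Option (I ⊕ Fin (m + 1))} (hT : IsTree T) :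
    ctrSum White χ (map (pick I q.succ) (map (Tw.optE I (m + 1)) (plus v T))) =
      (if q = 0 then 1 else -1) *
        ctrSum White (fun f => χ (map (Tw.optE I m) (plus v' f))) (map (pick I q) T) +
      if White v' ∧ T v = some (.inr q) then χ (ctr (.inr q) (plus v T)) else 0 := by
  have h₁ : map (pick I q.succ) (map (Tw.optE I (m + 1)) (plus v T)) =
      map (Equiv.optionCongr (pick I q).symm) (plusSwap v' (map (pick I q) T)) := by
    rw [map_map, optE_trans_pick_succ, plusSwap, ← hv, ← map_plus, map_map, map_map,
      Equiv.trans_assoc]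
  have h₂ : map (pick I q) T (some v') = some none ↔ T v = some (.inr q) := by
    rw [← hv, map_apply, ← pick_self q]
    rcases T v with _ | a <;> simp
  rw [h₁, ctrSum_map, ctrSum_plusSwap (not_white_pick_symm_none q) (white_pick_symm q)
    (isTree_map _ hT)]
  congr 1
  · simp only [Function.comp_apply, antisymm_pick_symm hχ, ctrSum, Finset.mul_sum]
    exact Finset.sum_congr rfl fun x _ => by ring
  · by_cases h : T v = some (.inr q)
    · simp only [h, h₂.2 h, and_true]
      congr 1
      rw [Function.comp_apply, ← ctr_none_plus (isTree_map _ hT) (h₂.2 h), map_ctr, pick_symm_none,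
        map_plus, map_map, Equiv.self_trans_symm, map_refl, ← hv, Equiv.symm_apply_apply]
    · simp [h, mt h₂.1 h]

/-- The homotopy, for a function that vanishes where the input `i` is a leaf attached to an
input. -/
theorem diff_plus [Fintype I] {χ : (I ⊕ Fin (m + 1) → Option (I ⊕ Fin (m + 1))) → k}
    (hχ : Antisymm χ) (i : I)
    (hW : ∀ g x, g (.inl i) = some (.inl x) → (∀ y, g y ≠ some (.inl i)) → χ g = 0)
    {T : I ⊕ Fin (m + 1) → Option (I ⊕ Fin (m + 1))} (hT : IsTree T) :
    diff χ (map (Tw.optE I (m + 1)) (plus (.inl i) T)) =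
      - χ T - diff (fun f => χ (map (Tw.optE I m) (plus (.inl i) f))) T := by
  classical
  have h : ∀ q : Fin (m + 1), (if q.succ = 0 then 1 else -1) *
      ctrSum White χ (map (pick I q.succ) (map (Tw.optE I (m + 1)) (plus (.inl i) T))) =
      - ((if q = 0 then 1 else -1) * ctrSum White
        (fun f => χ (map (Tw.optE I m) (plus (.inl i) f))) (map (pick I q) T)) -
      if T (.inl i) = some (.inr q) then χ (ctr (.inr q) (plus (.inl i) T)) else 0 := by
    intro q
    rw [ctrSum_pick_succ_plus hχ (pick_inl q i) hT, if_neg (Fin.succ_ne_zero q)]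
    simp only [White, Sum.isLeft_inl, true_and]
    ring
  have h₀ : map (pick I 0) (map (Tw.optE I (m + 1)) (plus (.inl i) T)) = plus (.inl i) T := by
    rw [pick_zero, map_map, Equiv.self_trans_symm, map_refl]
  -- The summand `0` contracts at the new vertex and gives `-χ T` and the contraction into a black
  -- parent of the input; the latter cancels the corrections in `h` for the old black vertices. A
  -- second vertex of `T` exists because there is at least one black label.
  rw [diff, Fin.sum_univ_succ]
  simp only [h]
  rw [Finset.sum_sub_distrib, Finset.sum_neg_distrib, if_pos trivial, one_mul, h₀,
    ctrSum_plus (wh := White) (v := .inl i) rfl hT ⟨.inr 0, by simp⟩, Fintype.sum_sum_type]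
  · simp only [White, Sum.isLeft_inl, Sum.isLeft_inr, not_true, and_false, if_false,
      Finset.sum_const_zero, zero_add, Bool.false_eq_true, not_false_eq_true, and_true]
    rw [diff]
    ring
  · rintro g (x | x) h₁ h₂ h₃
    · exact hW g x h₁ h₃
    · simp [White] at h₂

/-- Without black vertices only the contractions at the new one remain. Another input must be
present: for a single vertex the weights of white and of only child cancel and the left-hand side is
zero. -/
theorem diff_plus_zero [Fintype I] {χ : (I ⊕ Fin 0 → Option (I ⊕ Fin 0)) → k} (i : I)
    (hne : ∃ j, j ≠ i)
    (hW : ∀ g x, g (.inl i) = some (.inl x) → (∀ y, g y ≠ some (.inl i)) → χ g = 0)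
    {T : I ⊕ Fin 0 → Option (I ⊕ Fin 0)} (hT : IsTree T) :
    diff χ (map (Tw.optE I 0) (plus (.inl i) T)) = - χ T := by
  classical
  have h₀ : map (pick I 0) (map (Tw.optE I 0) (plus (.inl i) T)) = plus (.inl i) T := by
    rw [pick_zero, map_map, Equiv.self_trans_symm, map_refl]
  obtain ⟨j, hj⟩ := hne
  rw [diff, Fin.sum_univ_succ, Finset.univ_eq_empty, Finset.sum_empty, add_zero, if_pos rfl,
    one_mul, h₀, ctrSum_plus (wh := White) (v := .inl i) rfl hT ⟨.inl j, by simpa using hj⟩,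
    Fintype.sum_sum_type]
  · simp [White]
  · rintro g (x | x) h₁ h₂ h₃
    · exact hW g x h₁ h₃
    · exact x.elim0

theorem optionCongr_permR_trans_optE (σ : Equiv.Perm (Fin m)) :
    (Equiv.optionCongr (permR I σ)).trans (Tw.optE I m) =
      (Tw.optE I m).trans (permR I (Equiv.Perm.decomposeFin.symm (0, σ))) := by
  refine Equiv.ext fun o => ?_
  rcases o with _ | x | j
  · exact congrArg Sum.inr (by simp)
  · rfl
  · exact congrArg Sum.inr (by simp)

theorem antisymm_plus {χ : (I ⊕ Fin (m + 1) → Option (I ⊕ Fin (m + 1))) → k}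
    (hχ : Antisymm χ) (i : I) : Antisymm fun f => χ (map (Tw.optE I m) (plus (.inl i) f)) := by
  intro σ f
  have e : plus (.inl i) (map (permR I σ) f) = map (Equiv.optionCongr (permR I σ))
      (plus (.inl i) f) := (map_plus (permR I σ) (.inl i) f).symm
  simp only [e]
  rw [map_map, optionCongr_permR_trans_optE, ← map_map, hχ, Equiv.Perm.decomposeFin.symm_sign]
  simp

end

end ParentFun

/-! ### Acyclicity in arity zero -/

namespace ParentFun

open OperadData

variable {k : Type u} [Field k] {X : Type}

/-- The vertex `v` has no children. -/
def IsLeaf (f : X → Option X) (v : X) : Prop := ∀ y, f y ≠ some v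

theorem isLeaf_map {Y : Type} (e : X ≃ Y) (f : X → Option X) (v : X) :
    IsLeaf (map e f) (e v) ↔ IsLeaf f v := by
  simp only [IsLeaf, e.surjective.forall, map_apply]
  refine forall_congr' fun y => not_congr ?_
  rcases f y with _ | a <;> simp

/-- The number of leaves. -/
noncomputable def numLeaves [Fintype X] (f : X → Option X) : ℕ := {v | IsLeaf f v}.ncard

theorem numLeaves_map [Fintype X] {Y : Type} [Fintype Y] (e : X ≃ Y) (f : X → Option X) :
    numLeaves (map e f) = numLeaves f := by
  have h : {v | IsLeaf (map e f) v} = e '' {v | IsLeaf f v} := by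
    ext v
    obtain ⟨v, rfl⟩ := e.surjective v
    simp [isLeaf_map]
  rw [numLeaves, h, Set.ncard_image_of_injective _ e.injective, numLeaves]

theorem numLeaves_ne_zero [Fintype X] {f : X → Option X} (hf : IsTree f) : numLeaves f ≠ 0 := by
  obtain ⟨⟨r, _, _⟩, d, hd⟩ := hf
  have : Nonempty X := ⟨r⟩
  obtain ⟨v, hv⟩ := Finite.exists_max d
  have hl : IsLeaf f v := fun y hy => absurd (hd y v hy) (not_lt.2 (hv y))
  exact Set.ncard_ne_zero_of_mem (a := v) hl

/-- Above the black leaf `v` there is now a vertex with the single child `v`. It can be absorbed by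
its parent, or by `v` if it is the root; exactly one of these has weight `1`, and both give back
`T`. -/
theorem ctrSum_plus_leaf [Fintype X] {wh : X → Prop} (hw : ∀ x, ¬ wh x) {v : X} {T : X → Option X}
    (hT : IsTree T) (hv : IsLeaf T v) (χ : (X → Option X) → k) :
    ctrSum wh χ (plus v T) = χ T := by
  classical
  rcases hp : T v with _ | p
  · have hx := hT.eq_of_root_of_leaf hp hv
    have hoc : OnlyChild v (plus v T) := onlyChild_plus.2 ⟨rfl, hp, fun y _ => hx y⟩
    rw [ctrSum, Fintype.sum_eq_single v fun x h => absurd (hx x) h, ctr_plus_self (hv v)]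
    simp [wgt, hoc, plus_self, hw, plus_none, hp]
  · have hpv : p ≠ v := by rintro rfl; exact hv _ hp
    have hoc : ∀ x, ¬ OnlyChild x (plus v T) := fun x hx => by
      have := (onlyChild_plus.1 hx).2.1
      simp [hp] at this
    have hc : ctr p (plus v T) = T := by
      have h₀ : plus v T (some p) ≠ some none := by
        rw [Ne, plus_some_eq]
        exact fun h => h.elim hpv (hv p)
      have h₁ : ∀ y, ctr p (plus v T) y = (plus v T (some y)).map (·.getD p) := fun y => by
        by_cases hy : y = p
        · subst hy; exact ctr_self_of_ne h₀
        · exact ctr_of_ne hy _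
      funext y
      rw [h₁]
      by_cases hy : y = v
      · subst hy; rw [plus_self, hp]; rfl
      · rw [plus_of_ne hy (hv y)]
        rcases T y with _ | a <;> rfl
    rw [ctrSum, Fintype.sum_eq_single p, hc]
    · simp [wgt, hoc, hw, plus_none_eq, hp, not_leaf_plus]
    · intro x hx
      simp [wgt, hoc, hw, plus_none_eq, hp, Ne.symm hx]

/-- If all vertices are black, a contraction of nonzero weight merges `none` with its parent when
`none` is not a leaf, or with its only child when `none` is the root. Neither creates nor destroys
leaves. -/
theorem isLeaf_ctr {wh : X → Prop} (hw : ∀ x, ¬ wh x) {U : Option X → Option (Option X)}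
    (hU : IsTree U) {x : X} (hx : wgt k wh x U ≠ 0) :
    ¬ IsLeaf U none ∧ ∀ v, IsLeaf (ctr x U) v ↔ IsLeaf U (some v) := by
  classical
  by_cases hoc : OnlyChild x U
  · obtain ⟨h₀, h₁, h₂⟩ := hoc
    refine ⟨fun h => h _ h₁, fun v => ?_⟩
    constructor
    · rintro h (_ | y) hy
      · simp [h₀] at hy
      · have hyx : y ≠ x := by rintro rfl; simp [h₁] at hy
        exact h y (by rw [ctr_of_ne hyx, hy]; rfl)
    · intro h y hy
      by_cases hyx : y = x
      · subst hyx
        rw [ctr_self_of_child h₁, h₀] at hy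
        simp at hy
      · rw [ctr_of_ne hyx] at hy
        rcases hUy : U (some y) with _ | _ | a
        · simp [hUy] at hy
        · exact hyx (h₂ y hUy)
        · refine h (some y) ?_
          rw [hUy] at hy ⊢
          simpa using hy
  · have h : U none = some (some x) ∧ ¬ Leaf U := by
      by_contra h
      apply hx
      simp only [wgt, hoc, hw]
      by_cases h' : U none = some (some x)
      · have : Leaf U := by
          by_contra h''
          exact h ⟨h', h''⟩
        simp [this]
      · simp [h']
    obtain ⟨h₀, hl⟩ := h
    obtain ⟨c, hc⟩ : ∃ c, U (some c) = some none := by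
      simpa [Leaf] using hl
    have h₁ : U (some x) ≠ some none := hU.not_two_cycle h₀
    have h₂ : ∀ y, ctr x U y = (U (some y)).map (·.getD x) := fun y => by
      by_cases hy : y = x
      · subst hy; exact ctr_self_of_ne h₁
      · exact ctr_of_ne hy _
    refine ⟨fun h => h _ hc, fun v => ?_⟩
    by_cases hv : v = x
    · subst hv
      refine iff_of_false (fun h => h c ?_) (fun h => h _ h₀)
      rw [h₂, hc]; rfl
    · constructor
      · rintro h (_ | y) hy
        · rw [h₀] at hy
          exact hv (by simpa using hy.symm)
        · exact h y (by rw [h₂, hy]; rfl)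
      · intro h y hy
        rw [h₂] at hy
        rcases hUy : U (some y) with _ | _ | a
        · simp [hUy] at hy
        · rw [hUy] at hy
          exact hv (by simpa using hy.symm)
        · refine h (some y) ?_
          rw [hUy] at hy ⊢
          simpa using hy

theorem numLeaves_ctr [Fintype X] {wh : X → Prop} (hw : ∀ x, ¬ wh x)
    {U : Option X → Option (Option X)} (hU : IsTree U) {x : X} (hx : wgt k wh x U ≠ 0) :
    numLeaves (ctr x U) = numLeaves U := by
  obtain ⟨h₀, h₁⟩ := isLeaf_ctr hw hU hx
  have h : {v | IsLeaf U v} = some '' {v | IsLeaf (ctr x U) v} := by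
    ext o
    rcases o with _ | v
    · simp [h₀]
    · simp [h₁]
  rw [numLeaves, numLeaves, h, Set.ncard_image_of_injective _ (Option.some_injective _)]

section

variable {I : Type} {m : ℕ}

theorem not_white [IsEmpty I] (x : I ⊕ Fin m) : ¬ White x := by
  rcases x with x | x
  · exact isEmptyElim x
  · simp [White]

variable [Fintype I]

/-- The chosen vertex `q` hangs as a leaf from the new vertex: it has no children, and the edge from
a leaf to its parent has weight zero. -/
theorem ctrSum_pick_succ_plus_leaf (χ : (I ⊕ Fin (m + 1) → Option (I ⊕ Fin (m + 1))) → k)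
    {q : Fin (m + 1)} {T : I ⊕ Fin (m + 1) → Option (I ⊕ Fin (m + 1))} (hT : IsTree T) :
    ctrSum White χ (map (pick I q.succ) (map (Tw.optE I (m + 1)) (plus (.inr q) T))) = 0 := by
  classical
  rw [map_map]
  set e := (Tw.optE I (m + 1)).trans (pick I q.succ) with he
  have h₁ : e (some (.inr q)) = none := pick_self q.succ
  have hl : Leaf (map e (plus (.inr q) T)) := by
    intro y
    obtain ⟨o, ho⟩ := e.surjective (some y)
    have h := plus_ne (hT.ne_self (.inr q)) o
    rw [← ho, map_apply, ← h₁]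
    generalize plus (.inr q) T o = p at h ⊢
    rcases p with _ | a
    · simp
    · simpa using h
  refine Finset.sum_eq_zero fun x _ => ?_
  simp [wgt, hl, hl x]

open Classical in
-- Each leaf contributes `χ T` by the contractions at the new vertex. The contractions at the old
-- vertices commute with the sum over leaves, because they preserve the set of leaves by
-- `isLeaf_ctr`.
theorem sum_diff_plus [IsEmpty I] {χ : (I ⊕ Fin (m + 1) → Option (I ⊕ Fin (m + 1))) → k}
    (hχ : Antisymm χ) {T : I ⊕ Fin (m + 1) → Option (I ⊕ Fin (m + 1))} (hT : IsTree T) :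
    (∑ v, if IsLeaf T v then diff χ (map (Tw.optE I (m + 1)) (plus v T)) else 0) =
      numLeaves T * χ T -
        diff (fun f => ∑ v, if IsLeaf f v then χ (map (Tw.optE I m) (plus v f)) else 0) T := by
  have h₁ : ∀ v, IsLeaf T v → diff χ (map (Tw.optE I (m + 1)) (plus v T)) = χ T -
      ∑ q : Fin (m + 1), ctrSum White χ (map (pick I q.succ)
        (map (Tw.optE I (m + 1)) (plus v T))) := by
    intro v hv
    rw [diff, Fin.sum_univ_succ, if_pos rfl, one_mul, pick_zero, map_map, Equiv.self_trans_symm,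
      map_refl, ctrSum_plus_leaf not_white hT hv, sub_eq_add_neg, ← Finset.sum_neg_distrib]
    congr 1
    exact Finset.sum_congr rfl fun q _ => by rw [if_neg (Fin.succ_ne_zero q)]; ring
  have h₂ : ∀ q : Fin (m + 1), (∑ v, if IsLeaf T v then ctrSum White χ (map (pick I q.succ)
        (map (Tw.optE I (m + 1)) (plus v T))) else 0) = (if q = 0 then 1 else -1) *
      ctrSum White (fun f => ∑ v, if IsLeaf f v then χ (map (Tw.optE I m) (plus v f)) else 0)
        (map (pick I q) T) := by
    intro q
    have hU := isTree_map (pick I q) hT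
    rw [← Equiv.sum_comp (pick I q).symm, Fintype.sum_option, pick_symm_none,
      ctrSum_pick_succ_plus_leaf χ hT, ite_self, zero_add]
    have h : ∀ v', (if IsLeaf T ((pick I q).symm (some v')) then ctrSum White χ
        (map (pick I q.succ) (map (Tw.optE I (m + 1)) (plus ((pick I q).symm (some v')) T)))
        else 0) = (if q = 0 then 1 else -1) * ∑ x, wgt k White x (map (pick I q) T) *
          if IsLeaf (ctr x (map (pick I q) T)) v' then
            χ (map (Tw.optE I m) (plus v' (ctr x (map (pick I q) T)))) else 0 := by
      intro v'
      have hl : IsLeaf T ((pick I q).symm (some v')) ↔ IsLeaf (map (pick I q) T) (some v') := by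
        rw [← isLeaf_map (pick I q), Equiv.apply_symm_apply]
      have h' : ∀ x, (wgt k White x (map (pick I q) T) *
          if IsLeaf (ctr x (map (pick I q) T)) v' then
            χ (map (Tw.optE I m) (plus v' (ctr x (map (pick I q) T)))) else 0) =
          if IsLeaf (map (pick I q) T) (some v') then wgt k White x (map (pick I q) T) *
            χ (map (Tw.optE I m) (plus v' (ctr x (map (pick I q) T)))) else 0 := by
        intro x
        by_cases hx : wgt k White x (map (pick I q) T) = 0
        · simp [hx]
        · have := (isLeaf_ctr not_white hU hx).2 v'
          by_cases hl' : IsLeaf (map (pick I q) T) (some v')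
          · simp [hl', this.2 hl']
          · simp [hl', mt this.1 hl']
      simp only [h']
      by_cases hl' : IsLeaf (map (pick I q) T) (some v')
      · rw [if_pos (hl.2 hl'), ctrSum_pick_succ_plus hχ (Equiv.apply_symm_apply _ _) hT,
          if_neg (fun h : White v' ∧ _ => not_white _ h.1), add_zero]
        simp [hl', ctrSum]
      · simp [hl', mt hl.1 hl']
    simp only [h]
    rw [← Finset.mul_sum, Finset.sum_comm]
    simp only [ctrSum, Finset.mul_sum]
  have h₃ : ∀ v, (if IsLeaf T v then diff χ (map (Tw.optE I (m + 1)) (plus v T)) else 0) =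
      (if IsLeaf T v then χ T else 0) - ∑ q : Fin (m + 1), if IsLeaf T v then
        ctrSum White χ (map (pick I q.succ) (map (Tw.optE I (m + 1)) (plus v T))) else 0 := by
    intro v
    by_cases hv : IsLeaf T v
    · simp [hv, h₁ v hv]
    · simp [hv]
  simp only [h₃]
  rw [Finset.sum_sub_distrib, Finset.sum_comm (t := (Finset.univ : Finset (Fin (m + 1))))]
  simp only [h₂]
  rw [diff]
  congr 1
  rw [← Finset.sum_filter, Finset.sum_const, nsmul_eq_mul, numLeaves,
    Set.ncard_eq_toFinset_card', Set.toFinset_ofPred]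

/-- The differential respects the decomposition of functions by the number of leaves. -/
theorem diff_div_numLeaves [IsEmpty I] (χ : (I ⊕ Fin m → Option (I ⊕ Fin m)) → k)
    {T : I ⊕ Fin (m + 1) → Option (I ⊕ Fin (m + 1))} (hT : IsTree T) :
    diff (fun f => χ f / numLeaves f) T = diff χ T / numLeaves T := by
  rw [diff, diff, Finset.sum_div]
  refine Finset.sum_congr rfl fun p _ => ?_
  rw [mul_div_assoc, ctrSum, ctrSum, Finset.sum_div]
  congr 1
  refine Finset.sum_congr rfl fun x _ => ?_
  by_cases hx : wgt k White x (map (pick I p) T) = 0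
  · simp [hx]
  · rw [numLeaves_ctr not_white (isTree_map _ hT) hx, numLeaves_map, mul_div_assoc]

open Classical in
theorem antisymm_sum_plus {χ : (I ⊕ Fin (m + 1) → Option (I ⊕ Fin (m + 1))) → k}
    (hχ : Antisymm χ) :
    Antisymm fun f => ∑ v, if IsLeaf f v then χ (map (Tw.optE I m) (plus v f)) else 0 := by
  intro σ f
  simp only
  rw [← Equiv.sum_comp (permR I σ), Finset.mul_sum]
  refine Finset.sum_congr rfl fun v _ => ?_
  rw [← map_plus, map_map, optionCongr_permR_trans_optE, ← map_map, hχ,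
    Equiv.Perm.decomposeFin.symm_sign, if_pos rfl, one_mul, mul_ite, mul_zero]
  exact if_congr (isLeaf_map _ _ _) rfl rfl

/-- The complex of operations of arity zero is acyclic. -/
theorem exists_diff_eq_of_isEmpty [CharZero k] [IsEmpty I]
    {φ : (I ⊕ Fin (m + 1) → Option (I ⊕ Fin (m + 1))) → k} (hφ : Antisymm φ)
    (hd : ∀ f, IsTree f → diff φ f = 0) :
    ∃ ψ : (I ⊕ Fin m → Option (I ⊕ Fin m)) → k, Antisymm ψ ∧ ∀ f, IsTree f → diff ψ f = φ f := by
  classical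
  have hφ' : Antisymm fun f => φ f / numLeaves f := by
    intro σ f
    simp only [hφ σ f, numLeaves_map, mul_div_assoc]
  -- The homotopy is applied to `φ` divided by the number of leaves, which is still a cycle; this
  -- compensates the factor in `sum_diff_plus`.
  refine ⟨_, antisymm_sum_plus hφ', fun T hT => ?_⟩
  have h := sum_diff_plus hφ' hT
  rw [Finset.sum_eq_zero, eq_comm, sub_eq_zero] at h
  · rw [← h, mul_div_cancel₀]
    exact_mod_cast numLeaves_ne_zero hT
  · intro v _
    have hp := isTree_map (Tw.optE I (m + 1)) (isTree_plus v hT)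
    rw [diff_div_numLeaves _ hp, hd _ hp, zero_div, ite_self]

end

end ParentFun

/-! ### Induction on the arity: acyclicity in negative degrees -/

namespace ParentFun

open OperadData

variable {k : Type u} [Field k] {X : Type}

/-- A new leaf `none` is attached to the vertex `w`. -/
def addLeaf (w : X) (T : X → Option X) : Option X → Option (Option X)
  | none => some (some w)
  | some y => (T y).map some

theorem map_addLeaf {Y : Type} (e : X ≃ Y) (w : X) (T : X → Option X) :
    map (Equiv.optionCongr e) (addLeaf w T) = addLeaf (e w) (map e T) := by
  funext o
  rcases o with _ | y
  · rw [map_optionCongr_none]; rfl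
  · obtain ⟨y, rfl⟩ := e.surjective y
    rw [map_optionCongr_some, addLeaf, addLeaf, map_apply]
    rcases T y with _ | a <;> rfl

theorem isTree_addLeaf {w : X} {T : X → Option X} : IsTree (addLeaf w T) ↔ IsTree T := by
  constructor
  · rintro ⟨⟨r, hr, hru⟩, d, hd⟩
    have hru : ∀ y, addLeaf w T y = none → y = r := hru
    rcases r with _ | r
    · simp [addLeaf] at hr
    · refine ⟨⟨r, by simpa [addLeaf] using hr, fun y hy => ?_⟩, fun y => d (some y),
        fun x y h => hd _ _ (by simp [addLeaf, h])⟩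
      have hy : T y = none := hy
      simpa using hru (some y) (by simp [addLeaf, hy])
  · rintro ⟨⟨r, hr, hru⟩, d, hd⟩
    have hru : ∀ y, T y = none → y = r := hru
    refine ⟨⟨some r, by simp [addLeaf, hr], ?_⟩, fun o => o.elim (d w + 1) d, ?_⟩
    · rintro (_ | y) (hy : addLeaf w T _ = none)
      · simp [addLeaf] at hy
      · rw [hru y (by simpa [addLeaf] using hy)]
    · rintro (_ | x) y hxy
      · simp only [addLeaf, Option.some.injEq] at hxy
        subst hxy
        simp
      · obtain ⟨z, hz, rfl⟩ := Option.map_eq_some_iff.1 hxy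
        exact hd _ _ hz

theorem addLeaf_injective {w w' : X} {T T' : X → Option X} (h : addLeaf w T = addLeaf w' T') :
    w = w' ∧ T = T' := by
  refine ⟨by simpa [addLeaf] using congrFun h none, funext fun y => ?_⟩
  have := congrFun h (some y)
  simp only [addLeaf] at this
  exact Option.map_injective (Option.some_injective _) this

theorem exists_addLeaf {f : Option X → Option (Option X)} {w : X} (hw : f none = some (some w))
    (hl : ∀ y, f y ≠ some none) : ∃ T, f = addLeaf w T := by
  refine ⟨fun y => (f (some y)).bind id, funext fun o => ?_⟩
  rcases o with _ | y
  · exact hw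
  · have := hl (some y)
    simp only [addLeaf]
    generalize f (some y) = p at this ⊢
    rcases p with _ | _ | a
    · rfl
    · exact absurd rfl this
    · rfl

theorem ctr_addLeaf (w : X) (T : X → Option X) : ctr w (addLeaf w T) = T := by
  funext y
  have h : ∀ y, addLeaf w T (some y) ≠ some none := by
    intro y
    simp only [addLeaf]
    rcases T y with _ | a <;> simp
  have h' : ctr w (addLeaf w T) y = (addLeaf w T (some y)).map (·.getD w) := by
    by_cases hy : y = w
    · subst hy; exact ctr_self_of_ne (h _)
    · exact ctr_of_ne hy _
  rw [h']
  simp only [addLeaf]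
  rcases T y with _ | a <;> rfl

/-- The contractions at another vertex than the attached leaf. -/
theorem ctrSum_swap_addLeaf [Fintype X] {wh : X → Prop} {wh' : Option X → Prop}
    (hs : ∀ x, wh' (some x) ↔ wh x) (w : X) (U : Option X → Option (Option X))
    (Ψ : (Option X → Option (Option X)) → k) :
    ctrSum wh' Ψ (map (swapOpt X) (addLeaf (some w) U)) =
      ctrSum wh (fun f => Ψ (addLeaf w f)) U := by
  classical
  set V := map (swapOpt X) (addLeaf (some w) U) with hV
  have h₀ : V none = (U none).map (Option.map some) := by
    refine (map_apply (swapOpt X) (addLeaf (some w) U) (some none)).trans ?_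
    simp only [addLeaf]
    rcases U none with _ | _ | a <;> rfl
  have h₁ : V (some none) = some (some (some w)) :=
    map_apply (swapOpt X) (addLeaf (some w) U) none
  have h₂ : ∀ y, V (some (some y)) = (U (some y)).map (Option.map some) := by
    intro y
    refine (map_apply (swapOpt X) (addLeaf (some w) U) (some (some y))).trans ?_
    simp only [addLeaf]
    rcases U (some y) with _ | _ | a <;> rfl
  have hn : ∀ o : Option (Option X), o.map (Option.map some) = some none ↔ o = some none := by
    rintro (_ | _ | a) <;> simp
  have hsm : ∀ (o : Option (Option X)) x, o.map (Option.map some) = some (some (some x)) ↔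
      o = some (some x) := by
    rintro (_ | _ | a) x <;> simp
  have hg : ∀ (o : Option (Option X)) x, (o.map (Option.map some)).map (·.getD (some x)) =
      (o.map (·.getD x)).map some := by
    rintro (_ | _ | a) x <;> simp
  have hc : ∀ y, V (some (some y)) = some none ↔ U (some y) = some none := fun y => by rw [h₂, hn]
  have hnone : wgt k wh' none V = 0 := by
    have : V none ≠ some (some none) := by
      rw [h₀]
      rcases U none with _ | _ | a <;> simp
    simp [wgt, h₁, this]
  rw [ctrSum, Fintype.sum_option, hnone, zero_mul, zero_add, ctrSum]
  refine Finset.sum_congr rfl fun x _ => ?_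
  have hw : wgt k wh' (some x) V = wgt k wh x U := by
    refine wgt_congr (hc x) ?_ (hs x) (by rw [h₀, hsm]) ?_
    · refine and_congr (by rw [h₀, Option.map_eq_none_iff]) (and_congr (hc x) ⟨fun h y hy => ?_, ?_⟩)
      · exact Option.some.inj (h (some y) ((hc y).2 hy))
      · rintro h (_ | y) hy
        · rw [h₁] at hy; simp at hy
        · rw [h y ((hc y).1 hy)]
    · constructor
      · exact fun h y hy => h (some y) ((hc y).2 hy)
      · rintro h (_ | y) hy
        · rw [h₁] at hy; simp at hy
        · exact h y ((hc y).1 hy)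
  rw [hw]
  congr 2
  funext o
  rcases o with _ | y
  · rw [ctr_of_ne (by simp), h₁]; rfl
  · simp only [addLeaf]
    by_cases hy : y = x
    · subst hy
      by_cases h : U (some y) = some none
      · rw [ctr_self_of_child ((hc y).2 h), ctr_self_of_child h, h₀, hg]
      · rw [ctr_self_of_ne (mt (hc y).1 h), ctr_self_of_ne h, h₂, hg]
    · rw [ctr_of_ne (by simpa using hy), ctr_of_ne hy, h₂, hg]

section

variable {J : Type} {m : ℕ}

/-- The additional input is attached as a leaf to the input `j`. -/
def extLeaf (p : J × (J ⊕ Fin m → Option (J ⊕ Fin m))) :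
    Option J ⊕ Fin m → Option (Option J ⊕ Fin m) :=
  map (optSum J (Fin m)).symm (addLeaf (.inl p.1) p.2)

theorem isTree_map_iff {V W : Type} (e : V ≃ W) {f : V → Option V} :
    IsTree (map e f) ↔ IsTree f := by
  refine ⟨fun h => ?_, isTree_map e⟩
  have := isTree_map e.symm h
  rwa [map_map, Equiv.self_trans_symm, map_refl] at this

theorem map_injective {V W : Type} (e : V ≃ W) : Function.Injective (map e) := by
  intro f g h
  have := congrArg (map e.symm) h
  rwa [map_map, map_map, Equiv.self_trans_symm, map_refl, map_refl] at this

theorem isTree_extLeaf {p : J × (J ⊕ Fin m → Option (J ⊕ Fin m))} :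
    IsTree (extLeaf p) ↔ IsTree p.2 := by
  rw [extLeaf, isTree_map_iff, isTree_addLeaf]

theorem extLeaf_injective : Function.Injective (extLeaf (J := J) (m := m)) := by
  rintro ⟨j, T⟩ ⟨j', T'⟩ h
  obtain ⟨h₁, h₂⟩ := addLeaf_injective (map_injective _ h)
  exact Prod.ext (Sum.inl.inj h₁) h₂

theorem exists_extLeaf {g : Option J ⊕ Fin m → Option (Option J ⊕ Fin m)} {x : Option J}
    (hx : g (.inl none) = some (.inl x)) (hl : ∀ y, g y ≠ some (.inl none)) :
    ∃ p, extLeaf p = g := by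
  rcases x with _ | j
  · exact absurd hx (hl _)
  · obtain ⟨T, hT⟩ := exists_addLeaf (f := map (optSum J (Fin m)) g) (w := .inl j)
      ((map_apply (optSum J (Fin m)) g (.inl none)).trans (by rw [hx]; rfl)) (by
        intro y
        obtain ⟨y, rfl⟩ := (optSum J (Fin m)).surjective y
        rw [map_apply]
        have h : optSum J (Fin m) (.inl none) = none := rfl
        have := hl y
        rw [← h]
        generalize g y = p at this ⊢
        rcases p with _ | a
        · simp
        · simpa using this)
    refine ⟨(j, T), ?_⟩
    rw [extLeaf, ← hT, map_map, Equiv.self_trans_symm, map_refl]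

theorem map_permR_extLeaf (σ : Equiv.Perm (Fin m)) (j : J)
    (T : J ⊕ Fin m → Option (J ⊕ Fin m)) :
    map (permR (Option J) σ) (extLeaf (j, T)) = extLeaf (j, map (permR J σ) T) := by
  have h : (optSum J (Fin m)).symm.trans (permR (Option J) σ) =
      (Equiv.optionCongr (permR J σ)).trans (optSum J (Fin m)).symm := by
    refine Equiv.ext fun o => ?_
    rcases o with _ | _ | _ <;> rfl
  rw [extLeaf, map_map, h, ← map_map, map_addLeaf]
  rfl

/-- A leaf attached to an input is adjacent to no black vertex and does not change which black
vertices are leaves or have an only child. -/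
theorem diff_extLeaf [Fintype J] (φ : (Option J ⊕ Fin m → Option (Option J ⊕ Fin m)) → k) (j : J)
    (T : J ⊕ Fin (m + 1) → Option (J ⊕ Fin (m + 1))) :
    diff φ (extLeaf (j, T)) = diff (fun f => φ (extLeaf (j, f))) T := by
  refine Finset.sum_congr rfl fun p _ => ?_
  have h : (optSum J (Fin (m + 1))).symm.trans (pick (Option J) p) =
      ((Equiv.optionCongr (pick J p)).trans (swapOpt (J ⊕ Fin m))).trans
        (Equiv.optionCongr (optSum J (Fin m)).symm) := by
    refine Equiv.ext fun o => ?_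
    rcases o with _ | x | r
    · rfl
    · rfl
    · have h₁ : ∀ r : Fin (m + 1), (Tw.optE (Option J) m).symm (.inr r) =
          Equiv.optionCongr (optSum J (Fin m)).symm (swapOpt _ (some ((Tw.optE J m).symm (.inr r)))) := by
        refine Fin.cases ?_ fun r => ?_ <;> rfl
      exact h₁ (Equiv.swap 0 p r)
  rw [extLeaf, map_map, h, ← map_map, ← map_map, map_addLeaf, ctrSum_map, pick_inl,
    ctrSum_swap_addLeaf (wh := White)]
  · rfl
  · rintro (x | x) <;> rfl

theorem antisymm_extLeaf {φ : (Option J ⊕ Fin m → Option (Option J ⊕ Fin m)) → k}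
    (hφ : Antisymm φ) (j : J) : Antisymm fun f => φ (extLeaf (j, f)) := by
  intro σ f
  simp only [← map_permR_extLeaf, hφ σ]

theorem antisymm_extend {ψ : J → (J ⊕ Fin m → Option (J ⊕ Fin m)) → k}
    (hψ : ∀ j, Antisymm (ψ j)) :
    Antisymm (Function.extend extLeaf (fun p => ψ p.1 p.2) fun _ => 0) := by
  intro σ f
  by_cases h : ∃ p, extLeaf p = f
  · obtain ⟨⟨j, T⟩, rfl⟩ := h
    rw [map_permR_extLeaf, extLeaf_injective.extend_apply, extLeaf_injective.extend_apply, hψ]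
  · rw [Function.extend_apply' _ _ _ h, Function.extend_apply', mul_zero]
    rintro ⟨⟨j, T⟩, hT⟩
    refine h ⟨(j, map (permR J σ⁻¹) T), ?_⟩
    rw [← map_permR_extLeaf, hT, map_map]
    exact (congrArg (map · f) (Equiv.self_trans_symm (permR (Option J) σ))).trans (map_refl f)

end

theorem diff_sub {I : Type} [Fintype I] {m : ℕ} (φ ψ : (I ⊕ Fin m → Option (I ⊕ Fin m)) → k) (f) :
    diff (φ - ψ) f = diff φ f - diff ψ f := by
  simp [diff, ctrSum, mul_sub, Finset.sum_sub_distrib]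

theorem Antisymm.sub {I : Type} {m : ℕ} {φ ψ : (I ⊕ Fin m → Option (I ⊕ Fin m)) → k}
    (hφ : Antisymm φ) (hψ : Antisymm ψ) : Antisymm (φ - ψ) := by
  intro σ f
  simp only [Pi.sub_apply, hφ σ f, hψ σ f, mul_sub]

variable (k) in
/-- The complex of operations with the inputs `I` is acyclic in negative degrees. -/
def Acyclic (I : Type) : Prop := ∀ [Fintype I] (m : ℕ)
  (φ : (I ⊕ Fin (m + 1) → Option (I ⊕ Fin (m + 1))) → k), Antisymm φ →
    (∀ f, IsTree f → diff φ f = 0) →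
      ∃ ψ : (I ⊕ Fin m → Option (I ⊕ Fin m)) → k, Antisymm ψ ∧ ∀ f, IsTree f → diff ψ f = φ f

theorem Acyclic.of_equiv {I J : Type} (e : I ≃ J) (hI : Acyclic k I) : Acyclic k J := by
  intro _ m φ hφ hd
  have := Fintype.ofEquiv J e.symm
  let s (m : ℕ) : I ⊕ Fin m ≃ J ⊕ Fin m := Equiv.sumCongr e (Equiv.refl _)
  have hs : ∀ m (σ : Equiv.Perm (Fin m)) f, map (s m) (map (permR I σ) f) =
      map (permR J σ) (map (s m) f) := by
    intro m σ f
    rw [map_map, map_map]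
    congr 1
    refine Equiv.ext fun x => ?_
    rcases x with x | x <;> rfl
  have hdiff : ∀ m (χ : (J ⊕ Fin m → Option (J ⊕ Fin m)) → k) f,
      diff χ (map (s (m + 1)) f) = diff (χ ∘ map (s m)) f := by
    intro m χ f
    refine Finset.sum_congr rfl fun p _ => ?_
    have h : (s (m + 1)).trans (pick J p) = (pick I p).trans (Equiv.optionCongr (s m)) := by
      refine Equiv.ext fun x => ?_
      rcases x with x | r
      · rfl
      · have h₁ : ∀ r : Fin (m + 1), (Tw.optE J m).symm (.inr r) =
            Equiv.optionCongr (s m) ((Tw.optE I m).symm (.inr r)) := by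
          refine Fin.cases ?_ fun r => ?_ <;> rfl
        exact h₁ (Equiv.swap 0 p r)
    have hw : White ∘ s m = White := by
      funext x
      rcases x with x | x <;> rfl
    rw [map_map, h, ← map_map, ctrSum_map, hw]
  obtain ⟨ψ, hψ, h⟩ := hI m (φ ∘ map (s (m + 1)))
    (fun σ f => by simp only [Function.comp_apply, hs, hφ σ]) (fun f hf => by
      rw [← hdiff]
      exact hd _ (isTree_map _ hf))
  have hψs : (ψ ∘ map (s m).symm) ∘ map (s m) = ψ := by
    funext f
    simp [map_map, map_refl]
  refine ⟨ψ ∘ map (s m).symm, fun σ f => ?_, fun f hf => ?_⟩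
  · obtain ⟨f, rfl⟩ : ∃ f', map (s m) f' = f := ⟨map (s m).symm f, by simp [map_map, map_refl]⟩
    rw [← hs]
    exact (congrFun hψs _).trans ((hψ σ f).trans (congrArg _ (congrFun hψs f).symm))
  · obtain ⟨f, rfl⟩ : ∃ f', map (s (m + 1)) f' = f :=
      ⟨map (s (m + 1)).symm f, by simp [map_map, map_refl]⟩
    rw [hdiff, hψs, h f ((isTree_map_iff _).1 hf)]
    rfl

/-- At the trees where the new input is a leaf attached to `j`, the cycle `φ` is a cycle with inputs
`J` and so has a primitive. Extending these primitives by zero and subtracting the boundary leaves a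
cycle that vanishes at all such trees, where the homotopy `diff_plus` applies. -/
theorem Acyclic.option [CharZero k] {J : Type} [Fintype J] (hJ : Acyclic k J) :
    Acyclic k (Option J) := by
  intro inst m φ hφ hd
  obtain rfl : inst = instFintypeOption := Subsingleton.elim _ _
  choose ψ hψ hdψ using fun j : J => hJ m (fun f => φ (extLeaf (j, f))) (antisymm_extLeaf hφ j)
    (fun f hf => by rw [← diff_extLeaf]; exact hd _ (isTree_extLeaf.2 hf))
  obtain ⟨ψ', hψ', he⟩ : ∃ ψ' : (Option J ⊕ Fin m → Option (Option J ⊕ Fin m)) → k,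
      Antisymm ψ' ∧ ∀ j T, ψ' (extLeaf (j, T)) = ψ j T :=
    ⟨_, antisymm_extend hψ, fun j T => extLeaf_injective.extend_apply _ _ (j, T)⟩
  -- The difference `φ - diff ψ'` is replaced by the antisymmetrization `PL.alt η`, which agrees
  -- with it at trees but is antisymmetric and zero on non-trees, as `diff_plus` requires of all
  -- parent functions.
  obtain ⟨μ, hμ⟩ := PL.exists_alt_eq hψ'
  obtain ⟨ν, hν⟩ := PL.exists_alt_eq hφ
  let η := ν - (PL k).map (Tw.optE (Option J) m) (PL.dElt k White μ)
  have hη : ∀ f, IsTree f → PL.alt η f = (φ - diff ψ') f := by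
    intro f hf
    have h : ∀ f, PL.alt η f = PL.alt ν f -
        PL.alt ((PL k).map (Tw.optE (Option J) m) (PL.dElt k White μ)) f := fun f => by
      rw [show η = ν + (-1 : k) • _ by rw [neg_one_smul, ← sub_eq_add_neg], PL.alt_add, PL.alt_smul]
      ring
    rw [h, hν f hf, PL.alt_map_dElt μ hf, Pi.sub_apply, diff_congr hμ hf]
  have hd' : ∀ f, IsTree f → diff (PL.alt η) f = 0 := by
    intro f hf
    rw [diff_congr hη hf, diff_sub, hd f hf, PL.diff_diff hψ' hf, sub_zero]
  have hW : ∀ g x, g (.inl none) = some (.inl x) → (∀ y, g y ≠ some (.inl none)) →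
      PL.alt η g = 0 := by
    intro g x hx hl
    obtain ⟨⟨j, T⟩, rfl⟩ := exists_extLeaf hx hl
    by_cases hT : IsTree T
    · rw [hη _ (isTree_extLeaf.2 hT), Pi.sub_apply, diff_extLeaf]
      simp only [he]
      rw [sub_eq_zero]
      exact (hdψ j T hT).symm
    · exact PL.alt_of_not_isTree η (mt isTree_extLeaf.1 hT)
  refine ⟨ψ' - fun f => PL.alt η (map (Tw.optE (Option J) m) (plus (.inl none) f)),
    hψ'.sub (antisymm_plus (PL.alt_antisymm η) none), fun f hf => ?_⟩
  have h := diff_plus (PL.alt_antisymm η) none hW hf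
  rw [hd' _ (isTree_map _ (isTree_plus _ hf)), hη f hf, Pi.sub_apply] at h
  rw [diff_sub]
  linear_combination -h

variable (k) in
theorem acyclic [CharZero k] (I : Type) [Finite I] : Acyclic k I :=
  Finite.induction_empty_option (P := Acyclic k) (fun e h => h.of_equiv e)
    (fun _ _ hφ hd => exists_diff_eq_of_isEmpty hφ hd) (fun h => h.option) I

end ParentFun

/-! ### Lie elements with a marked input -/

namespace OperadData

variable {k : Type u} [Field k] {P : OperadData k} {b : P.obj (Fin 2)}

theorem IsOperad.bra_brR (hP : P.IsOperad) {X Y : Type} [Finite X] [Finite Y] (a : X)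
    (x : P.obj X) (y : P.obj Y) :
    P.map (optSum X Y) (P.bra b (P.brR b a x) y) = P.brR b (.inl a) (P.bra b x y) := by
  have h : P.brR b a x = P.map (rightEquiv a) (P.comp a x b) := rfl
  have h' := bra_map_map (P := P) (b := b) (rightEquiv a) (Equiv.refl Y) (P.comp a x b) y
  rw [P.map_refl] at h'
  rw [h, h', ← P.map_trans, brR, LinearMap.flip_apply]
  refine (hP.cmp_bra_left a x y b _ _ ?_ ?_ ?_).symm
  · intro c h
    rfl
  · intro c h
    rfl
  · intro c
    fin_cases c <;> rfl

theorem IsOperad.bra_one (hP : P.IsOperad) {Y : Type} [Finite Y] (y : P.obj Y) :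
    P.bra b P.one y = P.map ((Equiv.optionEquivSumPUnit Y).trans (Equiv.sumComm Y Unit))
      (P.brL b y) := by
  rw [bra_apply]
  have := hP.cmp_one (P := P) none (plugEquiv Unit Y)
    ((Equiv.optionEquivSumPUnit Y).trans (Equiv.sumComm Y Unit)) ?_ ?_ (Equiv.refl Unit)
    (P.brL b y)
  · rwa [P.map_refl] at this
  · rintro ⟨_ | a, h⟩
    · exact absurd rfl h
    · rfl
  · intro u
    rfl

end OperadData

namespace LieOp

open OperadData

variable {k : Type u} [Field k]

theorem eq_zero_of_isEmpty {X : Type} [Finite X] [IsEmpty X] (x : (LieOp k).obj X) : x = 0 := by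
  have key : IsEmpty X → x = 0 := by
    refine LieOp.induction (p := fun X _ x => IsEmpty X → x = 0) ?_ ?_ ?_ ?_ ?_ ?_ x
    · exact fun h => isEmptyElim ()
    · intro X Y _ _ x y hx _ h
      rw [hx (isEmpty_sum.1 h).1, map_zero, LinearMap.zero_apply]
    · intro X Y _ _ e x hx h
      rw [hx (e.isEmpty), map_zero]
    · exact fun _ => rfl
    · intro X _ x y hx hy h
      rw [hx h, hy h, add_zero]
    · intro X _ c x hx h
      rw [hx h, smul_zero]
  exact key ‹_›

theorem toOperad_self [CharZero k] [Fact (LieOp k).IsOperad]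
    [Fact ((LieOp k).IsLieBracket (bracket k))] {X : Type} [Finite X] (x : (LieOp k).obj X) :
    toOperad (LieOp k) (bracket k) X x = x := by
  refine LieOp.induction (p := fun X _ x => toOperad (LieOp k) (bracket k) X x = x)
    ?_ ?_ ?_ ?_ ?_ ?_ x
  · exact toOperad_one
  · intro X Y _ _ x y hx hy
    rw [toOperad_bra, hx, hy]
  · intro X Y _ _ e x hx
    rw [toOperad_map, hx]
  · exact fun {X} _ => map_zero _
  · intro X _ x y hx hy
    rw [map_add, hx, hy]
  · intro X _ c x hx
    rw [map_smul, hx]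

/-- Bracketing with a new letter is a derivation of the free Lie algebra; formally this is
`delta_toOperad` for the Lie operad itself. -/
theorem brL_eq_sum [CharZero k] {X : Type} [Fintype X] (x : (LieOp k).obj X) :
    (LieOp k).brL (bracket k) x = ∑ a, (LieOp k).brR (bracket k) a x := by
  have : Fact (LieOp k).IsOperad := ⟨isOperad k⟩
  have : Fact ((LieOp k).IsLieBracket (bracket k)) := ⟨isLieBracket k⟩
  have h := delta_toOperad (P := LieOp k) (b := bracket k) x
  rw [toOperad_self, delta_apply, sub_eq_zero] at h
  simpa using h

variable (k) in
/-- The span of the unit and of the operations in which the input `a` occurs as `[a, c]` with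
another input `c`. -/
noncomputable def brSpan (X : Type) [Finite X] (a : X) : Submodule k ((LieOp k).obj X) :=
  Submodule.span k ({y | ∃ e : Unit ≃ X, y = (LieOp k).map e (LieOp k).one} ∪
    {y | ∃ (Z : Type) (_ : Finite Z) (e : Option Z ≃ X) (c : Z) (z : (LieOp k).obj Z),
      e none = a ∧ y = (LieOp k).map e ((LieOp k).brR (bracket k) c z)})

theorem map_mem_brSpan {X Y : Type} [Finite X] [Finite Y] (f : X ≃ Y) {a : X} {b : Y}
    (hab : f a = b) {x : (LieOp k).obj X} (hx : x ∈ brSpan k X a) :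
    (LieOp k).map f x ∈ brSpan k Y b := by
  refine Submodule.span_induction (p := fun x _ => (LieOp k).map f x ∈ brSpan k Y b)
    ?_ ?_ ?_ ?_ hx
  · rintro _ (⟨e, rfl⟩ | ⟨Z, _, e, c, z, he, rfl⟩)
    · exact Submodule.subset_span (.inl ⟨e.trans f, ((LieOp k).map_trans _ _ _).symm⟩)
    · exact Submodule.subset_span (.inr ⟨Z, ‹_›, e.trans f, c, z, by simp [he, hab],
        ((LieOp k).map_trans _ _ _).symm⟩)
  · rw [map_zero]; exact zero_mem _
  · intro x y _ _ hx hy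
    rw [map_add]; exact add_mem hx hy
  · intro c x _ hx
    rw [map_smul]; exact Submodule.smul_mem _ _ hx

/-- If `a` already occurs in `x` as `[a, c]`, it does so in `[x, y]`. If `x` is the letter `a`, then
`[a, y]` is expanded by the derivation rule `brL_eq_sum`. -/
theorem bra_mem_brSpan [CharZero k] {X Y : Type} [Finite X] [Finite Y] {a : X}
    {x : (LieOp k).obj X} (hx : x ∈ brSpan k X a) (y : (LieOp k).obj Y) :
    (LieOp k).bra (bracket k) x y ∈ brSpan k (X ⊕ Y) (.inl a) := by
  refine Submodule.span_induction
    (p := fun x _ => (LieOp k).bra (bracket k) x y ∈ brSpan k (X ⊕ Y) (.inl a)) ?_ ?_ ?_ ?_ hx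
  · rintro _ (⟨e, rfl⟩ | ⟨Z, _, e, c, z, he, rfl⟩)
    · obtain ⟨⟨⟩, rfl⟩ := e.surjective a
      have h := bra_map_map (P := LieOp k) (b := bracket k) e (Equiv.refl Y) (LieOp k).one y
      rw [(LieOp k).map_refl] at h
      have := Fintype.ofFinite Y
      rw [h, (isOperad k).bra_one, brL_eq_sum, ← (LieOp k).map_trans, map_sum ((LieOp k).map _)]
      refine Submodule.sum_mem _ fun c _ => ?_
      exact Submodule.subset_span (.inr ⟨Y, ‹_›, _, c, y, rfl, rfl⟩)
    · have h := bra_map_map (P := LieOp k) (b := bracket k) e (Equiv.refl Y)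
        ((LieOp k).brR (bracket k) c z) y
      rw [(LieOp k).map_refl] at h
      have h' : (LieOp k).bra (bracket k) ((LieOp k).brR (bracket k) c z) y =
          (LieOp k).map (optSum Z Y).symm ((LieOp k).brR (bracket k) (.inl c)
            ((LieOp k).bra (bracket k) z y)) := by
        rw [← (isOperad k).bra_brR, ← (LieOp k).map_trans, Equiv.self_trans_symm,
          (LieOp k).map_refl]
      rw [h, h', ← (LieOp k).map_trans]
      exact Submodule.subset_span (.inr ⟨Z ⊕ Y, inferInstance, _, _, _,
        congrArg Sum.inl he, rfl⟩)
  · rw [map_zero, LinearMap.zero_apply]; exact zero_mem _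
  · intro x x' _ _ hx hx'
    rw [map_add, LinearMap.add_apply]; exact add_mem hx hx'
  · intro c x _ hx
    rw [map_smul, LinearMap.smul_apply]; exact Submodule.smul_mem _ _ hx

theorem mem_brSpan [CharZero k] {X : Type} [Finite X] (x : (LieOp k).obj X) (a : X) :
    x ∈ brSpan k X a := by
  refine LieOp.induction (p := fun X _ x => ∀ a, x ∈ brSpan k X a) ?_ ?_ ?_ ?_ ?_ ?_ x a
  · intro a
    exact Submodule.subset_span (.inl ⟨Equiv.refl _, ((LieOp k).map_refl _).symm⟩)
  · rintro X Y _ _ x y hx hy (a | a)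
    · exact bra_mem_brSpan (hx a) y
    · have h := (isOperad k).bra_swap (isLieBracket k) y x
      rw [← neg_eq_iff_eq_neg] at h
      rw [← h]
      exact Submodule.neg_mem _ (map_mem_brSpan (a := .inl a) (Equiv.sumComm Y X) rfl (bra_mem_brSpan (hy a) x))
  · intro X Y _ _ e x hx a
    exact map_mem_brSpan e (a := e.symm a) (e.apply_symm_apply a) (hx (e.symm a))
  · exact fun {X} _ a => zero_mem _
  · exact fun x y hx hy a => Submodule.add_mem (brSpan k _ a) (hx a) (hy a)
  · exact fun c x hx a => Submodule.smul_mem (brSpan k _ a) c (hx a)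

/-- The operations with one input are the multiples of the unit. -/
theorem exists_eq_smul_one [CharZero k] {X : Type} [Finite X] (e : Unit ≃ X) (x : (LieOp k).obj X) :
    ∃ c : k, x = c • (LieOp k).map e (LieOp k).one := by
  have : Subsingleton X := e.symm.subsingleton
  refine Submodule.span_induction (p := fun x _ => ∃ c : k, x = c • (LieOp k).map e (LieOp k).one)
    ?_ ?_ ?_ ?_ (mem_brSpan x (e ()))
  · rintro _ (⟨e', rfl⟩ | ⟨Z, _, e', c, z, he, rfl⟩)
    · refine ⟨1, ?_⟩
      rw [one_smul, show e' = e from Equiv.ext fun _ => Subsingleton.elim _ _]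
    · have := e'.injective (Subsingleton.elim (e' none) (e' (some c)))
      simp at this
  · exact ⟨0, (zero_smul _ _).symm⟩
  · rintro x y _ _ ⟨c, rfl⟩ ⟨c', rfl⟩
    exact ⟨c + c', (add_smul _ _ _).symm⟩
  · rintro c x _ ⟨c', rfl⟩
    exact ⟨c * c', smul_smul _ _ _⟩

/-- With at least two inputs the unit does not occur in `mem_brSpan`, and the remaining generators
are sorted by the partner of the marked input. -/
theorem exists_eq_sum_brR [CharZero k] {J : Type} [Fintype J] [Nonempty J]
    (x : (LieOp k).obj (Option J)) :
    ∃ z : J → (LieOp k).obj J, x = ∑ a, (LieOp k).brR (bracket k) a (z a) := by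
  classical
  refine Submodule.span_induction (p := fun x _ => ∃ z : J → (LieOp k).obj J,
    x = ∑ a, (LieOp k).brR (bracket k) a (z a)) ?_ ?_ ?_ ?_ (mem_brSpan x none)
  · rintro _ (⟨e, rfl⟩ | ⟨Z, _, e, c, z, he, rfl⟩)
    · have : Subsingleton (Option J) := e.symm.subsingleton
      obtain ⟨j⟩ := ‹Nonempty J›
      exact absurd (Subsingleton.elim none (some j)) (by simp)
    · have he' : e = Equiv.optionCongr (Equiv.removeNone e) := by
        refine Equiv.ext fun o => ?_
        rcases o with _ | o
        · exact he
        · refine (Equiv.removeNone_some e ?_).symm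
          rcases h : e (some o) with _ | y
          · exact absurd (e.injective (h.trans he.symm)) (by simp)
          · exact ⟨y, rfl⟩
      refine ⟨Pi.single (Equiv.removeNone e c) ((LieOp k).map (Equiv.removeNone e) z), ?_⟩
      rw [Fintype.sum_eq_single (Equiv.removeNone e c), Pi.single_eq_same, ← map_brR, ← he']
      intro a ha
      rw [Pi.single_eq_of_ne ha, map_zero]
  · exact ⟨0, by simp⟩
  · rintro x y _ _ ⟨z, rfl⟩ ⟨z', rfl⟩
    exact ⟨z + z', by simp [Finset.sum_add_distrib]⟩
  · rintro c x _ ⟨z, rfl⟩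
    exact ⟨c • z, by simp [Finset.smul_sum]⟩

theorem toOperad_brR [CharZero k] {P : OperadData k} {b : P.obj (Fin 2)} [hP : Fact P.IsOperad]
    [Fact (P.IsLieBracket b)] {X : Type} [Finite X] (a : X) (x : (LieOp k).obj X) :
    toOperad P b (Option X) ((LieOp k).brR (bracket k) a x) = P.brR b a (toOperad P b X x) := by
  change toOperad P b _ ((LieOp k).map (rightEquiv a) ((LieOp k).comp a x (bracket k))) =
    P.map (rightEquiv a) (P.comp a (toOperad P b X x) b)
  rw [toOperad_map, map_comp_of_map_bra hP.1 (toOperad P b) toOperad_map toOperad_one toOperad_bra,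
    toOperad_bracket]

end LieOp

/-! ### Cycles of degree zero and conclusion -/

theorem DGOperadData.Hom.mapHomology_bijective {k : Type u} [Field k] {P Q : DGOperadData k}
    (φ : Hom P Q) (I : Type) [Finite I] (n : ℤ)
    (inj : ∀ x ∈ P.cycles I n, φ.app I x ∈ Q.boundaries I n → x ∈ P.boundaries I n)
    (surj : ∀ y ∈ Q.cycles I n, (∃ x ∈ P.cycles I n, φ.app I x = y) ∨ y ∈ Q.boundaries I n) :
    Function.Bijective (φ.mapHomology I n) := by
  refine ⟨(injective_iff_map_eq_zero _).2 fun x hx => ?_, fun y => ?_⟩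
  · obtain ⟨x, rfl⟩ := Submodule.mkQ_surjective _ x
    have hx' : φ.mapCycles I n x ∈ (Q.boundaries I n).comap (Q.cycles I n).subtype :=
      (Submodule.Quotient.mk_eq_zero _).1 hx
    exact (Submodule.Quotient.mk_eq_zero _).2 (inj x.1 x.2 hx')
  · obtain ⟨y, rfl⟩ := Submodule.mkQ_surjective _ y
    rcases surj y.1 y.2 with ⟨x, hx, h⟩ | h
    · exact ⟨Submodule.Quotient.mk ⟨x, hx⟩, congrArg Submodule.Quotient.mk (Subtype.ext h)⟩
    · have h' : y ∈ (Q.boundaries I n).comap (Q.cycles I n).subtype := h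
      exact ⟨0, (map_zero _).trans ((Submodule.Quotient.mk_eq_zero _).2 h').symm⟩

namespace PL

open RT ParentFun OperadData

variable {k : Type u} [Field k]

theorem ext_ev {X : Type} [Finite X] {μ ν : (PL k).obj X} (h : ∀ f, IsTree f → ev f μ = ev f ν) :
    μ = ν :=
  ext_coeff fun T => by rw [← ev_parent, h _ T.isTree]

open Classical in
-- If `none` is a leaf attached to `c`, only the summand `c ◁ none` of `[none, c]` contributes, with
-- its negative sign, and contracting its edge removes the leaf. So the coefficients at these trees
-- separate the summands of `LieOp.exists_eq_sum_brR`.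
theorem ev_addLeaf_brR {X : Type} [Finite X] (a c : X) (μ : (PL k).obj X) {f : X → Option X}
    (hf : IsTree f) : ev (addLeaf c f) ((PL k).brR (PL.bracket k) a μ) =
      if a = c then - ev f μ else 0 := by
  obtain ⟨U, hU⟩ := (isTree_addLeaf (w := c).2 hf).exists_rt
  have h₁ : U.parent (some a) ≠ some none := by
    rw [hU]
    simp only [addLeaf]
    rcases f a with _ | _ <;> simp
  have h₂ : U.parent none = some (some a) ↔ a = c := by
    rw [hU]
    simp [addLeaf, eq_comm]
  rw [← hU, ev_parent, coeff_brR, if_neg h₁]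
  by_cases hac : a = c
  · subst hac
    rw [if_pos (h₂.2 rfl), if_pos rfl, hU, ctr_addLeaf]
    ring
  · rw [if_neg (mt h₂.1 hac), if_neg hac]
    ring

section

variable {I : Type} [Fintype I]

variable (k) in
/-- The cycles of degree zero. -/
noncomputable def zeroCycles (I : Type) [Finite I] : Submodule k ((PL k).obj I) :=
  LinearMap.ker (Tw.diff (PL k) (PL.bracket k) ∘ₗ Tw.incl (PL k) (PL.bracket k) I)

/-- An operation without additional inputs as a function on parent functions. -/
noncomputable def evSum (μ : (PL k).obj I) (f : I ⊕ Fin 0 → Option (I ⊕ Fin 0)) : k :=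
  ev (ParentFun.map (Equiv.sumEmpty I (Fin 0)) f) μ

theorem alt_map_sumEmpty (μ : (PL k).obj I) :
    alt ((PL k).map (Equiv.sumEmpty I (Fin 0)).symm μ) = evSum μ := by
  funext f
  have h₁ : permR I (1 : Equiv.Perm (Fin 0)) = Equiv.refl _ := Equiv.sumCongr_refl
  have h₂ : f = ParentFun.map (Equiv.sumEmpty I (Fin 0)).symm
      (ParentFun.map (Equiv.sumEmpty I (Fin 0)) f) := by
    rw [map_map, Equiv.self_trans_symm, ParentFun.map_refl]
  rw [alt, Fintype.sum_subsingleton _ 1, h₁, ParentFun.map_refl, evSum]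
  conv_lhs => rw [h₂, ev_map]
  simp

theorem evSum_map_symm (μ : (PL k).obj I) (f : I → Option I) :
    evSum μ (ParentFun.map (Equiv.sumEmpty I (Fin 0)).symm f) = ev f μ := by
  rw [evSum, map_map, Equiv.symm_trans_self, ParentFun.map_refl]

theorem mem_zeroCycles_iff [CharZero k] (μ : (PL k).obj I) :
    μ ∈ zeroCycles k I ↔ ∀ f, IsTree f → ParentFun.diff (evSum μ) f = 0 := by
  rw [← alt_map_sumEmpty]
  exact diff_cls_eq_zero_iff _

end

section

variable {J : Type} [Fintype J]

theorem evSum_extLeaf (μ : (PL k).obj (Option J)) (j : J)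
    (f : J ⊕ Fin 0 → Option (J ⊕ Fin 0)) :
    evSum μ (extLeaf (j, f)) = ev (addLeaf j (ParentFun.map (Equiv.sumEmpty J (Fin 0)) f)) μ := by
  have h : (optSum J (Fin 0)).symm.trans (Equiv.sumEmpty (Option J) (Fin 0)) =
      Equiv.optionCongr (Equiv.sumEmpty J (Fin 0)) := by
    refine Equiv.ext fun o => ?_
    rcases o with _ | j | r
    · rfl
    · rfl
    · exact r.elim0
  rw [evSum, extLeaf, map_map, h, map_addLeaf]
  rfl

/-- The coefficients at the trees in which the additional input is a leaf attached to `j` form a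
cycle. -/
theorem mem_zeroCycles_of_addLeaf [CharZero k] {μ : (PL k).obj (Option J)}
    (hμ : μ ∈ zeroCycles k (Option J)) {j : J} {ν : (PL k).obj J}
    (hν : ∀ f, IsTree f → ev f ν = ev (addLeaf j f) μ) : ν ∈ zeroCycles k J := by
  rw [mem_zeroCycles_iff] at hμ ⊢
  intro f hf
  rw [← hμ _ (isTree_extLeaf (p := (j, f)).2 hf), diff_extLeaf]
  refine diff_congr (fun g hg => ?_) hf
  rw [evSum_extLeaf, evSum, hν _ (isTree_map _ hg)]

/-- A cycle is determined by its coefficients at the trees in which the additional input is a leaf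
attached to another input. -/
theorem eq_zero_of_addLeaf [CharZero k] [Nonempty J] {μ : (PL k).obj (Option J)}
    (hμ : μ ∈ zeroCycles k (Option J)) (h : ∀ j f, IsTree f → ev (addLeaf j f) μ = 0) : μ = 0 := by
  rw [mem_zeroCycles_iff] at hμ
  obtain ⟨j⟩ := ‹Nonempty J›
  refine ext_ev fun f hf => ?_
  have hf' := isTree_map (Equiv.sumEmpty (Option J) (Fin 0)).symm hf
  -- The hypothesis on `μ` is that of the homotopy formula, which then expresses every coefficient
  -- of `μ` through `dμ = 0`.
  have := diff_plus_zero (χ := evSum μ) none ⟨some j, by simp⟩ ?_ hf'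
  · rw [hμ _ (isTree_map _ (isTree_plus _ hf')), evSum_map_symm, zero_eq_neg] at this
    rw [this, map_zero]
  · intro g x hx hl
    obtain ⟨⟨j, T⟩, rfl⟩ := exists_extLeaf hx hl
    rw [evSum_extLeaf]
    by_cases hT : IsTree T
    · exact h j _ (isTree_map _ hT)
    · rw [ev_of_not_isTree, LinearMap.zero_apply]
      rwa [isTree_addLeaf, isTree_map_iff]

end

instance : Fact (PL k).IsOperad := ⟨PL.isOperad⟩

instance : Fact ((PL k).IsLieBracket (PL.bracket k)) := ⟨PL.isLieBracket⟩

variable [CharZero k]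

theorem toOperad_mem_zeroCycles {I : Type} [Finite I] (x : (LieOp k).obj I) :
    LieOp.toOperad (PL k) (PL.bracket k) I x ∈ zeroCycles k I := by
  have h := (Tw.lieHom (PL k) (PL.bracket k)).app_d x
  exact h.symm.trans (map_zero ((Tw.lieHom (PL k) (PL.bracket k)).app I))

variable (k) in
/-- The Lie operad is the space of cycles of degree zero. -/
def LieEqZeroCycles (I : Type) : Prop := ∀ [Finite I],
  Function.Injective (LieOp.toOperad (PL k) (PL.bracket k) I) ∧
    ∀ μ ∈ zeroCycles k I, ∃ x, LieOp.toOperad (PL k) (PL.bracket k) I x = μ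

theorem LieEqZeroCycles.of_equiv {I J : Type} (e : I ≃ J) (hI : LieEqZeroCycles k I) :
    LieEqZeroCycles k J := by
  intro _
  have := Finite.of_equiv J e.symm
  have hmm : ∀ {P : OperadData k} (y : P.obj J), P.map e (P.map e.symm y) = y := fun {P} y => by
    rw [← P.map_trans, Equiv.symm_trans_self, P.map_refl]
  refine ⟨(injective_iff_map_eq_zero _).2 fun x hx => ?_, fun μ hμ => ?_⟩
  · have h : LieOp.toOperad (PL k) (PL.bracket k) I ((LieOp k).map e.symm x) = 0 := by
      rw [LieOp.toOperad_map, hx, map_zero]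
    rw [← hmm x, (injective_iff_map_eq_zero _).1 hI.1 _ h, map_zero]
  · obtain ⟨x, hx⟩ := hI.2 ((PL k).map e.symm μ) (by
      change Tw.diff _ _ (Tw.incl (PL k) (PL.bracket k) I ((PL k).map e.symm μ)) = 0
      have h := (Tw.isDGOperad (PL.isOperad (k := k)) PL.isLieBracket).d_map e.symm
        (Tw.incl (PL k) (PL.bracket k) J μ)
      have h' : (Tw (PL k) (PL.bracket k)).d (Tw.incl (PL k) (PL.bracket k) J μ) = 0 := hμ
      rw [h', map_zero] at h
      rw [← Tw.map_incl]
      exact h)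
    exact ⟨(LieOp k).map e x, by rw [LieOp.toOperad_map, hx, hmm]⟩

theorem lieEqZeroCycles_of_isEmpty {I : Type} [IsEmpty I] : LieEqZeroCycles k I := by
  intro _
  refine ⟨(injective_iff_map_eq_zero _).2 fun x _ => LieOp.eq_zero_of_isEmpty x,
    fun μ _ => ⟨0, ext_ev fun f hf => ?_⟩⟩
  obtain ⟨⟨r, _⟩, _⟩ := hf
  exact isEmptyElim r

theorem lieEqZeroCycles_unit : LieEqZeroCycles k Unit := by
  intro _
  have h₁ : ∀ f : Unit → Option Unit, IsTree f → f = RT.unit.parent := by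
    intro f hf
    obtain ⟨⟨r, hr, _⟩, _⟩ := hf
    funext x
    exact hr
  have h₂ : ev RT.unit.parent ((PL k).one) = 1 := by
    rw [ev_parent]
    exact Finsupp.single_eq_same
  refine ⟨(injective_iff_map_eq_zero _).2 fun x hx => ?_,
    fun μ _ => ⟨ev RT.unit.parent μ • (LieOp k).one, ext_ev fun f hf => ?_⟩⟩
  · obtain ⟨c, rfl⟩ := LieOp.exists_eq_smul_one (Equiv.refl Unit) x
    rw [(LieOp k).map_refl] at hx ⊢
    rw [map_smul, LieOp.toOperad_one] at hx
    have := congrArg (ev RT.unit.parent) hx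
    rw [map_smul, h₂, map_zero, smul_eq_mul, mul_one] at this
    rw [this, zero_smul]
  · rw [h₁ f hf, map_smul, LieOp.toOperad_one, map_smul, h₂, smul_eq_mul, mul_one]

/-- Lie elements and cycles are both controlled by the family of coefficients at trees with the
additional input a leaf attached to `c`. For a sum of brackets this family is minus the images of
the `z c`, and a cycle with zero family is zero; both injectivity and surjectivity descend to `J`.
-/
theorem LieEqZeroCycles.option {J : Type} [Fintype J] (hJ : LieEqZeroCycles k J) :
    LieEqZeroCycles k (Option J) := by
  classical
  intro _
  -- In arity one the recursion fails: the operation is a multiple of the unit, not a sum of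
  -- brackets.
  rcases isEmpty_or_nonempty J with hJe | hJn
  · exact lieEqZeroCycles_unit.of_equiv
      ((Equiv.equivPUnit (Option J)).symm : Unit ≃ Option J)
  have hev : ∀ (z : J → (LieOp k).obj J) (c : J) (f : J → Option J), IsTree f →
      ev (addLeaf c f) (LieOp.toOperad (PL k) (PL.bracket k) (Option J)
        (∑ a, (LieOp k).brR (LieOp.bracket k) a (z a))) =
      - ev f (LieOp.toOperad (PL k) (PL.bracket k) J (z c)) := by
    intro z c f hf
    rw [map_sum, map_sum]
    simp only [LieOp.toOperad_brR, ev_addLeaf_brR _ _ _ hf]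
    simp
  refine ⟨(injective_iff_map_eq_zero _).2 fun x hx => ?_, fun μ hμ => ?_⟩
  · obtain ⟨z, rfl⟩ := LieOp.exists_eq_sum_brR x
    refine Finset.sum_eq_zero fun c _ => ?_
    have h : LieOp.toOperad (PL k) (PL.bracket k) J (z c) = 0 := by
      refine ext_ev fun f hf => ?_
      have := hev z c f hf
      rw [hx, map_zero, zero_eq_neg] at this
      rw [this, map_zero]
    rw [(injective_iff_map_eq_zero _).1 hJ.1 _ h, map_zero]
  · choose ν hν using fun j : J => exists_ev_eq fun f => ev (addLeaf j f) μ
    choose z hz using fun j : J => hJ.2 (ν j) (mem_zeroCycles_of_addLeaf hμ (hν j))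
    refine ⟨- ∑ a, (LieOp k).brR (LieOp.bracket k) a (z a), ?_⟩
    have h := eq_zero_of_addLeaf (Submodule.add_mem _ hμ (toOperad_mem_zeroCycles
      (∑ a, (LieOp k).brR (LieOp.bracket k) a (z a)))) (fun j f hf => by
        rw [map_add, hev z j f hf, hz, hν j f hf, add_neg_cancel])
    rw [map_neg]
    exact neg_eq_of_add_eq_zero_left h

variable (k) in
theorem lieEqZeroCycles (I : Type) [Finite I] :
    Function.Injective (LieOp.toOperad (PL k) (PL.bracket k) I) ∧
      ∀ μ ∈ zeroCycles k I, ∃ x, LieOp.toOperad (PL k) (PL.bracket k) I x = μ :=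
  Finite.induction_empty_option (P := LieEqZeroCycles k) (fun e h => h.of_equiv e)
    lieEqZeroCycles_of_isEmpty (fun h => h.option) I

theorem incl_injective (I : Type) [Finite I] :
    Function.Injective (Tw.incl (PL k) (PL.bracket k) I) := by
  have := Fintype.ofFinite I
  refine (injective_iff_map_eq_zero _).2 fun μ hμ => ext_ev fun f hf => ?_
  have h := (cls_eq_zero_iff _).1 hμ _ (isTree_map (Equiv.sumEmpty I (Fin 0)).symm hf)
  rw [alt_map_sumEmpty, evSum_map_symm] at h
  rw [h, map_zero]

theorem exists_diff_eq {I : Type} [Finite I] {m : ℕ} {μ : (PL k).obj (I ⊕ Fin (m + 1))}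
    (hμ : Tw.diff (PL k) (PL.bracket k) (Tw.cls (PL k) (m + 1) μ) = 0) :
    ∃ ν : (PL k).obj (I ⊕ Fin m), Tw.diff (PL k) (PL.bracket k) (Tw.cls (PL k) m ν) =
      Tw.cls (PL k) (m + 1) μ := by
  have := Fintype.ofFinite I
  rw [diff_cls_eq_zero_iff] at hμ
  obtain ⟨ψ, hψ, h⟩ := acyclic k I m _ (alt_antisymm μ) hμ
  obtain ⟨ν, hν⟩ := exists_alt_eq hψ
  refine ⟨ν, (diff_cls_eq_iff ν μ).2 fun f hf => ?_⟩
  rw [diff_congr hν hf, h f hf]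

variable (k) in
/-- The morphism from the Lie operad to the twisting of the pre-Lie operad is a
quasi-isomorphism. -/
theorem lieHom_isHomologyIso : (Tw.lieHom (PL k) (PL.bracket k)).IsHomologyIso := by
  intro I _ n
  refine DGOperadData.Hom.mapHomology_bijective _ I n (fun x hx hx' => ?_) fun y hy => ?_
  · have h₀ : x = 0 := by
      rcases mem_toDG_gr.1 hx.1 with rfl | h
      · obtain ⟨y, hy, hyx⟩ := hx'
        -- Degree `1` would require a negative number of `α`'s, so there are no boundaries in degree
        -- zero.
        have hy₀ : y = 0 := by
          rcases Tw.exists_cls_of_mem_gr hy with h | ⟨m, _, hm, _⟩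
          · exact h
          · omega
        rw [hy₀, map_zero] at hyx
        exact (injective_iff_map_eq_zero _).1 (lieEqZeroCycles k I).1 x
          ((injective_iff_map_eq_zero _).1 (incl_injective I) _ hyx.symm)
      · exact h
    exact h₀ ▸ zero_mem _
  · obtain ⟨hy₁, hy₂⟩ := hy
    rcases Tw.exists_cls_of_mem_gr hy₁ with h | ⟨_ | m, μ, rfl, hμ⟩
    · have h : y = 0 := h
      exact .inr (h ▸ zero_mem _)
    · obtain ⟨μ, rfl⟩ : ∃ μ', (PL k).map (Equiv.sumEmpty I (Fin 0)).symm μ' = μ :=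
        ⟨(PL k).map (Equiv.sumEmpty I (Fin 0)) μ, by
          rw [← (PL k).map_trans, Equiv.self_trans_symm, (PL k).map_refl]⟩
      have hμ' : y = Tw.incl (PL k) (PL.bracket k) I μ := hμ
      subst hμ'
      obtain ⟨x, rfl⟩ := (lieEqZeroCycles k I).2 μ hy₂
      exact .inl ⟨x, ⟨mem_toDG_gr.2 (.inl (by simp)), rfl⟩, rfl⟩
    · have hd : Tw.diff (PL k) (PL.bracket k) (Tw.cls (PL k) (m + 1) μ) = 0 := hμ ▸ hy₂
      obtain ⟨ν, hν⟩ := exists_diff_eq hd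
      refine .inr ⟨Tw.cls (PL k) m ν, ?_, hν.trans hμ.symm⟩
      have h := Tw.cls_mem_gr (P := PL k) m ν
      rwa [show -(m : ℤ) = -((m + 1 : ℕ) : ℤ) + 1 by push_cast; ring] at h

end PL

theorem mainTheorem2 (k : Type*) [Field k] [CharZero k] :
    (LieOp k).toDG.IsDGOperad ∧ (Tw (PL k) (PL.bracket k)).IsDGOperad ∧
    ∃ φ : DGOperadData.Hom (LieOp k).toDG (Tw (PL k) (PL.bracket k)),
      (φ.app (Fin 2) (LieOp.bracket k) = Tw.incl (PL k) (PL.bracket k) (Fin 2) (PL.bracket k) ∧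
        ∀ ψ : DGOperadData.Hom (LieOp k).toDG (Tw (PL k) (PL.bracket k)),
          ψ.app (Fin 2) (LieOp.bracket k) =
            Tw.incl (PL k) (PL.bracket k) (Fin 2) (PL.bracket k) → ψ = φ) ∧
      φ.IsHomologyIso :=
  ⟨(LieOp.isOperad k).isDGOperad_toDG, Tw.isDGOperad PL.isOperad PL.isLieBracket,
    Tw.lieHom (PL k) (PL.bracket k),
    ⟨Tw.lieHom_bracket _ _, fun _ hψ => LieOp.hom_ext (hψ.trans (Tw.lieHom_bracket _ _).symm)⟩,
    PL.lieHom_isHomologyIso k⟩
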